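/- Let $n$ be a positive integer, let $E=\{0,\pm1,\dots,\pm n\}$, let $X'=\overline{\mathbb C}\setminus E$ be the punctured Riemann sphere, and let \[ \omega_1=\Big(\frac1{z^2}+\sum_{k=1}^n(-1)^k\Big(\frac1{(z-k)^2}+\frac1{(z+k)^2}\Big)\Big)dz,\quad \omega_2=\Big(\frac i{z^2}+i\sum_{k=1}^n\Big(\frac1{(z-k)^2}+\frac1{(z+k)^2}\Big)\Big)dz,\quad \omega_3=\Big(\frac1{z+n}-\frac1{z-n}\Big)dz . \] For a point $p\in E$ consider the triples of pole orders at $p$ of $(\tilde\omega_1,\tilde\omega_2,\tilde\omega_3)=A(\omega_1,\omega_2,\omega_3)$ for $A\in GL_3(\mathbb R)$; the *type* of the end $p$ is the lexicographically smallest of these triples (it is nondecreasing). Then: 1. $\omega_1,\omega_2,\omega_3$ are meromorphic one-forms on $\overline{\mathbb C}$ that are holomorphic on $X'$, all their residues at the points of $E$ are real, and $\operatorname{Re}\int_\gamma(\omega_1,\omega_2,\omega_3)=0$ for every closed curve $\gamma$ in $X'$. 2. The end at $k$ is of type $(0,2,2)$ (planar) for each integer $|k|<n$, and of type $(1,2,2)$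 (catenoid) for $k=\pm n$; so there are exactly $2n-1$ ends of type $(0,2,2)$ and exactly two of type $(1,2,2)$. 3. Every end has a vertical limiting normal: the Gauss map $N=\dfrac{\operatorname{Im}(\omega_2\overline{\omega_3},\,\omega_3\overline{\omega_1},\,\omega_1\overline{\omega_2})}{\|\operatorname{Im}(\omega_2\overline{\omega_3},\,\omega_3\overline{\omega_1},\,\omega_1\overline{\omega_2})\|}$ satisfies $N(z)\to(0,0,(-1)^{k+1})$ as $z\to k$, for each integer $|k|\le n$. 4. The map $f(z)=\operatorname{Re}\int^z(\omega_1,\omega_2,\omega_3)$ is well defined on $X'$ up to an additive constant, has harmonic coordinate functions, and is a smooth embedding $X'\to\mathbb R^3$ (an injective immersion that is a homeomorphism onto its image). Thus $f(X')$ is an embedded harmonic surface of genus zero. 5. The planar ends are stacked between the two catenoid ends: $f_3(z)\to-\infty$ as $z\to-n$, $f_3(z)\to+\infty$ as $z\to n$, and for each integer $|k|<n$ the limit $h_k=\lim_{z\to k}f_3(z)$ exists, with $h_{-n+1}<h_{-n+2}<\dots<h_{n-1}$. -/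

import Mathlib

open Filter Topology MeasureTheory

noncomputable section

namespace HarmonicSurface

/-- The Riemann sphere (the compact Riemann surface of genus zero). -/
abbrev Sphere : Type := OnePoint ℂ

/-- Inverse of the holomorphic chart centred at `p`: it sends `ζ` to `a + ζ` if `p = a` is finite,
and to `1 / ζ` (to `∞` if `ζ = 0`) if `p = ∞`. -/
def patch : Sphere → ℂ → Sphere
  | OnePoint.infty, ζ => if ζ = 0 then OnePoint.infty else OnePoint.some ζ⁻¹
  | OnePoint.some a, ζ => OnePoint.some (a + ζ)

/-- The holomorphic chart centred at `p`, the inverse of `patch p` near `p`: it is `z - a`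
at a finite point `a`, and `1 / z` at `∞`. (Only values at points near `p` are meaningful.) -/
def chart : Sphere → Sphere → ℂ
  | OnePoint.infty, OnePoint.infty => 0
  | OnePoint.infty, OnePoint.some z => z⁻¹
  | OnePoint.some _, OnePoint.infty => 0
  | OnePoint.some a, OnePoint.some z => z - a

/-- A one-form `g(z) dz` on the sphere is represented by `g : ℂ → ℂ`. In the coordinate `ζ`
centred at `p` it reads `localCoeff g p ζ dζ`; at `∞` one has `z = 1 / ζ`, `dz = - dζ / ζ²`. -/
def localCoeff (g : ℂ → ℂ) : Sphere → ℂ → ℂ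
  | OnePoint.infty, ζ => -(ζ ^ 2)⁻¹ * g ζ⁻¹
  | OnePoint.some a, ζ => g (a + ζ)

/-- `g dz` is a meromorphic one-form on the whole sphere. -/
def IsMeromorphicForm (g : ℂ → ℂ) : Prop :=
  ∀ p : Sphere, MeromorphicAt (localCoeff g p) 0

/-- The meromorphic one-form `g dz` is holomorphic at `p` (after filling in the value at `p`). -/
def IsHolomorphicFormAt (g : ℂ → ℂ) (p : Sphere) : Prop :=
  MeromorphicAt (localCoeff g p) 0 ∧ 0 ≤ meromorphicOrderAt (localCoeff g p) 0

/-- The value at `p` of the coefficient of `g dz` in the coordinate centred at `p`, where the form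
is holomorphic at `p`. -/
def coeffAt (g : ℂ → ℂ) (p : Sphere) : ℂ :=
  limUnder (𝓝[≠] (0 : ℂ)) (localCoeff g p)

/-- The order of the pole of `g dz` at `p`; it is `0` if there is no pole. -/
def poleOrder (g : ℂ → ℂ) (p : Sphere) : ℕ :=
  (-(meromorphicOrderAt (localCoeff g p) 0).untop₀).toNat

/-- `g dz` has residue `c` at `p`. -/
def HasResidue (g : ℂ → ℂ) (p : Sphere) (c : ℂ) : Prop :=
  ∀ᶠ r : ℝ in 𝓝[>] 0, (∮ ζ in C(0, r), localCoeff g p ζ) = 2 * Real.pi * Complex.I * c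

/-- Three meromorphic one-forms on the sphere, holomorphic off the finite set `E` of ends. -/
structure IsWeierstrassData (E : Set Sphere) (ω : Fin 3 → ℂ → ℂ) : Prop where
  finite : E.Finite
  meromorphic : ∀ i, IsMeromorphicForm (ω i)
  holomorphic : ∀ p ∉ E, ∀ i, IsHolomorphicFormAt (ω i) p

/-- The value of `g dz` on the velocity of the curve `γ` at the time `t`. -/
def pullback (g : ℂ → ℂ) (γ : ℝ → Sphere) (t : ℝ) : ℂ :=
  coeffAt g (γ t) * deriv (fun s => chart (γ t) (γ s)) t

/-- The integral of `g dz` along the curve `γ : [0,1] → Sphere`. -/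
def formIntegral (g : ℂ → ℂ) (γ : ℝ → Sphere) : ℂ :=
  ∫ t in (0 : ℝ)..1, pullback g γ t

/-- Curves in `Sphere \ E` along which the forms `ω` can be integrated: continuous on `[0,1]`,
differentiable (in the charts) at all but countably many times, with integrable pullbacks.
All piecewise `C¹` curves are of this kind. -/
structure IsCurve (E : Set Sphere) (ω : Fin 3 → ℂ → ℂ) (γ : ℝ → Sphere) : Prop where
  continuousOn : ContinuousOn γ (Set.Icc 0 1)
  avoids : ∀ t ∈ Set.Icc (0 : ℝ) 1, γ t ∉ E
  differentiable : ∃ S : Set ℝ, S.Countable ∧ ∀ t ∈ Set.Ioo (0 : ℝ) 1 \ S,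
    DifferentiableAt ℝ (fun s => chart (γ t) (γ s)) t
  integrable : ∀ i, IntervalIntegrable (pullback (ω i) γ) volume 0 1

/-- The real periods of all three forms along all closed curves in `Sphere \ E` vanish. -/
def SolvesPeriodProblem (E : Set Sphere) (ω : Fin 3 → ℂ → ℂ) : Prop :=
  ∀ γ : ℝ → Sphere, IsCurve E ω γ → γ 0 = γ 1 → ∀ i, (formIntegral (ω i) γ).re = 0

/-- `f = Re ∫ (ω₁, ω₂, ω₃)` on `Sphere \ E` (up to the constant of integration). Values of `f` on
`E` are irrelevant. -/
def IsWeierstrassMap (E : Set Sphere) (ω : Fin 3 → ℂ → ℂ)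
    (f : Sphere → EuclideanSpace ℝ (Fin 3)) : Prop :=
  ∀ γ : ℝ → Sphere, IsCurve E ω γ →
    ∀ i, f (γ 1) i - f (γ 0) i = (formIntegral (ω i) γ).re

/-- The coordinate functions of `f` are harmonic on `Sphere \ E`. -/
def IsHarmonicMap (E : Set Sphere) (f : Sphere → EuclideanSpace ℝ (Fin 3)) : Prop :=
  ∀ p ∉ E, ∀ i, InnerProductSpace.HarmonicAt (fun ζ : ℂ => f (patch p ζ) i) 0

/-- `f` restricts to a smooth embedding of `Sphere \ E` into `ℝ³`: a smooth immersion that is a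
homeomorphism onto its image (in particular injective). -/
structure IsSmoothEmbedding (E : Set Sphere) (f : Sphere → EuclideanSpace ℝ (Fin 3)) : Prop where
  smooth : ∀ p ∉ E, ContDiffAt ℝ ((⊤ : ℕ∞) : WithTop ℕ∞) (fun ζ : ℂ => f (patch p ζ)) 0
  immersion : ∀ p ∉ E, Function.Injective (fderiv ℝ (fun ζ : ℂ => f (patch p ζ)) 0)
  embedding : IsEmbedding (fun p : (Eᶜ : Set Sphere) => f p)

/-- The data obtained by applying the real linear map `A` to `(ω₁, ω₂, ω₃)`; these are the data of
`A ∘ f` (and of `A ∘ f + b`). -/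
def transform (A : Matrix (Fin 3) (Fin 3) ℝ) (ω : Fin 3 → ℂ → ℂ) : Fin 3 → ℂ → ℂ :=
  fun i z => ∑ j, (A i j : ℂ) * ω j z

/-- The pole orders of `ω₁, ω₂, ω₃` at `p`. -/
def poleOrders (ω : Fin 3 → ℂ → ℂ) (p : Sphere) : Fin 3 → ℕ :=
  fun i => poleOrder (ω i) p

/-- The end at `p` is of type `t`: `t` is nondecreasing, is the triple of pole orders of an affinely
equivalent end, and is lexicographically minimal among those of all affinely equivalent ends. -/
def IsEndType (ω : Fin 3 → ℂ → ℂ) (p : Sphere) (t : Fin 3 → ℕ) : Prop :=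
  Monotone t ∧
  (∃ A : Matrix.GeneralLinearGroup (Fin 3) ℝ, poleOrders (transform A.1 ω) p = t) ∧
  ∀ A : Matrix.GeneralLinearGroup (Fin 3) ℝ, toLex t ≤ toLex (poleOrders (transform A.1 ω) p)

/-- The (unnormalized) normal `Im (ω₂ ω̄₃, ω₃ ω̄₁, ω₁ ω̄₂)`, in the coordinate centred at `p`. -/
def normalVector (ω : Fin 3 → ℂ → ℂ) (p : Sphere) : EuclideanSpace ℝ (Fin 3) :=
  !₂[(coeffAt (ω 1) p * star (coeffAt (ω 2) p)).im,
     (coeffAt (ω 2) p * star (coeffAt (ω 0) p)).im,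
     (coeffAt (ω 0) p * star (coeffAt (ω 1) p)).im]

/-- The Gauss map. -/
def gaussMap (ω : Fin 3 → ℂ → ℂ) (p : Sphere) : EuclideanSpace ℝ (Fin 3) :=
  ‖normalVector ω p‖⁻¹ • normalVector ω p

/-- The point `k` of the sphere. -/
def pt (k : ℤ) : Sphere := OnePoint.some (k : ℂ)

/-- The ends `0, ±1, …, ±n`. -/
def stackEnds (n : ℕ) : Set Sphere := {p | ∃ k : ℤ, |k| ≤ n ∧ p = pt k}

/-- The Weierstrass data of the stack of planes between two catenoid ends. -/
def stackForms (n : ℕ) : Fin 3 → ℂ → ℂ :=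
  ![fun z => 1 / z ^ 2 +
      ∑ k ∈ Finset.Icc 1 n, (-1) ^ k * (1 / (z - k) ^ 2 + 1 / (z + k) ^ 2),
    fun z => Complex.I / z ^ 2 +
      Complex.I * ∑ k ∈ Finset.Icc 1 n, (1 / (z - k) ^ 2 + 1 / (z + k) ^ 2),
    fun z => 1 / (z + n) - 1 / (z - n)]

end HarmonicSurface

end

noncomputable section

namespace HarmonicSurface

/-- The sign `(-1)^k` of an integer, as a real number. -/
def alt (k : ℤ) : ℝ := (-1) ^ k.natAbs

lemma alt_neg (k : ℤ) : alt (-k) = alt k := by simp [alt]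

lemma alt_natCast (k : ℕ) : alt k = (-1) ^ k := by simp [alt]

lemma alt_mul_self (k : ℤ) : alt k * alt k = 1 := by
  rw [alt, ← mul_pow]; norm_num

lemma alt_eq_one_or (k : ℤ) : alt k = 1 ∨ alt k = -1 := neg_one_pow_eq_or ℝ _

lemma abs_alt (k : ℤ) : |alt k| = 1 := by rcases alt_eq_one_or k with h | h <;> simp [h]

lemma alt_eq_zpow (k : ℤ) : alt k = (-1 : ℝ) ^ k := by
  rcases Int.natAbs_eq k with h | h
  · rw [alt]; conv_rhs => rw [h]
    exact (zpow_natCast _ _).symm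
  · rw [alt]; conv_rhs => rw [h]
    rw [zpow_neg, zpow_natCast, ← inv_pow]; norm_num

lemma alt_add (j k : ℤ) : alt (j + k) = alt j * alt k := by
  simp only [alt_eq_zpow]; exact zpow_add₀ (by norm_num) _ _

lemma alt_succ (k : ℤ) : alt (k + 1) = -alt k := by
  rw [alt_add]; simp [alt]

lemma alt_sub (j k : ℤ) : alt (j - k) = alt j * alt k := by
  rw [sub_eq_add_neg, alt_add, alt_neg]

/-- Summation over the symmetric interval of integers `-n, …, n`. -/
lemma sum_Icc_neg_succ {M : Type*} [AddCommMonoid M] (f : ℤ → M) (n : ℕ) :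
    ∑ k ∈ Finset.Icc (-((n + 1 : ℕ) : ℤ)) ((n + 1 : ℕ) : ℤ), f k =
      ∑ k ∈ Finset.Icc (-(n : ℤ)) n, f k + (f (n + 1) + f (-(n + 1))) := by
  have : Finset.Icc (-((n + 1 : ℕ) : ℤ)) ((n + 1 : ℕ) : ℤ) =
      insert ((n : ℤ) + 1) (insert (-((n : ℤ) + 1)) (Finset.Icc (-(n : ℤ)) n)) := by
    ext k; simp only [Finset.mem_Icc, Finset.mem_insert]; push_cast; omega
  rw [this, Finset.sum_insert, Finset.sum_insert]
  · rw [← add_assoc, add_comm]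
  · simp
  · simp only [Finset.mem_insert, Finset.mem_Icc]; omega

lemma sum_Icc_neg_eq {M : Type*} [AddCommMonoid M] (f : ℤ → M) (n : ℕ) :
    ∑ k ∈ Finset.Icc (-(n : ℤ)) n, f k =
      f 0 + ∑ i ∈ Finset.range n, (f (i + 1) + f (-(i + 1))) := by
  induction n with
  | zero => simp
  | succ n ih => rw [sum_Icc_neg_succ, ih, Finset.sum_range_succ, add_assoc]

/-- `∑ (-1)^k / (z - k)` over `|k| ≤ n`. -/
def altSum (n : ℕ) (z : ℂ) : ℂ := ∑ k ∈ Finset.Icc (-(n : ℤ)) n, (alt k : ℂ) / (z - k)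

/-- `∑ 1 / (z - k)` over `|k| ≤ n`. -/
def fullSum (n : ℕ) (z : ℂ) : ℂ := ∑ k ∈ Finset.Icc (-(n : ℤ)) n, 1 / (z - k)

/-- `∑ (-1)^k / (z - k)²` over `|k| ≤ n`. -/
def altSum₂ (n : ℕ) (z : ℂ) : ℂ := ∑ k ∈ Finset.Icc (-(n : ℤ)) n, (alt k : ℂ) / (z - k) ^ 2

/-- `∑ 1 / (z - k)²` over `|k| ≤ n`. -/
def fullSum₂ (n : ℕ) (z : ℂ) : ℂ := ∑ k ∈ Finset.Icc (-(n : ℤ)) n, 1 / (z - k) ^ 2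

lemma hasDerivAt_altSum {n : ℕ} {z : ℂ} (hz : ∀ k : ℤ, |k| ≤ n → z ≠ k) :
    HasDerivAt (altSum n) (-altSum₂ n z) z := by
  unfold altSum altSum₂
  rw [← Finset.sum_neg_distrib]
  refine HasDerivAt.fun_sum fun k hk => ?_
  have h : z - k ≠ 0 := sub_ne_zero.mpr (hz k (by rw [abs_le]; simpa using hk))
  have := (((hasDerivAt_id z).sub_const (k : ℂ)).inv h).const_mul (alt k : ℂ)
  refine (this.congr_deriv ?_).congr_of_eventuallyEq (Eventually.of_forall fun x => ?_)
  · simp only [id]; field_simp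
  · simp [div_eq_mul_inv]

lemma hasDerivAt_fullSum {n : ℕ} {z : ℂ} (hz : ∀ k : ℤ, |k| ≤ n → z ≠ k) :
    HasDerivAt (fullSum n) (-fullSum₂ n z) z := by
  unfold fullSum fullSum₂
  rw [← Finset.sum_neg_distrib]
  refine HasDerivAt.fun_sum fun k hk => ?_
  have h : z - k ≠ 0 := sub_ne_zero.mpr (hz k (by rw [abs_le]; simpa using hk))
  have := ((hasDerivAt_id z).sub_const (k : ℂ)).inv h
  refine (this.congr_deriv ?_).congr_of_eventuallyEq (Eventually.of_forall fun x => ?_)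
  · simp only [id]; field_simp
  · simp

lemma ne_intCast_of_im_pos {z : ℂ} (hz : 0 < z.im) (k : ℤ) : z ≠ k := by
  rintro rfl; simp at hz

lemma mem_integerComplement {z : ℂ} (hz : 0 < z.im) : z ∈ Complex.integerComplement := by
  rintro ⟨k, hk⟩; exact ne_intCast_of_im_pos hz k hk.symm

lemma tendsto_fullSum {z : ℂ} (hz : 0 < z.im) :
    Tendsto (fun n => fullSum n z) atTop (𝓝 (Real.pi * Complex.cot (Real.pi * z))) := by
  have h := (tendsto_logDeriv_euler_cot_sub (mem_integerComplement hz)).const_add (1 / z)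
  refine (h.congr fun n => ?_).trans (by simp)
  simp only [fullSum, sum_Icc_neg_eq, cotTerm]
  push_cast; simp only [sub_zero, sub_neg_eq_add]

lemma sum_Icc_even {f : ℤ → ℂ} (m : ℕ) :
    ∑ k ∈ Finset.Icc (-((2 * m : ℕ) : ℤ)) ((2 * m : ℕ) : ℤ), ((alt k : ℂ) + 1) * f k =
      2 * ∑ k ∈ Finset.Icc (-(m : ℤ)) m, f (2 * k) := by
  induction m with
  | zero => simp [alt]; left; norm_num
  | succ m ih =>
    rw [sum_Icc_neg_succ _ m, show 2 * (m + 1) = 2 * m + 1 + 1 by ring,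
      sum_Icc_neg_succ, sum_Icc_neg_succ, ih]
    have e1 : ((2 * m + 1 : ℕ) : ℤ) + 1 = 2 * ((m : ℤ) + 1) := by push_cast; ring
    have e2 : alt (2 * ((m : ℤ) + 1)) = 1 := by
      rw [two_mul, alt_add, alt_mul_self]
    have e3 : alt (((2 * m : ℕ) : ℤ) + 1) = -1 := by
      rw [alt_succ, alt_natCast, pow_mul]; norm_num
    rw [e1, alt_neg, alt_neg, e2, e3, show -(2 * ((m : ℤ) + 1)) = 2 * (-((m : ℤ) + 1)) by ring]
    push_cast; ring

lemma altSum_two_mul (m : ℕ) (z : ℂ) :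
    altSum (2 * m) z = fullSum m (z / 2) - fullSum (2 * m) z := by
  have h := sum_Icc_even (f := fun k => 1 / (z - k)) m
  simp only [add_mul, Finset.sum_add_distrib, one_mul] at h
  have h2 : ∀ k : ℤ, 1 / (z / 2 - k) = 2 * (1 / (z - ((2 * k : ℤ) : ℂ))) := fun k => by
    push_cast
    rw [show z / 2 - k = (z - 2 * k) / 2 by ring, one_div_div]; ring
  have h3 : ∀ k : ℤ, (alt k : ℂ) / (z - k) = alt k * (1 / (z - k)) := fun k => by ring
  simp only [altSum, fullSum, h2, h3, ← Finset.mul_sum]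
  rw [← h]; ring

lemma altSum₂_two_mul (m : ℕ) (z : ℂ) :
    altSum₂ (2 * m) z = fullSum₂ m (z / 2) / 2 - fullSum₂ (2 * m) z := by
  have h := sum_Icc_even (f := fun k => 1 / (z - k) ^ 2) m
  simp only [add_mul, Finset.sum_add_distrib, one_mul] at h
  have h2 : ∀ k : ℤ, 1 / (z / 2 - k) ^ 2 = 4 * (1 / (z - ((2 * k : ℤ) : ℂ)) ^ 2) := fun k => by
    push_cast
    rw [show z / 2 - k = (z - 2 * k) / 2 by ring, div_pow, one_div_div]; ring
  have h3 : ∀ k : ℤ, (alt k : ℂ) / (z - k) ^ 2 = alt k * (1 / (z - k) ^ 2) := fun k => by ring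
  simp only [altSum₂, fullSum₂, h2, h3, ← Finset.mul_sum]
  rw [eq_sub_of_add_eq h]
  simp only [one_div]; ring

lemma sin_pi_ne {z : ℂ} (hz : 0 < z.im) : Complex.sin (Real.pi * z) ≠ 0 :=
  sin_pi_mul_ne_zero (mem_integerComplement hz)

lemma tendsto_fullSum₂ {z : ℂ} (hz : 0 < z.im) :
    Tendsto (fun n => fullSum₂ n z) atTop
      (𝓝 ((Real.pi / Complex.sin (Real.pi * z)) ^ 2)) := by
  have hz' : z ∈ UpperHalfPlane.upperHalfPlaneSet := hz
  have h1 := iteratedDerivWithin_cot_pi_mul_eq_mul_tsum_div_pow (k := 1) le_rfl hz'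
  have hs : Complex.sin (Real.pi * z) ≠ 0 := sin_pi_ne hz
  have hd : HasDerivAt (fun x : ℂ => Real.pi * Complex.cot (Real.pi * x))
      (-(Real.pi / Complex.sin (Real.pi * z)) ^ 2) z := by
    have h2 : HasDerivAt (fun x : ℂ => (Real.pi : ℂ) * x) Real.pi z := by
      simpa using (hasDerivAt_id z).const_mul (Real.pi : ℂ)
    have h3 := ((Complex.hasDerivAt_cos _).comp z h2).div ((Complex.hasDerivAt_sin _).comp z h2) hs
    have h4 := h3.const_mul (Real.pi : ℂ)
    simp only [Function.comp_apply] at h4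
    refine h4.congr_deriv ?_
    have h5 := Complex.sin_sq_add_cos_sq (Real.pi * z)
    generalize Complex.sin (Real.pi * z) = s at *
    generalize Complex.cos (Real.pi * z) = c at *
    field_simp
    linear_combination -h5
  rw [iteratedDerivWithin_one, hd.hasDerivWithinAt.derivWithin
    (UpperHalfPlane.isOpen_upperHalfPlaneSet.uniqueDiffWithinAt hz')] at h1
  have h5 : (Real.pi / Complex.sin (Real.pi * z)) ^ 2 = ∑' k : ℤ, 1 / (z + k) ^ 2 := by
    simpa using h1
  have hsum : Summable fun k : ℤ => 1 / (z + k) ^ 2 := by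
    have := (EisensteinSeries.linear_right_summable z 1 (k := 2) (by norm_num))
    refine this.congr fun k => ?_
    simp
  have h6 := hsum.hasSum
  rw [← h5] at h6
  have hIcc : Tendsto (fun n : ℕ => Finset.Icc (-(n : ℤ)) n) atTop atTop := by
    refine Filter.tendsto_atTop_finset_of_monotone ?_ ?_
    · intro a b hab x hx; simp only [Finset.mem_Icc] at hx ⊢; omega
    · intro x; refine ⟨x.natAbs, ?_⟩; simp only [Finset.mem_Icc]; omega
  have h7 := h6.comp hIcc
  refine h7.congr fun n => ?_
  simp only [Function.comp_apply, fullSum₂]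
  refine Finset.sum_nbij (fun k => -k) ?_ ?_ ?_ ?_
  · intro k hk; simp only [Finset.mem_Icc] at hk ⊢; omega
  · intro a _ b _ h; simpa using h
  · intro k hk; refine ⟨-k, ?_, by simp⟩; simp only [Finset.coe_Icc, Set.mem_Icc] at hk ⊢; omega
  · intro k _; push_cast; rw [sub_neg_eq_add]

lemma half_im_pos {z : ℂ} (hz : 0 < z.im) : 0 < (z / 2).im := by
  have : (z / 2).im = z.im / 2 := by simp
  rw [this]; positivity

lemma tendsto_altSum {z : ℂ} (hz : 0 < z.im) :
    Tendsto (fun m => altSum (2 * m) z) atTop (𝓝 (Real.pi / Complex.sin (Real.pi * z))) := by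
  have h := (tendsto_fullSum (half_im_pos hz)).sub
    ((tendsto_fullSum hz).comp (tendsto_id.const_mul_atTop' (by norm_num : 0 < 2)))
  refine (h.congr fun m => (altSum_two_mul m z).symm).trans (le_of_eq ?_)
  congr 1
  have hs := sin_pi_ne hz
  have hs2 := sin_pi_ne (half_im_pos hz)
  have e : (Real.pi : ℂ) * z = 2 * (Real.pi * (z / 2)) := by ring
  rw [e, Complex.sin_two_mul] at hs
  rw [e, Complex.cot, Complex.cot, Complex.sin_two_mul, Complex.cos_two_mul]
  have hc : Complex.cos (Real.pi * (z / 2)) ≠ 0 := fun h0 => hs (by rw [h0]; ring)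
  generalize Complex.cos (Real.pi * (z / 2)) = c at *
  generalize Complex.sin (Real.pi * (z / 2)) = s at *
  field_simp
  ring

lemma tendsto_altSum₂ {z : ℂ} (hz : 0 < z.im) :
    Tendsto (fun m => altSum₂ (2 * m) z) atTop
      (𝓝 (Real.pi ^ 2 * Complex.cos (Real.pi * z) / Complex.sin (Real.pi * z) ^ 2)) := by
  have h := ((tendsto_fullSum₂ (half_im_pos hz)).div_const 2).sub
    ((tendsto_fullSum₂ hz).comp (tendsto_id.const_mul_atTop' (by norm_num : 0 < 2)))
  refine (h.congr fun m => (altSum₂_two_mul m z).symm).trans (le_of_eq ?_)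
  congr 1
  have hs := sin_pi_ne hz
  have hs2 := sin_pi_ne (half_im_pos hz)
  have e : (Real.pi : ℂ) * z = 2 * (Real.pi * (z / 2)) := by ring
  rw [e, Complex.sin_two_mul] at hs
  rw [e, Complex.sin_two_mul, Complex.cos_two_mul]
  have hc : Complex.cos (Real.pi * (z / 2)) ≠ 0 := fun h0 => hs (by rw [h0]; ring)
  generalize Complex.cos (Real.pi * (z / 2)) = c at *
  generalize Complex.sin (Real.pi * (z / 2)) = s at *
  field_simp

/-- If at every time either `φ < K` and `φ` increases, or `φ ≥ K` and `ψ` increases, then the plane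
curve `(φ, ψ)` is injective. -/
lemma injOn_of_threshold {a b K : ℝ} {φ ψ φ' ψ' : ℝ → ℝ}
    (hφ : ∀ t ∈ Set.Ioo a b, HasDerivAt φ (φ' t) t) (hψ : ∀ t ∈ Set.Ioo a b, HasDerivAt ψ (ψ' t) t)
    (h₁ : ∀ t ∈ Set.Ioo a b, φ t < K → 0 < φ' t) (h₂ : ∀ t ∈ Set.Ioo a b, K ≤ φ t → 0 < ψ' t) :
    Set.InjOn (fun t => (φ t, ψ t)) (Set.Ioo a b) := by
  have key : ∀ s ∈ Set.Ioo a b, ∀ t ∈ Set.Ioo a b, s < t → K ≤ φ s → K ≤ φ t := by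
    intro s hs t ht hst hK
    by_contra hlt
    push Not at hlt
    have hsub : Set.Icc s t ⊆ Set.Ioo a b := fun r hr => ⟨hs.1.trans_le hr.1, hr.2.trans_lt ht.2⟩
    have hc : ContinuousOn φ (Set.Icc s t) := fun r hr =>
      (hφ r (hsub hr)).continuousAt.continuousWithinAt
    let A := Set.Icc s t ∩ φ ⁻¹' Set.Ici K
    have hA : IsCompact A :=
      isCompact_Icc.of_isClosed_subset (hc.preimage_isClosed_of_isClosed isClosed_Icc isClosed_Ici)
        Set.inter_subset_left
    obtain ⟨r, hrA, hr⟩ := hA.exists_isGreatest ⟨s, ⟨le_rfl, hst.le⟩, hK⟩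
    have hrt : r < t := lt_of_le_of_ne hrA.1.2 (fun h => absurd hrA.2 (by rw [h]; exact not_le.mpr hlt))
    have hlt' : ∀ q ∈ Set.Ioc r t, φ q < K := fun q hq => by
      by_contra hq'
      push Not at hq'
      exact absurd (hr ⟨⟨hrA.1.1.trans hq.1.le, hq.2⟩, hq'⟩) (not_le.mpr hq.1)
    have hmono : StrictMonoOn φ (Set.Icc r t) := by
      refine strictMonoOn_of_deriv_pos (convex_Icc r t) (hc.mono (Set.Icc_subset_Icc_left hrA.1.1)) ?_
      intro q hq
      rw [interior_Icc] at hq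
      have hq' : q ∈ Set.Ioo a b := hsub ⟨hrA.1.1.trans hq.1.le, hq.2.le⟩
      rw [(hφ q hq').deriv]
      exact h₁ q hq' (hlt' q ⟨hq.1, hq.2.le⟩)
    have h1 := hmono ⟨le_rfl, hrt.le⟩ ⟨hrt.le, le_rfl⟩ hrt
    have h2 := hlt' t ⟨hrt, le_rfl⟩
    have h3 : K ≤ φ r := hrA.2
    linarith
  have main : ∀ s ∈ Set.Ioo a b, ∀ t ∈ Set.Ioo a b, s < t → (φ s, ψ s) ≠ (φ t, ψ t) := by
    intro s hs t ht hst heq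
    obtain ⟨e1, e2⟩ := Prod.mk.inj heq
    have hsub : Set.Icc s t ⊆ Set.Ioo a b := fun r hr => ⟨hs.1.trans_le hr.1, hr.2.trans_lt ht.2⟩
    rcases lt_or_ge (φ s) K with hK | hK
    · have hall : ∀ r ∈ Set.Icc s t, φ r < K := fun r hr => by
        by_contra hr'
        push Not at hr'
        rcases hr.2.lt_or_eq with h | h
        · exact absurd (key r (hsub hr) t ht h hr') (by rw [← e1]; exact not_le.mpr hK)
        · rw [h, ← e1] at hr'; exact absurd hr' (not_le.mpr hK)
      have hmono : StrictMonoOn φ (Set.Icc s t) := by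
        refine strictMonoOn_of_deriv_pos (convex_Icc s t)
          (fun r hr => (hφ r (hsub hr)).continuousAt.continuousWithinAt) fun q hq => ?_
        have hq' := interior_subset hq
        rw [(hφ q (hsub hq')).deriv]
        exact h₁ q (hsub hq') (hall q hq')
      exact absurd (hmono ⟨le_rfl, hst.le⟩ ⟨hst.le, le_rfl⟩ hst) (by rw [e1]; exact lt_irrefl _)
    · have hmono : StrictMonoOn ψ (Set.Icc s t) := by
        refine strictMonoOn_of_deriv_pos (convex_Icc s t)
          (fun r hr => (hψ r (hsub hr)).continuousAt.continuousWithinAt) fun q hq => ?_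
        have hq' := interior_subset hq
        rw [(hψ q (hsub hq')).deriv]
        refine h₂ q (hsub hq') ?_
        rcases hq'.1.lt_or_eq with h | h
        · exact key s hs q (hsub hq') h hK
        · rwa [← h]
      exact absurd (hmono ⟨le_rfl, hst.le⟩ ⟨hst.le, le_rfl⟩ hst) (by rw [e2]; exact lt_irrefl _)
  intro s hs t ht heq
  rcases lt_trichotomy s t with h | h | h
  · exact absurd heq (main s hs t ht h)
  · exact h
  · exact absurd heq.symm (main t ht s hs h)

lemma re_div_sq (g z : ℂ) :
    (g / z ^ 2).re = (g.re * (z.re ^ 2 - z.im ^ 2) + g.im * (2 * z.re * z.im)) /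
      (z.re ^ 2 + z.im ^ 2) ^ 2 := by
  rw [Complex.div_re]
  have : Complex.normSq (z ^ 2) = (z.re ^ 2 + z.im ^ 2) ^ 2 := by
    rw [map_pow, Complex.normSq_apply]; ring
  rw [this, ← add_div, pow_two z]
  simp only [Complex.mul_re, Complex.mul_im]
  congr 1; ring

lemma im_div_sq (g z : ℂ) :
    (g / z ^ 2).im = (g.im * (z.re ^ 2 - z.im ^ 2) - g.re * (2 * z.re * z.im)) /
      (z.re ^ 2 + z.im ^ 2) ^ 2 := by
  rw [Complex.div_im]
  have : Complex.normSq (z ^ 2) = (z.re ^ 2 + z.im ^ 2) ^ 2 := by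
    rw [map_pow, Complex.normSq_apply]; ring
  rw [this, ← sub_div, pow_two z]
  simp only [Complex.mul_re, Complex.mul_im]
  congr 1; ring

lemma re_mul_fullSum₂ (n : ℕ) (g z : ℂ) :
    (g * fullSum₂ n z).re = ∑ k ∈ Finset.Icc (-(n : ℤ)) n, (g / (z - k) ^ 2).re := by
  rw [fullSum₂, Finset.mul_sum, Complex.re_sum]
  exact Finset.sum_congr rfl fun k _ => by rw [mul_one_div]

lemma im_mul_altSum₂ (n : ℕ) (g z : ℂ) :
    (g * altSum₂ n z).im = ∑ k ∈ Finset.Icc (-(n : ℤ)) n, alt k * (g / (z - k) ^ 2).im := by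
  rw [altSum₂, Finset.mul_sum, Complex.im_sum]
  refine Finset.sum_congr rfl fun k _ => ?_
  rw [← Complex.im_ofReal_mul]; congr 1; ring

/-- Outside the disc of radius `n` all terms of the derivative of the second coordinate along a
level circle have the same sign. -/
lemma re_term_neg {n : ℕ} (hn : 0 < n) {z : ℂ} (hy : 0 < z.im) (hz : (n : ℝ) ^ 2 ≤ z.re ^ 2 + z.im ^ 2)
    {k : ℤ} (hk : k ∈ Finset.Icc (-(n : ℤ)) n) :
    (((n : ℂ) ^ 2 - z ^ 2) / (z - k) ^ 2).re ≤ 0 ∧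
      (|k| < n → (((n : ℂ) ^ 2 - z ^ 2) / (z - k) ^ 2).re < 0) := by
  rw [re_div_sq]
  simp only [Complex.sub_re, Complex.sub_im, Complex.intCast_re, Complex.intCast_im, sub_zero]
  have hg1 : ((n : ℂ) ^ 2 - z ^ 2).re = n ^ 2 - z.re ^ 2 + z.im ^ 2 := by
    simp [pow_two]; ring
  have hg2 : ((n : ℂ) ^ 2 - z ^ 2).im = -2 * z.re * z.im := by
    simp [pow_two]; ring
  have hg1' : ((n : ℂ) ^ 2).re - (z ^ 2).re = n ^ 2 - z.re ^ 2 + z.im ^ 2 := by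
    rw [← hg1, Complex.sub_re]
  have hg2' : ((n : ℂ) ^ 2).im - (z ^ 2).im = -2 * z.re * z.im := by
    rw [← hg2, Complex.sub_im]
  rw [hg1', hg2']
  generalize z.re = x at *
  generalize z.im = y at *
  have hN : (0 : ℝ) < n := by exact_mod_cast hn
  rw [Finset.mem_Icc] at hk
  have hk1 : -(n : ℝ) ≤ k := by exact_mod_cast hk.1
  have hk2 : (k : ℝ) ≤ n := by exact_mod_cast hk.2
  have hden : 0 < ((x - k) ^ 2 + y ^ 2) ^ 2 := by positivity
  have id : 4 * (n : ℝ) ^ 2 * (((n : ℝ) ^ 2 - x ^ 2 + y ^ 2) * ((x - k) ^ 2 - y ^ 2) +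
      -2 * x * y * (2 * (x - k) * y)) = -((x ^ 2 + y ^ 2 - n ^ 2) * ((n + k) ^ 2 * ((n - x) ^ 2 + y ^ 2)
      + (n - k) ^ 2 * ((n + x) ^ 2 + y ^ 2)) +
      2 * ((n + k) * (n - k)) * (((n - x) ^ 2 + y ^ 2) * ((n + x) ^ 2 + y ^ 2))) := by ring
  have hA : 0 ≤ (x ^ 2 + y ^ 2 - n ^ 2) * ((n + k : ℝ) ^ 2 * ((n - x) ^ 2 + y ^ 2)
      + (n - k) ^ 2 * ((n + x) ^ 2 + y ^ 2)) := mul_nonneg (by linarith) (by positivity)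
  have hP : 0 < ((n - x : ℝ) ^ 2 + y ^ 2) * ((n + x) ^ 2 + y ^ 2) := by positivity
  have hB : 0 ≤ (n + k : ℝ) * (n - k) := mul_nonneg (by linarith) (by linarith)
  have h4 : 0 < 4 * (n : ℝ) ^ 2 := by positivity
  constructor
  · refine div_nonpos_of_nonpos_of_nonneg ?_ hden.le
    by_contra h
    push Not at h
    have := mul_pos h4 h
    linarith only [this, id, hA, mul_nonneg hB hP.le]
  · intro hk3
    have hk3' := abs_lt.mp hk3
    have hk4 : -(n : ℝ) < k := by exact_mod_cast hk3'.1
    have hk5 : (k : ℝ) < n := by exact_mod_cast hk3'.2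
    have hB' : 0 < (n + k : ℝ) * (n - k) := mul_pos (by linarith) (by linarith)
    refine div_neg_of_neg_of_pos ?_ hden
    by_contra h
    push Not at h
    have := mul_nonneg h4.le h
    linarith only [this, id, hA, mul_pos hB' hP]

lemma re_mul_fullSum₂_neg {n : ℕ} (hn : 0 < n) {z : ℂ} (hy : 0 < z.im)
    (hz : (n : ℝ) ^ 2 ≤ z.re ^ 2 + z.im ^ 2) : (((n : ℂ) ^ 2 - z ^ 2) * fullSum₂ n z).re < 0 := by
  rw [re_mul_fullSum₂]
  have h0 : (0 : ℤ) ∈ Finset.Icc (-(n : ℤ)) n := by simp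
  refine (Finset.sum_lt_sum (fun k hk => (re_term_neg hn hy hz hk).1)
    ⟨0, h0, (re_term_neg hn hy hz h0).2 (by simpa using hn)⟩).trans_eq (by simp)

/-- The point `x₀ + ξ + i y` lies on the upper half of the circle `|z + n| = c |z - n|` that meets
the real axis in `x₀` and whose radius is `ρ`. -/
structure ArcPoint (n : ℕ) (x₀ ρ ξ y : ℝ) : Prop where
  left_pos : 0 < x₀
  left_lt : x₀ < n
  radius : 2 * x₀ * ρ = n ^ 2 - x₀ ^ 2
  im_pos : 0 < y
  circle : y ^ 2 = ξ * (2 * ρ - ξ)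

namespace ArcPoint
variable {n : ℕ} {x₀ ρ ξ y : ℝ}

lemma rho_pos (h : ArcPoint n x₀ ρ ξ y) : 0 < ρ := by
  have h1 := h.left_pos; have h2 := h.left_lt; have h3 := h.radius
  by_contra hc
  nlinarith

lemma xi_pos (h : ArcPoint n x₀ ρ ξ y) : 0 < ξ := by
  have h1 := h.rho_pos; have h2 := h.im_pos; have h3 := h.circle
  by_contra hc
  nlinarith [sq_pos_of_pos h2]

lemma xi_lt (h : ArcPoint n x₀ ρ ξ y) : ξ < 2 * ρ := by
  have h1 := h.xi_pos; have h2 := h.im_pos; have h3 := h.circle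
  by_contra hc
  nlinarith [sq_pos_of_pos h2]

lemma radius' (h : ArcPoint n x₀ ρ ξ y) : 2 * x₀ * (ρ - (n - x₀)) = (n - x₀) ^ 2 := by
  linear_combination h.radius

lemma le_rho (h : ArcPoint n x₀ ρ ξ y) : n - x₀ ≤ ρ := by
  have h1 := h.left_pos; have h3 := h.radius'
  by_contra hc
  nlinarith [sq_nonneg ((n : ℝ) - x₀)]

lemma den_pos (h : ArcPoint n x₀ ρ ξ y) (W : ℝ) : 0 < W ^ 2 - 2 * ξ * (W - ρ) := by
  have h2 := h.im_pos; have h3 := h.circle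
  nlinarith [sq_nonneg (W - ξ)]

lemma normSq_sub (h : ArcPoint n x₀ ρ ξ y) (k : ℝ) :
    (x₀ + ξ - k) ^ 2 + y ^ 2 = (k - x₀) ^ 2 - 2 * ξ * (k - x₀ - ρ) := by
  linear_combination h.circle

lemma im_term (h : ArcPoint n x₀ ρ ξ y) (k : ℤ) :
    ((⟨ρ - ξ, -y⟩ : ℂ) / ((⟨x₀ + ξ, y⟩ : ℂ) - k) ^ 2).im =
      y * ((k - x₀) * (2 * ρ - (k - x₀)) / ((k - x₀) ^ 2 - 2 * ξ * (k - x₀ - ρ)) ^ 2) := by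
  rw [im_div_sq]
  simp only [Complex.sub_re, Complex.sub_im, Complex.intCast_re, Complex.intCast_im, sub_zero]
  rw [h.normSq_sub, mul_div_assoc']
  congr 1
  linear_combination y * h.circle

lemma sq_sub_sq (h : ArcPoint n x₀ ρ ξ y) :
    (n : ℂ) ^ 2 - (⟨x₀ + ξ, y⟩ : ℂ) ^ 2 = (2 * (x₀ + ξ) : ℝ) * (⟨ρ - ξ, -y⟩ : ℂ) := by
  apply Complex.ext
  · simp [pow_two]
    linear_combination h.circle - h.radius
  · simp [pow_two]; ring

/-- In the exterior of the disc of radius `n` the second coordinate increases along the arc. -/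
lemma re_mul_fullSum₂_neg (h : ArcPoint n x₀ ρ ξ y) (hz : (n : ℝ) ^ 2 ≤ (x₀ + ξ) ^ 2 + y ^ 2) :
    ((⟨ρ - ξ, -y⟩ : ℂ) * fullSum₂ n ⟨x₀ + ξ, y⟩).re < 0 := by
  have hn : 0 < n := by
    have := h.left_pos.trans h.left_lt
    exact_mod_cast this
  have h1 := HarmonicSurface.re_mul_fullSum₂_neg hn (z := ⟨x₀ + ξ, y⟩) h.im_pos hz
  rw [h.sq_sub_sq, mul_assoc, Complex.re_ofReal_mul] at h1
  have h2 : 0 < 2 * (x₀ + ξ) := by linarith [h.left_pos, h.xi_pos]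
  by_contra hc
  nlinarith

/-- With three ends the first coordinate is monotone along the arc. -/
lemma im_mul_altSum₂_neg_of_one (h : ArcPoint 1 x₀ ρ ξ y) :
    ((⟨ρ - ξ, -y⟩ : ℂ) * altSum₂ 1 ⟨x₀ + ξ, y⟩).im < 0 := by
  set z : ℂ := ⟨x₀ + ξ, y⟩ with hz
  have hx : 0 < x₀ + ξ := by linarith [h.left_pos, h.xi_pos]
  have hy := h.im_pos
  have e1 := h.sq_sub_sq
  have hzi : z.im = y := rfl
  have hzr : z.re = x₀ + ξ := rfl
  have hz0 : z ≠ 0 := fun h0 => by rw [h0] at hzi; simp at hzi; linarith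
  have hz1 : z - 1 ≠ 0 := fun h0 => by
    have := congrArg Complex.im h0; simp [hzi] at this; linarith
  have hz2 : z + 1 ≠ 0 := fun h0 => by
    have := congrArg Complex.im h0; simp [hzi] at this; linarith
  have hz3 : z ^ 2 - 1 ≠ 0 := by
    rw [show z ^ 2 - 1 = (z - 1) * (z + 1) by ring]; exact mul_ne_zero hz1 hz2
  have e2 : (((1 : ℕ) : ℂ) ^ 2 - z ^ 2) * altSum₂ 1 z = (z ^ 2)⁻¹ + 1 + 4 * (z ^ 2 - 1)⁻¹ := by
    have e3 : altSum₂ 1 z = 1 / z ^ 2 - 1 / (z - 1) ^ 2 - 1 / (z + 1) ^ 2 := by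
      rw [altSum₂, sum_Icc_neg_eq]; simp [alt]; ring
    rw [e3]; field_simp; push_cast; ring
  rw [e1, mul_assoc] at e2
  have e4 := congrArg Complex.im e2
  rw [Complex.im_ofReal_mul] at e4
  have hw : (z ^ 2).im = 2 * (x₀ + ξ) * y := by rw [pow_two, Complex.mul_im, hzr, hzi]; ring
  have hw' : (z ^ 2 - 1).im = 2 * (x₀ + ξ) * y := by rw [Complex.sub_im, hw]; simp
  have n1 : 0 < Complex.normSq (z ^ 2) := Complex.normSq_pos.2 (pow_ne_zero _ hz0)
  have n2 : 0 < Complex.normSq (z ^ 2 - 1) := Complex.normSq_pos.2 hz3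
  have e5 : ((z ^ 2)⁻¹ + 1 + 4 * (z ^ 2 - 1)⁻¹).im < 0 := by
    rw [show (4 : ℂ) = ((4 : ℝ) : ℂ) by norm_num]
    rw [Complex.add_im, Complex.add_im, Complex.im_ofReal_mul, Complex.inv_im, Complex.inv_im, hw, hw']
    have p1 : 0 < 2 * (x₀ + ξ) * y / Complex.normSq (z ^ 2) := by positivity
    have p2 : 0 < 2 * (x₀ + ξ) * y / Complex.normSq (z ^ 2 - 1) := by positivity
    simp only [neg_div, Complex.one_im]
    linarith
  rw [← e4] at e5
  by_contra hc
  nlinarith only [e5, hx, hc]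

end ArcPoint

lemma alt_mul_sum_Icc (n : ℕ) (g : ℤ → ℝ) :
    alt n * ∑ k ∈ Finset.Icc (-(n : ℤ)) n, alt k * g k =
      ∑ i ∈ Finset.range (2 * n + 1), (-1) ^ i * g (n - i) := by
  rw [Finset.mul_sum]
  refine Finset.sum_nbij' (fun k => (n - k).toNat) (fun i => (n : ℤ) - i) ?_ ?_ ?_ ?_ ?_
  · intro k hk; simp at hk ⊢; omega
  · intro i hi; simp at hi ⊢; omega
  · intro k hk; simp at hk ⊢; omega
  · intro i hi; simp
  · intro k hk
    simp at hk
    have h1 : (((n : ℤ) - k).toNat : ℤ) = n - k := by omega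
    rw [h1, ← mul_assoc, ← alt_sub, ← h1, alt_natCast]
    simp [h1]

lemma sum_alternating_ge {u : ℕ → ℝ} {N : ℕ} (h : ∀ i, N ≤ i → u (2 * i + 1) ≤ u (2 * i + 2)) (m : ℕ) :
    ∑ i ∈ Finset.range (2 * N + 1), (-1) ^ i * u i ≤
      ∑ i ∈ Finset.range (2 * (N + m) + 1), (-1) ^ i * u i := by
  induction m with
  | zero => simp
  | succ m ih =>
    rw [show 2 * (N + (m + 1)) + 1 = 2 * (N + m) + 1 + 1 + 1 by ring,
      Finset.sum_range_succ _ (2 * (N + m) + 1 + 1), Finset.sum_range_succ _ (2 * (N + m) + 1)]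
    have := h (N + m) (by omega)
    have e1 : (-1 : ℝ) ^ (2 * (N + m) + 1) = -1 := by rw [pow_succ, pow_mul]; norm_num
    have e2 : (-1 : ℝ) ^ (2 * (N + m) + 1 + 1) = 1 := by rw [pow_succ, e1]; norm_num
    simp only [e1, e2]
    linarith

/-- `X (X + 2ρ) / (X² + 2ξ(X + ρ))²` decreases for `X ≥ ρ`. -/
lemma antitoneOn_kernel {ρ ξ : ℝ} (hρ : 0 < ρ) (hξ : 0 < ξ) (hξ' : ξ ≤ 2 * ρ) :
    AntitoneOn (fun X : ℝ => X * (X + 2 * ρ) / (X ^ 2 + 2 * ξ * (X + ρ)) ^ 2) (Set.Ici ρ) := by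
  have hd : ∀ X, 0 < X → 0 < X ^ 2 + 2 * ξ * (X + ρ) := fun X hX => by positivity
  have hD : ∀ X, 0 < X → HasDerivAt (fun X : ℝ => X * (X + 2 * ρ) / (X ^ 2 + 2 * ξ * (X + ρ)) ^ 2)
      (((1 * (X + 2 * ρ) + X * 1) * (X ^ 2 + 2 * ξ * (X + ρ)) ^ 2 -
        (X * (X + 2 * ρ)) * (2 * (X ^ 2 + 2 * ξ * (X + ρ)) * (2 * X + 2 * ξ))) /
          ((X ^ 2 + 2 * ξ * (X + ρ)) ^ 2) ^ 2) X := by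
    intro X hX
    have hden : HasDerivAt (fun X : ℝ => (X ^ 2 + 2 * ξ * (X + ρ)) ^ 2)
        (2 * (X ^ 2 + 2 * ξ * (X + ρ)) * (2 * X + 2 * ξ)) X := by
      have := (((hasDerivAt_id X).pow 2).add (((hasDerivAt_id X).add_const ρ).const_mul (2 * ξ))).pow 2
      refine this.congr_deriv ?_
      simp
    exact ((hasDerivAt_id X).mul ((hasDerivAt_id X).add_const (2 * ρ))).div hden
      (pow_ne_zero _ (hd X hX).ne')
  refine antitoneOn_of_deriv_nonpos (convex_Ici ρ) ?_ ?_ ?_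
  · exact fun X hX => (hD X (hρ.trans_le hX)).continuousAt.continuousWithinAt
  · exact fun X hX => (hD X (hρ.trans_le (interior_subset hX))).differentiableAt.differentiableWithinAt
  · intro X hX
    have hX' : ρ ≤ X := interior_subset hX
    have hX0 := hρ.trans_le hX'
    rw [(hD X hX0).deriv]
    refine div_nonpos_of_nonpos_of_nonneg ?_ (by positivity)
    have e : (1 * (X + 2 * ρ) + X * 1) * (X ^ 2 + 2 * ξ * (X + ρ)) ^ 2 -
        (X * (X + 2 * ρ)) * (2 * (X ^ 2 + 2 * ξ * (X + ρ)) * (2 * X + 2 * ξ)) =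
        -(X ^ 2 + 2 * ξ * (X + ρ)) * (2 * X ^ 3 + 6 * ρ * X ^ 2 - 4 * ξ * ρ ^ 2) := by ring
    rw [e]
    have h1 : 0 ≤ 2 * X ^ 3 + 6 * ρ * X ^ 2 - 4 * ξ * ρ ^ 2 := by
      have : ρ ^ 2 ≤ X ^ 2 := by gcongr
      have : ρ ^ 3 ≤ X ^ 3 := by gcongr
      nlinarith [mul_le_mul_of_nonneg_right hξ' (sq_nonneg ρ)]
    nlinarith [hd X hX0]

set_option maxHeartbeats 800000 in
/-- The three terms of the derivative of the first coordinate that belong to the poles next to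
the catenoid end. -/
lemma three_terms_pos {d δ ζ : ℝ} (hd : 0 < d) (hd' : d ≤ 19 / 20) (hδ : 0 ≤ δ)
    (hδ' : 2 * δ * (2 - d) ≤ d ^ 2) (hζ : 0 < ζ) :
    (2 - d) * (2 + d + 2 * δ) / ((2 - d) ^ 2 + ζ * (2 + δ)) ^ 2 <
      d * (d + 2 * δ) / (d ^ 2 + ζ * δ) ^ 2 +
      (1 - d) * (1 + d + 2 * δ) / ((1 - d) ^ 2 + ζ * (1 + δ)) ^ 2 := by
  set P := d * (d + 2 * δ) with hP
  set Q := (1 - d) * (1 + d + 2 * δ) with hQ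
  set B := (2 - d) * (2 + d + 2 * δ) with hB
  set p := d ^ 2 + ζ * δ with hp
  set q := (1 - d) ^ 2 + ζ * (1 + δ) with hq
  set r := (2 - d) ^ 2 + ζ * (2 + δ) with hr
  have h1d : 0 < 1 - d := by linarith
  have hp0 : 0 < p := by positivity
  have hq0 : 0 < q := by positivity
  have hr0 : 0 < r := by positivity
  have hP0 : 0 < P := by positivity
  have hQ0 : 0 < Q := by positivity
  have hB0 : 0 < B := by
    have : 0 < 2 - d := by linarith
    positivity
  -- the square root of `P * Q`
  set κ := Real.sqrt (P * Q) with hκ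
  have hκ2 : κ ^ 2 = P * Q := Real.sq_sqrt (by positivity)
  have hκ0 : 0 < κ := Real.sqrt_pos.2 (by positivity)
  have h95 : 0 ≤ 19 / 20 - d := sub_nonneg.2 hd'
  have hδ95 := mul_nonneg hδ h95
  have hd95 := mul_nonneg hd.le h95
  have hδδ := mul_nonneg hδ hδ
  have hδ1 : δ ≤ 0.43 := by linarith only [hδ', hδ95, hd95, hd']
  have hκd : d * 0.312 * (1 + 1.4 * δ) ≤ κ := by
    apply Real.le_sqrt_of_sq_le
    have h1 : d * d * (1 + 2 * δ) ≤ P := by rw [hP]; linarith only [mul_nonneg (mul_nonneg hd.le hδ) h1d.le]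
    have h2 : 0.0975 * (1 + 1.02 * δ) ≤ Q := by
      have : 0.05 * (1.95 + 2 * δ) ≤ Q := by rw [hQ]; linarith only [hδ95, hd95, hd']
      linarith only [this, hδ]
    have h3 := mul_le_mul h1 h2 (by positivity) hP0.le
    refine le_trans ?_ h3
    have : (0.312 * (1 + 1.4 * δ)) ^ 2 ≤ (1 + 2 * δ) * (0.0975 * (1 + 1.02 * δ)) := by linarith only [hδ, hδδ]
    linarith only [mul_le_mul_of_nonneg_left this (sq_nonneg d)]
  have h2d : 0 < 2 - d := by linarith
  have hB4 : B ≤ 4 := by rw [hB]; linarith only [hδ']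
  have c0 : B * (d ^ 2 * (1 - d) ^ 2) ≤ 1.6 * κ * (2 - d) ^ 4 := by
    have h1 : 4 * (d * (1 - d) ^ 2) ≤ 1.6 * 0.312 * (2 - d) ^ 4 := by
      nlinarith only [sq_nonneg (d - 0.5), sq_nonneg (d * (1 - d)), sq_nonneg (1 - d), mul_pos hd h1d, hd, h1d]
    calc B * (d ^ 2 * (1 - d) ^ 2) ≤ 4 * (d ^ 2 * (1 - d) ^ 2) := by gcongr
      _ = d * (4 * (d * (1 - d) ^ 2)) := by ring
      _ ≤ d * (1.6 * 0.312 * (2 - d) ^ 4) := by gcongr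
      _ = 1.6 * (d * 0.312 * 1) * (2 - d) ^ 4 := by ring
      _ ≤ 1.6 * (d * 0.312 * (1 + 1.4 * δ)) * (2 - d) ^ 4 := by gcongr; linarith only [hδ]
      _ ≤ _ := by gcongr
  have hδY : δ * (1 - d) ^ 2 ≤ d ^ 2 * ((1 - d) / 4) := by
    have h1 : 2 * δ * (2 - d) * (1 - d) ≤ d ^ 2 * (1 - d) := by gcongr
    linarith only [h1, mul_nonneg (mul_nonneg hδ h1d.le) hd.le]
  have c1 : B * (d ^ 2 * (1 + δ) + δ * (1 - d) ^ 2) < 4.8 * κ * ((2 - d) ^ 2 * (2 + δ)) := by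
    have h1 : (2 + d + 2 * δ) * (d * (1 + δ + (1 - d) / 4)) <
        4.8 * 0.312 * (1 + 1.4 * δ) * ((2 - d) * (2 + δ)) := by
      have hA : d * (1 + δ + (1 - d) / 4) ≤ 0.961875 + 0.95 * δ := by linarith only [hδ95, sq_nonneg (19 / 20 - d), hd']
      have hA0 : 0 ≤ d * (1 + δ + (1 - d) / 4) := by positivity
      calc (2 + d + 2 * δ) * (d * (1 + δ + (1 - d) / 4))
          ≤ (2.95 + 2 * δ) * (0.961875 + 0.95 * δ) := by gcongr; linarith only [hd']
        _ < 4.8 * 0.312 * (1 + 1.4 * δ) * (1.05 * (2 + δ)) := by linarith only [hδ, hδδ]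
        _ ≤ 4.8 * 0.312 * (1 + 1.4 * δ) * ((2 - d) * (2 + δ)) := by gcongr; linarith only [hd']
    calc B * (d ^ 2 * (1 + δ) + δ * (1 - d) ^ 2)
        ≤ B * (d ^ 2 * (1 + δ) + d ^ 2 * ((1 - d) / 4)) := by gcongr
      _ = d * (2 - d) * ((2 + d + 2 * δ) * (d * (1 + δ + (1 - d) / 4))) := by rw [hB]; ring
      _ < d * (2 - d) * (4.8 * 0.312 * (1 + 1.4 * δ) * ((2 - d) * (2 + δ))) := by gcongr
      _ = 4.8 * (d * 0.312 * (1 + 1.4 * δ)) * ((2 - d) ^ 2 * (2 + δ)) := by ring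
      _ ≤ _ := by gcongr
  have c2 : B * (δ * (1 + δ)) ≤ 1.6 * κ * (2 + δ) ^ 2 := by
    have hδ2 : δ ≤ d * 0.4525 := by linarith only [hδ', hδ95, hd95, hd]
    calc B * (δ * (1 + δ)) ≤ 4 * (d * 0.4525 * (1 + δ)) := by gcongr
      _ ≤ 1.6 * (d * 0.312 * (1 + 1.4 * δ)) * (2 + δ) ^ 2 := by
        have : 4 * 0.4525 * (1 + δ) ≤ 1.6 * 0.312 * (1 + 1.4 * δ) * (2 + δ) ^ 2 := by
          linarith only [hδ, hδδ, mul_nonneg hδδ hδ]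
        linarith only [mul_le_mul_of_nonneg_left this hd.le]
      _ ≤ _ := by gcongr
  have hmain : B * (p * q) < 2 * κ * r ^ 2 := by
    have h1 : 2 * κ * (0.8 * ((2 - d) ^ 4 + ζ ^ 2 * (2 + δ) ^ 2) + 2.4 * ((2 - d) ^ 2 * (2 + δ)) * ζ) ≤
        2 * κ * r ^ 2 := by
      gcongr
      rw [hr]; linarith only [sq_nonneg ((2 - d) ^ 2 - ζ * (2 + δ))]
    refine lt_of_lt_of_le ?_ h1
    have e1 : B * (p * q) = B * (d ^ 2 * (1 - d) ^ 2) + B * (d ^ 2 * (1 + δ) + δ * (1 - d) ^ 2) * ζ +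
        B * (δ * (1 + δ)) * ζ ^ 2 := by rw [hp, hq]; ring
    rw [e1]
    have h2 := mul_lt_mul_of_pos_right c1 hζ
    have h3 := mul_le_mul_of_nonneg_right c2 (sq_nonneg ζ)
    have e2 : 2 * κ * (0.8 * ((2 - d) ^ 4 + ζ ^ 2 * (2 + δ) ^ 2) + 2.4 * ((2 - d) ^ 2 * (2 + δ)) * ζ) =
        1.6 * κ * (2 - d) ^ 4 + 4.8 * κ * ((2 - d) ^ 2 * (2 + δ)) * ζ +
          1.6 * κ * (2 + δ) ^ 2 * ζ ^ 2 := by ring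
    rw [e2]
    exact add_lt_add_of_lt_of_le (add_lt_add_of_le_of_lt c0 h2) h3
  have hAM : 2 * κ / (p * q) ≤ P / p ^ 2 + Q / q ^ 2 := by
    have e : P / p ^ 2 + Q / q ^ 2 - 2 * κ / (p * q) =
        (Real.sqrt P / p - Real.sqrt Q / q) ^ 2 := by
      have : κ = Real.sqrt P * Real.sqrt Q := Real.sqrt_mul hP0.le Q
      rw [this]
      have hp2 := Real.sq_sqrt hP0.le
      have hq2 := Real.sq_sqrt hQ0.le
      field_simp
      linear_combination (-q ^ 2) * hp2 - p ^ 2 * hq2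
    exact sub_nonneg.1 (e ▸ sq_nonneg _)
  refine lt_of_lt_of_le ?_ hAM
  rw [div_lt_div_iff₀ (by positivity) (by positivity)]
  linarith only [hmain]

/-- If `x₀` is close to `n`, the first coordinate is monotone along the whole arc. -/
lemma ArcPoint.alt_mul_im_pos {n : ℕ} {x₀ ρ ξ y : ℝ} (h : ArcPoint n x₀ ρ ξ y) (hn : 2 ≤ n)
    (hd : n - x₀ ≤ 19 / 20) : 0 < alt n * ((⟨ρ - ξ, -y⟩ : ℂ) * altSum₂ n ⟨x₀ + ξ, y⟩).im := by
  have hn' : (2 : ℝ) ≤ n := by exact_mod_cast hn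
  rw [im_mul_altSum₂, alt_mul_sum_Icc]
  set d := n - x₀ with hdd
  have hd0 : 0 < d := sub_pos.2 h.left_lt
  have hρ := h.rho_pos
  have hξ := h.xi_pos
  have hξ' := h.xi_lt
  have hr' := h.radius'
  have hρd := h.le_rho
  set t : ℝ → ℝ := fun X => X * (X + 2 * ρ) / (X ^ 2 + 2 * ξ * (X + ρ)) ^ 2 with ht
  have hterm : ∀ i : ℕ, ((⟨ρ - ξ, -y⟩ : ℂ) / ((⟨x₀ + ξ, y⟩ : ℂ) - ((n - i : ℤ) : ℂ)) ^ 2).im =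
      -(y * t (i - d)) := by
    intro i
    rw [h.im_term, ht]
    push_cast
    rw [show (n : ℝ) - i - x₀ = -(i - d) by rw [hdd]; ring, ← mul_neg, ← neg_div]
    congr 2
    · ring
    · ring
  simp only [hterm]
  have hρ3 : ρ ≤ 1.4 := by
    have h1 : 2 * (ρ - d) * (2 - d) ≤ d ^ 2 := by nlinarith [hr']
    nlinarith
  obtain ⟨m, rfl⟩ : ∃ m, n = 1 + m := ⟨n - 1, by omega⟩
  have hge := sum_alternating_ge (u := fun i : ℕ => -(y * t (i - d))) (N := 1) (fun i hi => by
    have hi' : (1 : ℝ) ≤ i := by exact_mod_cast hi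
    have := antitoneOn_kernel hρ hξ hξ'.le (a := ((2 * i + 1 : ℕ) : ℝ) - d)
      (b := ((2 * i + 2 : ℕ) : ℝ) - d) (by simp; linarith) (by simp; linarith) (by simp)
    have := mul_le_mul_of_nonneg_left this h.im_pos.le
    simp only [ht]
    linarith only [this]) m
  refine lt_of_lt_of_le ?_ hge
  have h3 := three_terms_pos (d := d) (δ := ρ - d) (ζ := 2 * ξ) hd0 hd (by linarith) (by nlinarith)
    (by linarith)
  have h4 := mul_lt_mul_of_pos_left h3 h.im_pos
  simp only [Finset.sum_range_succ, Finset.sum_range_zero, ht]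
  push_cast
  convert sub_pos.2 h4 using 1
  ring_nf

lemma sum_Icc_tail {M : Type*} [AddCommMonoid M] (f : ℤ → M) (n m : ℕ) :
    ∑ k ∈ Finset.Icc (-((n + m : ℕ) : ℤ)) ((n + m : ℕ) : ℤ), f k =
      ∑ k ∈ Finset.Icc (-(n : ℤ)) n, f k +
        ∑ i ∈ Finset.range m, (f (n + i + 1) + f (-(n + i + 1))) := by
  induction m with
  | zero => simp
  | succ m ih =>
    rw [show n + (m + 1) = (n + m) + 1 by ring, sum_Icc_neg_succ, ih, Finset.sum_range_succ, add_assoc]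
    push_cast
    rfl

lemma alt_tail (n i : ℕ) : alt ((n : ℤ) + i + 1) = -(alt n * (-1) ^ i) := by
  rw [alt_succ, alt_add, alt_natCast i]

lemma tendsto_tail_fullSum₂ (n : ℕ) {z : ℂ} (hz : 0 < z.im) :
    Tendsto (fun m : ℕ => ∑ i ∈ Finset.range m,
      (1 / (n - z + (i + 1)) ^ 2 + 1 / (n + z + (i + 1)) ^ 2)) atTop
      (𝓝 ((Real.pi / Complex.sin (Real.pi * z)) ^ 2 - fullSum₂ n z)) := by
  have h := ((tendsto_fullSum₂ hz).comp (tendsto_add_atTop_nat n)).sub_const (fullSum₂ n z)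
  refine h.congr fun m => ?_
  simp only [Function.comp, fullSum₂]
  rw [add_comm m n, sum_Icc_tail, add_sub_cancel_left]
  refine Finset.sum_congr rfl fun i _ => ?_
  push_cast
  congr 2
  · ring
  · ring

lemma tendsto_tail_fullSum (n : ℕ) {z : ℂ} (hz : 0 < z.im) :
    Tendsto (fun m : ℕ => ∑ i ∈ Finset.range m,
      (1 / (z - (n + (i + 1))) + 1 / (z + (n + (i + 1))))) atTop
      (𝓝 (Real.pi * Complex.cot (Real.pi * z) - fullSum n z)) := by
  have h := ((tendsto_fullSum hz).comp (tendsto_add_atTop_nat n)).sub_const (fullSum n z)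
  refine h.congr fun m => ?_
  simp only [Function.comp, fullSum]
  rw [add_comm m n, sum_Icc_tail, add_sub_cancel_left]
  refine Finset.sum_congr rfl fun i _ => ?_
  push_cast
  congr 2
  · ring
  · ring

lemma tendsto_two_mul_add (n : ℕ) : Tendsto (fun m : ℕ => 2 * m + n) atTop atTop :=
  tendsto_atTop_mono (fun m => by simp only [id]; omega) tendsto_id

lemma tendsto_tail_altSum (n : ℕ) {z : ℂ} (hz : 0 < z.im) :
    Tendsto (fun m : ℕ => (alt n : ℂ) * ∑ i ∈ Finset.range (2 * m + n),
      (-1) ^ i * (1 / (n - z + (i + 1)) - 1 / (n + z + (i + 1)))) atTop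
      (𝓝 (Real.pi / Complex.sin (Real.pi * z) - altSum n z)) := by
  have h := ((tendsto_altSum hz).comp (tendsto_add_atTop_nat n)).sub_const (altSum n z)
  refine h.congr fun m => ?_
  simp only [Function.comp, altSum]
  rw [show 2 * (m + n) = n + (2 * m + n) by ring, sum_Icc_tail, add_sub_cancel_left, Finset.mul_sum]
  refine Finset.sum_congr rfl fun i _ => ?_
  rw [alt_neg, alt_tail]
  push_cast
  rw [show z - ((n : ℂ) + i + 1) = -(n - z + (i + 1)) by ring,
    show z - (-((n : ℂ) + i + 1)) = n + z + (i + 1) by ring, neg_div_neg_eq]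
  ring

lemma tendsto_tail_altSum₂ (n : ℕ) {z : ℂ} (hz : 0 < z.im) :
    Tendsto (fun m : ℕ => -(alt n : ℂ) * ∑ i ∈ Finset.range (2 * m + n),
      (-1) ^ i * (1 / (z - (n + i + 1 : ℤ)) ^ 2 + 1 / (z - (-(n + i + 1) : ℤ)) ^ 2)) atTop
      (𝓝 (Real.pi ^ 2 * Complex.cos (Real.pi * z) / Complex.sin (Real.pi * z) ^ 2 -
        altSum₂ n z)) := by
  have h := ((tendsto_altSum₂ hz).comp (tendsto_add_atTop_nat n)).sub_const (altSum₂ n z)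
  refine h.congr fun m => ?_
  simp only [Function.comp, altSum₂]
  rw [show 2 * (m + n) = n + (2 * m + n) by ring, sum_Icc_tail, add_sub_cancel_left, Finset.mul_sum]
  refine Finset.sum_congr rfl fun i _ => ?_
  rw [alt_neg, alt_tail]
  push_cast
  ring

/-- Comparison of `∑ 1 / (v + i)²` with the telescoping sum of `1 / (v + i - 1/2)`. -/
lemma sum_inv_sq_eq (v : ℂ) (hv : ∀ i : ℕ, v + (i + 1) ≠ 0) (hv' : ∀ i : ℕ, v + i + 1 / 2 ≠ 0) (m : ℕ) :
    ∑ i ∈ Finset.range m, 1 / (v + (i + 1)) ^ 2 = 1 / (v + 1 / 2) - 1 / (v + m + 1 / 2) -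
      ∑ i ∈ Finset.range m, 1 / (4 * (v + (i + 1)) ^ 2 * ((v + (i + 1)) ^ 2 - 1 / 4)) := by
  induction m with
  | zero => simp
  | succ m ih =>
    rw [Finset.sum_range_succ, ih, Finset.sum_range_succ]
    have h1 := hv m
    have h2 := hv' m
    have h3 := hv' (m + 1)
    push_cast at h3 ⊢
    have e : (v + (m + 1)) ^ 2 - 1 / 4 = (v + m + 1 / 2) * (v + (m + 1) + 1 / 2) := by ring
    have key : 1 / (v + (m + 1)) ^ 2 = 1 / (v + m + 1 / 2) - 1 / (v + (m + 1) + 1 / 2) -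
        1 / (4 * (v + (m + 1)) ^ 2 * ((v + (m + 1)) ^ 2 - 1 / 4)) := by
      rw [e]
      generalize hA : v + m + 1 / 2 = A at *
      generalize hB : v + (m + 1) + 1 / 2 = B at *
      generalize hw : v + (m + 1) = w at *
      have hA' : A = w - 1 / 2 := by rw [← hA, ← hw]; ring
      have hB' : B = w + 1 / 2 := by rw [← hB, ← hw]
      field_simp
      rw [hA', hB']; ring
    rw [key]; ring

/-- Comparison of `∑ (-1)^i / (v + i)` with the telescoping sum of `1 / (2 (v + i - 1/2))`. -/
lemma sum_alternating_inv_eq (v : ℂ) (hv : ∀ i : ℕ, v + (i + 1) ≠ 0)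
    (hv' : ∀ i : ℕ, v + i + 1 / 2 ≠ 0) (m : ℕ) :
    ∑ i ∈ Finset.range m, (-1) ^ i * (1 / (v + (i + 1))) =
      1 / (2 * (v + 1 / 2)) - (-1) ^ m * (1 / (2 * (v + m + 1 / 2))) -
      ∑ i ∈ Finset.range m, (-1) ^ i * (1 / (4 * (v + (i + 1)) * ((v + (i + 1)) ^ 2 - 1 / 4))) := by
  induction m with
  | zero => simp
  | succ m ih =>
    rw [Finset.sum_range_succ, ih, Finset.sum_range_succ]
    have h1 := hv m
    have h2 := hv' m
    have h3 := hv' (m + 1)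
    push_cast at h3 ⊢
    have e : (v + (m + 1)) ^ 2 - 1 / 4 = (v + m + 1 / 2) * (v + (m + 1) + 1 / 2) := by ring
    have key : 1 / (v + (m + 1)) = 1 / (2 * (v + m + 1 / 2)) + 1 / (2 * (v + (m + 1) + 1 / 2)) -
        1 / (4 * (v + (m + 1)) * ((v + (m + 1)) ^ 2 - 1 / 4)) := by
      rw [e]
      generalize hA : v + m + 1 / 2 = A at *
      generalize hB : v + (m + 1) + 1 / 2 = B at *
      generalize hw : v + (m + 1) = w at *
      have hA' : A = w - 1 / 2 := by rw [← hA, ← hw]; ring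
      have hB' : B = w + 1 / 2 := by rw [← hB, ← hw]
      field_simp
      rw [hA', hB']; ring
    rw [key, pow_succ]; ring

lemma tendsto_inv_add_nat (v : ℂ) : Tendsto (fun m : ℕ => 1 / (v + m + 1 / 2)) atTop (𝓝 0) := by
  have : Tendsto (fun m : ℕ => ‖v + m + 1 / 2‖) atTop atTop := by
    have h1 : Tendsto (fun m : ℕ => (m : ℝ) - ‖v + 1 / 2‖) atTop atTop :=
      tendsto_atTop_add_const_right _ _ tendsto_natCast_atTop_atTop
    refine tendsto_atTop_mono (fun m => ?_) h1
    have := norm_sub_norm_le (m : ℂ) (-(v + 1 / 2))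
    rw [norm_neg, sub_neg_eq_add, Complex.norm_natCast] at this
    rwa [show v + m + 1 / 2 = m + (v + 1 / 2) by ring]
  rw [tendsto_zero_iff_norm_tendsto_zero]
  refine this.inv_tendsto_atTop.congr fun m => ?_
  simp

lemma norm_sq_sub_quarter (w : ℂ) : ‖w‖ ^ 2 - 1 / 4 ≤ ‖w ^ 2 - 1 / 4‖ := by
  have := norm_sub_norm_le (w ^ 2) (1 / 4)
  simpa [norm_pow] using this

lemma add_ne_zero_of_re {v : ℂ} (hv : 0 ≤ v.re) : (∀ i : ℕ, v + (i + 1) ≠ 0) ∧ ∀ i : ℕ, v + i + 1 / 2 ≠ 0 := by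
  constructor
  · intro i h
    have := congrArg Complex.re h
    simp at this
    have : (0 : ℝ) ≤ i := Nat.cast_nonneg i
    linarith
  · intro i h
    have := congrArg Complex.re h
    simp at this
    have : (0 : ℝ) ≤ i := Nat.cast_nonneg i
    linarith

lemma normSq_add_natSucc (v : ℂ) (i : ℕ) :
    ‖v + (i + 1)‖ ^ 2 = (v.re + (i + 1)) ^ 2 + v.im ^ 2 := by
  rw [← Complex.normSq_eq_norm_sq, Complex.normSq_apply]
  simp; ring

/-- The error in the comparison of `∑ 1 / (v + i)²` with `1 / (v + 1/2)`. -/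
lemma sum_inv_sq_error_le {v : ℂ} (hv : 0 ≤ v.re) (hr : 0.95 ≤ ‖v‖) (m : ℕ) :
    (1 + ‖v‖) ^ 2 * ∑ i ∈ Finset.range m,
      ‖1 / (4 * (v + (i + 1)) ^ 2 * ((v + (i + 1)) ^ 2 - 1 / 4))‖ ≤ 0.41 := by
  set r := ‖v‖ with hrdef
  have hterm : ∀ i : ℕ, ‖1 / (4 * (v + (i + 1)) ^ 2 * ((v + (i + 1)) ^ 2 - 1 / 4))‖ ≤
      1 / (4 * (r ^ 2 + (i + 1) ^ 2) * (r ^ 2 + (i + 1) ^ 2 - 1 / 4)) := by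
    intro i
    have h1 : r ^ 2 + ((i : ℝ) + 1) ^ 2 ≤ ‖v + (i + 1)‖ ^ 2 := by
      rw [normSq_add_natSucc, hrdef, ← Complex.normSq_eq_norm_sq, Complex.normSq_apply]
      have : (0 : ℝ) ≤ i := Nat.cast_nonneg i
      nlinarith [mul_nonneg hv (by linarith : (0 : ℝ) ≤ i + 1)]
    have h2 := norm_sq_sub_quarter (v + (i + 1))
    rw [norm_div, norm_one, norm_mul, norm_mul, norm_pow]
    have h3 : (0 : ℝ) < (i + 1) ^ 2 := by positivity
    have h4 : (0 : ℝ) < r ^ 2 + (i + 1) ^ 2 - 1 / 4 := by nlinarith only [hr, h3]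
    have h5 : ‖(4 : ℂ)‖ = 4 := by norm_num
    rw [h5]
    apply one_div_le_one_div_of_le (by positivity)
    gcongr
    linarith
  have hi : ∀ i : ℕ, 1 ≤ i → (1 + r) ^ 2 * (1 / (4 * (r ^ 2 + (i + 1) ^ 2) * (r ^ 2 + (i + 1) ^ 2 - 1 / 4))) ≤
      1 / 16 * (1 / (i : ℝ) ^ 2) := by
    intro i hi
    have hi' : (1 : ℝ) ≤ i := by exact_mod_cast hi
    have h1 : 2 * (1 + r) * i ≤ r ^ 2 + (i + 1) ^ 2 - 1 / 4 := by nlinarith [sq_nonneg (r - i)]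
    have h2 : 0 < 2 * (1 + r) * i := by positivity
    have h3 : (2 * (1 + r) * i) * (2 * (1 + r) * i) ≤ (r ^ 2 + (i + 1) ^ 2) * (r ^ 2 + (i + 1) ^ 2 - 1 / 4) :=
      mul_le_mul (by linarith) h1 h2.le (by positivity)
    have h4 : 0 < (r ^ 2 + ((i : ℝ) + 1) ^ 2) * (r ^ 2 + (i + 1) ^ 2 - 1 / 4) := lt_of_lt_of_le (by positivity) h3
    rw [mul_one_div, mul_one_div, div_div, div_le_div_iff₀ (by nlinarith only [h4]) (by positivity)]
    nlinarith only [h3]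
  have hsum : ∀ m : ℕ, (1 + r) ^ 2 * ∑ i ∈ Finset.range (m + 2),
      1 / (4 * (r ^ 2 + ((i : ℝ) + 1) ^ 2) * (r ^ 2 + (i + 1) ^ 2 - 1 / 4)) ≤
      0.41 - 1 / 16 * (1 / (m + 3 / 2)) := by
    intro m
    induction m with
    | zero =>
      rw [Finset.sum_range_succ, Finset.sum_range_one, mul_add]
      have h0 : (1 + r) ^ 2 * (1 / (4 * (r ^ 2 + (((0 : ℕ) : ℝ) + 1) ^ 2) * (r ^ 2 + (((0 : ℕ) : ℝ) + 1) ^ 2 - 1 / 4))) ≤ 0.3055 := by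
        rw [mul_one_div, div_le_iff₀ (by norm_num; nlinarith)]
        norm_num
        have hr' : 0 ≤ r - 0.95 := by linarith
        nlinarith [mul_nonneg hr' hr', mul_nonneg (mul_nonneg hr' hr') hr', mul_nonneg (mul_nonneg hr' hr') (mul_nonneg hr' hr')]
      have h1 := hi 1 le_rfl
      norm_num at h0 h1 ⊢
      linarith
    | succ m ih =>
      rw [show m + 1 + 2 = (m + 2) + 1 by ring, Finset.sum_range_succ, mul_add]
      have h1 := hi (m + 2) (by omega)
      have h2 : 1 / 16 * (1 / ((m + 2 : ℕ) : ℝ) ^ 2) ≤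
          1 / 16 * (1 / (m + 3 / 2)) - 1 / 16 * (1 / (((m + 1 : ℕ) : ℝ) + 3 / 2)) := by
        have : (0 : ℝ) ≤ m := Nat.cast_nonneg m
        push_cast
        rw [← mul_sub]
        gcongr
        rw [div_sub_div _ _ (by positivity) (by positivity), div_le_div_iff₀ (by positivity) (by positivity)]
        nlinarith only []
      linarith only [ih, h1, h2]
  have hmono : ∑ i ∈ Finset.range m, ‖1 / (4 * (v + (i + 1)) ^ 2 * ((v + (i + 1)) ^ 2 - 1 / 4))‖ ≤
      ∑ i ∈ Finset.range (m + 2), 1 / (4 * (r ^ 2 + ((i : ℝ) + 1) ^ 2) * (r ^ 2 + (i + 1) ^ 2 - 1 / 4)) := by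
    refine (Finset.sum_le_sum fun i _ => hterm i).trans ?_
    refine Finset.sum_le_sum_of_subset_of_nonneg (Finset.range_mono (by omega)) fun i _ _ => ?_
    exact (norm_nonneg _).trans (hterm i)
  calc _ ≤ (1 + r) ^ 2 * ∑ i ∈ Finset.range (m + 2), 1 / (4 * (r ^ 2 + ((i : ℝ) + 1) ^ 2) * (r ^ 2 + (i + 1) ^ 2 - 1 / 4)) := by gcongr
    _ ≤ _ := hsum m
    _ ≤ 0.41 := by
      have : (0 : ℝ) ≤ 1 / 16 * (1 / (m + 3 / 2)) := by positivity
      linarith only [this]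

lemma sum_le_of_telescope {f g : ℕ → ℝ} (hg : ∀ i, 0 ≤ g i) (h : ∀ i, f i ≤ g i - g (i + 1)) (m : ℕ) :
    ∑ i ∈ Finset.range m, f i ≤ g 0 := by
  calc ∑ i ∈ Finset.range m, f i ≤ ∑ i ∈ Finset.range m, (g i - g (i + 1)) :=
        Finset.sum_le_sum fun i _ => h i
    _ = g 0 - g m := Finset.sum_range_sub' g m
    _ ≤ g 0 := by linarith [hg m]

lemma sum_inv_sq_error_le' {v : ℂ} {p : ℝ} (hp : 0 ≤ p) (hv : p ≤ v.re) (m : ℕ) :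
    ∑ i ∈ Finset.range m, ‖1 / (4 * (v + (i + 1)) ^ 2 * ((v + (i + 1)) ^ 2 - 1 / 4))‖ ≤
      1 / (12 * (p + 1 / 2) ^ 3) := by
  have h := sum_le_of_telescope (g := fun i : ℕ => 1 / (12 * (p + i + 1 / 2) ^ 3))
    (f := fun i : ℕ => ‖1 / (4 * (v + (i + 1)) ^ 2 * ((v + (i + 1)) ^ 2 - 1 / 4))‖)
    (fun i => by positivity) (fun i => ?_) m
  · simpa using h
  · have hi : (0 : ℝ) ≤ i := Nat.cast_nonneg i
    obtain ⟨k, hk⟩ : ∃ k, k = p + (i + 1) := ⟨_, rfl⟩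
    have hk1 : 1 ≤ k := by rw [hk]; linarith
    have h1 : k ^ 2 ≤ ‖v + (i + 1)‖ ^ 2 := by
      rw [normSq_add_natSucc, hk]
      nlinarith [sq_nonneg v.im]
    have h2 := norm_sq_sub_quarter (v + (i + 1))
    have h4 : (0 : ℝ) < k ^ 2 - 1 / 4 := by nlinarith only [hp, hk]
    rw [norm_div, norm_one, norm_mul, norm_mul, norm_pow, show ‖(4 : ℂ)‖ = 4 by norm_num]
    calc 1 / (4 * ‖v + (i + 1)‖ ^ 2 * ‖(v + (i + 1)) ^ 2 - 1 / 4‖) ≤ 1 / (4 * k ^ 2 * (k ^ 2 - 1 / 4)) := by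
          apply one_div_le_one_div_of_le (by positivity)
          gcongr
          linarith
      _ ≤ 1 / (12 * (k - 1 / 2) ^ 3) - 1 / (12 * (k + 1 / 2) ^ 3) := by
          have hA : 0 < k - 1 / 2 := by linarith
          rw [div_sub_div _ _ (by positivity) (by positivity), div_le_div_iff₀ (by positivity) (by positivity)]
          have e : (1 * (12 * (k + 1 / 2) ^ 3) - 12 * (k - 1 / 2) ^ 3 * 1) * (4 * k ^ 2 * (k ^ 2 - 1 / 4)) -
              1 * (12 * (k - 1 / 2) ^ 3 * (12 * (k + 1 / 2) ^ 3)) =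
              (k ^ 2 - 1 / 4) * (84 * k ^ 2 - 9) := by ring
          have : 0 ≤ (k ^ 2 - 1 / 4) * (84 * k ^ 2 - 9) := mul_nonneg h4.le (by nlinarith only [h4])
          linarith only [this]
      _ = _ := by rw [hk]; push_cast; ring_nf

lemma sum_alternating_error_le {v : ℂ} {p : ℝ} (hp : 0 ≤ p) (hv : p ≤ v.re) (m : ℕ) :
    ∑ i ∈ Finset.range m, ‖1 / (4 * (v + (i + 1)) * ((v + (i + 1)) ^ 2 - 1 / 4))‖ ≤
      1 / (8 * (p + 1 / 2) ^ 2) := by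
  have h := sum_le_of_telescope (g := fun i : ℕ => 1 / (8 * (p + i + 1 / 2) ^ 2))
    (f := fun i : ℕ => ‖1 / (4 * (v + (i + 1)) * ((v + (i + 1)) ^ 2 - 1 / 4))‖)
    (fun i => by positivity) (fun i => ?_) m
  · simpa using h
  · have hi : (0 : ℝ) ≤ i := Nat.cast_nonneg i
    obtain ⟨k, hk⟩ : ∃ k, k = p + (i + 1) := ⟨_, rfl⟩
    have hk1 : 1 ≤ k := by rw [hk]; linarith
    have h1 : k ^ 2 ≤ ‖v + (i + 1)‖ ^ 2 := by
      rw [normSq_add_natSucc, hk]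
      nlinarith [sq_nonneg v.im]
    have h1' : k ≤ ‖v + (i + 1)‖ := by
      exact (sq_le_sq₀ (by linarith) (norm_nonneg _)).1 h1
    have h2 := norm_sq_sub_quarter (v + (i + 1))
    have h4 : (0 : ℝ) < k ^ 2 - 1 / 4 := by nlinarith only [hp, hk]
    rw [norm_div, norm_one, norm_mul, norm_mul, show ‖(4 : ℂ)‖ = 4 by norm_num]
    calc 1 / (4 * ‖v + (i + 1)‖ * ‖(v + (i + 1)) ^ 2 - 1 / 4‖) ≤ 1 / (4 * k * (k ^ 2 - 1 / 4)) := by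
          apply one_div_le_one_div_of_le (by positivity)
          gcongr
          linarith
      _ ≤ 1 / (8 * (k - 1 / 2) ^ 2) - 1 / (8 * (k + 1 / 2) ^ 2) := by
          have hA : 0 < k - 1 / 2 := by linarith
          rw [div_sub_div _ _ (by positivity) (by positivity), div_le_div_iff₀ (by positivity) (by positivity)]
          have e : (1 * (8 * (k + 1 / 2) ^ 2) - 8 * (k - 1 / 2) ^ 2 * 1) * (4 * k * (k ^ 2 - 1 / 4)) -
              1 * (8 * (k - 1 / 2) ^ 2 * (8 * (k + 1 / 2) ^ 2)) = 16 * (k ^ 2 - 1 / 4) := by ring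
          linarith only [h4]
      _ = _ := by rw [hk]; push_cast; ring_nf

lemma sum_alternating_error_le' {v : ℂ} (hv : 0 ≤ v.re) {y : ℝ} (hy : |v.im| = y) (hy' : 1 / 2 ≤ y) (m : ℕ) :
    ∑ i ∈ Finset.range m, ‖1 / (4 * (v + (i + 1)) * ((v + (i + 1)) ^ 2 - 1 / 4))‖ ≤
      3 / (8 * (v.re + 1 / 2 + y) ^ 2) := by
  have h := sum_le_of_telescope (g := fun i : ℕ => 3 / (8 * (v.re + i + 1 / 2 + y) ^ 2))
    (f := fun i : ℕ => ‖1 / (4 * (v + (i + 1)) * ((v + (i + 1)) ^ 2 - 1 / 4))‖)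
    (fun i => by positivity) (fun i => ?_) m
  · simpa using h
  · have hi : (0 : ℝ) ≤ i := Nat.cast_nonneg i
    obtain ⟨k, hk⟩ : ∃ k, k = v.re + (i + 1) + y := ⟨_, rfl⟩
    have hk1 : 3 / 2 ≤ k := by rw [hk]; linarith
    have h1 : k ^ 2 / 2 ≤ ‖v + (i + 1)‖ ^ 2 := by
      rw [normSq_add_natSucc, hk, ← sq_abs v.im, hy]
      nlinarith [sq_nonneg (v.re + (i + 1) - y)]
    have h1' : 0.7071 * k ≤ ‖v + (i + 1)‖ := by
      refine (sq_le_sq₀ (by linarith) (norm_nonneg _)).1 (le_trans ?_ h1)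
      nlinarith [sq_nonneg k]
    have h2 := norm_sq_sub_quarter (v + (i + 1))
    have h4 : (0 : ℝ) < k ^ 2 / 2 - 1 / 4 := by nlinarith only [hv, hy', hk]
    rw [norm_div, norm_one, norm_mul, norm_mul, show ‖(4 : ℂ)‖ = 4 by norm_num]
    calc 1 / (4 * ‖v + (i + 1)‖ * ‖(v + (i + 1)) ^ 2 - 1 / 4‖) ≤ 1 / (4 * (0.7071 * k) * (k ^ 2 / 2 - 1 / 4)) := by
          apply one_div_le_one_div_of_le (by positivity)
          gcongr
          linarith
      _ ≤ 3 / (8 * (k - 1 / 2) ^ 2) - 3 / (8 * (k + 1 / 2) ^ 2) := by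
          have hA : 0 < k - 1 / 2 := by linarith
          rw [div_sub_div 3 3 (show 8 * (k - 1 / 2) ^ 2 ≠ 0 by positivity)
            (show 8 * (k + 1 / 2) ^ 2 ≠ 0 by positivity), div_le_div_iff₀ (by positivity) (by positivity)]
          have h5 : 0 ≤ k ^ 2 - 9 / 4 := by nlinarith only [hv, hy', hk]
          have e : (3 * (8 * (k + 1 / 2) ^ 2) - 8 * (k - 1 / 2) ^ 2 * 3) * (4 * (0.7071 * k) * (k ^ 2 / 2 - 1 / 4)) -
              1 * (8 * (k - 1 / 2) ^ 2 * (8 * (k + 1 / 2) ^ 2)) =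
              3.8816 * k ^ 4 - 1.9408 * k ^ 2 - 4 := by ring
          nlinarith [mul_nonneg h5 h5]
      _ = _ := by rw [hk]; push_cast; ring_nf

lemma sq_le_cube_of_two_le {t : ℝ} (ht : 2 ≤ t) : (t + 1) ^ 2 ≤ 0.05 * (12 * (t + 1 / 2) ^ 3) := by
  have h2 : 0 ≤ t - 2 := by linarith
  nlinarith only [mul_nonneg h2 h2, mul_nonneg (mul_nonneg h2 h2) h2, h2]

namespace ArcPoint
variable {n : ℕ} {x₀ ρ ξ y : ℝ}

/-- Properties of the part of the arc inside the disc of radius `n`. -/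
lemma early_bounds (h : ArcPoint n x₀ ρ ξ y) (he : (x₀ + ξ) ^ 2 + y ^ 2 < n ^ 2) :
    ξ < ρ ∧ ξ ≤ y ∧ y < n ∧ x₀ + ξ < n ∧ 2 * ρ * ξ ≤ 2 * y ^ 2 ∧ ρ * ξ ≤ y ^ 2 := by
  have h1 := h.left_pos; have h2 := h.xi_pos; have h3 := h.im_pos; have h4 := h.circle
  have h5 := h.radius; have h6 := h.rho_pos
  have hn : (0 : ℝ) ≤ n := Nat.cast_nonneg n
  have a1 : ξ < ρ := by
    by_contra hc
    nlinarith
  have a2 : ξ ≤ y := by nlinarith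
  refine ⟨a1, a2, by nlinarith, by nlinarith, by nlinarith only [h4, h2, a1], by nlinarith⟩

lemma norm_om (h : ArcPoint n x₀ ρ ξ y) : ‖(⟨ρ - ξ, -y⟩ : ℂ)‖ = ρ := by
  have : ‖(⟨ρ - ξ, -y⟩ : ℂ)‖ ^ 2 = ρ ^ 2 := by
    rw [← Complex.normSq_eq_norm_sq, Complex.normSq_apply]
    simp
    linear_combination h.circle
  exact (sq_eq_sq₀ (norm_nonneg _) h.rho_pos.le).1 this

/-- The main part of the contribution of the integers `|k| > n`. -/
lemma re_mul_main_ge (h : ArcPoint n x₀ ρ ξ y) (he : (x₀ + ξ) ^ 2 + y ^ 2 < n ^ 2) (hn : 2 ≤ n)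
    (hd : 0.95 ≤ n - x₀) :
    2 / (2 * (n - x₀) + 1 + y ^ 2) * ρ ≤ ((⟨ρ - ξ, -y⟩ : ℂ) *
      (1 / ((n : ℂ) - ⟨x₀ + ξ, y⟩ + 1 / 2) + 1 / ((n : ℂ) + ⟨x₀ + ξ, y⟩ + 1 / 2))).re := by
  obtain ⟨a1, a2, a3, a4, a5, a6⟩ := h.early_bounds he
  have hρ := h.rho_pos
  have hx0 := h.left_pos
  have hξ := h.xi_pos
  have hy := h.im_pos
  have hrad := h.radius
  have hn' : (2 : ℝ) ≤ n := by exact_mod_cast hn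
  set g := 2 * (x₀ + ξ) * ρ with hg
  set N := (n : ℝ) + 1 / 4 with hN
  set B := 2 * (n - x₀) + 1 + y ^ 2 with hB
  have hB0 : 0 < B := by positivity
  have hgN : N ≤ g := by
    have h1 : x₀ ^ 2 ≤ ((n : ℝ) - 0.95) ^ 2 := by gcongr; linarith
    have h2 : 0 < 2 * ξ * ρ := by positivity
    have h3 : g = n ^ 2 - x₀ ^ 2 + 2 * ξ * ρ := by rw [← hrad, hg]; ring
    rw [h3, hN]
    nlinarith only [h1, h2, hn']
  have k2 : 2 * (g + N) ≤ (2 * n + 1) * B := by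
    have h3 : g = n ^ 2 - x₀ ^ 2 + 2 * ρ * ξ := by rw [← hrad, hg]; ring
    have h4 : 2 * y ^ 2 * 2 ≤ (2 * n + 1) * y ^ 2 := by nlinarith only [sq_nonneg y, hn']
    have h5 : 0 ≤ x₀ ^ 2 := sq_nonneg _
    rw [h3, hN, hB]
    nlinarith only [h4, h5, a5, hd, hx0, hn', sq_nonneg ((n : ℝ) - x₀)]
  clear_value g
  have hmul : g = 2 * (x₀ + ξ) * ρ := hg
  set z : ℂ := ⟨x₀ + ξ, y⟩ with hz
  set ω : ℂ := ⟨ρ - ξ, -y⟩ with hω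
  have hzr : z.re = x₀ + ξ := rfl
  set v : ℂ := n - z with hv
  set v' : ℂ := n + z with hv'
  have hv0 : 0 ≤ v.re := by simp only [hv, Complex.sub_re, Complex.natCast_re, hzr]; linarith
  have hv0' : 0 ≤ v'.re := by simp only [hv', Complex.add_re, Complex.natCast_re, hzr]; linarith
  have hω2 : ω.re ^ 2 + ω.im ^ 2 = ρ ^ 2 := by
    rw [← h.norm_om, ← Complex.normSq_eq_norm_sq, Complex.normSq_apply]; ring
  have hA0eq : 1 / (v + 1 / 2) + 1 / (v' + 1 / 2) = (2 * n + 1) / (((N : ℝ) : ℂ) + (2 * (x₀ + ξ) : ℝ) * ω) := by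
    have h1 := (add_ne_zero_of_re hv0).2 0
    have h2 := (add_ne_zero_of_re hv0').2 0
    have e1 : ((N : ℝ) : ℂ) + (2 * (x₀ + ξ) : ℝ) * ω = (v + 1 / 2) * (v' + 1 / 2) := by
      rw [← h.sq_sub_sq, hN, hv, hv']; push_cast; ring
    simp only [Nat.cast_zero, add_zero] at h1 h2
    rw [e1, div_add_div _ _ h1 h2]
    congr 1
    rw [hv, hv']; ring
  set c := ω.re with hc
  have hcpos : 0 < c := by rw [hc, hω]; simpa using a1
  have hcle : c ≤ ρ := by rw [hc, hω]; simpa using hξ.le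
  set x2 := 2 * (x₀ + ξ) with hx2
  have hx2p : 0 < x2 := by positivity
  have hnorm : Complex.normSq (((N : ℝ) : ℂ) + (x2 : ℝ) * ω) = N ^ 2 + 2 * N * x2 * c + x2 ^ 2 * ρ ^ 2 := by
    rw [Complex.normSq_apply, ← hω2]
    simp [hc]
    ring
  have hNp : 0 < N := by rw [hN]; linarith
  have hre : (ω * (1 / (v + 1 / 2) + 1 / (v' + 1 / 2))).re =
      (2 * n + 1) * (N * c + x2 * ρ ^ 2) / (N ^ 2 + 2 * N * x2 * c + x2 ^ 2 * ρ ^ 2) := by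
    rw [hA0eq, ← mul_div_assoc, Complex.div_re, hnorm, ← add_div, ← hω2]
    congr 1
    simp [hc]
    ring
  rw [hre, div_mul_eq_mul_div, div_le_div_iff₀ hB0 (by positivity)]
  have k1 : ρ * (N ^ 2 + 2 * N * x2 * c + x2 ^ 2 * ρ ^ 2) ≤ (N * c + x2 * ρ ^ 2) * (g + N) := by
    have : 0 ≤ N * (ρ - c) * (g - N) := by
      have := sub_nonneg.2 hcle
      have := sub_nonneg.2 hgN
      positivity
    rw [hmul] at this ⊢
    nlinarith only [this]
  have k3 : 0 ≤ N * c + x2 * ρ ^ 2 := by positivity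
  have k4 := mul_le_mul_of_nonneg_left k2 k3
  nlinarith only [k1, k4]

/-- The part of `(π / sin πz)²` that stems from the integers `|k| > n`. -/
lemma re_tail_ge (h : ArcPoint n x₀ ρ ξ y) (he : (x₀ + ξ) ^ 2 + y ^ 2 < n ^ 2) (hn : 2 ≤ n)
    (hd : 0.95 ≤ n - x₀) :
    1.54 / (2 * (n - x₀) + 1 + y ^ 2) * ρ ≤ ((⟨ρ - ξ, -y⟩ : ℂ) *
      ((Real.pi / Complex.sin (Real.pi * ⟨x₀ + ξ, y⟩)) ^ 2 - fullSum₂ n ⟨x₀ + ξ, y⟩)).re := by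
  obtain ⟨a1, a2, a3, a4, a5, a6⟩ := h.early_bounds he
  have hρ := h.rho_pos
  have hx0 := h.left_pos
  have hξ := h.xi_pos
  have hy := h.im_pos
  have hn' : (2 : ℝ) ≤ n := by exact_mod_cast hn
  set z : ℂ := ⟨x₀ + ξ, y⟩ with hz
  set ω : ℂ := ⟨ρ - ξ, -y⟩ with hω
  have hzr : z.re = x₀ + ξ := rfl
  have hzi : z.im = y := rfl
  set B := 2 * (n - x₀) + 1 + y ^ 2 with hB
  have hB0 : 0 < B := by positivity
  set v : ℂ := n - z with hv
  set v' : ℂ := n + z with hv'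
  have hvr : v.re = n - (x₀ + ξ) := by simp [hv, hzr]
  have hvi : v.im = -y := by simp [hv, hzi]
  have hvr' : v'.re = n + (x₀ + ξ) := by simp [hv', hzr]
  have hvi' : v'.im = y := by simp [hv', hzi]
  have hv0 : 0 ≤ v.re := by rw [hvr]; linarith
  have hv0' : (n : ℝ) ≤ v'.re := by rw [hvr']; linarith
  have hr2 : ‖v‖ ^ 2 = (n - (x₀ + ξ)) ^ 2 + y ^ 2 := by
    rw [← Complex.normSq_eq_norm_sq, Complex.normSq_apply, hvr, hvi]; ring
  have hrd : n - x₀ ≤ ‖v‖ := by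
    refine (sq_le_sq₀ (by linarith) (norm_nonneg _)).1 ?_
    rw [hr2]
    have h1 := h.normSq_sub n
    have h2 : 0 ≤ ξ * (ρ - (n - x₀)) := mul_nonneg hξ.le (by linarith [h.le_rho])
    nlinarith only [h1, h2]
  have hry : y ≤ ‖v‖ := by
    refine (sq_le_sq₀ hy.le (norm_nonneg _)).1 ?_
    rw [hr2]; nlinarith only [sq_nonneg (n - (x₀ + ξ))]
  have hB1 : B ≤ (1 + ‖v‖) ^ 2 := by
    have h1 := mul_self_le_mul_self hy.le hry
    nlinarith only [h1, hrd, hB]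
  have hB2 : B ≤ (n + 1) ^ 2 := by
    have h1 := mul_self_le_mul_self hy.le a3.le
    nlinarith only [h1, hB, hx0]
  -- the limit
  have hlim := tendsto_tail_fullSum₂ n (z := z) hy
  set A := (Real.pi / Complex.sin (Real.pi * z)) ^ 2 - fullSum₂ n z with hA
  set A₀ : ℂ := 1 / (v + 1 / 2) + 1 / (v' + 1 / 2) with hA₀
  have hE : ‖A - A₀‖ ≤ 0.46 / B := by
    have hl2 : Tendsto (fun m : ℕ => (∑ i ∈ Finset.range m,
        (1 / (n - z + (i + 1)) ^ 2 + 1 / (n + z + (i + 1)) ^ 2)) - A₀ +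
        (1 / (v + m + 1 / 2) + 1 / (v' + m + 1 / 2))) atTop (𝓝 (A - A₀ + (0 + 0))) :=
      (hlim.sub_const _).add ((tendsto_inv_add_nat v).add (tendsto_inv_add_nat v'))
    rw [add_zero, add_zero] at hl2
    refine le_of_tendsto hl2.norm (Eventually.of_forall fun m => ?_)
    rw [Finset.sum_add_distrib, ← hv, ← hv', sum_inv_sq_eq v (add_ne_zero_of_re hv0).1 (add_ne_zero_of_re hv0).2,
      sum_inv_sq_eq v' (add_ne_zero_of_re (by linarith)).1 (add_ne_zero_of_re (by linarith)).2, hA₀]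
    set s₁ := ∑ i ∈ Finset.range m, 1 / (4 * (v + (i + 1)) ^ 2 * ((v + (i + 1)) ^ 2 - 1 / 4)) with hs₁
    set s₂ := ∑ i ∈ Finset.range m, 1 / (4 * (v' + (i + 1)) ^ 2 * ((v' + (i + 1)) ^ 2 - 1 / 4)) with hs₂
    have e : 1 / (v + 1 / 2) - 1 / (v + m + 1 / 2) - s₁ + (1 / (v' + 1 / 2) - 1 / (v' + m + 1 / 2) - s₂) -
        (1 / (v + 1 / 2) + 1 / (v' + 1 / 2)) + (1 / (v + m + 1 / 2) + 1 / (v' + m + 1 / 2)) = -(s₁ + s₂) := by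
      ring
    rw [e, norm_neg]
    have b1 : ‖s₁‖ ≤ 0.41 / B := by
      have := sum_inv_sq_error_le hv0 (by linarith) m
      rw [le_div_iff₀ hB0, mul_comm]
      refine le_trans ?_ this
      exact mul_le_mul hB1 (norm_sum_le _ _) (norm_nonneg _) (by positivity)
    have b2 : ‖s₂‖ ≤ 0.05 / B := by
      have h1 := (norm_sum_le _ _).trans (sum_inv_sq_error_le' (by positivity) hv0' m)
      rw [le_div_iff₀ hB0]
      calc ‖s₂‖ * B ≤ 1 / (12 * ((n : ℝ) + 1 / 2) ^ 3) * (n + 1) ^ 2 :=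
            mul_le_mul h1 hB2 hB0.le (by positivity)
        _ ≤ 0.05 := by
          rw [one_div_mul_eq_div, div_le_iff₀ (by positivity)]
          exact sq_le_cube_of_two_le hn'
    calc ‖s₁ + s₂‖ ≤ 0.41 / B + 0.05 / B := (norm_add_le _ _).trans (add_le_add b1 b2)
      _ = 0.46 / B := by rw [← add_div]; norm_num
  have hmain : 2 / B * ρ ≤ (ω * A₀).re := h.re_mul_main_ge he hn hd
  have hdiff : |(ω * (A - A₀)).re| ≤ ρ * (0.46 / B) := by
    refine (Complex.abs_re_le_norm _).trans ?_
    rw [norm_mul, h.norm_om]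
    gcongr
  have e1 : (ω * A).re = (ω * A₀).re + (ω * (A - A₀)).re := by
    rw [← Complex.add_re]; congr 1; ring
  rw [e1]
  have := (abs_le.1 hdiff).1
  have e2 : 1.54 / B * ρ = 2 / B * ρ - ρ * (0.46 / B) := by ring
  linarith

end ArcPoint

lemma sum_alternating_mem {m : ℕ} : ∀ {u : ℕ → ℝ}, (∀ i, 0 ≤ u i) → (∀ i, u (i + 1) ≤ u i) →
    0 ≤ ∑ i ∈ Finset.range m, (-1) ^ i * u i ∧ ∑ i ∈ Finset.range m, (-1) ^ i * u i ≤ u 0 := by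
  induction m with
  | zero => intro u h0 _; simpa using h0 0
  | succ m ih =>
    intro u h0 h1
    rw [Finset.sum_range_succ']
    have := ih (u := fun i => u (i + 1)) (fun i => h0 _) (fun i => h1 _)
    have e : ∑ i ∈ Finset.range m, (-1 : ℝ) ^ (i + 1) * u (i + 1) =
        -∑ i ∈ Finset.range m, (-1 : ℝ) ^ i * u (i + 1) := by
      rw [← Finset.sum_neg_distrib]
      exact Finset.sum_congr rfl fun i _ => by ring
    rw [e]
    have h2 := h1 0
    simp only [zero_add, pow_zero, one_mul] at this h2 ⊢
    constructor <;> linarith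

/-- `(-1)^j sin πx`. -/
def stripSin (j : ℤ) (x : ℝ) : ℝ := Real.sin (Real.pi * (x - j))

/-- `(-1)^j cos πx`. -/
def stripCos (j : ℤ) (x : ℝ) : ℝ := Real.cos (Real.pi * (x - j))

/-- `|sin πz|²` at `z = x + i y`. -/
def stripDen (j : ℤ) (x y : ℝ) : ℝ := stripSin j x ^ 2 + Real.sinh (Real.pi * y) ^ 2

/-- The real part of `(-1)^j π / sin πz` at `z = x + i y`. -/
def stripRe (j : ℤ) (x y : ℝ) : ℝ :=
  Real.pi * stripSin j x * Real.cosh (Real.pi * y) / stripDen j x y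

/-- The imaginary part of `(-1)^j π / sin πz` at `z = x + i y`. -/
def stripIm (j : ℤ) (x y : ℝ) : ℝ :=
  -(Real.pi * stripCos j x * Real.sinh (Real.pi * y) / stripDen j x y)

lemma stripSin_sq_add (j : ℤ) (x : ℝ) : stripSin j x ^ 2 + stripCos j x ^ 2 = 1 :=
  Real.sin_sq_add_cos_sq _

lemma stripDen_pos (j : ℤ) (x : ℝ) {y : ℝ} (hy : 0 < y) : 0 < stripDen j x y := by
  have h : 0 < Real.sinh (Real.pi * y) := Real.sinh_pos_iff.2 (by positivity)
  rw [stripDen]; positivity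

lemma sin_cos_pi (x y : ℝ) (j : ℤ) :
    Complex.sin (Real.pi * ⟨x, y⟩) = (alt j : ℂ) *
      ⟨stripSin j x * Real.cosh (Real.pi * y), stripCos j x * Real.sinh (Real.pi * y)⟩ ∧
    Complex.cos (Real.pi * ⟨x, y⟩) = (alt j : ℂ) *
      ⟨stripCos j x * Real.cosh (Real.pi * y), -(stripSin j x * Real.sinh (Real.pi * y))⟩ := by
  have e1 : (Real.pi : ℂ) * ⟨x, y⟩ = ((Real.pi * (x - j) : ℝ) : ℂ) + ((Real.pi * y : ℝ) : ℂ) * Complex.I +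
      (j : ℂ) * Real.pi := by
    apply Complex.ext <;> simp; ring
  have hs : Complex.sin (((Real.pi * (x - j) : ℝ) : ℂ) + ((Real.pi * y : ℝ) : ℂ) * Complex.I) =
      ⟨stripSin j x * Real.cosh (Real.pi * y), stripCos j x * Real.sinh (Real.pi * y)⟩ := by
    rw [Complex.sin_add_mul_I, ← Complex.ofReal_sin, ← Complex.ofReal_cos, ← Complex.ofReal_cosh,
      ← Complex.ofReal_sinh, stripSin, stripCos]
    generalize Real.sin (Real.pi * (x - j)) = S
    generalize Real.cos (Real.pi * (x - j)) = C
    generalize Real.cosh (Real.pi * y) = c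
    generalize Real.sinh (Real.pi * y) = s
    apply Complex.ext <;> simp
  have hc : Complex.cos (((Real.pi * (x - j) : ℝ) : ℂ) + ((Real.pi * y : ℝ) : ℂ) * Complex.I) =
      ⟨stripCos j x * Real.cosh (Real.pi * y), -(stripSin j x * Real.sinh (Real.pi * y))⟩ := by
    rw [Complex.cos_add_mul_I, ← Complex.ofReal_sin, ← Complex.ofReal_cos, ← Complex.ofReal_cosh,
      ← Complex.ofReal_sinh, stripSin, stripCos]
    generalize Real.sin (Real.pi * (x - j)) = S
    generalize Real.cos (Real.pi * (x - j)) = C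
    generalize Real.cosh (Real.pi * y) = c
    generalize Real.sinh (Real.pi * y) = s
    apply Complex.ext <;> simp
  have ha : (alt j : ℂ) = (-1) ^ j.natAbs := by simp [alt]
  rw [e1, Complex.sin_antiperiodic.add_int_mul_eq, Complex.cos_antiperiodic.add_int_mul_eq, hs, hc, ha]
  simp

lemma normSq_strip (j : ℤ) (x y : ℝ) :
    Complex.normSq ⟨stripSin j x * Real.cosh (Real.pi * y), stripCos j x * Real.sinh (Real.pi * y)⟩ =
      stripDen j x y := by
  rw [Complex.normSq_apply, stripDen]
  linear_combination (stripSin j x ^ 2) * Real.cosh_sq (Real.pi * y) +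
    Real.sinh (Real.pi * y) ^ 2 * stripSin_sq_add j x

lemma alt_mul_alt (j : ℤ) : (alt j : ℂ) * alt j = 1 := by
  rw [← Complex.ofReal_mul, alt_mul_self, Complex.ofReal_one]

lemma inv_strip (j : ℤ) (x y : ℝ) :
    (⟨stripSin j x * Real.cosh (Real.pi * y), stripCos j x * Real.sinh (Real.pi * y)⟩ : ℂ)⁻¹ =
      ((stripDen j x y)⁻¹ : ℝ) * ⟨stripSin j x * Real.cosh (Real.pi * y), -(stripCos j x * Real.sinh (Real.pi * y))⟩ := by
  rw [Complex.inv_def, normSq_strip, mul_comm]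
  rfl

/-- `π / sin πz` in real terms. -/
lemma pi_div_sin (j : ℤ) (x y : ℝ) :
    (Real.pi : ℂ) / Complex.sin (Real.pi * ⟨x, y⟩) = (alt j : ℂ) * ⟨stripRe j x y, stripIm j x y⟩ := by
  rw [(sin_cos_pi x y j).1, div_eq_mul_inv, mul_inv, inv_strip,
    show (alt j : ℂ)⁻¹ = alt j from inv_eq_of_mul_eq_one_left (alt_mul_alt j)]
  rw [← mul_assoc, mul_comm (Real.pi : ℂ), mul_assoc]
  congr 1
  apply Complex.ext
  · rw [stripRe, Complex.re_ofReal_mul, Complex.re_ofReal_mul]; simp only []; ring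
  · rw [stripIm, Complex.im_ofReal_mul, Complex.im_ofReal_mul]; simp only []; ring

/-- Imaginary part of `π cot πz`. -/
lemma im_pi_cot (j : ℤ) (x y : ℝ) :
    ((Real.pi : ℂ) * Complex.cot (Real.pi * ⟨x, y⟩)).im =
      -(Real.pi * Real.sinh (Real.pi * y) * Real.cosh (Real.pi * y) / stripDen j x y) := by
  rw [Complex.cot_eq_cos_div_sin, (sin_cos_pi x y j).1, (sin_cos_pi x y j).2,
    mul_div_mul_left _ _ (by rcases alt_eq_one_or j with h | h <;> simp [h]), div_eq_mul_inv, inv_strip,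
    Complex.im_ofReal_mul, mul_left_comm, Complex.im_ofReal_mul, Complex.mul_im]
  simp only []
  have := stripSin_sq_add j x
  linear_combination -(Real.pi * (stripDen j x y)⁻¹ * Real.cosh (Real.pi * y) * Real.sinh (Real.pi * y)) * this

/-- The derivative of `π / sin πz` in the direction of `-i (u - i v)`. -/
lemma im_mul_pi_cos_div_sin_sq (j : ℤ) (x y u v : ℝ) :
    alt j * ((⟨u, -v⟩ : ℂ) * (Real.pi ^ 2 * Complex.cos (Real.pi * ⟨x, y⟩) /
      Complex.sin (Real.pi * ⟨x, y⟩) ^ 2)).im =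
      -(Real.pi ^ 2 / stripDen j x y ^ 2 *
        (u * (stripSin j x * Real.sinh (Real.pi * y)) * (Real.cosh (Real.pi * y) ^ 2 + stripCos j x ^ 2) -
         v * (stripCos j x * Real.cosh (Real.pi * y)) * (Real.sinh (Real.pi * y) ^ 2 - stripSin j x ^ 2))) := by
  have h1 := stripSin_sq_add j x
  have h2 := Real.cosh_sq (Real.pi * y)
  rw [← Complex.im_ofReal_mul]
  set S := stripSin j x
  set C := stripCos j x
  set D := stripDen j x y
  have e : (alt j : ℂ) * ((⟨u, -v⟩ : ℂ) * (Real.pi ^ 2 * Complex.cos (Real.pi * ⟨x, y⟩) /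
      Complex.sin (Real.pi * ⟨x, y⟩) ^ 2)) =
      ((Real.pi ^ 2 * D⁻¹ ^ 2 : ℝ) : ℂ) * (⟨u, -v⟩ * (⟨C * Real.cosh (Real.pi * y), -(S * Real.sinh (Real.pi * y))⟩ *
        ⟨S * Real.cosh (Real.pi * y), -(C * Real.sinh (Real.pi * y))⟩ ^ 2)) := by
    rw [(sin_cos_pi x y j).1, (sin_cos_pi x y j).2, div_eq_mul_inv, mul_pow, mul_inv, ← inv_pow, ← inv_pow, inv_strip,
      show (alt j : ℂ)⁻¹ = alt j from inv_eq_of_mul_eq_one_left (alt_mul_alt j)]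
    push_cast
    have := alt_mul_alt j
    linear_combination (Real.pi ^ 2 * (D : ℂ)⁻¹ ^ 2 * (⟨u, -v⟩ : ℂ) * (⟨C * Real.cosh (Real.pi * y), -(S * Real.sinh (Real.pi * y))⟩ : ℂ) *
        (⟨S * Real.cosh (Real.pi * y), -(C * Real.sinh (Real.pi * y))⟩ : ℂ) ^ 2) * ((alt j : ℂ) * alt j + 1) * this
  rw [e, Complex.im_ofReal_mul]
  generalize Real.cosh (Real.pi * y) = c at *
  generalize Real.sinh (Real.pi * y) = s at *
  have e2 : ((⟨u, -v⟩ : ℂ) * ((⟨C * c, -(S * s)⟩ : ℂ) * (⟨S * c, -(C * s)⟩ : ℂ) ^ 2)).im =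
      -(u * (S * s) * (c ^ 2 + C ^ 2) - v * (C * c) * (s ^ 2 - S ^ 2)) := by
    simp only [pow_two, Complex.mul_im, Complex.mul_re]
    linear_combination (u * (-S * s) * C ^ 2 - v * (C * c) * S ^ 2) * h2 +
      (u * (-S * s) * c ^ 2 + v * (C * c) * s ^ 2) * h1
  rw [e2]; ring

namespace ArcPoint
variable {n : ℕ} {x₀ ρ ξ y : ℝ}

lemma re_half_inv (h : ArcPoint n x₀ ρ ξ y) (k : ℝ) (hk : k ≠ x₀) :
    (1 / (2 * ((k : ℂ) - ⟨x₀ + ξ, y⟩))).re =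
      1 / (2 * (k - x₀)) - ξ * (2 * ρ - (k - x₀)) / (2 * (k - x₀) * ((k - x₀) ^ 2 - 2 * ξ * (k - x₀ - ρ))) := by
  have hd := h.den_pos (k - x₀)
  have hk' : k - x₀ ≠ 0 := sub_ne_zero.2 hk
  rw [one_div, Complex.inv_re]
  have e1 : Complex.normSq (2 * ((k : ℂ) - ⟨x₀ + ξ, y⟩)) = 4 * ((k - x₀) ^ 2 - 2 * ξ * (k - x₀ - ρ)) := by
    rw [← h.normSq_sub, Complex.normSq_apply]; simp; ring
  have e2 : (2 * ((k : ℂ) - ⟨x₀ + ξ, y⟩)).re = 2 * (k - x₀ - ξ) := by simp; ring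
  rw [e1, e2]
  field_simp
  ring

/-- The first coordinate in terms of `π / sin πz`, with an explicit approximation of the contribution
of the integers `|k| > n`. -/
lemma altSum_re_approx (h : ArcPoint n x₀ ρ ξ y) (he : (x₀ + ξ) ^ 2 + y ^ 2 < n ^ 2) (j : ℤ) :
    ∃ E : ℝ, |E| ≤ 1 / (8 * (n - (x₀ + ξ) + 1 / 2) ^ 2) + 1 / (8 * (n + x₀ + 1 / 2) ^ 2) ∧
      (1 / 2 ≤ y → |E| ≤ 3 / (8 * (n - (x₀ + ξ) + 1 / 2 + y) ^ 2) + 1 / (8 * (n + x₀ + 1 / 2) ^ 2)) ∧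
      -(alt j * (altSum n ⟨x₀ + ξ, y⟩).re) = -stripRe j (x₀ + ξ) y + alt j * alt n *
        (1 / (2 * (n - x₀ + 1 / 2)) - 1 / (2 * (n + x₀ + 1 / 2)) -
        ξ * (2 * ρ - (n - x₀ + 1 / 2)) / (2 * (n - x₀ + 1 / 2) *
          ((n - x₀ + 1 / 2) ^ 2 - 2 * ξ * (n - x₀ + 1 / 2 - ρ))) +
        ξ * (2 * ρ + (n + x₀ + 1 / 2)) / (2 * (n + x₀ + 1 / 2) *
          ((n + x₀ + 1 / 2) ^ 2 + 2 * ξ * (n + x₀ + 1 / 2 + ρ))) + E) := by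
  obtain ⟨a1, a2, a3, a4, a5, a6⟩ := h.early_bounds he
  have hx0 := h.left_pos
  have hξ := h.xi_pos
  have hy := h.im_pos
  have hx0n := h.left_lt
  set z : ℂ := ⟨x₀ + ξ, y⟩ with hz
  have hzr : z.re = x₀ + ξ := rfl
  have hzi : z.im = y := rfl
  set v : ℂ := n - z with hv
  set v' : ℂ := n + z with hv'
  have hvr : v.re = n - (x₀ + ξ) := by simp [hv, hzr]
  have hvi : |v.im| = y := by simp [hv, hzi, abs_of_pos hy]
  have hvr' : n + x₀ ≤ v'.re := by simp [hv', hzr]; linarith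
  have hv0 : 0 ≤ v.re := by rw [hvr]; linarith
  have hnx : (0 : ℝ) ≤ n + x₀ := by positivity
  set F : ℂ := 1 / (2 * (v + 1 / 2)) - 1 / (2 * (v' + 1 / 2)) with hF
  set α : ℂ := Real.pi / Complex.sin (Real.pi * z) - altSum n z with hα
  have hlim := tendsto_tail_altSum n (z := z) hy
  have hbound : ∀ e : ℝ, (∀ m, ∑ i ∈ Finset.range m, ‖1 / (4 * (v + (i + 1)) * ((v + (i + 1)) ^ 2 - 1 / 4))‖ ≤ e) →
      ‖α - alt n * F‖ ≤ e + 1 / (8 * (n + x₀ + 1 / 2) ^ 2) := by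
    intro e hev
    have t1 : Tendsto (fun m : ℕ => (-1 : ℂ) ^ (2 * m + n) * (1 / (2 * (v + (2 * m + n : ℕ) + 1 / 2)))) atTop (𝓝 0) := by
      have := ((tendsto_inv_add_nat v).comp (tendsto_two_mul_add n)).const_mul (1 / 2 : ℂ)
      rw [mul_zero] at this
      rw [tendsto_zero_iff_norm_tendsto_zero] at this ⊢
      refine this.congr fun m => ?_
      simp
      ring
    have t2 : Tendsto (fun m : ℕ => (-1 : ℂ) ^ (2 * m + n) * (1 / (2 * (v' + (2 * m + n : ℕ) + 1 / 2)))) atTop (𝓝 0) := by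
      have := ((tendsto_inv_add_nat v').comp (tendsto_two_mul_add n)).const_mul (1 / 2 : ℂ)
      rw [mul_zero] at this
      rw [tendsto_zero_iff_norm_tendsto_zero] at this ⊢
      refine this.congr fun m => ?_
      simp
      ring
    have hl2 := (hlim.sub_const (alt n * F)).add ((t1.sub t2).const_mul (alt n : ℂ))
    rw [sub_zero, mul_zero, add_zero] at hl2
    refine le_of_tendsto hl2.norm (Eventually.of_forall fun m => ?_)
    simp only [mul_sub ((-1 : ℂ) ^ _) (1 / (_ - _ + (_ + 1)))]
    rw [Finset.sum_sub_distrib, ← hv, ← hv',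
      sum_alternating_inv_eq v (add_ne_zero_of_re hv0).1 (add_ne_zero_of_re hv0).2,
      sum_alternating_inv_eq v' (add_ne_zero_of_re (by linarith)).1 (add_ne_zero_of_re (by linarith)).2, hF]
    set s₁ := ∑ i ∈ Finset.range (2 * m + n), (-1) ^ i * (1 / (4 * (v + (i + 1)) * ((v + (i + 1)) ^ 2 - 1 / 4))) with hs₁
    set s₂ := ∑ i ∈ Finset.range (2 * m + n), (-1) ^ i * (1 / (4 * (v' + (i + 1)) * ((v' + (i + 1)) ^ 2 - 1 / 4))) with hs₂
    have b1 : ‖s₁‖ ≤ e := by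
      refine (norm_sum_le _ _).trans (le_trans (le_of_eq ?_) (hev (2 * m + n)))
      exact Finset.sum_congr rfl fun i _ => by rw [norm_mul, norm_pow, norm_neg, norm_one, one_pow, one_mul]
    have b2 : ‖s₂‖ ≤ 1 / (8 * (n + x₀ + 1 / 2) ^ 2) := by
      refine (norm_sum_le _ _).trans (le_trans (le_of_eq ?_) (sum_alternating_error_le hnx hvr' (2 * m + n)))
      exact Finset.sum_congr rfl fun i _ => by rw [norm_mul, norm_pow, norm_neg, norm_one, one_pow, one_mul]
    rw [show ∀ A B G H I J : ℂ, (alt n : ℂ) * (A - G - s₁ - (B - H - s₂)) - alt n * (A - B) + alt n * (G - H) =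
      alt n * (s₂ - s₁) from fun A B G H I J => by ring]
    · rw [norm_mul, Complex.norm_real, Real.norm_eq_abs, abs_alt, one_mul]
      refine (norm_sub_le _ _).trans ?_
      linarith
    · exact 0
    · exact 0
  refine ⟨alt n * (α - alt n * F).re, ?_, ?_, ?_⟩
  · rw [abs_mul, abs_alt, one_mul]
    refine (Complex.abs_re_le_norm _).trans (hbound _ fun m => ?_)
    exact sum_alternating_error_le (by linarith) hvr.ge m
  · intro hy2
    rw [abs_mul, abs_alt, one_mul]
    refine (Complex.abs_re_le_norm _).trans (hbound _ fun m => ?_)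
    have := sum_alternating_error_le' hv0 hvi hy2 m
    rwa [hvr] at this
  · have e1 : altSum n z = alt j * ⟨stripRe j (x₀ + ξ) y, stripIm j (x₀ + ξ) y⟩ - α := by
      rw [hα, ← pi_div_sin]; ring
    have e2 : (altSum n z).re = alt j * stripRe j (x₀ + ξ) y - α.re := by
      rw [e1, Complex.sub_re, Complex.re_ofReal_mul]
    have e3 : (α - alt n * F).re = α.re - alt n * F.re := by
      rw [Complex.sub_re, Complex.re_ofReal_mul]
    have f1 := h.re_half_inv (n + 1 / 2) (by linarith)
    have f2 := h.re_half_inv (-(n + 1 / 2)) (by linarith)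
    have e4 : F = 1 / (2 * (((n + 1 / 2 : ℝ) : ℂ) - z)) + 1 / (2 * (((-(n + 1 / 2) : ℝ) : ℂ) - z)) := by
      rw [hF, hv, hv', sub_eq_add_neg, ← one_div_neg_eq_neg_one_div]
      congr 2
      · push_cast; ring
      · push_cast; ring
    have e5 : F.re = _ := (congrArg Complex.re e4).trans ((Complex.add_re _ _).trans (congrArg₂ (· + ·) f1 f2))
    have e6 : F.re = 1 / (2 * (n - x₀ + 1 / 2)) - 1 / (2 * (n + x₀ + 1 / 2)) -
        ξ * (2 * ρ - (n - x₀ + 1 / 2)) / (2 * (n - x₀ + 1 / 2) *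
          ((n - x₀ + 1 / 2) ^ 2 - 2 * ξ * (n - x₀ + 1 / 2 - ρ))) +
        ξ * (2 * ρ + (n + x₀ + 1 / 2)) / (2 * (n + x₀ + 1 / 2) *
          ((n + x₀ + 1 / 2) ^ 2 + 2 * ξ * (n + x₀ + 1 / 2 + ρ))) := by
      rw [e5, show (n : ℝ) + 1 / 2 - x₀ = n - x₀ + 1 / 2 by ring,
        show -((n : ℝ) + 1 / 2) - x₀ = -(n + x₀ + 1 / 2) by ring]
      rw [show 2 * -((n : ℝ) + x₀ + 1 / 2) = -(2 * (n + x₀ + 1 / 2)) by ring, one_div_neg_eq_neg_one_div,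
        neg_mul, div_neg, sub_neg_eq_add, sub_neg_eq_add,
        show (-((n : ℝ) + x₀ + 1 / 2)) ^ 2 - 2 * ξ * (-(n + x₀ + 1 / 2) - ρ) =
          (n + x₀ + 1 / 2) ^ 2 + 2 * ξ * (n + x₀ + 1 / 2 + ρ) by ring]
      ring
    rw [← e6, e2, e3]
    have hj := alt_mul_self j
    have hnn := alt_mul_self n
    linear_combination (-stripRe j (x₀ + ξ) y) * hj + alt j * (-α.re + alt n * F.re) * hnn

/-- The contribution of the integers `|k| > n` to the derivative of the first coordinate. -/
lemma abs_im_tail_le (h : ArcPoint n x₀ ρ ξ y) (he : (x₀ + ξ) ^ 2 + y ^ 2 < n ^ 2)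
    (hyd : 2 * y ^ 2 ≤ (n - x₀ + 1) * (n - x₀ + 2)) (hd : 1 ≤ n - x₀) :
    |((⟨ρ - ξ, -y⟩ : ℂ) * (Real.pi ^ 2 * Complex.cos (Real.pi * ⟨x₀ + ξ, y⟩) /
      Complex.sin (Real.pi * ⟨x₀ + ξ, y⟩) ^ 2 - altSum₂ n ⟨x₀ + ξ, y⟩)).im| ≤
      y * ((n - x₀ + 1) * (2 * ρ) / ((n - x₀ + 1) ^ 2 - 2 * ξ * (n - x₀ + 1 - ρ)) ^ 2 +
        (n + x₀ + 1) * (2 * ρ + (n + x₀ + 1)) / ((n + x₀ + 1) ^ 2 + 2 * ξ * (n + x₀ + 1 + ρ)) ^ 2) := by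
  obtain ⟨a1, a2, a3, a4, a5, a6⟩ := h.early_bounds he
  have hx0 := h.left_pos
  have hξ := h.xi_pos
  have hy := h.im_pos
  have hx0n := h.left_lt
  have hρ := h.rho_pos
  set den : ℝ → ℝ := fun W => W ^ 2 - 2 * ξ * (W - ρ) with hden
  have hden0 : ∀ W, 0 < den W := fun W => h.den_pos W
  set den' : ℝ → ℝ := fun U => U ^ 2 + 2 * ξ * (U + ρ) with hden'
  have hden0' : ∀ U, 0 ≤ U → 0 < den' U := fun U hU => by simp only [hden']; positivity
  set W : ℕ → ℝ := fun i => n - x₀ + 1 + i with hW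
  set U : ℕ → ℝ := fun i => n + x₀ + 1 + i with hU
  have hi : ∀ i : ℕ, (0 : ℝ) ≤ i := fun i => Nat.cast_nonneg i
  have hW0 : ∀ i, 0 < W i := fun i => by simp only [hW]; linarith [hi i]
  have hU0 : ∀ i, 0 < U i := fun i => by simp only [hU]; linarith [hi i]
  have hWs : ∀ i, W (i + 1) = W i + 1 := fun i => by simp only [hW]; push_cast; ring
  have hUs : ∀ i, U (i + 1) = U i + 1 := fun i => by simp only [hU]; push_cast; ring
  have hW2 : ∀ i, 2 * ξ * ρ ≤ W i * (W i + 1) := fun i => by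
    have h1 : n - x₀ + 1 ≤ W i := by simp only [hW]; linarith [hi i]
    nlinarith only [h1, a5, hyd, hd]
  have hWξ : ∀ i, ξ ≤ W i := fun i => by
    have : n - x₀ + 1 ≤ W i := by simp only [hW]; linarith [hi i]
    linarith
  have hU2 : ∀ i, 2 * ξ * ρ ≤ U i * (U i + 1) := fun i => by
    have h1 : n - x₀ + 1 ≤ U i := by simp only [hU]; linarith [hi i]
    nlinarith only [h1, a5, hyd, hd]
  have d1 : ∀ i, W (i + 1) / den (W (i + 1)) ≤ W i / den (W i) := fun i => by
    rw [div_le_div_iff₀ (hden0 _) (hden0 _), hWs]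
    have := hW2 i
    simp only [hden]
    nlinarith
  have d2 : ∀ i, 1 / den (W (i + 1)) ≤ 1 / den (W i) := fun i => by
    apply one_div_le_one_div_of_le (hden0 _)
    rw [hWs]
    have := hWξ i
    simp only [hden]
    nlinarith
  have d3 : ∀ i, U (i + 1) / den' (U (i + 1)) ≤ U i / den' (U i) := fun i => by
    rw [div_le_div_iff₀ (hden0' _ (hU0 _).le) (hden0' _ (hU0 _).le), hUs]
    have := hU2 i
    simp only [hden']
    nlinarith
  have d4 : ∀ i, 1 / den' (U (i + 1)) ≤ 1 / den' (U i) := fun i => by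
    apply one_div_le_one_div_of_le (hden0' _ (hU0 _).le)
    rw [hUs]
    have := hU0 i
    simp only [hden']
    nlinarith
  have p1 : ∀ i, 0 ≤ W i / den (W i) := fun i => (div_pos (hW0 i) (hden0 _)).le
  have p2 : ∀ i, 0 ≤ 1 / den (W i) := fun i => (div_pos one_pos (hden0 _)).le
  have p3 : ∀ i, 0 ≤ U i / den' (U i) := fun i => (div_pos (hU0 i) (hden0' _ (hU0 i).le)).le
  have p4 : ∀ i, 0 ≤ 1 / den' (U i) := fun i => (div_pos one_pos (hden0' _ (hU0 i).le)).le
  have s1 := fun m : ℕ => sum_alternating_mem (m := m) (u := fun i => 2 * ρ * (W i / den (W i) * (1 / den (W i))))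
    (fun i => by have := p1 i; have := p2 i; positivity)
    (fun i => mul_le_mul_of_nonneg_left (mul_le_mul (d1 i) (d2 i) (p2 _) (p1 _)) (by positivity))
  have s2 := fun m : ℕ => sum_alternating_mem (m := m) (u := fun i => (W i / den (W i)) ^ 2)
    (fun i => by positivity) (fun i => pow_le_pow_left₀ (p1 _) (d1 i) 2)
  have s3 := fun m : ℕ => sum_alternating_mem (m := m)
    (u := fun i => U i / den' (U i) * (U i / den' (U i) + 2 * ρ * (1 / den' (U i))))
    (fun i => by have := p3 i; have := p4 i; positivity)
    (fun i => mul_le_mul (d3 i)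
      (add_le_add (d3 i) (mul_le_mul_of_nonneg_left (d4 i) (by positivity)))
      (by have := p3 (i + 1); have := p4 (i + 1); positivity) (p3 i))
  have hlim := ((Complex.continuous_im.comp (continuous_const_mul (⟨ρ - ξ, -y⟩ : ℂ))).tendsto _).comp
    (tendsto_tail_altSum₂ n (z := ⟨x₀ + ξ, y⟩) hy)
  refine le_of_tendsto hlim.abs (Eventually.of_forall fun m => ?_)
  have e : (Complex.im ∘ fun x => (⟨ρ - ξ, -y⟩ : ℂ) * x) (-(alt n : ℂ) * ∑ i ∈ Finset.range (2 * m + n),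
      (-1) ^ i * (1 / ((⟨x₀ + ξ, y⟩ : ℂ) - (n + i + 1 : ℤ)) ^ 2 + 1 / ((⟨x₀ + ξ, y⟩ : ℂ) - (-(n + i + 1) : ℤ)) ^ 2)) =
      -alt n * (y * (∑ i ∈ Finset.range (2 * m + n), (-1) ^ i * (2 * ρ * (W i / den (W i) * (1 / den (W i)))) -
        ∑ i ∈ Finset.range (2 * m + n), (-1) ^ i * (W i / den (W i)) ^ 2 -
        ∑ i ∈ Finset.range (2 * m + n), (-1) ^ i * (U i / den' (U i) * (U i / den' (U i) + 2 * ρ * (1 / den' (U i)))))) := by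
    rw [← Finset.sum_sub_distrib, ← Finset.sum_sub_distrib, Finset.mul_sum, Finset.mul_sum, Finset.mul_sum]
    simp only [Function.comp]
    rw [Finset.mul_sum, Complex.im_sum]
    refine Finset.sum_congr rfl fun i _ => ?_
    have i1 := h.im_term (n + i + 1)
    have i2 := h.im_term (-(n + i + 1))
    push_cast at i1 i2
    have hp : ((-1 : ℂ) ^ i) = (((-1 : ℝ) ^ i : ℝ) : ℂ) := by push_cast; rfl
    rw [hp, show ∀ A B : ℂ, (⟨ρ - ξ, -y⟩ : ℂ) * (-(alt n : ℂ) * ((((-1 : ℝ) ^ i : ℝ) : ℂ) * (1 / A + 1 / B))) =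
      ((-alt n * (-1) ^ i : ℝ) : ℂ) * ((⟨ρ - ξ, -y⟩ : ℂ) / A + (⟨ρ - ξ, -y⟩ : ℂ) / B) from fun A B => by push_cast; ring,
      Complex.im_ofReal_mul, Complex.add_im]
    push_cast
    rw [i1, i2]
    have w1 : (n : ℝ) + i + 1 - x₀ = W i := by simp only [hW]; ring
    have w2 : -((n : ℝ) + i + 1) - x₀ = -U i := by simp only [hU]; ring
    rw [w1, w2]
    have w3 : (-U i) ^ 2 - 2 * ξ * (-U i - ρ) = den' (U i) := by simp only [hden']; ring
    have w4 : (W i) ^ 2 - 2 * ξ * (W i - ρ) = den (W i) := rfl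
    rw [w3, w4]
    ring_nf
  simp only [Function.comp] at e ⊢
  rw [e, abs_mul, abs_neg, abs_alt, one_mul, abs_mul, abs_of_pos hy]
  refine mul_le_mul_of_nonneg_left ?_ hy.le
  have t1 := s1 (2 * m + n)
  have t2 := s2 (2 * m + n)
  have t3 := s3 (2 * m + n)
  have f1 : W 0 = n - x₀ + 1 := by simp [hW]
  have f2 : U 0 = n + x₀ + 1 := by simp [hU]
  rw [← f1, ← f2]
  have g1 : W 0 * (2 * ρ) / ((W 0) ^ 2 - 2 * ξ * (W 0 - ρ)) ^ 2 =
      2 * ρ * (W 0 / den (W 0) * (1 / den (W 0))) := by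
    rw [show (W 0) ^ 2 - 2 * ξ * (W 0 - ρ) = den (W 0) from rfl]
    have := (hden0 (W 0)).ne'
    field_simp
  have g2 : U 0 * (2 * ρ + U 0) / ((U 0) ^ 2 + 2 * ξ * (U 0 + ρ)) ^ 2 =
      U 0 / den' (U 0) * (U 0 / den' (U 0) + 2 * ρ * (1 / den' (U 0))) := by
    rw [show (U 0) ^ 2 + 2 * ξ * (U 0 + ρ) = den' (U 0) from rfl]
    have := (hden0' (U 0) (hU0 0).le).ne'
    field_simp
    ring
  have g3 : (W 0 / den (W 0)) ^ 2 ≤ 2 * ρ * (W 0 / den (W 0) * (1 / den (W 0))) := by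
    have e0 : (W 0 / den (W 0)) ^ 2 = W 0 * (W 0 / den (W 0) * (1 / den (W 0))) := by ring
    rw [e0]
    have := p1 0
    have := p2 0
    have hle : W 0 ≤ 2 * ρ := by rw [f1]; linarith [h.le_rho]
    gcongr
  rw [g1, g2, abs_le]
  constructor <;> linarith [t1.1, t1.2, t2.1, t2.2, t3.1, t3.2]

end ArcPoint

lemma nonneg_of_deriv_nonneg {f f' : ℝ → ℝ} (hf : ∀ x, HasDerivAt f (f' x) x) (h0 : f 0 = 0)
    (hf' : ∀ x, 0 ≤ x → 0 ≤ f' x) {x : ℝ} (hx : 0 ≤ x) : 0 ≤ f x := by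
  have h : MonotoneOn f (Set.Ici 0) := by
    refine monotoneOn_of_deriv_nonneg (convex_Ici 0) (fun x _ => (hf x).continuousAt.continuousWithinAt)
      (fun x _ => (hf x).differentiableAt.differentiableWithinAt) fun x hx => ?_
    rw [interior_Ici] at hx
    rw [(hf x).deriv]
    exact hf' x (le_of_lt hx)
  rw [← h0]
  exact h Set.self_mem_Ici hx hx

lemma cos_le_quartic {x : ℝ} (hx : 0 ≤ x) : Real.cos x ≤ 1 - x ^ 2 / 2 + x ^ 4 / 24 := by
  have h := nonneg_of_deriv_nonneg (f := fun x => 1 - x ^ 2 / 2 + x ^ 4 / 24 - Real.cos x)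
    (f' := fun x => -x + x ^ 3 / 6 + Real.sin x)
    (fun x => by
      have h1 := (((hasDerivAt_const x (1 : ℝ)).sub ((hasDerivAt_pow 2 x).div_const 2)).add
        ((hasDerivAt_pow 4 x).div_const 24)).sub (Real.hasDerivAt_cos x)
      refine h1.congr_deriv ?_
      norm_num; ring)
    (by simp) (fun x hx => by linarith [Real.sin_ge_sub_cube hx]) hx
  simpa using h

lemma sin_le_quintic {x : ℝ} (hx : 0 ≤ x) : Real.sin x ≤ x - x ^ 3 / 6 + x ^ 5 / 120 := by
  have h := nonneg_of_deriv_nonneg (f := fun x => x - x ^ 3 / 6 + x ^ 5 / 120 - Real.sin x)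
    (f' := fun x => 1 - x ^ 2 / 2 + x ^ 4 / 24 - Real.cos x)
    (fun x => by
      have h1 := (((hasDerivAt_id x).sub ((hasDerivAt_pow 3 x).div_const 6)).add
        ((hasDerivAt_pow 5 x).div_const 120)).sub (Real.hasDerivAt_sin x)
      refine h1.congr_deriv ?_
      norm_num; ring)
    (by simp) (fun x hx => by linarith [cos_le_quartic hx]) hx
  simpa using h

lemma pi_sq_bounds : 9.8696 < Real.pi ^ 2 ∧ Real.pi ^ 2 < 9.86961 := by
  have h1 := Real.pi_gt_d6
  have h2 := Real.pi_lt_d6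
  constructor <;> nlinarith

/-- A lower bound for `sinh² (π y)` in terms of `y²`. -/
lemma sinh_sq_ge (y : ℝ) : 9.869 * y ^ 2 + 32.46 * y ^ 4 + 42.7 * y ^ 6 + 30.1 * y ^ 8 + 13.2 * y ^ 10 ≤
    Real.sinh (Real.pi * y) ^ 2 := by
  have h1 : Real.sinh (Real.pi * y) ^ 2 = (Real.cosh (2 * (Real.pi * y)) - 1) / 2 := by
    rw [Real.cosh_two_mul, Real.cosh_sq]; ring
  have h2 := sum_le_hasSum (Finset.range 6) (fun i _ => by
    rw [pow_mul]; positivity) (Real.hasSum_cosh (2 * (Real.pi * y)))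
  simp only [Finset.sum_range_succ, Finset.sum_range_zero, Nat.factorial] at h2
  rw [h1]
  set P := Real.pi ^ 2 with hP
  obtain ⟨b1, b2⟩ := pi_sq_bounds
  rw [← hP] at b1 b2
  have e2 : 97.4 ≤ P ^ 2 := by nlinarith only [b1, b2]
  have e2' : 0 < P ^ 2 := by positivity
  have e3 : 961.3 ≤ P ^ 3 := by nlinarith only [b1, e2]
  have e4 : 9487 ≤ P ^ 4 := by nlinarith only [b1, b2, e2]
  have e5 : 93636 ≤ P ^ 5 := by nlinarith
  have t1 : 9.869 * y ^ 2 ≤ P * y ^ 2 := by gcongr; linarith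
  have t2 : 97.4 * y ^ 4 ≤ P ^ 2 * y ^ 4 := by gcongr
  have t3 : 961.3 * y ^ 6 ≤ P ^ 3 * y ^ 6 := by gcongr
  have t4 : 9487 * y ^ 8 ≤ P ^ 4 * y ^ 8 := by gcongr
  have t5 : 93636 * y ^ 10 ≤ P ^ 5 * y ^ 10 := by gcongr
  have z3 : 0 ≤ y ^ 6 := by positivity
  have z2 : 0 ≤ y ^ 4 := by positivity
  have z4 : 0 ≤ y ^ 8 := by positivity
  have z5 : 0 ≤ y ^ 10 := by positivity
  have k1 : (2 * (Real.pi * y)) ^ (2 * 1) = 4 * (P * y ^ 2) := by rw [hP]; ring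
  have k2 : (2 * (Real.pi * y)) ^ (2 * 2) = 16 * (P ^ 2 * y ^ 4) := by rw [hP]; ring
  have k3 : (2 * (Real.pi * y)) ^ (2 * 3) = 64 * (P ^ 3 * y ^ 6) := by rw [hP]; ring
  have k4 : (2 * (Real.pi * y)) ^ (2 * 4) = 256 * (P ^ 4 * y ^ 8) := by rw [hP]; ring
  have k5 : (2 * (Real.pi * y)) ^ (2 * 5) = 1024 * (P ^ 5 * y ^ 10) := by rw [hP]; ring
  rw [k1, k2, k3, k4, k5] at h2
  norm_num at h2
  nlinarith only [h2, t1, t2, t3, t4, t5, z2, z3, z4, z5]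

namespace ArcPoint
variable {n : ℕ} {x₀ ρ ξ y : ℝ}

lemma xi_mul_le (h : ArcPoint n x₀ ρ ξ y) : ξ * (2 * (n - x₀) - ξ) ≤ y ^ 2 := by
  rw [h.circle]
  exact mul_le_mul_of_nonneg_left (by linarith [h.le_rho]) h.xi_pos.le

/-- Where the curve turns back in the second coordinate, `(π / sin πz)²` dominates its tail. -/
lemma strip_ge_of_turn (h : ArcPoint n x₀ ρ ξ y) (he : (x₀ + ξ) ^ 2 + y ^ 2 < n ^ 2) (hn : 2 ≤ n)
    (hd : 0.95 ≤ n - x₀) (hb : 0 ≤ ((⟨ρ - ξ, -y⟩ : ℂ) * fullSum₂ n ⟨x₀ + ξ, y⟩).re) (j : ℤ) :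
    1.54 / (2 * (n - x₀) + 1 + y ^ 2) * ρ ≤
      (ρ - ξ) * (stripRe j (x₀ + ξ) y ^ 2 - stripIm j (x₀ + ξ) y ^ 2) +
        2 * y * (stripRe j (x₀ + ξ) y * stripIm j (x₀ + ξ) y) := by
  have h1 := h.re_tail_ge he hn hd
  rw [mul_sub (⟨ρ - ξ, -y⟩ : ℂ), Complex.sub_re, pi_div_sin j, mul_pow] at h1
  have e : ((alt j : ℂ)) ^ 2 = 1 := by rw [sq, alt_mul_alt]
  rw [e, one_mul] at h1
  have e2 : ((⟨ρ - ξ, -y⟩ : ℂ) * (⟨stripRe j (x₀ + ξ) y, stripIm j (x₀ + ξ) y⟩ : ℂ) ^ 2).re =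
      (ρ - ξ) * (stripRe j (x₀ + ξ) y ^ 2 - stripIm j (x₀ + ξ) y ^ 2) +
        2 * y * (stripRe j (x₀ + ξ) y * stripIm j (x₀ + ξ) y) := by
    rw [sq, Complex.mul_re, Complex.mul_re, Complex.mul_im]; ring
  rw [e2] at h1
  linarith

end ArcPoint

lemma stripRe_sq_add (j : ℤ) (x : ℝ) {y : ℝ} (hy : 0 < y) :
    (stripRe j x y ^ 2 + stripIm j x y ^ 2) * stripDen j x y = Real.pi ^ 2 := by
  have hD := stripDen_pos j x hy
  have h1 := normSq_strip j x y
  rw [Complex.normSq_apply] at h1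
  simp only at h1
  rw [stripRe, stripIm]
  field_simp
  nlinarith only [h1]

lemma stripRe_sq_sub (j : ℤ) (x : ℝ) {y : ℝ} (hy : 0 < y) :
    (stripRe j x y ^ 2 - stripIm j x y ^ 2) * stripDen j x y ^ 2 = Real.pi ^ 2 *
      (stripSin j x ^ 2 * (1 + 2 * Real.sinh (Real.pi * y) ^ 2) - Real.sinh (Real.pi * y) ^ 2) := by
  have hD := stripDen_pos j x hy
  have hc := Real.cosh_sq (Real.pi * y)
  have h2 := stripSin_sq_add j x
  rw [stripRe, stripIm]
  field_simp
  have h3 : stripCos j x ^ 2 = 1 - stripSin j x ^ 2 := by linarith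
  rw [hc, h3]
  ring

lemma sq_le_of_sinh_sq_le {d y : ℝ} (hd : 0.95 ≤ d)
    (h : Real.sinh (Real.pi * y) ^ 2 ≤ 6.41 * (2 * d + 1 + y ^ 2)) : y ^ 2 ≤ 0.39 + 0.14 * d := by
  by_contra! hc
  have h1 := (sinh_sq_ge y).trans h
  set t := y ^ 2 with ht
  have e4 : y ^ 4 = t ^ 2 := by rw [ht]; ring
  have e6 : y ^ 6 = t ^ 3 := by rw [ht]; ring
  have e8 : y ^ 8 = t ^ 4 := by rw [ht]; ring
  have e10 : y ^ 10 = t ^ 5 := by rw [ht]; ring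
  rw [e4, e6, e8, e10] at h1
  have h2 : 0 ≤ t - 0.523 := by linarith
  have t2 : 0.523 ^ 2 + 2 * 0.523 * (t - 0.523) ≤ t ^ 2 := by nlinarith only [sq_nonneg (t - 0.523)]
  have t3 : 0.523 ^ 3 + 3 * 0.523 ^ 2 * (t - 0.523) ≤ t ^ 3 := by
    nlinarith only [mul_nonneg h2 (sq_nonneg (t - 0.523)), sq_nonneg (t - 0.523)]
  have t4 : 0.523 ^ 4 + 4 * 0.523 ^ 3 * (t - 0.523) ≤ t ^ 4 := by
    nlinarith only [mul_nonneg h2 (sq_nonneg (t - 0.523)), sq_nonneg (t - 0.523), mul_nonneg (sq_nonneg (t - 0.523)) (sq_nonneg (t - 0.523))]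
  have t5 : 0.523 ^ 5 + 5 * 0.523 ^ 4 * (t - 0.523) ≤ t ^ 5 := by
    have : 0 ≤ t := by linarith only [hd, hc]
    nlinarith only [t4, mul_le_mul_of_nonneg_left t4 this, sq_nonneg (t - 0.523)]
  nlinarith only [h1, t2, t3, t4, t5, h2, hc]

namespace ArcPoint
variable {n : ℕ} {x₀ ρ ξ y : ℝ}

lemma sq_le_of_turn (h : ArcPoint n x₀ ρ ξ y) (he : (x₀ + ξ) ^ 2 + y ^ 2 < n ^ 2) (hn : 2 ≤ n)
    (hd : 0.95 ≤ n - x₀) (hb : 0 ≤ ((⟨ρ - ξ, -y⟩ : ℂ) * fullSum₂ n ⟨x₀ + ξ, y⟩).re) :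
    y ^ 2 ≤ 0.39 + 0.14 * (n - x₀) := by
  have h1 := h.strip_ge_of_turn he hn hd hb 0
  have hD := stripDen_pos 0 (x₀ + ξ) h.im_pos
  have h2 := stripRe_sq_add 0 (x₀ + ξ) h.im_pos
  have hρ := h.rho_pos
  set a := stripRe 0 (x₀ + ξ) y
  set b := stripIm 0 (x₀ + ξ) y
  have hB : 0 < 2 * (n - x₀) + 1 + y ^ 2 := by positivity
  have h3 : (ρ - ξ) * (a ^ 2 - b ^ 2) + 2 * y * (a * b) ≤ ρ * (a ^ 2 + b ^ 2) := by
    have e : (ρ - ξ) ^ 2 + y ^ 2 = ρ ^ 2 := by rw [h.circle]; ring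
    refine abs_le_of_sq_le_sq' ?_ (by positivity) |>.2
    have : ((ρ - ξ) * (a ^ 2 - b ^ 2) + 2 * y * (a * b)) ^ 2 +
      ((ρ - ξ) * (2 * (a * b)) - y * (a ^ 2 - b ^ 2)) ^ 2 = ((ρ - ξ) ^ 2 + y ^ 2) * (a ^ 2 + b ^ 2) ^ 2 := by ring
    rw [e] at this
    nlinarith only [this, sq_nonneg ((ρ - ξ) * (2 * (a * b)) - y * (a ^ 2 - b ^ 2))]
  have h4 : 1.54 / (2 * (n - x₀) + 1 + y ^ 2) ≤ a ^ 2 + b ^ 2 := by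
    have := h1.trans h3
    rw [mul_comm ρ] at this
    exact le_of_mul_le_mul_right this hρ
  have h5 : 1.54 / (2 * (n - x₀) + 1 + y ^ 2) * stripDen 0 (x₀ + ξ) y ≤ Real.pi ^ 2 := by
    rw [← h2]; gcongr
  rw [div_mul_eq_mul_div, div_le_iff₀ hB] at h5
  refine sq_le_of_sinh_sq_le hd ?_
  have h6 : Real.sinh (Real.pi * y) ^ 2 ≤ stripDen 0 (x₀ + ξ) y := by
    rw [stripDen]; nlinarith only [sq_nonneg (stripSin 0 (x₀ + ξ))]
  nlinarith only [h5, h6, pi_sq_bounds.2, hB]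

lemma le_stripRe_sq_of_turn (h : ArcPoint n x₀ ρ ξ y) (he : (x₀ + ξ) ^ 2 + y ^ 2 < n ^ 2) (hn : 2 ≤ n)
    (hd : 0.95 ≤ n - x₀) (hb : 0 ≤ ((⟨ρ - ξ, -y⟩ : ℂ) * fullSum₂ n ⟨x₀ + ξ, y⟩).re) (j : ℤ) :
    1.54 / (2 * (n - x₀) + 1 + y ^ 2) * (ρ - ξ) ≤ stripRe j (x₀ + ξ) y ^ 2 * ρ := by
  have h1 := h.strip_ge_of_turn he hn hd hb j
  have hρ := h.rho_pos
  have a1 := (h.early_bounds he).1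
  set a := stripRe j (x₀ + ξ) y
  set b := stripIm j (x₀ + ξ) y
  set T := 1.54 / (2 * (n - x₀) + 1 + y ^ 2)
  have e : (ρ - ξ) ^ 2 + y ^ 2 = ρ ^ 2 := by rw [h.circle]; ring
  have h2 : (ρ - ξ) * ((ρ - ξ) * (a ^ 2 - b ^ 2) + 2 * y * (a * b)) ≤ a ^ 2 * ρ ^ 2 := by
    rw [← e]
    nlinarith only [sq_nonneg ((ρ - ξ) * b - y * a)]
  have h3 := mul_le_mul_of_nonneg_left h1 (sub_pos.2 a1).le
  refine le_of_mul_le_mul_right ?_ hρ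
  nlinarith only [h2, h3]

lemma stripSin_ge_of_turn (h : ArcPoint n x₀ ρ ξ y) (he : (x₀ + ξ) ^ 2 + y ^ 2 < n ^ 2) (hn : 2 ≤ n)
    (hd : 0.95 ≤ n - x₀) (hb : 0 ≤ ((⟨ρ - ξ, -y⟩ : ℂ) * fullSum₂ n ⟨x₀ + ξ, y⟩).re) (j : ℤ)
    (hj : 0 ≤ stripSin j (x₀ + ξ) * stripCos j (x₀ + ξ)) {q : ℝ} (hq0 : 0 ≤ q)
    (hq : q ≤ Real.sinh (Real.pi * y) ^ 2) :
    q + 0.156 / (2.14 * (n - x₀) + 1.39) * q ^ 2 ≤ stripSin j (x₀ + ξ) ^ 2 * (1 + 2 * q) := by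
  have h1 := h.strip_ge_of_turn he hn hd hb j
  have hy2 := h.sq_le_of_turn he hn hd hb
  have hρ := h.rho_pos
  have hξ := h.xi_pos
  have a1 := (h.early_bounds he).1
  have hD := stripDen_pos j (x₀ + ξ) h.im_pos
  have h2 := stripRe_sq_sub j (x₀ + ξ) h.im_pos
  have hab : stripRe j (x₀ + ξ) y * stripIm j (x₀ + ξ) y ≤ 0 := by
    rw [stripRe, stripIm]
    have hsh : 0 ≤ Real.sinh (Real.pi * y) := Real.sinh_nonneg_iff.2 (by have := h.im_pos; positivity)
    have hch := Real.cosh_pos (Real.pi * y)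
    rw [mul_neg, div_mul_div_comm]
    refine neg_nonpos.2 (div_nonneg ?_ (by positivity))
    have : 0 ≤ Real.pi ^ 2 * (stripSin j (x₀ + ξ) * stripCos j (x₀ + ξ)) * (Real.cosh (Real.pi * y) * Real.sinh (Real.pi * y)) := by
      positivity
    nlinarith only [this]
  set D := stripDen j (x₀ + ξ) y with hDdef
  set A := stripRe j (x₀ + ξ) y ^ 2 - stripIm j (x₀ + ξ) y ^ 2 with hA
  set S := stripSin j (x₀ + ξ)
  set Q := Real.sinh (Real.pi * y) ^ 2
  have hS1 : S ^ 2 ≤ 1 := by have := stripSin_sq_add j (x₀ + ξ); nlinarith only [this, sq_nonneg (stripCos j (x₀ + ξ))]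
  have hB : 0 < 2 * (n - x₀) + 1 + y ^ 2 := by positivity
  set T := 1.54 / (2 * (n - x₀) + 1 + y ^ 2) with hT
  have hT0 : 0 < T := by positivity
  have hA1 : T ≤ A := by
    have : T * ρ ≤ (ρ - ξ) * A := by nlinarith only [h1, hab, h.im_pos]
    have hA0 : 0 ≤ A := by
      by_contra! hc
      nlinarith only [this, hc, sub_pos.2 a1, mul_pos hT0 hρ]
    have h5 : T * ρ ≤ A * ρ := by nlinarith only [this, hA0, hξ, mul_nonneg hξ.le hA0]
    exact le_of_mul_le_mul_right h5 hρ
  have hD2 : Q ≤ D := by rw [hDdef, stripDen]; nlinarith only [sq_nonneg (stripSin j (x₀ + ξ))]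
  have hQ0 : 0 ≤ Q := sq_nonneg _
  have h3 : T * Q ^ 2 ≤ Real.pi ^ 2 * (S ^ 2 * (1 + 2 * Q) - Q) := by
    rw [← h2]
    refine mul_le_mul hA1 (by gcongr) (by positivity) (hT0.le.trans hA1)
  set τ := 0.156 / (2.14 * (n - x₀) + 1.39) with hτ
  have hτT : τ * Real.pi ^ 2 ≤ T := by
    rw [hτ, hT, div_mul_eq_mul_div, div_le_div_iff₀ (by linarith only [hd]) hB]
    have := pi_sq_bounds.2
    have h6 : 0.156 * Real.pi ^ 2 ≤ 1.54 := by linarith only [this]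
    have h7 : 2 * (n - x₀) + 1 + y ^ 2 ≤ 2.14 * (n - x₀) + 1.39 := by linarith only [hy2]
    exact mul_le_mul h6 h7 hB.le (by norm_num)
  have hτ0 : 0 < τ := by rw [hτ]; apply div_pos (by norm_num) (by linarith only [hd])
  have h4 : Q + τ * Q ^ 2 ≤ S ^ 2 * (1 + 2 * Q) := by
    have h8 := mul_le_mul_of_nonneg_right hτT (sq_nonneg Q)
    have h9 : Real.pi ^ 2 * (τ * Q ^ 2) ≤ Real.pi ^ 2 * (S ^ 2 * (1 + 2 * Q) - Q) := by
      refine le_trans ?_ h3; linarith only [h8]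
    have := le_of_mul_le_mul_left h9 (by positivity)
    linarith only [this]
  by_contra! hc
  have h10 : 0 < 1 - 2 * S ^ 2 + τ * (q + Q) := by
    by_contra! h11
    nlinarith only [mul_nonneg (mul_nonneg hτ0.le hQ0) hq0, h11, hc, hq0, hτ0, hQ0, sq_nonneg S, h4, mul_nonneg hq0 (sub_nonneg.2 hS1), mul_nonneg hQ0 (sub_nonneg.2 hS1), mul_nonneg hτ0.le (sq_nonneg q)]
  nlinarith only [mul_nonneg (sub_nonneg.2 hq) h10.le, h4, hc]

end ArcPoint

/-- The deviation of `Re (1 / (2 (n + 1/2 - z)))` from its value at `x₀`, where `d = n - x₀`. -/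
def endRight (d ξ y : ℝ) : ℝ :=
  (y ^ 2 + ξ ^ 2 - ξ * (d + 1 / 2)) / ((2 * d + 1) * ((d + 1 / 2 - ξ) ^ 2 + y ^ 2))

/-- The deviation of `-Re (1 / (2 (n + 1/2 + z)))` from its value at `x₀`, where `W = n + x₀ + 1/2`. -/
def endLeft (W ξ y : ℝ) : ℝ :=
  (y ^ 2 + ξ ^ 2 + ξ * W) / (2 * W * ((W + ξ) ^ 2 + y ^ 2))

lemma endLeft_le {W W₀ ξ Z y Y : ℝ} (hW₀ : 0 < W₀) (hW : W₀ ≤ W) (hξ : 0 ≤ ξ) (hξZ : ξ ≤ Z)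
    (hY : y ^ 2 ≤ Y) : endLeft W ξ y ≤ (Y + Z ^ 2) / (2 * W₀ ^ 3) + Z / (2 * W₀ ^ 2) := by
  have hWp : 0 < W := by linarith
  have h1 : endLeft W ξ y ≤ (y ^ 2 + ξ ^ 2 + ξ * W) / (2 * W * W ^ 2) := by
    rw [endLeft]
    gcongr
    nlinarith [sq_nonneg y]
  have h2 : (y ^ 2 + ξ ^ 2 + ξ * W) / (2 * W * W ^ 2) = (y ^ 2 + ξ ^ 2) / (2 * W ^ 3) + ξ / (2 * W ^ 2) := by
    field_simp
  rw [h2] at h1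
  refine h1.trans ?_
  have hZ : 0 ≤ Z := hξ.trans hξZ
  have hY0 : 0 ≤ Y := (sq_nonneg y).trans hY
  gcongr

lemma endRight_le {d p ξ y Y : ℝ} (hp : 0 < p) (hpd : p ≤ d + 1 / 2 - ξ) (hξ : 0 ≤ ξ)
    (hY : y ^ 2 ≤ Y) : endRight d ξ y ≤ Y / ((2 * d + 1) * p ^ 2) := by
  have hM : 0 < 2 * d + 1 := by linarith
  have hY0 : 0 ≤ Y := (sq_nonneg y).trans hY
  rw [endRight]
  refine div_le_div₀ hY0 ?_ (by positivity) ?_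
  · nlinarith
  · gcongr
    nlinarith [sq_nonneg y]

lemma endRight_eq {d ξ y : ℝ} (hp : 0 < d + 1 / 2 - ξ) (hd : 0 < 2 * d + 1) :
    endRight d ξ y = 1 / (2 * d + 1) - (d + 1 / 2 - ξ) / (2 * ((d + 1 / 2 - ξ) ^ 2 + y ^ 2)) := by
  have : 0 < (d + 1 / 2 - ξ) ^ 2 + y ^ 2 := by positivity
  rw [endRight, div_sub_div _ _ hd.ne' (by positivity), div_eq_div_iff (by positivity) (by positivity)]
  ring

namespace ArcPoint
variable {n : ℕ} {x₀ ρ ξ y : ℝ}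

lemma phi_eq (h : ArcPoint n x₀ ρ ξ y) (he : (x₀ + ξ) ^ 2 + y ^ 2 < n ^ 2) (hd : 0.95 ≤ n - x₀) (j : ℤ) :
    0 ≤ endRight (n - x₀) ξ y ∧ 0 ≤ endLeft (n + x₀ + 1 / 2) ξ y ∧
    ∃ E : ℝ, |E| ≤ 1 / (8 * (n - (x₀ + ξ) + 1 / 2) ^ 2) + 1 / (8 * (n + x₀ + 1 / 2) ^ 2) ∧
      (1 / 2 ≤ y → |E| ≤ 3 / (8 * (n - (x₀ + ξ) + 1 / 2 + y) ^ 2) + 1 / (8 * (n + x₀ + 1 / 2) ^ 2)) ∧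
      -(alt j * (altSum n ⟨x₀ + ξ, y⟩).re) = -stripRe j (x₀ + ξ) y + alt j * alt n *
        (1 / (2 * (n - x₀ + 1 / 2)) - 1 / (2 * (n + x₀ + 1 / 2)) -
          endRight (n - x₀) ξ y + endLeft (n + x₀ + 1 / 2) ξ y + E) := by
  obtain ⟨E, h1, h2, h3⟩ := h.altSum_re_approx he j
  have hξ := h.xi_pos
  have hx := h.left_pos
  have hc : y ^ 2 + ξ ^ 2 = 2 * ρ * ξ := by rw [h.circle]; ring
  have e1 : endRight (n - x₀) ξ y = ξ * (2 * ρ - (n - x₀ + 1 / 2)) / (2 * (n - x₀ + 1 / 2) *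
          ((n - x₀ + 1 / 2) ^ 2 - 2 * ξ * (n - x₀ + 1 / 2 - ρ))) := by
    rw [endRight]
    congr 1
    · rw [hc]; ring
    · rw [show (n - x₀ + 1 / 2) ^ 2 - 2 * ξ * (n - x₀ + 1 / 2 - ρ) = (n - x₀ + 1 / 2 - ξ) ^ 2 + y ^ 2 by
        nlinarith only [hc]]
      ring
  have e2 : endLeft (n + x₀ + 1 / 2) ξ y = ξ * (2 * ρ + (n + x₀ + 1 / 2)) / (2 * (n + x₀ + 1 / 2) *
          ((n + x₀ + 1 / 2) ^ 2 + 2 * ξ * (n + x₀ + 1 / 2 + ρ))) := by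
    rw [endLeft]
    congr 1
    · rw [hc]; ring
    · rw [show (n + x₀ + 1 / 2) ^ 2 + 2 * ξ * (n + x₀ + 1 / 2 + ρ) = (n + x₀ + 1 / 2 + ξ) ^ 2 + y ^ 2 by
        nlinarith only [hc]]
  refine ⟨?_, ?_, E, h1, h2, ?_⟩
  · rw [endRight]
    refine div_nonneg ?_ (by have : 0 ≤ 2 * (n - x₀) + 1 := by linarith only [hd]
                             positivity)
    have : y ^ 2 + ξ ^ 2 - ξ * (n - x₀ + 1 / 2) = ξ * (2 * ρ - (n - x₀ + 1 / 2)) := by rw [hc]; ring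
    rw [this]
    exact mul_nonneg hξ.le (by linarith [h.le_rho])
  · rw [endLeft]; positivity
  · rw [h3, e1, e2]

/-- Upper bound for the first coordinate. -/
lemma phi_le (h : ArcPoint n x₀ ρ ξ y) (he : (x₀ + ξ) ^ 2 + y ^ 2 < n ^ 2) (hd : 0.95 ≤ n - x₀) (j : ℤ)
    {G : ℝ} (hl : alt j * alt n = 1 → endLeft (n + x₀ + 1 / 2) ξ y ≤ G)
    (hr : alt j * alt n = -1 → endRight (n - x₀) ξ y ≤ G) :
    -(alt j * (altSum n ⟨x₀ + ξ, y⟩).re) ≤ -stripRe j (x₀ + ξ) y + alt j * alt n *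
        (1 / (2 * (n - x₀ + 1 / 2)) - 1 / (2 * (n + x₀ + 1 / 2))) + G +
        (1 / (8 * (n - (x₀ + ξ) + 1 / 2) ^ 2) + 1 / (8 * (n + x₀ + 1 / 2) ^ 2)) := by
  obtain ⟨p1, p2, E, h1, -, h3⟩ := h.phi_eq he hd j
  rw [h3]
  have hE := abs_le.1 h1
  rw [← alt_add] at *
  rcases alt_eq_one_or (j + n) with hε | hε
  · have := hl hε
    rw [hε]; linarith
  · have := hr hε
    rw [hε]; linarith

/-- Lower bound for `Re (π / sin πz)` where the first coordinate lies below a threshold. -/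
lemma stripRe_gt_of_phi_lt (h : ArcPoint n x₀ ρ ξ y) (he : (x₀ + ξ) ^ 2 + y ^ 2 < n ^ 2) (hd : 0.95 ≤ n - x₀)
    (j : ℤ) {G κ : ℝ} (hr : alt j * alt n = 1 → endRight (n - x₀) ξ y ≤ G)
    (hl : alt j * alt n = -1 → endLeft (n + x₀ + 1 / 2) ξ y ≤ G)
    (hφ : -(alt j * (altSum n ⟨x₀ + ξ, y⟩).re) < alt j * alt n *
        (1 / (2 * (n - x₀ + 1 / 2)) - 1 / (2 * (n + x₀ + 1 / 2))) - κ) :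
    κ - G - (1 / (8 * (n - (x₀ + ξ) + 1 / 2) ^ 2) + 1 / (8 * (n + x₀ + 1 / 2) ^ 2)) < stripRe j (x₀ + ξ) y ∧
    (1 / 2 ≤ y → κ - G - (3 / (8 * (n - (x₀ + ξ) + 1 / 2 + y) ^ 2) + 1 / (8 * (n + x₀ + 1 / 2) ^ 2)) <
      stripRe j (x₀ + ξ) y) := by
  obtain ⟨p1, p2, E, h1, h2, h3⟩ := h.phi_eq he hd j
  rw [h3] at hφ
  have hE := neg_abs_le E
  have hE' := le_abs_self E
  have key : κ - G - |E| < stripRe j (x₀ + ξ) y := by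
    rw [← alt_add] at *
    rcases alt_eq_one_or (j + n) with hε | hε
    · have := hr hε
      rw [hε] at hφ; linarith
    · have := hl hε
      rw [hε] at hφ; linarith
  exact ⟨by linarith only [h1, key], fun hy => by linarith [h2 hy]⟩

lemma xi_le_of_sq_le (h : ArcPoint n x₀ ρ ξ y) (he : (x₀ + ξ) ^ 2 + y ^ 2 < n ^ 2) {Z Y : ℝ}
    (hZ : Y ≤ Z * (2 * (n - x₀) - Z)) (hY : y ^ 2 ≤ Y) : ξ ≤ Z := by
  have h1 := h.xi_mul_le
  have h2 := (h.early_bounds he).2.2.2.1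
  by_contra! hc
  have h3 := hY
  nlinarith only [h1, h2, hc, hZ, h3, mul_pos (sub_pos.2 hc) (sub_pos.2 h2), mul_pos (sub_pos.2 hc) (sub_pos.2 hc)]

/-- Before the curve turns back it stays in the strip in which it started. -/
lemma lt_of_turn (h : ArcPoint n x₀ ρ ξ y) (he : (x₀ + ξ) ^ 2 + y ^ 2 < n ^ 2) (hn : 2 ≤ n)
    (hd : 1 ≤ n - x₀) (hb : 0 ≤ ((⟨ρ - ξ, -y⟩ : ℂ) * fullSum₂ n ⟨x₀ + ξ, y⟩).re) {j : ℤ}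
    (hj : x₀ < j + 1) : x₀ + ξ < j + 1 := by
  by_contra! hc
  have hd' : 0.95 ≤ n - x₀ := by linarith
  have hξ := h.xi_pos
  have hy2 := h.sq_le_of_turn he hn hd' hb
  have h1 := h.xi_mul_le
  have hξ3 : ξ ≤ 0.32 := h.xi_le_of_sq_le he (Z := 0.32) (by nlinarith only [hd]) hy2
  set σ := x₀ + ξ - (j + 1) with hσ
  have hσ0 : 0 ≤ σ := by linarith
  have hσξ : σ ≤ ξ := by linarith
  have hS : stripSin (j + 1) (x₀ + ξ) = Real.sin (Real.pi * σ) := by rw [stripSin, hσ]; push_cast; rfl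
  have hC : stripCos (j + 1) (x₀ + ξ) = Real.cos (Real.pi * σ) := by rw [stripCos, hσ]; push_cast; rfl
  have hπ := Real.pi_pos
  have hπ1 := Real.pi_lt_d6
  have hπσ : 0 ≤ Real.pi * σ := by positivity
  have hπσ' : Real.pi * σ ≤ 1.00532 := by nlinarith only [hξ3, hj, hc, hπ1]
  have hS0 : 0 ≤ Real.sin (Real.pi * σ) := Real.sin_nonneg_of_nonneg_of_le_pi hπσ (by linarith [Real.pi_gt_d6])
  have hC0 : 0 ≤ Real.cos (Real.pi * σ) := Real.cos_nonneg_of_neg_pi_div_two_le_of_le (by linarith) (by linarith [Real.pi_gt_d6])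
  have key := fun q hq0 hq => h.stripSin_ge_of_turn he hn hd' hb (j + 1) (by rw [hS, hC]; positivity) (q := q) hq0 hq
  rw [hS] at key
  have hsin : ∀ t, Real.pi * σ ≤ t → t ≤ 1.1 → Real.sin (Real.pi * σ) ≤ t - t ^ 3 / 6 + t ^ 5 / 120 := by
    intro t ht ht'
    refine (Real.sin_le_sin_of_le_of_le_pi_div_two (by linarith) (by linarith [Real.pi_gt_d6]) ht).trans (sin_le_quintic (by linarith))
  have hsh := sinh_sq_ge y
  have hpow : ∀ t, 0 ≤ t → t ≤ y ^ 2 → 9.869 * t + 32.46 * t ^ 2 + 42.7 * t ^ 3 + 30.1 * t ^ 4 ≤ Real.sinh (Real.pi * y) ^ 2 := by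
    intro t ht0 ht
    refine le_trans ?_ hsh
    have e2 : t ^ 2 ≤ y ^ 4 := by rw [show y ^ 4 = (y ^ 2) ^ 2 by ring]; gcongr
    have e3 : t ^ 3 ≤ y ^ 6 := by rw [show y ^ 6 = (y ^ 2) ^ 3 by ring]; gcongr
    have e4 : t ^ 4 ≤ y ^ 8 := by rw [show y ^ 8 = (y ^ 2) ^ 4 by ring]; gcongr
    have e5 : 0 ≤ y ^ 10 := by positivity
    linarith only [ht, e2, e3, e4, e5]
  set D := (n : ℝ) - x₀ with hD
  by_cases c1 : ξ ≤ 0.2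
  · have hq : 17.7 * ξ ≤ Real.sinh (Real.pi * y) ^ 2 := by
      refine le_trans ?_ (hpow (1.8 * ξ) (by positivity) ?_)
      · nlinarith only [hξ, pow_pos hξ 2, pow_pos hξ 3, pow_pos hξ 4]
      · nlinarith only [h1, hξ, c1, hd]
    have k := key (17.7 * ξ) (by positivity) hq
    have hs2 : Real.sin (Real.pi * σ) ^ 2 ≤ 9.87 * ξ ^ 2 := by
      have s1 := Real.sin_le hπσ
      have : Real.sin (Real.pi * σ) ≤ Real.pi * ξ := s1.trans (by gcongr)
      calc _ ≤ (Real.pi * ξ) ^ 2 := by gcongr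
        _ = Real.pi ^ 2 * ξ ^ 2 := by ring
        _ ≤ _ := by gcongr; linarith [pi_sq_bounds.2]
    have : 0 ≤ 0.156 / (2.14 * D + 1.39) * (17.7 * ξ) ^ 2 := by positivity
    have k2 : 17.7 * ξ ≤ 9.87 * ξ ^ 2 * (1 + 2 * (17.7 * ξ)) := by
      have := mul_le_mul_of_nonneg_right hs2 (show 0 ≤ 1 + 2 * (17.7 * ξ) by positivity)
      linarith
    nlinarith only [k2, hξ, c1, mul_pos hξ hξ, mul_nonneg hξ.le (sub_nonneg.2 c1), mul_nonneg (mul_pos hξ hξ).le (sub_nonneg.2 c1)]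
  · push Not at c1
    have hD2 : D ≤ 1.66 := by nlinarith only [h1, c1, hy2, hξ3, hd, mul_pos (sub_pos.2 c1) (sub_pos.2 c1)]
    have hτ : 0.0315 ≤ 0.156 / (2.14 * D + 1.39) := by
      rw [le_div_iff₀ (by linarith)]; linarith
    have hyξ : ∀ t, t ≤ ξ → 0 ≤ t → t * (2 - t) ≤ y ^ 2 := by
      intro t ht ht0
      nlinarith only [h1, hd, ht, ht0, hξ3, mul_nonneg (sub_nonneg.2 ht) (show 0 ≤ 2 - ξ - t by linarith)]
    by_cases c2 : ξ ≤ 0.25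
    · have hq : (10.2 : ℝ) ≤ Real.sinh (Real.pi * y) ^ 2 := by
        refine le_trans ?_ (hpow 0.36 (by norm_num) ?_)
        · norm_num
        · have := hyξ 0.2 c1.le (by norm_num); linarith only [this]
      have k := key 10.2 (by norm_num) hq
      have hs := hsin 0.7855 (by nlinarith only [c2, hj, hc, hπ1]) (by norm_num)
      have : Real.sin (Real.pi * σ) ^ 2 ≤ 0.51 := by
        norm_num at hs
        nlinarith only [hs, hS0]
      norm_num at k
      linarith
    · push Not at c2
      have hq : (15.2 : ℝ) ≤ Real.sinh (Real.pi * y) ^ 2 := by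
        refine le_trans ?_ (hpow 0.4375 (by norm_num) ?_)
        · norm_num
        · have := hyξ 0.25 c2.le (by norm_num); linarith only [this]
      have k := key 15.2 (by norm_num) hq
      have hs := hsin 1.00532 hπσ' (by norm_num)
      have : Real.sin (Real.pi * σ) ^ 2 ≤ 0.7136 := by
        norm_num at hs
        nlinarith only [hs, hS0]
      norm_num at k
      linarith

end ArcPoint

lemma stripSin_pos {j : ℤ} {x : ℝ} (h0 : (j : ℝ) < x) (h1 : x < j + 1) : 0 < stripSin j x := by
  have := Real.pi_pos
  exact Real.sin_pos_of_pos_of_lt_pi (mul_pos this (by linarith)) (by nlinarith)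

lemma stripRe_pos {j : ℤ} {x y : ℝ} (hy : 0 < y) (h : 0 < stripSin j x) : 0 < stripRe j x y := by
  have := stripDen_pos j x hy
  have := Real.pi_pos
  have := Real.cosh_pos (Real.pi * y)
  rw [stripRe]; positivity

lemma alt_mul_alt_of_sub_two {n : ℕ} {j : ℤ} (h : j = n - 2) : alt j * alt n = 1 := by
  rw [h, alt_sub, mul_right_comm, alt_mul_self, one_mul]
  simp [alt]

namespace ArcPoint
variable {n : ℕ} {x₀ ρ ξ y : ℝ}

lemma strip_index {j : ℤ} (hj : j ≤ x₀) (hj' : x₀ < j + 1)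
    (hd : 1 < n - x₀) (hd2 : n - x₀ ≤ 2) : j = n - 2 := by
  have h1 : (j : ℝ) < ((n : ℤ) - 1 : ℤ) := by push_cast; linarith
  have h2 : (((n : ℤ) - 3 : ℤ) : ℝ) < j := by push_cast; linarith
  have h3 := Int.cast_lt.1 h1
  have h4 := Int.cast_lt.1 h2
  omega

lemma le_stripRe_mul (h : ArcPoint n x₀ ρ ξ y) (he : (x₀ + ξ) ^ 2 + y ^ 2 < n ^ 2) (hn : 2 ≤ n)
    (hd : 1 < n - x₀) (hb : 0 ≤ ((⟨ρ - ξ, -y⟩ : ℂ) * fullSum₂ n ⟨x₀ + ξ, y⟩).re) {j : ℤ}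
    (ha : 0 < stripRe j (x₀ + ξ) y) {m L γ : ℝ} (hm : 0 < m) (hm2 : m ^ 2 = 2 * (n - x₀) + 1)
    (hγ : ξ ≤ γ * (n - x₀)) (hγ0 : 0 ≤ γ)
    (hL : L ^ 2 * (1.07 * m ^ 2 + 0.32) ≤ 1.54 * (1 - γ) * m ^ 2) :
    L ≤ stripRe j (x₀ + ξ) y * m := by
  have h1 := h.le_stripRe_sq_of_turn he hn (by linarith) hb j
  have hy2 := h.sq_le_of_turn he hn (by linarith) hb
  have hρ := h.rho_pos
  set a := stripRe j (x₀ + ξ) y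
  have hB : 0 < m ^ 2 + y ^ 2 := by positivity
  rw [← hm2, div_mul_eq_mul_div, div_le_iff₀ hB] at h1
  have h2 : (1 - γ) * ρ ≤ ρ - ξ := by nlinarith only [hγ, h.le_rho, hγ0]
  have h3 : 1.54 * (1 - γ) ≤ a ^ 2 * (m ^ 2 + y ^ 2) := by
    refine le_of_mul_le_mul_right ?_ hρ
    nlinarith only [h1, h2]
  have h4 : 1.54 * (1 - γ) * m ^ 2 ≤ (a * m) ^ 2 * (1.07 * m ^ 2 + 0.32) := by
    have h5 : m ^ 2 + y ^ 2 ≤ 1.07 * m ^ 2 + 0.32 := by linarith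
    have h6 := mul_le_mul_of_nonneg_left h5 (sq_nonneg a)
    nlinarith only [h3, h6, sq_nonneg m]
  refine le_of_sq_le_sq ?_ (by positivity)
  exact le_of_mul_le_mul_right (hL.trans h4) (by positivity)

/-- Where the curve turns back in the second coordinate, the first one lies below a threshold. -/
lemma phi_lt_of_turn (h : ArcPoint n x₀ ρ ξ y) (he : (x₀ + ξ) ^ 2 + y ^ 2 < n ^ 2) (hn : 2 ≤ n)
    (hd : 1 < n - x₀) (hb : 0 ≤ ((⟨ρ - ξ, -y⟩ : ℂ) * fullSum₂ n ⟨x₀ + ξ, y⟩).re) {j : ℤ}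
    (hj : j ≤ x₀) (hj' : x₀ < j + 1) {m κ : ℝ} (hm : 0 < m) (hm2 : m ^ 2 = 2 * (n - x₀) + 1)
    (hκ : κ = 0.83 ∨ κ = 0.88 ∧ 1.5 ≤ n - x₀ ∨ κ = 0.95 ∧ 1.5 ≤ n - x₀ ∧ n - x₀ ≤ 2 ∧ 3 ≤ n) :
    -(alt j * (altSum n ⟨x₀ + ξ, y⟩).re) < alt j * alt n *
        (1 / (2 * (n - x₀ + 1 / 2)) - 1 / (2 * (n + x₀ + 1 / 2))) - κ / m := by
  have hξ := h.xi_pos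
  have hx0 := h.left_pos
  have hn' : (2 : ℝ) ≤ n := by exact_mod_cast hn
  have hx := h.lt_of_turn he hn hd.le hb hj'
  have hy2 := h.sq_le_of_turn he hn (by linarith) hb
  have ha : 0 < stripRe j (x₀ + ξ) y := stripRe_pos h.im_pos (stripSin_pos (by linarith) hx)
  have hp0 := (h.early_bounds he).2.2.2.1
  have key : ∀ {L γ G p W Q : ℝ}, ξ ≤ γ * (n - x₀) → 0 ≤ γ →
      L ^ 2 * (1.07 * m ^ 2 + 0.32) ≤ 1.54 * (1 - γ) * m ^ 2 →
      (alt j * alt n = 1 → endLeft (n + x₀ + 1 / 2) ξ y ≤ G) →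
      (alt j * alt n = -1 → endRight (n - x₀) ξ y ≤ G) → 0 < p → p ≤ n - (x₀ + ξ) + 1 / 2 →
      0 < W → W ≤ n + x₀ + 1 / 2 → G + (1 / (8 * p ^ 2) + 1 / (8 * W ^ 2)) ≤ Q → Q * m + κ < L →
      -(alt j * (altSum n ⟨x₀ + ξ, y⟩).re) < alt j * alt n *
        (1 / (2 * (n - x₀ + 1 / 2)) - 1 / (2 * (n + x₀ + 1 / 2))) - κ / m := by
    intro L γ G p W Q k1 k2 k4 k5 k6 k7 k8 k9 k10 k11 k12
    have l1 := h.le_stripRe_mul he hn hd hb ha hm hm2 k1 k2 k4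
    have l2 := h.phi_le he (by linarith) j k5 k6
    have l3 : 1 / (8 * (n - (x₀ + ξ) + 1 / 2) ^ 2) ≤ 1 / (8 * p ^ 2) := by gcongr
    have l4 : 1 / (8 * (n + x₀ + 1 / 2) ^ 2) ≤ 1 / (8 * W ^ 2) := by gcongr
    have l5 : Q + κ / m < stripRe j (x₀ + ξ) y := by
      rw [← mul_lt_mul_iff_left₀ hm, add_mul, div_mul_cancel₀ _ hm.ne']
      linarith only [k12, l1]
    linarith
  have hmle : ∀ t, 0 ≤ t → 2 * (n - x₀) + 1 ≤ t ^ 2 → m ≤ t := fun t ht h1 => le_of_sq_le_sq (by linarith) ht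
  have hodd : ∀ {G : ℝ}, n - x₀ ≤ 2 → (alt j * alt n = -1 → endRight (n - x₀) ξ y ≤ G) := by
    intro G hd2 h1
    rw [alt_mul_alt_of_sub_two (strip_index hj hj' hd hd2)] at h1
    norm_num at h1
  by_cases c5 : n - x₀ ≤ 2
  · have hX : x₀ + ξ < n - 1 := by
      have := strip_index hj hj' hd c5
      rw [this] at hx; push_cast at hx; linarith
    have hW : ∀ {Y Z W : ℝ}, 0 < W → W ≤ n + x₀ + 1 / 2 → ξ ≤ Z → y ^ 2 ≤ Y →
        (alt j * alt n = 1 → endLeft (n + x₀ + 1 / 2) ξ y ≤ (Y + Z ^ 2) / (2 * W ^ 3) + Z / (2 * W ^ 2)) :=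
      fun h1 h2 h3 h4 _ => endLeft_le h1 h2 hξ.le h3 h4
    by_cases c1 : n - x₀ ≤ 1.25
    · have hκ' : κ = 0.83 := by
        rcases hκ with h | h | h
        · exact h
        · linarith [h.2]
        · linarith [h.2.1]
      subst hκ'
      refine key (L := 1.022) (γ := 0.2) (p := 1.5) (W := 3.25) (Q := 0.0885) (by linarith) (by norm_num)
        (by nlinarith only [hm2, hd])
        (hW (Y := 0.565) (Z := 0.25) (W := 3.25) (by norm_num) (by linarith) (by linarith) (by linarith)) (hodd c5)
        (by norm_num) (by linarith) (by norm_num) (by linarith) (by norm_num) ?_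
      have := hmle 1.871 (by norm_num) (by linarith)
      linarith
    · push Not at c1
      by_cases c2 : n - x₀ < 1.5
      · have hκ' : κ = 0.83 := by
          rcases hκ with h | h | h
          · exact h
          · linarith [h.2]
          · linarith [h.2.1]
        subst hκ'
        have hξZ : ξ ≤ 0.253 := h.xi_le_of_sq_le he (Z := 0.253) (by nlinarith only [c1]) hy2
        refine key (L := 1.027) (γ := 0.2024) (p := 1.497) (W := 3) (Q := 0.0962) (by linarith) (by norm_num)
          (by nlinarith only [hm2, c1])
          (hW (Y := 0.6) (Z := 0.253) (W := 3) (by norm_num) (by linarith) hξZ (by linarith)) (hodd c5)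
          (by norm_num) (by linarith) (by norm_num) (by linarith) (by norm_num) ?_
        have := hmle 2 (by norm_num) (by linarith)
        linarith
      · push Not at c2
        have hn3 : 3 ≤ n → (3 : ℝ) ≤ n := fun h => by exact_mod_cast h
        by_cases c3 : n - x₀ ≤ 1.75
        · have hξZ : ξ ≤ 0.217 := h.xi_le_of_sq_le he (Z := 0.217) (by nlinarith only [c2]) hy2
          have hm' := hmle 2.1214 (by norm_num) (by linarith)
          by_cases c4 : 3 ≤ n
          · have := hn3 c4
            have hκ' : κ ≤ 0.95 := by rcases hκ with h | ⟨h, -⟩ | ⟨h, -⟩ <;> linarith only [hξ, hξZ, h]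
            refine key (L := 1.07) (γ := 0.1447) (p := 1.783) (W := 4.75) (Q := 0.0532) (by linarith) (by norm_num)
              (by nlinarith only [hm2, c2])
              (hW (Y := 0.635) (Z := 0.217) (W := 4.75) (by norm_num) (by linarith) hξZ (by linarith)) (hodd c5)
              (by norm_num) (by linarith) (by norm_num) (by linarith) (by norm_num) ?_
            linarith
          · have hκ' : κ ≤ 0.88 := by
              rcases hκ with h | h | h
              · linarith
              · linarith [h.1]
              · exact absurd h.2.2.2 c4
            refine key (L := 1.07) (γ := 0.1447) (p := 1.783) (W := 2.75) (Q := 0.0867) (by linarith) (by norm_num)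
              (by nlinarith only [hm2, c2])
              (hW (Y := 0.635) (Z := 0.217) (W := 2.75) (by norm_num) (by linarith) hξZ (by linarith)) (hodd c5)
              (by norm_num) (by linarith) (by norm_num) (by linarith) (by norm_num) ?_
            linarith
        · push Not at c3
          have hξZ : ξ ≤ 0.193 := h.xi_le_of_sq_le he (Z := 0.193) (by nlinarith only [c3]) hy2
          have hm' := hmle 2.2361 (by norm_num) (by linarith)
          by_cases c4 : 3 ≤ n
          · have := hn3 c4
            have hκ' : κ ≤ 0.95 := by rcases hκ with h | ⟨h, -⟩ | ⟨h, -⟩ <;> linarith only [hξ, hξZ, h]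
            refine key (L := 1.095) (γ := 0.1103) (p := 2.057) (W := 4.5) (Q := 0.0446) (by linarith) (by norm_num)
              (by nlinarith only [hm2, c3])
              (hW (Y := 0.67) (Z := 0.193) (W := 4.5) (by norm_num) (by linarith) hξZ (by linarith)) (hodd c5)
              (by norm_num) (by linarith) (by norm_num) (by linarith) (by norm_num) ?_
            linarith
          · have hκ' : κ ≤ 0.88 := by
              rcases hκ with h | h | h
              · linarith
              · linarith [h.1]
              · exact absurd h.2.2.2 c4
            refine key (L := 1.095) (γ := 0.1103) (p := 2.057) (W := 2.5) (Q := 0.0877) (by linarith) (by norm_num)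
              (by nlinarith only [hm2, c3])
              (hW (Y := 0.67) (Z := 0.193) (W := 2.5) (by norm_num) (by linarith) hξZ (by linarith)) (hodd c5)
              (by norm_num) (by linarith) (by norm_num) (by linarith) (by norm_num) ?_
            linarith
  · push Not at c5
    have hκ' : κ ≤ 0.88 := by
      rcases hκ with h | h | h
      · linarith
      · linarith [h.1]
      · linarith [h.2.2.1]
    have hξZ : ξ ≤ 0.09 * (n - x₀) := h.xi_le_of_sq_le he (Z := 0.09 * (n - x₀)) (by nlinarith only [c5]) hy2
    set M := m ^ 2 with hM
    have hM5 : 5 ≤ M := by linarith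
    have hd' : n - x₀ = (M - 1) / 2 := by linarith
    have hY : y ^ 2 ≤ 0.32 + 0.07 * M := by linarith
    have hξ2 : ξ ≤ 0.045 * M := by linarith
    have i1 : 1 / M ≤ 1 / 5 := by gcongr
    have hMp : 0 < M := by linarith
    have hi : 0 < 1 / M := by positivity
    have hG1 : endLeft (n + x₀ + 1 / 2) ξ y ≤ 1.6 / M ^ 3 + 0.34 / M ^ 2 + 0.0981 / M := by
      refine (endLeft_le (W₀ := M / 2) (Z := 0.045 * M) (by positivity) (by linarith) hξ.le hξ2 hY).trans ?_
      have e : (0.32 + 0.07 * M + (0.045 * M) ^ 2) / (2 * (M / 2) ^ 3) + 0.045 * M / (2 * (M / 2) ^ 2) =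
        1.28 / M ^ 3 + 0.28 / M ^ 2 + 0.0981 / M := by
        field_simp; ring
      rw [e]
      gcongr <;> norm_num
    have hG2 : endRight (n - x₀) ξ y ≤ 1.6 / M ^ 3 + 0.34 / M ^ 2 + 0.0981 / M := by
      refine (endRight_le (p := 0.455 * M) (by positivity) (by linarith) hξ.le hY).trans ?_
      have e : (0.32 + 0.07 * M) / ((2 * (n - x₀) + 1) * (0.455 * M) ^ 2) =
        0.32 / 0.455 ^ 2 / M ^ 3 + 0.07 / 0.455 ^ 2 / M ^ 2 := by
        rw [← hm2]; field_simp
      rw [e]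
      have : 0 ≤ 0.0981 / M := by positivity
      have : 0.32 / 0.455 ^ 2 / M ^ 3 ≤ 1.6 / M ^ 3 := by gcongr; norm_num
      have : 0.07 / 0.455 ^ 2 / M ^ 2 ≤ 0.34 / M ^ 2 := by gcongr; norm_num
      linarith
    refine key (L := 1.11) (γ := 0.09) (p := 0.455 * M) (W := M / 2) (Q := 0.451 / M) hξZ (by norm_num)
      (by nlinarith only [hM5]) (fun _ => hG1) (fun _ => hG2)
      (by positivity) (by linarith) (by positivity) (by linarith) ?_ ?_
    · have e : 1.6 / M ^ 3 + 0.34 / M ^ 2 + 0.0981 / M + (1 / (8 * (0.455 * M) ^ 2) + 1 / (8 * (M / 2) ^ 2)) =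
        (1 / M) * (0.0981 + (1 / M) * (0.34 + 1 / (8 * 0.455 ^ 2) + 0.5 + 1.6 * (1 / M))) := by
        field_simp; ring
      rw [e, show 0.451 / M = 1 / M * 0.451 by ring]
      refine mul_le_mul_of_nonneg_left ?_ hi.le
      nlinarith only [i1, hi]
    · have : 2.236 ≤ m := le_of_sq_le_sq (by linarith) hm.le
      have e : 0.451 / M * m = 0.451 / m := by rw [hM]; field_simp
      rw [e]
      have : 0.451 / m ≤ 0.451 / 2.236 := by gcongr
      have : (0.451 : ℝ) / 2.236 < 0.22 := by norm_num
      linarith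

end ArcPoint

/-- `-Im (π cot πz)` at `z = x + i y`. -/
def stripCot (j : ℤ) (x y : ℝ) : ℝ :=
  Real.pi * Real.sinh (Real.pi * y) * Real.cosh (Real.pi * y) / stripDen j x y

/-- The derivative of `Re (π / sin πz)` in the direction of `i (r + i v)`, up to sign. -/
def stripDeriv (j : ℤ) (x y r : ℝ) : ℝ :=
  Real.pi ^ 2 / stripDen j x y ^ 2 *
    (r * (stripSin j x * Real.sinh (Real.pi * y)) * (Real.cosh (Real.pi * y) ^ 2 + stripCos j x ^ 2) -
     y * (stripCos j x * Real.cosh (Real.pi * y)) * (Real.sinh (Real.pi * y) ^ 2 - stripSin j x ^ 2))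

lemma stripSin_pos_of_re {j : ℤ} {x y : ℝ} (hy : 0 < y) (h : 0 < stripRe j x y) : 0 < stripSin j x := by
  have h1 := stripDen_pos j x hy
  have h2 := Real.pi_pos
  have h3 := Real.cosh_pos (Real.pi * y)
  by_contra! hc
  refine absurd h (not_lt.2 ?_)
  rw [stripRe]
  exact div_nonpos_of_nonpos_of_nonneg
    (mul_nonpos_of_nonpos_of_nonneg (mul_nonpos_of_nonneg_of_nonpos h2.le hc) h3.le) h1.le

lemma stripCot_pos {j : ℤ} {x y : ℝ} (hy : 0 < y) : 0 < stripCot j x y := by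
  have h1 := stripDen_pos j x hy
  have h2 : 0 < Real.sinh (Real.pi * y) := Real.sinh_pos_iff.2 (by positivity)
  rw [stripCot]; positivity

lemma stripDeriv_ge_of_cos_nonpos {j : ℤ} {x y r : ℝ} (hy : 0 < y) (hr : 0 ≤ r) (hS : 0 < stripSin j x)
    (hC : stripCos j x ≤ 0) :
    stripCot j x y * stripRe j x y * (r - 0.16) ≤ stripDeriv j x y r := by
  have hD := stripDen_pos j x hy
  have hu : Real.pi * y ≤ Real.sinh (Real.pi * y) := Real.self_le_sinh_iff.2 (by positivity)
  have h1 := stripSin_sq_add j x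
  have hc := Real.one_le_cosh (Real.pi * y)
  rw [stripCot, stripRe, stripDeriv]
  set S := stripSin j x
  set C := stripCos j x
  set D := stripDen j x y
  set sh := Real.sinh (Real.pi * y)
  set ch := Real.cosh (Real.pi * y)
  have hsh : 0 < sh := lt_of_lt_of_le (by positivity) hu
  have e : Real.pi * sh * ch / D * (Real.pi * S * ch / D) * (r - 0.16) =
      Real.pi ^ 2 / D ^ 2 * (S * sh * ch ^ 2 * (r - 0.16)) := by field_simp
  rw [e]
  refine mul_le_mul_of_nonneg_left ?_ (by positivity)
  have h2 : -C * S ≤ 1 / 2 := by nlinarith only [h1, sq_nonneg (C + S)]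
  have h3 : y ≤ 0.32 * sh := by nlinarith only [hu, Real.pi_gt_d2, hy]
  have h4 : y * (-C * S) ≤ 0.16 * sh := by
    have := mul_le_mul_of_nonneg_left h2 hy.le
    linarith
  have h5 : y * (-C * S) * (S * ch) ≤ 0.16 * sh * (S * ch * ch) := by
    have a1 := mul_le_mul_of_nonneg_right h4 (show 0 ≤ S * ch by positivity)
    have a2 : S * ch ≤ S * ch * ch := le_mul_of_one_le_right (by positivity) hc
    have a3 := mul_le_mul_of_nonneg_left a2 (show 0 ≤ 0.16 * sh by positivity)
    linarith
  have h6 : 0 ≤ r * (S * sh) * C ^ 2 := by positivity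
  have h7 : 0 ≤ y * (-C * ch) * sh ^ 2 := by
    have : 0 ≤ -C := by linarith
    positivity
  nlinarith only [h5, h6, h7]

lemma stripDeriv_ge_of_cos_nonneg {j : ℤ} {x y r : ℝ} (hy : 0 < y) (hC : 0 ≤ stripCos j x) :
    stripCot j x y * (r * stripRe j x y * (1 + stripCos j x ^ 2 / Real.cosh (Real.pi * y) ^ 2) -
      stripCos j x * (Real.pi * y / Real.sinh (Real.pi * y))) ≤ stripDeriv j x y r := by
  have hD := stripDen_pos j x hy
  have hu : Real.pi * y ≤ Real.sinh (Real.pi * y) := Real.self_le_sinh_iff.2 (by positivity)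
  have hc := Real.one_le_cosh (Real.pi * y)
  have hD' : stripDen j x y = stripSin j x ^ 2 + Real.sinh (Real.pi * y) ^ 2 := rfl
  rw [stripCot, stripRe, stripDeriv]
  set S := stripSin j x
  set C := stripCos j x
  set D := stripDen j x y
  set sh := Real.sinh (Real.pi * y)
  set ch := Real.cosh (Real.pi * y)
  have hsh : 0 < sh := lt_of_lt_of_le (by positivity) hu
  have hch : 0 < ch := by linarith
  have e : Real.pi * sh * ch / D * (r * (Real.pi * S * ch / D) * (1 + C ^ 2 / ch ^ 2) -
      C * (Real.pi * y / sh)) =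
      Real.pi ^ 2 / D ^ 2 * (r * (S * sh) * (ch ^ 2 + C ^ 2) - y * (C * ch) * D) := by field_simp
  rw [e]
  refine mul_le_mul_of_nonneg_left ?_ (by positivity)
  have : 0 ≤ y * (C * ch) := by positivity
  nlinarith only [mul_le_mul_of_nonneg_left (show sh ^ 2 - S ^ 2 ≤ D by nlinarith only [hD', sq_nonneg S]) this]

lemma sinh_ge_quintic {u : ℝ} (hu : 0 ≤ u) : u * (1 + u ^ 2 / 6 + u ^ 4 / 120) ≤ Real.sinh u := by
  have h2 := sum_le_hasSum (Finset.range 3) (fun i _ => by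
    positivity) (Real.hasSum_sinh u)
  simp only [Finset.sum_range_succ, Finset.sum_range_zero, Nat.factorial] at h2
  norm_num at h2
  linarith

lemma sinh_mul_ge {u c : ℝ} (hu : 0 ≤ u) (hc : 0 ≤ c) (hc1 : c ≤ 1) :
    u * (1 + 0.61 * c) ≤ Real.sinh u * (1 + c / Real.cosh u ^ 2) := by
  have h1 : u ≤ Real.sinh u := Real.self_le_sinh_iff.2 hu
  suffices h2 : 1.61 * u ≤ Real.sinh u * (1 + 1 / Real.cosh u ^ 2) by
    have e : Real.sinh u * (1 + c / Real.cosh u ^ 2) = (1 - c) * Real.sinh u +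
      c * (Real.sinh u * (1 + 1 / Real.cosh u ^ 2)) := by ring
    rw [e]
    nlinarith only [h1, h2, hc, hc1]
  have h3 := sinh_ge_quintic hu
  rw [Real.cosh_sq]
  set s := Real.sinh u
  set k := 1 + u ^ 2 / 6 + u ^ 4 / 120 with hk
  have hk1 : 1 ≤ k := by rw [hk]; nlinarith only [sq_nonneg u, sq_nonneg (u ^ 2)]
  have hmono : u * k * (1 + 1 / ((u * k) ^ 2 + 1)) ≤ s * (1 + 1 / (s ^ 2 + 1)) := by
    set v := u * k with hv
    have hv0 : 0 ≤ v := by positivity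
    have e : s * (1 + 1 / (s ^ 2 + 1)) - v * (1 + 1 / (v ^ 2 + 1)) =
        (s - v) * ((s ^ 2 + 1) * (v ^ 2 + 1) + 1 - s * v) / ((s ^ 2 + 1) * (v ^ 2 + 1)) := by
      field_simp; ring
    have : 0 ≤ (s - v) * ((s ^ 2 + 1) * (v ^ 2 + 1) + 1 - s * v) / ((s ^ 2 + 1) * (v ^ 2 + 1)) := by
      apply div_nonneg _ (by positivity)
      apply mul_nonneg (by linarith)
      nlinarith only [sq_nonneg (s - v), sq_nonneg (s * v), sq_nonneg s, sq_nonneg v]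
    linarith
  refine le_trans ?_ hmono
  have hkey : 1.61 ≤ k * (1 + 1 / ((u * k) ^ 2 + 1)) := by
    by_cases hk2 : 1.61 ≤ k
    · have : 0 ≤ k * (1 / ((u * k) ^ 2 + 1)) := by positivity
      linarith
    · push Not at hk2
      have ht : u ^ 2 ≤ 6 * (k - 1) := by rw [hk]; nlinarith only [sq_nonneg (u ^ 2)]
      rw [← sub_nonneg]
      have e : k * (1 + 1 / ((u * k) ^ 2 + 1)) - 1.61 = (k - (1.61 - k) * (u ^ 2 * k ^ 2 + 1)) / ((u * k) ^ 2 + 1) := by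
        field_simp; ring
      rw [e]
      apply div_nonneg _ (by positivity)
      have h5 : (1.61 - k) * (u ^ 2 * k ^ 2) ≤ (1.61 - k) * (6 * (k - 1) * k ^ 2) :=
        mul_le_mul_of_nonneg_left (mul_le_mul_of_nonneg_right ht (sq_nonneg k)) (by linarith)
      nlinarith only [h5, hk1, hk2, sq_nonneg (k ^ 2 - 1.3 * k), sq_nonneg (k - 1.27), sq_nonneg (k ^ 2 - 1.27 ^ 2),
        mul_nonneg (sub_nonneg.2 hk1) (sub_nonneg.2 hk2.le), sq_nonneg (k ^ 2 - 0.7 * k - 0.73)]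
  nlinarith only [hkey, hu]

lemma cosh_two_le : Real.cosh 2 ≤ 3.763 := by
  have h1 := Real.exp_one_lt_d9
  have h2 := Real.exp_one_gt_d9
  have e1 : Real.exp 2 = Real.exp 1 ^ 2 := by rw [← Real.exp_nat_mul]; norm_num
  have e2 : Real.exp (-2) = (Real.exp 1 ^ 2)⁻¹ := by rw [Real.exp_neg, e1]
  rw [Real.cosh_eq, e2, e1]
  have h3 : Real.exp 1 ^ 2 ≤ 7.38906 := by nlinarith
  have h4 : 7.389 ≤ Real.exp 1 ^ 2 := by nlinarith
  have h5 : (Real.exp 1 ^ 2)⁻¹ ≤ 7.389⁻¹ := by gcongr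
  have : (7.389 : ℝ)⁻¹ ≤ 0.13534 := by norm_num
  linarith

lemma stripCot_ge {j : ℤ} {x y : ℝ} (hy : 0 < y) {β : ℝ} (hβ : 0 ≤ β)
    (h : β ^ 2 * (1 + Real.sinh (Real.pi * y) ^ 2) ≤ 9.8696 * Real.sinh (Real.pi * y) ^ 2) : β ≤ stripCot j x y := by
  have hD := stripDen_pos j x hy
  have hsh : 0 < Real.sinh (Real.pi * y) := Real.sinh_pos_iff.2 (by positivity)
  have hc := Real.cosh_sq (Real.pi * y)
  have hch := Real.cosh_pos (Real.pi * y)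
  have h1 := stripSin_sq_add j x
  have hDle : stripDen j x y ≤ Real.cosh (Real.pi * y) ^ 2 := by
    rw [stripDen, hc]; nlinarith only [h1, sq_nonneg (stripCos j x)]
  have h2 : β * Real.cosh (Real.pi * y) ≤ Real.pi * Real.sinh (Real.pi * y) := by
    refine le_of_sq_le_sq ?_ (by positivity)
    rw [mul_pow, mul_pow, hc]
    nlinarith only [h, pi_sq_bounds.1, sq_nonneg (Real.sinh (Real.pi * y))]
  rw [stripCot, le_div_iff₀ hD]
  calc β * stripDen j x y ≤ β * Real.cosh (Real.pi * y) ^ 2 := by gcongr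
    _ = β * Real.cosh (Real.pi * y) * Real.cosh (Real.pi * y) := by ring
    _ ≤ _ := by gcongr

lemma stripCot_ge_mul {j : ℤ} {x y : ℝ} (hy : 0 < y) (hy1 : y ≤ 1.05) : 2.9 * y ≤ stripCot j x y := by
  apply stripCot_ge hy (by positivity)
  have h := sinh_sq_ge y
  set q := Real.sinh (Real.pi * y) ^ 2
  have h1 : 9.869 * y ^ 2 + 32.46 * y ^ 4 ≤ q := by
    nlinarith only [h, sq_nonneg (y ^ 3), sq_nonneg (y ^ 4), sq_nonneg (y ^ 5)]
  have hY : y ^ 2 ≤ 1.1025 := by nlinarith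
  have hY0 : 0 < y ^ 2 := by positivity
  nlinarith only [mul_le_mul_of_nonneg_right h1 (show 0 ≤ 9.8696 - 8.41 * y ^ 2 by linarith only [hY]), hY, hY0,
    mul_nonneg hY0.le (sub_nonneg.2 hY)]

lemma stripCot_ge_of_one_le {j : ℤ} {x y : ℝ} (hy : 1 ≤ y) : 3.05 ≤ stripCot j x y := by
  apply stripCot_ge (by linarith) (by norm_num)
  have h := sinh_sq_ge y
  have h1 : 1 ≤ y ^ 2 := by nlinarith
  nlinarith only [h, h1, sq_nonneg (y ^ 3), sq_nonneg (y ^ 4), sq_nonneg (y ^ 5), sq_nonneg (y ^ 2)]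

/-- An upper bound for `Re (π / sin πz)` away from the real axis. -/
lemma stripRe_sq_le {j : ℤ} {x y : ℝ} (hy : 0.4 ≤ y) (hS : 0 < stripSin j x) :
    stripRe j x y ^ 2 * (1 + Real.sinh (Real.pi * y) ^ 2) ≤ 9.86961 := by
  have hD := stripDen_pos j x (y := y) (by linarith)
  have hc := Real.cosh_sq (Real.pi * y)
  have hch := Real.cosh_pos (Real.pi * y)
  have h1 := stripSin_sq_add j x
  have h := sinh_sq_ge y
  have hS1 : stripSin j x ≤ 1 := Real.sin_le_one _
  have hq : 1 ≤ Real.sinh (Real.pi * y) ^ 2 := by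
    have : 0.16 ≤ y ^ 2 := by nlinarith only [hy]
    nlinarith only [h, this, sq_nonneg (y ^ 3), sq_nonneg (y ^ 4), sq_nonneg (y ^ 5), sq_nonneg (y ^ 2)]
  have h3 : stripSin j x * Real.cosh (Real.pi * y) ^ 2 ≤ stripDen j x y := by
    rw [stripDen, hc]
    nlinarith only [mul_nonneg (sub_nonneg.2 hS1) (show 0 ≤ Real.sinh (Real.pi * y) ^ 2 - stripSin j x by linarith)]
  have h4 : stripRe j x y * Real.cosh (Real.pi * y) ≤ Real.pi := by
    rw [stripRe, div_mul_eq_mul_div, div_le_iff₀ hD]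
    nlinarith only [mul_le_mul_of_nonneg_left h3 Real.pi_pos.le]
  have h5 := stripRe_pos (x := x) (y := y) (by linarith) hS
  rw [show 1 + Real.sinh (Real.pi * y) ^ 2 = Real.cosh (Real.pi * y) ^ 2 by rw [hc]; ring, ← mul_pow]
  have := pow_le_pow_left₀ (by positivity) h4 2
  linarith [pi_sq_bounds.2]

lemma stripRe_lt_of_le {j : ℤ} {x y Y A : ℝ} (hy : 0.4 ≤ y) (hS : 0 < stripSin j x) (hY : 0 ≤ Y) (hyY : Y ≤ y ^ 2)
    (hA : 0 < A) (h : 9.86961 < A ^ 2 * (1 + (9.869 * Y + 32.46 * Y ^ 2 + 42.7 * Y ^ 3 + 30.1 * Y ^ 4 + 13.2 * Y ^ 5))) :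
    stripRe j x y < A := by
  have h1 := stripRe_sq_le (x := x) hy hS
  have h2 := sinh_sq_ge y
  by_contra! hc
  have h3 : 9.869 * Y + 32.46 * Y ^ 2 + 42.7 * Y ^ 3 + 30.1 * Y ^ 4 + 13.2 * Y ^ 5 ≤
      9.869 * y ^ 2 + 32.46 * (y ^ 2) ^ 2 + 42.7 * (y ^ 2) ^ 3 + 30.1 * (y ^ 2) ^ 4 + 13.2 * (y ^ 2) ^ 5 := by gcongr
  have h4 : A ^ 2 ≤ stripRe j x y ^ 2 := by gcongr
  have h5 : A ^ 2 * (1 + (9.869 * Y + 32.46 * Y ^ 2 + 42.7 * Y ^ 3 + 30.1 * Y ^ 4 + 13.2 * Y ^ 5)) ≤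
      stripRe j x y ^ 2 * (1 + Real.sinh (Real.pi * y) ^ 2) := by
    gcongr
    refine h3.trans (le_trans (le_of_eq ?_) h2)
    ring
  linarith only [h, h1, h5]

lemma pi_div_sinh_le {y y₁ ν : ℝ} (hy₁ : 0 ≤ y₁) (hy : y₁ ≤ y) (hy0 : 0 < y)
    (h : 1 ≤ ν * (1 + 9.8696 * y₁ ^ 2 / 6 + 97.4 * y₁ ^ 4 / 120)) :
    Real.pi * y / Real.sinh (Real.pi * y) ≤ ν := by
  have h1 := sinh_ge_quintic (u := Real.pi * y) (by positivity)
  have hsh : 0 < Real.sinh (Real.pi * y) := Real.sinh_pos_iff.2 (by positivity)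
  have hν : 0 < ν := by
    by_contra! hc
    have : 0 ≤ 1 + 9.8696 * y₁ ^ 2 / 6 + 97.4 * y₁ ^ 4 / 120 := by positivity
    nlinarith only [h, hc, this]
  rw [div_le_iff₀ hsh]
  have hP := pi_sq_bounds.1
  have hP2 : 97.4 ≤ Real.pi ^ 4 := by nlinarith only [hP]
  have h2 : 1 + 9.8696 * y₁ ^ 2 / 6 + 97.4 * y₁ ^ 4 / 120 ≤ 1 + (Real.pi * y) ^ 2 / 6 + (Real.pi * y) ^ 4 / 120 := by
    rw [mul_pow, mul_pow]; gcongr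
  have h3 : 1 ≤ ν * (1 + (Real.pi * y) ^ 2 / 6 + (Real.pi * y) ^ 4 / 120) :=
    h.trans (mul_le_mul_of_nonneg_left h2 hν.le)
  have h4 : 0 < Real.pi * y := by positivity
  nlinarith only [mul_le_mul_of_nonneg_left h1 hν.le, mul_le_mul_of_nonneg_left h3 h4.le]

/-- A bound for the derivative of the part of `π / sin πz` not contained in the finite sum. -/
def arcTail (d U ρ ξ y : ℝ) : ℝ :=
  ρ * (2 * (d + 1) / ((d - ξ + 1) ^ 2 + y ^ 2) ^ 2 + 2 / U ^ 3) + 1 / U ^ 2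

namespace ArcPoint
variable {n : ℕ} {x₀ ρ ξ y : ℝ}

lemma im_neg_of_tail_lt (h : ArcPoint n x₀ ρ ξ y) (he : (x₀ + ξ) ^ 2 + y ^ 2 < n ^ 2)
    (hyd : 2 * y ^ 2 ≤ (n - x₀ + 1) * (n - x₀ + 2)) (hd : 1 ≤ n - x₀) (j : ℤ)
    (hV : y * arcTail (n - x₀) (n + x₀ + 1) ρ ξ y < stripDeriv j (x₀ + ξ) y (ρ - ξ)) :
    alt j * ((⟨ρ - ξ, -y⟩ : ℂ) * altSum₂ n ⟨x₀ + ξ, y⟩).im < 0 := by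
  have h1 := h.abs_im_tail_le he hyd hd
  have h2 := im_mul_pi_cos_div_sin_sq j (x₀ + ξ) y (ρ - ξ) y
  rw [← stripDeriv] at h2
  rw [mul_sub, Complex.sub_im] at h1
  set M := ((⟨ρ - ξ, -y⟩ : ℂ) * (Real.pi ^ 2 * Complex.cos (Real.pi * ⟨x₀ + ξ, y⟩) /
      Complex.sin (Real.pi * ⟨x₀ + ξ, y⟩) ^ 2)).im
  set V := ((⟨ρ - ξ, -y⟩ : ℂ) * altSum₂ n ⟨x₀ + ξ, y⟩).im
  have hρ := h.rho_pos
  have hξ := h.xi_pos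
  have hy := h.im_pos
  have hx := h.left_pos
  have e1 : (n - x₀ + 1) ^ 2 - 2 * ξ * (n - x₀ + 1 - ρ) = (n - x₀ - ξ + 1) ^ 2 + y ^ 2 := by
    linear_combination -h.circle
  have hU : 0 < n + x₀ + 1 := by positivity
  have h3 : (n - x₀ + 1) * (2 * ρ) / ((n - x₀ + 1) ^ 2 - 2 * ξ * (n - x₀ + 1 - ρ)) ^ 2 +
        (n + x₀ + 1) * (2 * ρ + (n + x₀ + 1)) / ((n + x₀ + 1) ^ 2 + 2 * ξ * (n + x₀ + 1 + ρ)) ^ 2 ≤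
        arcTail (n - x₀) (n + x₀ + 1) ρ ξ y := by
    have k1 : (n + x₀ + 1) * (2 * ρ + (n + x₀ + 1)) / ((n + x₀ + 1) ^ 2 + 2 * ξ * (n + x₀ + 1 + ρ)) ^ 2 ≤
      (n + x₀ + 1) * (2 * ρ + (n + x₀ + 1)) / ((n + x₀ + 1) ^ 2) ^ 2 := by
      gcongr
      have : 0 ≤ 2 * ξ * (n + x₀ + 1 + ρ) := by positivity
      linarith
    have k2 : (n + x₀ + 1) * (2 * ρ + (n + x₀ + 1)) / ((n + x₀ + 1) ^ 2) ^ 2 =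
      2 * ρ / (n + x₀ + 1) ^ 3 + 1 / (n + x₀ + 1) ^ 2 := by field_simp
    rw [arcTail, e1]
    calc _ ≤ (n - x₀ + 1) * (2 * ρ) / ((n - x₀ - ξ + 1) ^ 2 + y ^ 2) ^ 2 +
          (2 * ρ / (n + x₀ + 1) ^ 3 + 1 / (n + x₀ + 1) ^ 2) := by linarith only [k1, k2]
      _ = _ := by ring
  have h4 := h1.trans (mul_le_mul_of_nonneg_left h3 hy.le)
  have h5 : |alt j * (M - V)| ≤ y * arcTail (n - x₀) (n + x₀ + 1) ρ ξ y := by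
    rwa [abs_mul, abs_alt, one_mul]
  have h6 := abs_le.1 h5
  have h7 : alt j * V = alt j * M - alt j * (M - V) := by ring
  rw [h7, h2]
  linarith

/-- The tail is controlled by a multiple of the radius. -/
lemma arcTail_le (h : ArcPoint n x₀ ρ ξ y) {τ : ℝ}
    (hτ : 2 * (n - x₀ + 1) / ((n - x₀ - ξ + 1) ^ 2 + y ^ 2) ^ 2 + 2 / (n + x₀ + 1) ^ 3 +
      1 / ((n - x₀) * (n + x₀ + 1) ^ 2) ≤ τ) : arcTail (n - x₀) (n + x₀ + 1) ρ ξ y ≤ ρ * τ := by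
  have hρ := h.rho_pos
  have hx := h.left_pos
  have hd : 0 < n - x₀ := sub_pos.2 h.left_lt
  have hU : 0 < n + x₀ + 1 := by positivity
  refine le_trans ?_ (mul_le_mul_of_nonneg_left hτ hρ.le)
  rw [arcTail, mul_add ρ (_ + _)]
  gcongr
  rw [mul_one_div, div_le_div_iff₀ (by positivity) (by positivity)]
  nlinarith only [mul_le_mul_of_nonneg_right h.le_rho (sq_nonneg ((n : ℝ) + x₀ + 1))]

lemma im_neg_of_cos_nonpos (h : ArcPoint n x₀ ρ ξ y) (he : (x₀ + ξ) ^ 2 + y ^ 2 < n ^ 2)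
    (hyd : 2 * y ^ 2 ≤ (n - x₀ + 1) * (n - x₀ + 2)) (hd : 1 ≤ n - x₀) (j : ℤ)
    (hS : 0 < stripSin j (x₀ + ξ)) (hC : stripCos j (x₀ + ξ) ≤ 0) {A β Z τ : ℝ} (hA : 0 ≤ A)
    (hA' : A ≤ stripRe j (x₀ + ξ) y) (hβ : 0 ≤ β) (hB : β * y ≤ stripCot j (x₀ + ξ) y) (hZ : ξ ≤ Z)
    (hZ' : Z + 0.16 ≤ n - x₀)
    (hτ : 2 * (n - x₀ + 1) / ((n - x₀ - ξ + 1) ^ 2 + y ^ 2) ^ 2 + 2 / (n + x₀ + 1) ^ 3 +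
      1 / ((n - x₀) * (n + x₀ + 1) ^ 2) ≤ τ) (hlt : τ * (n - x₀) < β * A * (n - x₀ - Z - 0.16)) :
    alt j * ((⟨ρ - ξ, -y⟩ : ℂ) * altSum₂ n ⟨x₀ + ξ, y⟩).im < 0 := by
  have hρ := h.rho_pos
  have hξ := h.xi_pos
  have hy := h.im_pos
  have hdρ := h.le_rho
  refine h.im_neg_of_tail_lt he hyd hd j (lt_of_lt_of_le ?_ (stripDeriv_ge_of_cos_nonpos hy (by linarith) hS hC))
  have h1 := mul_le_mul_of_nonneg_left (h.arcTail_le hτ) hy.le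
  refine h1.trans_lt ?_
  have h2 : β * y * A * (ρ - ξ - 0.16) ≤ stripCot j (x₀ + ξ) y * stripRe j (x₀ + ξ) y * (ρ - ξ - 0.16) := by
    have : 0 ≤ ρ - ξ - 0.16 := by linarith
    have := stripCot_pos (j := j) (x := x₀ + ξ) hy
    gcongr
  refine lt_of_lt_of_le ?_ h2
  have hd0 : 0 < n - x₀ := by linarith
  have h3 : ρ * (n - x₀ - Z - 0.16) ≤ (ρ - ξ - 0.16) * (n - x₀) := by nlinarith only [hdρ, hZ, hd0, hξ]
  have h4 : ρ * τ < β * A * (ρ - ξ - 0.16) := by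
    refine lt_of_mul_lt_mul_right ?_ hd0.le
    calc ρ * τ * (n - x₀) = ρ * (τ * (n - x₀)) := by ring
      _ < ρ * (β * A * (n - x₀ - Z - 0.16)) := by gcongr
      _ = β * A * (ρ * (n - x₀ - Z - 0.16)) := by ring
      _ ≤ β * A * ((ρ - ξ - 0.16) * (n - x₀)) := by gcongr
      _ = _ := by ring
  nlinarith only [mul_lt_mul_of_pos_left h4 hy]

lemma im_neg_of_cos_nonneg (h : ArcPoint n x₀ ρ ξ y) (he : (x₀ + ξ) ^ 2 + y ^ 2 < n ^ 2)
    (hyd : 2 * y ^ 2 ≤ (n - x₀ + 1) * (n - x₀ + 2)) (hd : 1 ≤ n - x₀) (j : ℤ)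
    (hC : 0 ≤ stripCos j (x₀ + ξ)) {A β ν c : ℝ} (hA : 0 ≤ A)
    (hA' : A ≤ stripRe j (x₀ + ξ) y) (hβ : 0 < β) (hB : β * y ≤ stripCot j (x₀ + ξ) y)
    (hν : Real.pi * y / Real.sinh (Real.pi * y) ≤ ν) (hc : stripCos j (x₀ + ξ) ≤ c)
    (hlt : arcTail (n - x₀) (n + x₀ + 1) ρ ξ y < β * ((ρ - ξ) * A - ν * c)) :
    alt j * ((⟨ρ - ξ, -y⟩ : ℂ) * altSum₂ n ⟨x₀ + ξ, y⟩).im < 0 := by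
  have hρ := h.rho_pos
  have hy := h.im_pos
  have hx := h.left_pos
  have hd0 : 0 < n - x₀ := by linarith
  have hr := (h.early_bounds he).1
  have hsh : 0 < Real.sinh (Real.pi * y) := Real.sinh_pos_iff.2 (by positivity)
  refine h.im_neg_of_tail_lt he hyd hd j (lt_of_lt_of_le ?_ (stripDeriv_ge_of_cos_nonneg hy hC))
  have hT : 0 ≤ arcTail (n - x₀) (n + x₀ + 1) ρ ξ y := by rw [arcTail]; positivity
  have h1 : (ρ - ξ) * A - ν * c ≤ (ρ - ξ) * stripRe j (x₀ + ξ) y *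
      (1 + stripCos j (x₀ + ξ) ^ 2 / Real.cosh (Real.pi * y) ^ 2) -
      stripCos j (x₀ + ξ) * (Real.pi * y / Real.sinh (Real.pi * y)) := by
    have k1 : (ρ - ξ) * A ≤ (ρ - ξ) * stripRe j (x₀ + ξ) y := by
      have : 0 ≤ ρ - ξ := by linarith
      gcongr
    have k2 : 0 ≤ (ρ - ξ) * stripRe j (x₀ + ξ) y * (stripCos j (x₀ + ξ) ^ 2 / Real.cosh (Real.pi * y) ^ 2) := by
      have : 0 ≤ ρ - ξ := by linarith
      have : 0 ≤ stripRe j (x₀ + ξ) y := hA.trans hA'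
      positivity
    have k3 : stripCos j (x₀ + ξ) * (Real.pi * y / Real.sinh (Real.pi * y)) ≤ c * ν := by
      have : 0 ≤ Real.pi * y / Real.sinh (Real.pi * y) := by positivity
      gcongr
      exact hC.trans hc
    linarith
  have hpos : 0 < (ρ - ξ) * A - ν * c := by
    by_contra! hneg
    nlinarith only [hlt, hT, hβ, hneg]
  calc _ < y * (β * ((ρ - ξ) * A - ν * c)) := by gcongr
    _ = β * y * ((ρ - ξ) * A - ν * c) := by ring
    _ ≤ _ := by
      have := stripCot_pos (j := j) (x := x₀ + ξ) hy
      gcongr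

lemma im_neg_of_cos_nonneg' (h : ArcPoint n x₀ ρ ξ y) (he : (x₀ + ξ) ^ 2 + y ^ 2 < n ^ 2)
    (hyd : 2 * y ^ 2 ≤ (n - x₀ + 1) * (n - x₀ + 2)) (hd : 1 ≤ n - x₀) (j : ℤ)
    (hC : 0 ≤ stripCos j (x₀ + ξ)) {A r c : ℝ} (hA : 0 ≤ A)
    (hA' : A ≤ stripRe j (x₀ + ξ) y) (hy1 : y ≤ 0.6366) (hr : r ≤ 0.81) (hrA : r ≤ (ρ - ξ) * A)
    (hc : stripCos j (x₀ + ξ) ≤ c) (hc1 : c ≤ 1)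
    (hlt : arcTail (n - x₀) (n + x₀ + 1) ρ ξ y < 2.62 * ((ρ - ξ) * A - r + (r * (1 + 0.61 * c ^ 2) - c))) :
    alt j * ((⟨ρ - ξ, -y⟩ : ℂ) * altSum₂ n ⟨x₀ + ξ, y⟩).im < 0 := by
  have hρ := h.rho_pos
  have hy := h.im_pos
  have hx := h.left_pos
  have hd0 : 0 < n - x₀ := by linarith
  have hr0 := (h.early_bounds he).1
  have hsh : 0 < Real.sinh (Real.pi * y) := Real.sinh_pos_iff.2 (by positivity)
  have hch := Real.cosh_pos (Real.pi * y)
  have hD := stripDen_pos j (x₀ + ξ) hy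
  have hC1 := stripSin_sq_add j (x₀ + ξ)
  refine h.im_neg_of_tail_lt he hyd hd j (lt_of_lt_of_le ?_ (stripDeriv_ge_of_cos_nonneg hy hC))
  have hT : 0 ≤ arcTail (n - x₀) (n + x₀ + 1) ρ ξ y := by rw [arcTail]; positivity
  set C := stripCos j (x₀ + ξ)
  set a := stripRe j (x₀ + ξ) y
  have hC2 : C ^ 2 ≤ 1 := by nlinarith only [hC1, sq_nonneg (stripSin j (x₀ + ξ))]
  have k1 := sinh_mul_ge (u := Real.pi * y) (by positivity) (sq_nonneg C) hC2
  have hra : (ρ - ξ) * A ≤ (ρ - ξ) * a := by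
    have : 0 ≤ ρ - ξ := by linarith
    gcongr
  have k2 : Real.pi * y / Real.sinh (Real.pi * y) * ((ρ - ξ) * a * (1 + 0.61 * C ^ 2) - C) ≤
      (ρ - ξ) * a * (1 + C ^ 2 / Real.cosh (Real.pi * y) ^ 2) - C * (Real.pi * y / Real.sinh (Real.pi * y)) := by
    have : Real.pi * y / Real.sinh (Real.pi * y) * (1 + 0.61 * C ^ 2) ≤ 1 + C ^ 2 / Real.cosh (Real.pi * y) ^ 2 := by
      rw [div_mul_eq_mul_div, div_le_iff₀ hsh]; linarith
    have h0 : 0 ≤ (ρ - ξ) * a := by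
      have : 0 ≤ ρ - ξ := by linarith
      have : 0 ≤ a := hA.trans hA'
      positivity
    nlinarith only [mul_le_mul_of_nonneg_left this h0]
  have k3 : (ρ - ξ) * A - r + (r * (1 + 0.61 * c ^ 2) - c) ≤ (ρ - ξ) * a * (1 + 0.61 * C ^ 2) - C := by
    have l1 : r * (1 + 0.61 * c ^ 2) - c ≤ r * (1 + 0.61 * C ^ 2) - C := by
      have : 0 ≤ (c - C) * (1 - 0.61 * r * (c + C)) := by
        apply mul_nonneg (by linarith)
        by_cases hr' : 0 ≤ r
        · have : r * (c + C) ≤ 0.81 * 2 := by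
            have : 0 ≤ c + C := by linarith
            have : c + C ≤ 2 := by linarith
            nlinarith only [hc1, hc, hr, hC]
          linarith
        · have : 0 ≤ c + C := by linarith
          nlinarith only [hy1, hc1, hy, hc, hr, hC]
      nlinarith only [this]
    have l2 : 0 ≤ ((ρ - ξ) * a - r) * (0.61 * C ^ 2) := mul_nonneg (by linarith) (by positivity)
    linarith
  have hpos : 0 < (ρ - ξ) * A - r + (r * (1 + 0.61 * c ^ 2) - c) := by
    by_contra! hneg
    nlinarith only [hlt, hT, hneg]
  have k4 : 2.62 * y ≤ stripCot j (x₀ + ξ) y * (Real.pi * y / Real.sinh (Real.pi * y)) := by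
    have e : stripCot j (x₀ + ξ) y * (Real.pi * y / Real.sinh (Real.pi * y)) =
        Real.pi ^ 2 * y * Real.cosh (Real.pi * y) / stripDen j (x₀ + ξ) y := by
      rw [stripCot]; field_simp
    rw [e, le_div_iff₀ hD]
    have hDle : stripDen j (x₀ + ξ) y ≤ Real.cosh (Real.pi * y) ^ 2 := by
      rw [stripDen, Real.cosh_sq]; nlinarith only [hC1, sq_nonneg C]
    have hch2 : Real.cosh (Real.pi * y) ≤ 3.763 := by
      refine le_trans ?_ cosh_two_le
      rw [Real.cosh_le_cosh, abs_of_pos (by positivity), abs_of_pos (by norm_num)]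
      nlinarith only [Real.pi_lt_d6, hy1, hy, Real.pi_pos]
    have hP := pi_sq_bounds.1
    calc 2.62 * y * stripDen j (x₀ + ξ) y ≤ 2.62 * y * Real.cosh (Real.pi * y) ^ 2 := by gcongr
      _ = y * Real.cosh (Real.pi * y) * (2.62 * Real.cosh (Real.pi * y)) := by ring
      _ ≤ y * Real.cosh (Real.pi * y) * Real.pi ^ 2 := by gcongr; linarith
      _ = _ := by ring
  have hcot := stripCot_pos (j := j) (x := x₀ + ξ) hy
  calc _ < y * (2.62 * ((ρ - ξ) * A - r + (r * (1 + 0.61 * c ^ 2) - c))) := by gcongr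
    _ = 2.62 * y * ((ρ - ξ) * A - r + (r * (1 + 0.61 * c ^ 2) - c)) := by ring
    _ ≤ stripCot j (x₀ + ξ) y * (Real.pi * y / Real.sinh (Real.pi * y)) * ((ρ - ξ) * a * (1 + 0.61 * C ^ 2) - C) := by
      gcongr
    _ = stripCot j (x₀ + ξ) y * (Real.pi * y / Real.sinh (Real.pi * y) * ((ρ - ξ) * a * (1 + 0.61 * C ^ 2) - C)) := by ring
    _ ≤ _ := by gcongr

end ArcPoint

lemma lt_of_stripSin_pos {j : ℤ} {x : ℝ} (h : 0 < stripSin j x) (hx : x ≤ j + 2) : x < j + 1 := by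
  by_contra! hc
  have h1 := Real.pi_pos
  rw [stripSin, ← Real.sin_sub_two_pi] at h
  have := Real.sin_nonpos_of_nonpos_of_neg_pi_le (x := Real.pi * (x - j) - 2 * Real.pi) (by nlinarith) (by nlinarith)
  linarith

lemma stripCos_nonpos {j : ℤ} {x : ℝ} (h : j + 1 / 2 ≤ x) (hx : x ≤ j + 1) : stripCos j x ≤ 0 := by
  have h1 := Real.pi_pos
  rw [stripCos]
  exact Real.cos_nonpos_of_pi_div_two_le_of_le (by nlinarith) (by nlinarith)

lemma stripCos_le {j : ℤ} {x s : ℝ} (h : 1 / 2 - s ≤ x - j) (hx : x ≤ j + 1) (hs : 0 ≤ s) (hs' : s ≤ 0.4999) :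
    stripCos j x ≤ 3.1416 * s - (3.1416 * s) ^ 3 / 6 + (3.1416 * s) ^ 5 / 120 := by
  have h1 := Real.pi_gt_d6
  have h2 := Real.pi_lt_d6
  refine le_trans ?_ (sin_le_quintic (by positivity))
  rw [stripCos]
  calc Real.cos (Real.pi * (x - j)) ≤ Real.cos (Real.pi * (1 / 2 - s)) :=
        Real.cos_le_cos_of_nonneg_of_le_pi (mul_nonneg (by linarith) (by linarith)) (by nlinarith) (by nlinarith)
    _ = Real.sin (Real.pi * s) := by rw [← Real.cos_pi_div_two_sub]; congr 1; ring
    _ ≤ _ := Real.sin_le_sin_of_le_of_le_pi_div_two (by nlinarith) (by nlinarith) (by nlinarith)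

lemma stripCos_le_one (j : ℤ) (x : ℝ) : stripCos j x ≤ 1 := Real.cos_le_one _

lemma near_kernel_ge {p y : ℝ} (hp : 1.5 ≤ p) (hp' : p ≤ 2.5) :
    (1 / 2 ≤ y → y ≤ 1.05 → 0.125 ≤ p / (2 * (p ^ 2 + y ^ 2)) - 3 / (8 * (p + y) ^ 2)) ∧
    (1.05 ≤ y → y ≤ 1.3 → 0.125 ≤ p / (2 * (p ^ 2 + y ^ 2)) - 3 / (8 * (p + y) ^ 2)) := by
  have key : ∀ {y₁ y₂ : ℝ}, 0 ≤ y₁ → y₁ ≤ y → y ≤ y₂ →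
      (p ^ 2 + y₂ ^ 2) * ((p + y₁) ^ 2 + 3) ≤ 4 * p * (p + y₁) ^ 2 →
      0.125 ≤ p / (2 * (p ^ 2 + y ^ 2)) - 3 / (8 * (p + y) ^ 2) := by
    intro y₁ y₂ h0 h1 h2 h3
    have hp0 : 0 < p := by linarith
    have hy : 0 ≤ y := h0.trans h1
    have k1 : p / (2 * (p ^ 2 + y₂ ^ 2)) ≤ p / (2 * (p ^ 2 + y ^ 2)) := by gcongr
    have k2 : 3 / (8 * (p + y) ^ 2) ≤ 3 / (8 * (p + y₁) ^ 2) := by gcongr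
    have k3 : 0.125 + 3 / (8 * (p + y₁) ^ 2) ≤ p / (2 * (p ^ 2 + y₂ ^ 2)) := by
      rw [show 0.125 + 3 / (8 * (p + y₁) ^ 2) = ((p + y₁) ^ 2 + 3) / (8 * (p + y₁) ^ 2) by field_simp; ring,
        div_le_div_iff₀ (by positivity) (by positivity)]
      linarith
    linarith
  have hq : 0 ≤ (p - 1.5) * (2.5 - p) := mul_nonneg (by linarith) (by linarith)
  refine ⟨fun h1 h2 => key (by norm_num) h1 h2 ?_, fun h1 h2 => key (by norm_num) h1 h2 ?_⟩
  · nlinarith only [hq, hp, hp', mul_nonneg hq hq, mul_nonneg hq (sub_nonneg.2 hp)]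
  · nlinarith only [hq, hp, hp', mul_nonneg hq hq, mul_nonneg hq (sub_nonneg.2 hp)]

lemma kernel_ge {p y : ℝ} (hp : 0.75 ≤ p) (hy : 0 ≤ y) : 3 / (8 * (p + y) ^ 2) ≤ p / (2 * (p ^ 2 + y ^ 2)) := by
  rw [div_le_div_iff₀ (by positivity) (by positivity)]
  nlinarith only [mul_nonneg (sub_nonneg.2 hp) (sq_nonneg (p + y)), mul_nonneg hy (by linarith : (0 : ℝ) ≤ p)]

lemma inv_sqrt_bounds {m t l u : ℝ} (hm : 0 < m) (hm2 : m ^ 2 = t) (hl : l ^ 2 * t ≤ 1) (hu : 1 ≤ u ^ 2 * t)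
    (hu0 : 0 ≤ u) : l ≤ 1 / m ∧ 1 / m ≤ u := by
  subst hm2
  constructor
  · rw [le_div_iff₀ hm]
    exact le_of_sq_le_sq (by rw [mul_pow]; linarith) (by norm_num)
  · rw [div_le_iff₀ hm]
    exact le_of_sq_le_sq (by rw [mul_pow]; linarith) (by positivity)

lemma kernel_ge' {p y : ℝ} (hp : 1 / 2 ≤ p) (hy : 0 ≤ y) (hpy : 1.5 ≤ p + y) :
    3 / (8 * (p + y) ^ 2) ≤ p / (2 * (p ^ 2 + y ^ 2)) + 0.06 := by
  have h1 : 1 / (4 * (p + y) ^ 2) ≤ p / (2 * (p ^ 2 + y ^ 2)) := by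
    rw [div_le_div_iff₀ (by positivity) (by positivity)]
    nlinarith only [mul_nonneg (sub_nonneg.2 hp) (sq_nonneg (p + y)), mul_nonneg hy (by linarith : (0 : ℝ) ≤ p)]
  have h2 : 1 / (8 * (p + y) ^ 2) ≤ 1 / (8 * 1.5 ^ 2) := by gcongr
  have h3 : 3 / (8 * (p + y) ^ 2) = 1 / (4 * (p + y) ^ 2) + 1 / (8 * (p + y) ^ 2) := by field_simp; ring
  linarith

namespace ArcPoint
variable {n : ℕ} {x₀ ρ ξ y : ℝ}

set_option maxHeartbeats 1000000 in
/-- Near the ends, the points where the first coordinate lies below the threshold. -/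
lemma near_bounds (h : ArcPoint n x₀ ρ ξ y) (he : (x₀ + ξ) ^ 2 + y ^ 2 < n ^ 2) (hn : 2 ≤ n)
    (hd : 1 < n - x₀) (hd2 : n - x₀ ≤ 2) {j : ℤ} (hj : j = n - 2) {m κ : ℝ} (hm : 0 < m)
    (hm2 : m ^ 2 = 2 * (n - x₀) + 1) (hκ : 0.83 ≤ κ) (hκ' : 1.5 ≤ n - x₀ → 0.88 ≤ κ)
    (hφ : -(alt j * (altSum n ⟨x₀ + ξ, y⟩).re) < alt j * alt n *
        (1 / (2 * (n - x₀ + 1 / 2)) - 1 / (2 * (n + x₀ + 1 / 2))) - κ / m) :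
    0 < stripSin j (x₀ + ξ) ∧ 1 < n - x₀ - ξ ∧ y ≤ 1.05 ∧ (y < 1 / 2 → 0.29 ≤ stripRe j (x₀ + ξ) y) ∧
    (n - x₀ ≤ 1.25 → 0.25 ≤ stripRe j (x₀ + ξ) y) ∧ (1.25 ≤ n - x₀ → 0.263 ≤ stripRe j (x₀ + ξ) y) ∧
    (1.5 ≤ n - x₀ → 0.29 ≤ stripRe j (x₀ + ξ) y) := by
  obtain ⟨b1, b2, b3, b4, b5, b6⟩ := h.early_bounds he
  have hx0 := h.left_pos
  have hξ := h.xi_pos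
  have hy := h.im_pos
  have hn' : (2 : ℝ) ≤ n := by exact_mod_cast hn
  have hε := alt_mul_alt_of_sub_two hj
  obtain ⟨g1, g2⟩ := h.stripRe_gt_of_phi_lt he (by linarith) j (κ := κ / m) (G := endRight (n - x₀) ξ y)
    (fun _ => le_rfl) (fun h => by rw [hε] at h; norm_num at h) hφ
  have hpp : n - (x₀ + ξ) + 1 / 2 = n - x₀ + 1 / 2 - ξ := by ring
  rw [hpp] at g1 g2
  set d := n - x₀ with hdd
  have hsq := h.xi_mul_le
  rw [← hdd] at hsq
  set p := d + 1 / 2 - ξ with hp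
  have hXpos : 0 < d - ξ := by linarith only [b4]
  have hp0 : 0 < p := by linarith
  have hW : 1 / (8 * (n + x₀ + 1 / 2) ^ 2) ≤ 0.02 ∧ (d < 1.5 → 1 / (8 * (n + x₀ + 1 / 2) ^ 2) ≤ 0.0139) := by
    constructor
    · have : 1 / (8 * (n + x₀ + 1 / 2) ^ 2) ≤ 1 / (8 * 2.5 ^ 2) := by gcongr; linarith
      linarith only [this]
    · intro hd'
      have : 1 / (8 * (n + x₀ + 1 / 2) ^ 2) ≤ 1 / (8 * 3 ^ 2) := by gcongr; linarith
      linarith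
  set e := 1 / (8 * (n + x₀ + 1 / 2) ^ 2)
  rw [show κ / m = κ * (1 / m) by ring] at g1 g2
  have hi2 : (1 / m) ^ 2 = 1 / (2 * d + 1) := by rw [div_pow, hm2]; simp
  have hi := inv_sqrt_bounds hm hm2 (l := 0.447) (u := 0.5774) (by nlinarith only [hd, hd2]) (by nlinarith only [hd, hd2]) (by norm_num)
  have hi' : d ≤ 1.5 → 0.4999 ≤ 1 / m := fun hd' => (inv_sqrt_bounds hm hm2 (l := 0.4999) (u := 0.5774) (by nlinarith only [hd, hd']) (by nlinarith only [hd, hd']) (by norm_num)).1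
  have hi'' : 1.25 ≤ d → 1 / m ≤ 0.5346 := fun hd' => (inv_sqrt_bounds hm hm2 (l := 0.447) (u := 0.5346) (by nlinarith only [hd', hd2]) (by nlinarith only [hd', hd2]) (by norm_num)).2
  have hi3 : 1.5 ≤ d → 1 / m ≤ 0.5 := fun hd' => (inv_sqrt_bounds hm hm2 (l := 0.447) (u := 0.5) (by nlinarith only [hd', hd2]) (by nlinarith only [hd', hd2]) (by norm_num)).2
  have hsmall : y < 1 / 2 → ∀ P, 0 < P → P ≤ p → κ * (1 / m) - 0.25 / P ^ 2 * (1 / m) ^ 2 - 1 / (8 * P ^ 2) - e <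
      stripRe j (x₀ + ξ) y := by
    intro hy' P hP hPp
    have k1 := endRight_le (y := y) (Y := 0.25) hP hPp hξ.le (by nlinarith only [hy, hy'])
    have k2 : 1 / (8 * p ^ 2) ≤ 1 / (8 * P ^ 2) := by gcongr
    have k3 : 0.25 / ((2 * d + 1) * P ^ 2) = 0.25 / P ^ 2 * (1 / m) ^ 2 := by rw [hi2]; field_simp
    linarith only [g1, k1, k2, k3]
  have hbig : 1 / 2 ≤ y → κ * (1 / m) - (1 / m) ^ 2 + (p / (2 * (p ^ 2 + y ^ 2)) - 3 / (8 * (p + y) ^ 2)) - e <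
      stripRe j (x₀ + ξ) y := by
    intro hy'
    have k1 := g2 hy'
    rw [endRight_eq hp0 (by linarith only [b4, hξ]), ← hi2, ← hp] at k1
    linarith only [k1]
  set i := 1 / m
  have hdi : d < 1.5 → 0.1457 ≤ κ * i - i ^ 2 := fun hd' => by
    have := hi' hd'.le
    nlinarith only [mul_nonneg (sub_nonneg.2 this) (sub_nonneg.2 hi.2), hi.2, hκ, this]
  have hdi' : 1.5 ≤ d → 0.1899 ≤ κ * i - i ^ 2 := fun hd' => by
    have h1 := hi3 hd'
    have h2 := hκ' hd'
    nlinarith only [mul_nonneg (sub_nonneg.2 hi.1) (sub_nonneg.2 h1), hi.1, h1, h2]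
  have hdie : 0.1318 ≤ κ * i - i ^ 2 - e := by
    rcases lt_or_ge d 1.5 with h1 | h1
    · linarith [hdi h1, hW.2 h1]
    · linarith [hdi' h1, hW.1]
  have ha0 : 0 < stripRe j (x₀ + ξ) y := by
    rcases lt_or_ge y (1 / 2) with hy' | hy'
    · have hξ1 : ξ ≤ 0.135 := h.xi_le_of_sq_le he (Y := 0.25) (by linarith) (by nlinarith only [hy, hy'])
      have := hsmall hy' 1.365 (by norm_num) (by linarith)
      norm_num at this
      nlinarith only [this, hW.1, hi.1, hi.2, hκ, mul_nonneg (sub_nonneg.2 hi.1) (sub_nonneg.2 hi.2)]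
    · have k1 := hbig hy'
      have k2 := kernel_ge' (p := p) (by linarith only [b4, hpp]) hy.le (by linarith only [b2, hd, hpp])
      linarith only [hdie, k1, k2]
  have hS := stripSin_pos_of_re hy ha0
  have hX : 1 < d - ξ := by
    have := lt_of_stripSin_pos hS (by rw [hj]; push_cast; linarith only [b4])
    rw [hj] at this; push_cast at this; linarith only [this]
  have hy1 : y ≤ 1.05 := by
    by_contra! hc
    have k1 := hbig (by linarith only [b2, hξ, hc])
    by_cases hy3 : y ≤ 1.3
    · have k2 := (near_kernel_ge (p := p) (y := y) (by linarith only [hpp, hX]) (by linarith only [hξ, hd2, hpp])).2 hc.le hy3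
      have k3 := stripRe_lt_of_le (y := y) (Y := 1.1025) (A := 0.2385) (by linarith only [b2, hξ, hc]) hS (by norm_num) (by nlinarith only [hc]) (by norm_num) (by norm_num)
      linarith
    · rw [not_le] at hy3
      have k2 := kernel_ge (p := p) (by linarith) hy.le
      have k3 := stripRe_lt_of_le (y := y) (Y := 1.69) (A := 0.12) (by linarith only [b2, hξ, hc]) hS (by norm_num) (by nlinarith only [hy3]) (by norm_num) (by norm_num)
      linarith
  have hsm : y < 1 / 2 → 0.29 ≤ stripRe j (x₀ + ξ) y := by
    intro hy'
    have := hsmall hy' 1.5 (by norm_num) (by linarith only [hpp, hX])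
    norm_num at this
    rcases lt_or_ge d 1.5 with h1 | h1
    · have h2 := hi' h1.le
      nlinarith only [this, hW.1, h2, hi.2, hκ, mul_nonneg (sub_nonneg.2 h2) (sub_nonneg.2 hi.2)]
    · have h2 := hi3 h1
      have h3 := hκ' h1
      nlinarith only [this, hW.1, h2, hi.1, h3, mul_nonneg (sub_nonneg.2 hi.1) (sub_nonneg.2 h2)]
  have hker : 1 / 2 ≤ y → 0.125 ≤ p / (2 * (p ^ 2 + y ^ 2)) - 3 / (8 * (p + y) ^ 2) := fun hy' =>
    (near_kernel_ge (p := p) (y := y) (by linarith only [hpp, hX]) (by linarith)).1 hy' hy1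
  refine ⟨hS, hX, hy1, hsm, fun hd' => ?_, fun hd' => ?_, fun hd' => ?_⟩
  · rcases lt_or_ge y (1 / 2) with hy' | hy'
    · linarith [hsm hy']
    · linarith [hbig hy', hker hy', hdie]
  · rcases lt_or_ge y (1 / 2) with hy' | hy'
    · linarith [hsm hy']
    · rcases lt_or_ge d 1.5 with h1 | h1
      · have h2 := hi' h1.le
        have h3 := hi'' hd'
        have : 0.157 ≤ κ * i - i ^ 2 := by
          nlinarith only [mul_nonneg (sub_nonneg.2 h2) (sub_nonneg.2 h3), h2, h3, hκ]
        linarith [hbig hy', hker hy', hW.2 h1]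
      · linarith [hbig hy', hker hy', hdi' h1, hW.1]
  · rcases lt_or_ge y (1 / 2) with hy' | hy'
    · linarith [hsm hy']
    · linarith [hbig hy', hker hy', hdi' hd', hW.1]

lemma near_cos_nonpos (h : ArcPoint n x₀ ρ ξ y) (he : (x₀ + ξ) ^ 2 + y ^ 2 < n ^ 2) (hn : 2 ≤ n)
    (hd : 1 < n - x₀) (hd2 : n - x₀ ≤ 2) {j : ℤ} (hS : 0 < stripSin j (x₀ + ξ)) (hC : stripCos j (x₀ + ξ) ≤ 0)
    (hX : 1 < n - x₀ - ξ) (hy1 : y ≤ 1.05) (a1 : y < 1 / 2 → 0.29 ≤ stripRe j (x₀ + ξ) y)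
    (a2 : n - x₀ ≤ 1.25 → 0.25 ≤ stripRe j (x₀ + ξ) y) (a3 : 1.25 ≤ n - x₀ → 0.263 ≤ stripRe j (x₀ + ξ) y)
    (a4 : 1.5 ≤ n - x₀ → 0.29 ≤ stripRe j (x₀ + ξ) y) :
    alt j * ((⟨ρ - ξ, -y⟩ : ℂ) * altSum₂ n ⟨x₀ + ξ, y⟩).im < 0 := by
  have hx0 := h.left_pos
  have hξ := h.xi_pos
  have hy := h.im_pos
  have hn' : (2 : ℝ) ≤ n := by exact_mod_cast hn
  have hB := stripCot_ge_mul (j := j) (x := x₀ + ξ) hy hy1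
  have hyd : 2 * y ^ 2 ≤ (n - x₀ + 1) * (n - x₀ + 2) := by nlinarith only [hd, hy1, hξ, hX, hy]
  have hd0 : 0 < n - x₀ := by linarith
  have key : ∀ {A Z τ R U d₁ d₂ y₁ : ℝ}, 0 ≤ A → A ≤ stripRe j (x₀ + ξ) y → ξ ≤ Z → Z + 0.16 ≤ n - x₀ → 0 ≤ R →
      R ≤ n - x₀ - ξ + 1 → 0 ≤ y₁ → y₁ ≤ y → 0 < U → U ≤ n + x₀ + 1 → 0 < d₁ → d₁ ≤ n - x₀ → n - x₀ ≤ d₂ →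
      2 * (d₂ + 1) / (R ^ 2 + y₁ ^ 2) ^ 2 + 2 / U ^ 3 + 1 / (d₁ * U ^ 2) ≤ τ → 0 < R ^ 2 + y₁ ^ 2 →
      τ * (n - x₀) < 2.9 * A * (n - x₀ - Z - 0.16) →
      alt j * ((⟨ρ - ξ, -y⟩ : ℂ) * altSum₂ n ⟨x₀ + ξ, y⟩).im < 0 := by
    intro A Z τ R U d₁ d₂ y₁ k1 k2 k3 k4 k5 k6 k7 k8 k9 k10 k11 k12 k13 k14 k15 k16
    refine h.im_neg_of_cos_nonpos he hyd hd.le j hS hC k1 k2 (by norm_num) hB k3 k4 (le_trans ?_ k14) k16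
    have : 0 ≤ d₂ + 1 := by linarith
    gcongr
  rcases lt_or_ge y (1 / 2) with hy' | hy'
  · have hξ1 : ξ ≤ 0.135 := h.xi_le_of_sq_le he (Y := 0.25) (by linarith) (by nlinarith only [hy, hy'])
    rcases le_or_gt (n - x₀) 1.3 with h1 | h1
    · exact key (A := 0.29) (Z := 0.135) (τ := 0.45) (R := 2) (U := 3.7) (d₁ := 1) (d₂ := 1.3) (y₁ := 0) (by norm_num)
        (a1 hy') hξ1 (by linarith) (by norm_num) (by linarith) le_rfl hy.le (by norm_num) (by linarith) (by norm_num)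
        (by linarith) h1 (by norm_num) (by norm_num) (by linarith)
    · exact key (A := 0.29) (Z := 0.135) (τ := 0.45) (R := 2.165) (U := 3) (d₁ := 1.3) (d₂ := 2) (y₁ := 0) (by norm_num)
        (a1 hy') hξ1 (by linarith) (by norm_num) (by linarith) le_rfl hy.le (by norm_num) (by linarith) (by norm_num)
        (by linarith) hd2 (by norm_num) (by norm_num) (by linarith)
  · rcases le_or_gt (n - x₀) 1.25 with h1 | h1
    · exact key (A := 0.25) (Z := n - x₀ - 1) (τ := 0.359) (R := 2) (U := 3.75) (d₁ := 1) (d₂ := 1.25) (y₁ := 1 / 2) (by norm_num)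
        (a2 h1) (by linarith) (by linarith) (by norm_num) (by linarith) (by norm_num) hy' (by norm_num) (by linarith) (by norm_num)
        (by linarith) h1 (by norm_num) (by norm_num) (by linarith)
    · rcases lt_or_ge (n - x₀) 1.5 with h2 | h2
      · exact key (A := 0.263) (Z := n - x₀ - 1) (τ := 0.39) (R := 2) (U := 3.5) (d₁ := 1.25) (d₂ := 1.5) (y₁ := 1 / 2) (by norm_num)
          (a3 h1.le) (by linarith) (by linarith) (by norm_num) (by linarith) (by norm_num) hy' (by norm_num) (by linarith) (by norm_num)
          (by linarith) h2.le (by norm_num) (by norm_num) (by linarith)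
      · have hξ1 : ξ ≤ 0.45 := h.xi_le_of_sq_le he (Y := 1.1025) (by linarith) (by nlinarith only [hy, hy1])
        rcases le_or_gt (n - x₀) 1.75 with h3 | h3
        · exact key (A := 0.29) (Z := 0.45) (τ := 0.41) (R := 2.05) (U := 3.25) (d₁ := 1.5) (d₂ := 1.75) (y₁ := 1 / 2) (by norm_num)
            (a4 h2) hξ1 (by linarith) (by norm_num) (by linarith) (by norm_num) hy' (by norm_num) (by linarith) (by norm_num)
            (by linarith) h3 (by norm_num) (by norm_num) (by linarith)
        · exact key (A := 0.29) (Z := 0.45) (τ := 0.41) (R := 2.3) (U := 3) (d₁ := 1.75) (d₂ := 2) (y₁ := 1 / 2) (by norm_num)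
            (a4 h2) hξ1 (by linarith) (by norm_num) (by linarith) (by norm_num) hy' (by norm_num) (by linarith) (by norm_num)
            (by linarith) hd2 (by norm_num) (by norm_num) (by linarith)

/-- The left end contributes little to the tail. -/
lemma tail_left_le (h : ArcPoint n x₀ ρ ξ y) (hn : 3 ≤ n) (hd : 1.5 ≤ n - x₀) (hd2 : n - x₀ ≤ 2) :
    ρ * (2 / (n + x₀ + 1) ^ 3) + 1 / (n + x₀ + 1) ^ 2 ≤ 0.159 * (ρ - (n - x₀)) := by
  have hx0 := h.left_pos
  have hn' : (3 : ℝ) ≤ n := by exact_mod_cast hn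
  have h1 := h.radius'
  have h2 := h.le_rho
  set d := n - x₀ with hd'
  set U := n + x₀ + 1 with hU
  have hU5 : 5 ≤ U := by linarith
  have hxU : 2 * x₀ = U - d - 1 := by rw [hU, hd']; ring
  rw [hxU] at h1
  set δ := ρ - d with hδ
  have hδ0 : 0 ≤ δ := by linarith
  have h3 : d ^ 2 ≤ δ * U := by nlinarith only [h1, hδ0, hd]
  have hρ : ρ = d + δ := by rw [hδ]; ring
  have k1 : 1 / U ^ 2 ≤ δ * (1 / (2.25 * U)) := by
    rw [mul_one_div, div_le_div_iff₀ (by positivity) (by positivity)]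
    have hU0 : 0 ≤ U := by linarith
    have hd2' : 2.25 ≤ d ^ 2 := by nlinarith only [hd]
    have : 2.25 * U ≤ δ * U ^ 2 := by
      nlinarith only [mul_le_mul_of_nonneg_right h3 hU0, mul_le_mul_of_nonneg_right hd2' hU0]
    linarith
  have k2 : d * (2 / U ^ 3) ≤ δ * (2 / (1.5 * U ^ 2)) := by
    rw [mul_div_assoc', mul_div_assoc', div_le_div_iff₀ (by positivity) (by positivity)]
    have : d * 1.5 ≤ δ * U := by nlinarith only [h3, hd]
    nlinarith only [mul_le_mul_of_nonneg_right this (show 0 ≤ U ^ 2 by positivity)]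
  have k3 : 1 / (2.25 * U) ≤ 1 / (2.25 * 5) := by gcongr
  have k4 : 2 / (1.5 * U ^ 2) ≤ 2 / (1.5 * 5 ^ 2) := by gcongr
  have k5 : 2 / U ^ 3 ≤ 2 / 5 ^ 3 := by gcongr
  have l3 := mul_le_mul_of_nonneg_left k3 hδ0
  have l4 := mul_le_mul_of_nonneg_left k4 hδ0
  have l5 := mul_le_mul_of_nonneg_left k5 hδ0
  rw [hρ, add_mul]
  linarith

/-- The estimate on one box of parameters. -/
lemma near_box (h : ArcPoint n x₀ ρ ξ y) (he : (x₀ + ξ) ^ 2 + y ^ 2 < n ^ 2) (hn : 3 ≤ n)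
    (hd2 : n - x₀ ≤ 2) {j : ℤ} (hj : j = n - 2) {m κ : ℝ} (hm : 0 < m)
    (hm2 : m ^ 2 = 2 * (n - x₀) + 1) (hκ : 0.95 ≤ κ)
    (hφ : -(alt j * (altSum n ⟨x₀ + ξ, y⟩).re) < alt j * alt n *
        (1 / (2 * (n - x₀ + 1 / 2)) - 1 / (2 * (n + x₀ + 1 / 2))) - κ / m)
    (hX : 1.5 < n - x₀ - ξ) (hC : 0 ≤ stripCos j (x₀ + ξ)) {d₁ d₂ y₁ y₂ R A c ν m₂ : ℝ}
    (hd1 : d₁ ≤ n - x₀) (hdd : n - x₀ ≤ d₂) (hy1 : y₁ ≤ y) (hy2 : y ≤ y₂)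
    (hnum : 1.5 ≤ d₁ ∧ y₂ ≤ 1.05 ∧ 0 ≤ y₁ ∧ 0 ≤ R ∧ R ≤ d₁ ∧ (R ≤ 1.5 ∨ y₂ ^ 2 ≤ (d₁ - R) * (d₁ + R)) ∧
      0 < m₂ ∧ 2 * d₂ + 1 ≤ m₂ ^ 2 ∧
      0.12 ≤ A ∧ A ≤ 0.95 / m₂ - y₂ ^ 2 / ((2 * d₁ + 1) * (R + 1 / 2) ^ 2) - 1 / (8 * (R + 1 / 2) ^ 2) - 0.0062 ∧
      (c = 1 ∨ d₂ ≤ 1.9999 ∧ 3.1416 * (d₂ - 1.5) - (3.1416 * (d₂ - 1.5)) ^ 3 / 6 + (3.1416 * (d₂ - 1.5)) ^ 5 / 120 ≤ c) ∧ c ≤ 1 ∧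
      1 ≤ ν * (1 + 9.8696 * y₁ ^ 2 / 6 + 97.4 * y₁ ^ 4 / 120) ∧
      (y₂ ≤ 0.6366 ∧ R * A ≤ 0.81 ∧ d₂ * (2 * (d₂ + 1) / ((R + 1) ^ 2 + y₁ ^ 2) ^ 2) < 2.62 * (R * A * (1 + 0.61 * c ^ 2) - c) ∨
        d₂ * (2 * (d₂ + 1) / ((R + 1) ^ 2 + y₁ ^ 2) ^ 2) < 2.9 * (R * A - ν * c)) ∧
      2 * (d₂ + 1) / ((R + 1) ^ 2 + y₁ ^ 2) ^ 2 + 0.159 ≤ 2.62 * A) :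
    alt j * ((⟨ρ - ξ, -y⟩ : ℂ) * altSum₂ n ⟨x₀ + ξ, y⟩).im < 0 := by
  obtain ⟨c1, c2, c3, c4, c5, c6, c7, c8, c9, c10, c11, c12, c13, c14, c15⟩ := hnum
  obtain ⟨b1, b2, b3, b4, b5, b6⟩ := h.early_bounds he
  have hx0 := h.left_pos
  have hξ := h.xi_pos
  have hy := h.im_pos
  have hn' : (3 : ℝ) ≤ n := by exact_mod_cast hn
  have hε := alt_mul_alt_of_sub_two hj
  obtain ⟨g1, -⟩ := h.stripRe_gt_of_phi_lt he (by linarith only [hd2, hX, hξ]) j (κ := κ / m) (G := endRight (n - x₀) ξ y)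
    (fun _ => le_rfl) (fun h => by rw [hε] at h; norm_num at h) hφ
  have hpp : n - (x₀ + ξ) + 1 / 2 = n - x₀ + 1 / 2 - ξ := by ring
  rw [hpp] at g1
  have hRX : R ≤ n - x₀ - ξ := by
    rcases c6 with h1 | h1
    · linarith only [hX, h1]
    · have h2 := h.xi_mul_le
      have h3 : y ^ 2 ≤ y₂ ^ 2 := by gcongr
      by_contra! hc
      nlinarith only [h1, h2, h3, mul_pos (sub_pos.2 hc) (show 0 < R + (n - x₀ - ξ) by linarith only [hd2, hX, hξ, hc]),
        mul_nonneg (sub_nonneg.2 hd1) (show 0 ≤ n - x₀ + d₁ by linarith)]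
  have hW : 1 / (8 * (n + x₀ + 1 / 2) ^ 2) ≤ 0.0062 := by
    have : 1 / (8 * (n + x₀ + 1 / 2) ^ 2) ≤ 1 / (8 * 4.5 ^ 2) := by gcongr; linarith only [hd2, hn']
    linarith
  have hA : A ≤ stripRe j (x₀ + ξ) y := by
    have k1 := endRight_le (y := y) (Y := y₂ ^ 2) (p := R + 1 / 2) (by linarith only [hd2, hX, c4, hξ]) (by linarith only [hRX] : R + 1 / 2 ≤ n - x₀ + 1 / 2 - ξ) hξ.le (by gcongr)
    have k2 : y₂ ^ 2 / ((2 * (n - x₀) + 1) * (R + 1 / 2) ^ 2) ≤ y₂ ^ 2 / ((2 * d₁ + 1) * (R + 1 / 2) ^ 2) := by gcongr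
    have k3 : 1 / (8 * (n - x₀ + 1 / 2 - ξ) ^ 2) ≤ 1 / (8 * (R + 1 / 2) ^ 2) := by
      gcongr; linarith only [hRX]
    have k4 : 0.95 / m₂ ≤ κ / m := by
      have : m ≤ m₂ := le_of_sq_le_sq (by linarith only [hm2, hdd, c8]) c7.le
      gcongr
    linarith
  have hCc : stripCos j (x₀ + ξ) ≤ c := by
    rcases c11 with h1 | ⟨h1, h2⟩
    · rw [h1]; exact stripCos_le_one _ _
    · exact (stripCos_le (by rw [hj]; push_cast; linarith only [hdd, hξ]) (by rw [hj]; push_cast; linarith only [hX, hdd, hξ, h1]) (by linarith only [hX, hdd, hξ]) (by linarith only [h1])).trans h2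
  have hyd : 2 * y ^ 2 ≤ (n - x₀ + 1) * (n - x₀ + 2) := by
    have hy105 : y ≤ 1.05 := hy2.trans c2
    have hd15 : 1.5 ≤ n - x₀ := c1.trans hd1
    have : y ^ 2 ≤ 1.1025 := by nlinarith only [hy, hy105]
    nlinarith only [this, hd15]
  have hT : arcTail (n - x₀) (n + x₀ + 1) ρ ξ y ≤ d₂ * (2 * (d₂ + 1) / ((R + 1) ^ 2 + y₁ ^ 2) ^ 2) +
      (ρ - (n - x₀)) * (2.62 * A) := by
    have k1 := h.tail_left_le hn (by linarith only [hX, hξ]) hd2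
    have k2 : 2 * (n - x₀ + 1) / ((n - x₀ - ξ + 1) ^ 2 + y ^ 2) ^ 2 ≤ 2 * (d₂ + 1) / ((R + 1) ^ 2 + y₁ ^ 2) ^ 2 := by
      have : 0 ≤ d₂ + 1 := by linarith only [hd2, hX, hdd, hξ]
      gcongr
    set t := 2 * (d₂ + 1) / ((R + 1) ^ 2 + y₁ ^ 2) ^ 2 with ht
    have ht0 : 0 ≤ t := by
      have : 0 ≤ d₂ + 1 := by linarith only [hd2, hX, hdd, hξ]
      positivity
    have hδ := h.le_rho
    rw [arcTail, mul_add]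
    have k3 := mul_le_mul_of_nonneg_left k2 h.rho_pos.le
    have k4 : ρ * t ≤ d₂ * t + (ρ - (n - x₀)) * t := by nlinarith only [ht0, hdd]
    have k5 := mul_le_mul_of_nonneg_left c15 (sub_nonneg.2 hδ)
    linarith only [k1, k3, k4, k5]
  have hRρ : R + (ρ - (n - x₀)) ≤ ρ - ξ := by linarith only [hRX]
  have hRA : R * A + (ρ - (n - x₀)) * A ≤ (ρ - ξ) * A := by
    have := mul_le_mul_of_nonneg_right hRρ (show 0 ≤ A by linarith only [hd2, hX, c9, hξ])
    linarith only [this]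
  have hδA : 0 ≤ (ρ - (n - x₀)) * A := mul_nonneg (sub_nonneg.2 h.le_rho) (by linarith only [hd2, hX, c9, hξ])
  rcases c14 with ⟨l1, l2, l3⟩ | l1
  · refine h.im_neg_of_cos_nonneg' he hyd (by linarith only [hd2, hX, hξ]) j hC (by linarith only [hd2, hX, c9, hξ]) hA (by linarith only [hy2, l1]) l2 (by linarith only [hRA, hδA]) hCc c12 ?_
    linarith only [hT, hRA, l3]
  · refine h.im_neg_of_cos_nonneg he hyd (by linarith only [hd2, hX, hξ]) j hC (by linarith only [hd2, hX, c9, hξ]) hA (by norm_num)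
      (stripCot_ge_mul hy (by linarith only [hy2, c2])) (pi_div_sinh_le c3 hy1 hy c13) hCc ?_
    linarith only [hT, hRA, hδA, l1]

lemma near_cos_pos_two (h : ArcPoint n x₀ ρ ξ y) (he : (x₀ + ξ) ^ 2 + y ^ 2 < n ^ 2) (hn : (n : ℝ) = 2)
    {j : ℤ} (hj : j = n - 2) (hX : 1.5 < n - x₀ - ξ) (hy1 : y ≤ 1.05) (hC : 0 ≤ stripCos j (x₀ + ξ))
    (ha : 0.29 ≤ stripRe j (x₀ + ξ) y) :
    alt j * ((⟨ρ - ξ, -y⟩ : ℂ) * altSum₂ n ⟨x₀ + ξ, y⟩).im < 0 := by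
  have hx0 := h.left_pos
  have hξ := h.xi_pos
  have hy := h.im_pos
  have hρ := h.radius
  have hcirc := h.circle
  have hρ0 := h.rho_pos
  have hτ := h.arcTail_le (τ := 0.302) (by
    rw [hn] at hX ⊢
    have k1 : 2 * (2 - x₀ + 1) / ((2 - x₀ - ξ + 1) ^ 2 + y ^ 2) ^ 2 ≤ 2 * 3 / ((1.5 + 1) ^ 2 + (0 : ℝ) ^ 2) ^ 2 := by
      gcongr; linarith
    have k2 : 2 / (2 + x₀ + 1) ^ 3 ≤ 2 / (3 : ℝ) ^ 3 := by
      gcongr; linarith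
    have k3 : 1 / ((2 - x₀) * (2 + x₀ + 1) ^ 2) ≤ 1 / (1.5 * (3 : ℝ) ^ 2) := by
      gcongr <;> linarith only [hX, hx0, hξ]
    linarith)
  have hyy : y ^ 2 ≤ 1.1025 := by nlinarith only [hy, hy1]
  have hyd : 2 * y ^ 2 ≤ (n - x₀ + 1) * (n - x₀ + 2) := by
    nlinarith only [hyy, show 1.5 ≤ n - x₀ by linarith]
  have hx5 : x₀ < 0.5 := by linarith
  rw [hn] at hρ
  have hρ375 : 3.75 ≤ ρ := by nlinarith only [hρ, hx5, hx0, hρ0]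
  have hρξ := (h.early_bounds he).1
  have hξ15 : ξ ≤ 0.08 * ρ := by
    nlinarith only [hcirc, hyy, hρ375, hξ, hρξ]
  have main : ∀ c, stripCos j (x₀ + ξ) ≤ c → 0.302 * ρ < 2.9 * (0.92 * ρ * 0.29 - c) →
      alt j * ((⟨ρ - ξ, -y⟩ : ℂ) * altSum₂ n ⟨x₀ + ξ, y⟩).im < 0 := by
    intro c hc hlt
    refine h.im_neg_of_cos_nonneg he hyd (by linarith) j hC (by norm_num : (0 : ℝ) ≤ 0.29) ha (by norm_num)
      (stripCot_ge_mul hy hy1) (pi_div_sinh_le (y₁ := 0) (ν := 1) le_rfl hy.le hy (by norm_num)) hc ?_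
    linarith
  rcases le_or_gt 0.3 x₀ with h1 | h1
  · have hCc := stripCos_le (j := j) (x := x₀ + ξ) (s := 0.2) (by rw [hj]; push_cast; linarith)
      (by rw [hj]; push_cast; linarith) (by norm_num) (by norm_num)
    refine main 0.59 (hCc.trans (by norm_num)) ?_
    linarith
  · refine main 1 (stripCos_le_one _ _) ?_
    have : 6.4 ≤ ρ := by nlinarith only [hρ, h1, hx0, hρ0]
    linarith

lemma near_cos_pos (h : ArcPoint n x₀ ρ ξ y) (he : (x₀ + ξ) ^ 2 + y ^ 2 < n ^ 2) (hn : 3 ≤ n)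
    (hd2 : n - x₀ ≤ 2) {j : ℤ} (hj : j = n - 2) {m κ : ℝ} (hm : 0 < m)
    (hm2 : m ^ 2 = 2 * (n - x₀) + 1) (hκ : 0.95 ≤ κ)
    (hφ : -(alt j * (altSum n ⟨x₀ + ξ, y⟩).re) < alt j * alt n *
        (1 / (2 * (n - x₀ + 1 / 2)) - 1 / (2 * (n + x₀ + 1 / 2))) - κ / m)
    (hX : 1.5 < n - x₀ - ξ) (hy1 : y ≤ 1.05) (hC : 0 ≤ stripCos j (x₀ + ξ)) :
    alt j * ((⟨ρ - ξ, -y⟩ : ℂ) * altSum₂ n ⟨x₀ + ξ, y⟩).im < 0 := by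
  have hξ := h.xi_pos
  have hy := h.im_pos
  have hd1 : 1.5 ≤ n - x₀ := by linarith
  have box := @near_box n x₀ ρ ξ y h he hn hd2 j hj m κ hm hm2 hκ hφ hX hC
  have hD : ∀ P : Prop, (n - x₀ ≤ 1.65 → P) → (1.65 < n - x₀ → n - x₀ ≤ 1.75 → P) → (1.75 < n - x₀ → n - x₀ ≤ 1.8 → P) →
      (1.8 < n - x₀ → n - x₀ ≤ 1.85 → P) → (1.85 < n - x₀ → n - x₀ ≤ 1.9 → P) → (1.9 < n - x₀ → P) → P := by
    intro P p1 p2 p3 p4 p5 p6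
    by_cases k1 : n - x₀ ≤ 1.65
    · exact p1 k1
    by_cases k2 : n - x₀ ≤ 1.75
    · exact p2 (not_le.1 k1) k2
    by_cases k3 : n - x₀ ≤ 1.8
    · exact p3 (not_le.1 k2) k3
    by_cases k4 : n - x₀ ≤ 1.85
    · exact p4 (not_le.1 k3) k4
    by_cases k5 : n - x₀ ≤ 1.9
    · exact p5 (not_le.1 k4) k5
    · exact p6 (not_le.1 k5)
  by_cases l1 : y ≤ 0.5
  · apply hD
    · intro k1
      exact box (R := 1.5) (A := 0.405) (c := 0.454) (ν := 1) (m₂ := 2.0737) hd1 k1 hy.le l1 (by norm_num)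
    · intro k1 k2
      exact box (R := 1.572) (A := 0.3989) (c := 0.7072) (ν := 1) (m₂ := 2.1214) k1.le k2 hy.le l1 (by norm_num)
    · intro k2 k3
      exact box (R := 1.677) (A := 0.3986) (c := 0.8092) (ν := 1) (m₂ := 2.1448) k2.le k3 hy.le l1 (by norm_num)
    · intro k3 k4
      exact box (R := 1.729) (A := 0.3958) (c := 0.8914) (ν := 1) (m₂ := 2.168) k3.le k4 hy.le l1 (by norm_num)
    · intro k4 k5
      exact box (R := 1.781) (A := 0.3931) (c := 0.9521) (ν := 1) (m₂ := 2.1909) k4.le k5 hy.le l1 (by norm_num)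
    · intro k5
      exact box (R := 1.833) (A := 0.3861) (c := 1) (ν := 1) (m₂ := 2.2361) k5.le hd2 hy.le l1 (by norm_num)
  rw [not_le] at l1
  by_cases l2 : y ≤ 0.6366
  · apply hD
    · intro k1
      exact box (R := 1.5) (A := 0.3953) (c := 0.454) (ν := 0.6841) (m₂ := 2.0737) hd1 k1 l1.le l2 (by norm_num)
    · intro k1 k2
      exact box (R := 1.522) (A := 0.3879) (c := 0.7072) (ν := 0.6841) (m₂ := 2.1214) k1.le k2 l1.le l2 (by norm_num)
    · intro k2 k3
      exact box (R := 1.63) (A := 0.3893) (c := 0.8092) (ν := 0.6841) (m₂ := 2.1448) k2.le k3 l1.le l2 (by norm_num)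
    · intro k3 k4
      exact box (R := 1.683) (A := 0.3872) (c := 0.8914) (ν := 0.6841) (m₂ := 2.168) k3.le k4 l1.le l2 (by norm_num)
    · intro k4 k5
      exact box (R := 1.737) (A := 0.3852) (c := 0.9521) (ν := 0.6841) (m₂ := 2.1909) k4.le k5 l1.le l2 (by norm_num)
    · intro k5
      exact box (R := 1.79) (A := 0.3787) (c := 1) (ν := 0.6841) (m₂ := 2.2361) k5.le hd2 l1.le l2 (by norm_num)
  rw [not_le] at l2
  by_cases l3 : y ≤ 0.8
  · apply hD
    · intro k1
      exact box (R := 1.5) (A := 0.3806) (c := 0.454) (ν := 0.5556) (m₂ := 2.0737) hd1 k1 l2.le l3 (by norm_num)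
    · intro k1 k2
      exact box (R := 1.5) (A := 0.3731) (c := 0.7072) (ν := 0.5556) (m₂ := 2.1214) k1.le k2 l2.le l3 (by norm_num)
    · intro k2 k3
      exact box (R := 1.556) (A := 0.3735) (c := 0.8092) (ν := 0.5556) (m₂ := 2.1448) k2.le k3 l2.le l3 (by norm_num)
    · intro k3 k4
      exact box (R := 1.612) (A := 0.3727) (c := 0.8914) (ν := 0.5556) (m₂ := 2.168) k3.le k4 l2.le l3 (by norm_num)
    · intro k4 k5
      exact box (R := 1.668) (A := 0.3718) (c := 0.9521) (ν := 0.5556) (m₂ := 2.1909) k4.le k5 l2.le l3 (by norm_num)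
    · intro k5
      exact box (R := 1.723) (A := 0.3663) (c := 1) (ν := 0.5556) (m₂ := 2.2361) k5.le hd2 l2.le l3 (by norm_num)
  rw [not_le] at l3
  apply hD
  · intro k1
    exact box (R := 1.5) (A := 0.3517) (c := 0.454) (ν := 0.4193) (m₂ := 2.0737) hd1 k1 l3.le hy1 (by norm_num)
  · intro k1 k2
    exact box (R := 1.5) (A := 0.3462) (c := 0.7072) (ν := 0.4193) (m₂ := 2.1214) k1.le k2 l3.le hy1 (by norm_num)
  · intro k2 k3
    exact box (R := 1.5) (A := 0.3442) (c := 0.8092) (ν := 0.4193) (m₂ := 2.1448) k2.le k3 l3.le hy1 (by norm_num)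
  · intro k3 k4
    exact box (R := 1.5) (A := 0.3408) (c := 0.8914) (ν := 0.4193) (m₂ := 2.168) k3.le k4 l3.le hy1 (by norm_num)
  · intro k4 k5
    exact box (R := 1.523) (A := 0.3395) (c := 0.9521) (ν := 0.4193) (m₂ := 2.1909) k4.le k5 l3.le hy1 (by norm_num)
  · intro k5
    exact box (R := 1.583) (A := 0.3369) (c := 1) (ν := 0.4193) (m₂ := 2.2361) k5.le hd2 l3.le hy1 (by norm_num)

/-- Below the threshold the first coordinate moves in one direction, near the ends. -/
lemma im_neg_of_phi_lt_near (h : ArcPoint n x₀ ρ ξ y) (he : (x₀ + ξ) ^ 2 + y ^ 2 < n ^ 2) (hn : 2 ≤ n)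
    (hd : 1 < n - x₀) (hd2 : n - x₀ ≤ 2) {j : ℤ} (hj : j = n - 2) {m κ : ℝ} (hm : 0 < m)
    (hm2 : m ^ 2 = 2 * (n - x₀) + 1) (hκ : 0.83 ≤ κ) (hκ' : 1.5 ≤ n - x₀ → 0.88 ≤ κ)
    (hκ3 : 1.5 ≤ n - x₀ → 3 ≤ n → 0.95 ≤ κ)
    (hφ : -(alt j * (altSum n ⟨x₀ + ξ, y⟩).re) < alt j * alt n *
        (1 / (2 * (n - x₀ + 1 / 2)) - 1 / (2 * (n + x₀ + 1 / 2))) - κ / m) :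
    alt j * ((⟨ρ - ξ, -y⟩ : ℂ) * altSum₂ n ⟨x₀ + ξ, y⟩).im < 0 := by
  obtain ⟨hS, hX, hy1, a1, a2, a3, a4⟩ := h.near_bounds he hn hd hd2 hj hm hm2 hκ hκ' hφ
  have hξ := h.xi_pos
  by_cases hC : stripCos j (x₀ + ξ) ≤ 0
  · exact h.near_cos_nonpos he hn hd hd2 hS hC hX hy1 a1 a2 a3 a4
  · have hX' : 1.5 < n - x₀ - ξ := by
      by_contra! hc
      exact hC (stripCos_nonpos (by rw [hj]; push_cast; linarith only [hc]) (by rw [hj]; push_cast; linarith))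
    have hd15 : 1.5 ≤ n - x₀ := by linarith
    rcases lt_or_ge n 3 with hn3 | hn3
    · have hn2 : n = 2 := by omega
      exact h.near_cos_pos_two he (by rw [hn2]; norm_num) hj hX' hy1 (not_le.1 hC).le (a4 hd15)
    · exact h.near_cos_pos he hn3 hd2 hj hm hm2 (hκ3 hd15 hn3) hφ hX' hy1 (not_le.1 hC).le

end ArcPoint

lemma alt_mul_alt_of_sub_three {n : ℕ} {j : ℤ} (h : j = n - 3) : alt j * alt n = -1 := by
  rw [h, alt_sub, mul_right_comm, alt_mul_self, one_mul]
  norm_num [alt]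

lemma endLeft_le_half {W ξ y : ℝ} (hW : 0 < W) (hξ : 0 ≤ ξ) (hy : 0 < y) : endLeft W ξ y ≤ 1 / (2 * W) := by
  rw [endLeft, div_le_div_iff₀ (by positivity) (by positivity)]
  have : y ^ 2 + ξ ^ 2 + ξ * W ≤ (W + ξ) ^ 2 + y ^ 2 := by nlinarith [mul_nonneg hξ hW.le]
  nlinarith

lemma endRight_le_inv {d ξ y : ℝ} (hp : 0 < d + 1 / 2 - ξ) (hd : 0 < 2 * d + 1) :
    endRight d ξ y ≤ 1 / (2 * d + 1) := by
  rw [endRight_eq hp hd]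
  have : 0 ≤ (d + 1 / 2 - ξ) / (2 * ((d + 1 / 2 - ξ) ^ 2 + y ^ 2)) := by positivity
  linarith

namespace ArcPoint
variable {n : ℕ} {x₀ ρ ξ y : ℝ}

/-- A lower bound for `Re (π / sin πz)` at points where the first coordinate lies below the threshold. -/
lemma far_stripRe_ge (h : ArcPoint n x₀ ρ ξ y) (he : (x₀ + ξ) ^ 2 + y ^ 2 < n ^ 2) (hn : 3 ≤ n)
    (hd : 2 < n - x₀) {j : ℤ} (hj : j ≤ x₀) (hj' : x₀ < j + 1) {m κ : ℝ} (hm : 0 < m)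
    (hm2 : m ^ 2 = 2 * (n - x₀) + 1) (hκ : 0.88 ≤ κ)
    (hφ : -(alt j * (altSum n ⟨x₀ + ξ, y⟩).re) < alt j * alt n *
        (1 / (2 * (n - x₀ + 1 / 2)) - 1 / (2 * (n + x₀ + 1 / 2))) - κ / m) :
    0.38 / m ≤ stripRe j (x₀ + ξ) y := by
  have hx0 := h.left_pos
  have hξ := h.xi_pos
  have hy := h.im_pos
  have hn' : (3 : ℝ) ≤ n := by exact_mod_cast hn
  obtain ⟨-, b2, -, b4, -, -⟩ := h.early_bounds he
  set M := m ^ 2 with hM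
  have hM5 : 5 ≤ M := by linarith
  have hMp : 0 < M := by linarith
  have hm0 : 2.236 ≤ m := le_of_sq_le_sq (by linarith) hm.le
  have hWM : M / 2 ≤ n + x₀ + 1 / 2 := by linarith
  have hκm : 0.88 / m ≤ κ / m := by gcongr
  have fin : ∀ {q : ℝ}, q ≤ 0.5 * 2.236 → 0.38 / m ≤ 0.88 / m - q / M := by
    intro q hq
    have h1 : q / M ≤ 0.5 / m := by
      rw [div_le_div_iff₀ hMp hm, hM]
      nlinarith only [hq, hm0]
    have h2 : 0.88 / m = 0.38 / m + 0.5 / m := by ring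
    linarith only [h1, h2]
  rcases lt_or_ge y (1 / 2) with hy' | hy'
  · have hξ1 : ξ ≤ 0.064 := h.xi_le_of_sq_le he (Y := 0.25) (by linarith) (by nlinarith only [hy, hy'])
    have hpM : 0.48 * M ≤ n - x₀ + 1 / 2 - ξ := by linarith
    obtain ⟨g1, -⟩ := h.stripRe_gt_of_phi_lt he (by linarith) j (κ := κ / m) (G := 1.09 / M ^ 3 + 0.14 / M ^ 2)
      (fun _ => by
        refine (endRight_le (y := y) (Y := 0.25) (p := 0.48 * M) (by positivity) hpM hξ.le (by nlinarith only [hy, hy'])).trans ?_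
        rw [← hm2]
        have : 0.25 / (M * (0.48 * M) ^ 2) = 0.25 / 0.48 ^ 2 / M ^ 3 := by field_simp
        rw [this]
        have : 0.25 / 0.48 ^ 2 / M ^ 3 ≤ 1.09 / M ^ 3 := by gcongr; norm_num
        have : 0 ≤ 0.14 / M ^ 2 := by positivity
        linarith)
      (fun _ => by
        refine (endLeft_le (Y := 0.25) (W₀ := M / 2) (by positivity) hWM hξ.le hξ1 (by nlinarith only [hy, hy'])).trans ?_
        have e : (0.25 + 0.064 ^ 2) / (2 * (M / 2) ^ 3) + 0.064 / (2 * (M / 2) ^ 2) =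
          (0.25 + 0.064 ^ 2) * 4 / M ^ 3 + 0.128 / M ^ 2 := by field_simp; ring
        rw [e]
        gcongr <;> norm_num) hφ
    have k1 : 1 / (8 * (n - (x₀ + ξ) + 1 / 2) ^ 2) ≤ 1 / (8 * (0.48 * M) ^ 2) := by
      gcongr; linarith
    have k2 : 1 / (8 * (n + x₀ + 1 / 2) ^ 2) ≤ 1 / (8 * (M / 2) ^ 2) := by gcongr
    have k3 : 1.09 / M ^ 3 + 0.14 / M ^ 2 + (1 / (8 * (0.48 * M) ^ 2) + 1 / (8 * (M / 2) ^ 2)) ≤ 0.3 / M := by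
      have e : 1.09 / M ^ 3 + 0.14 / M ^ 2 + (1 / (8 * (0.48 * M) ^ 2) + 1 / (8 * (M / 2) ^ 2)) =
        (1.09 * (1 / M) + (0.14 + 1 / (8 * 0.48 ^ 2) + 0.5)) * (1 / M) * (1 / M) := by field_simp; ring
      have i1 : 1 / M ≤ 1 / 5 := by gcongr
      have i0 : 0 < 1 / M := by positivity
      rw [e, show 0.3 / M = 0.3 * (1 / M) by ring]
      gcongr
      nlinarith only [i1, i0]
    have := fin (q := 0.3) (by norm_num)
    linarith
  · have k1 : 3 / (8 * (n - (x₀ + ξ) + 1 / 2 + y) ^ 2) ≤ 3 / (8 * (M / 2) ^ 2) := by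
      gcongr; linarith
    rcases lt_or_ge (n - x₀) 3 with hd3 | hd3
    · have hjn : j = n - 3 := by
        have h1 : (j : ℝ) < ((n : ℤ) - 2 : ℤ) := by push_cast; linarith
        have h2 : (((n : ℤ) - 4 : ℤ) : ℝ) < j := by push_cast; linarith
        have h3 := Int.cast_lt.1 h1
        have h4 := Int.cast_lt.1 h2
        omega
      have hε := alt_mul_alt_of_sub_three hjn
      have key : ∀ {d₁ W m₂ : ℝ}, d₁ ≤ n - x₀ → 2 ≤ d₁ → 2 * (n - x₀) + 1 ≤ m₂ ^ 2 → 0 < m₂ → 0 < W → W ≤ n + x₀ + 1 / 2 →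
          (1 / (2 * W) + 3 / (8 * (d₁ + 1 / 2) ^ 2) + 1 / (8 * W ^ 2)) * m₂ ≤ 0.5 → 0.38 / m ≤ stripRe j (x₀ + ξ) y := by
        intro d₁ W m₂ c1 c2 c3 c4 c5 c6 c7
        obtain ⟨-, g1⟩ := h.stripRe_gt_of_phi_lt he (by linarith only [hd, hd3]) j (κ := κ / m) (G := 1 / (2 * W))
          (fun h => by rw [hε] at h; norm_num at h)
          (fun _ => (endLeft_le_half (by positivity) hξ.le hy).trans (by gcongr)) hφ
        have g1 := g1 hy'
        have l1 : 3 / (8 * (n - (x₀ + ξ) + 1 / 2 + y) ^ 2) ≤ 3 / (8 * (d₁ + 1 / 2) ^ 2) := by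
          refine div_le_div_of_nonneg_left (by norm_num) (by positivity) ?_
          exact mul_le_mul_of_nonneg_left (pow_le_pow_left₀ (by linarith) (by linarith only [b2, c1]) 2) (by norm_num)
        have l2 : 1 / (8 * (n + x₀ + 1 / 2) ^ 2) ≤ 1 / (8 * W ^ 2) := by gcongr
        have l3 : m ≤ m₂ := le_of_sq_le_sq (by linarith only [hm2, c3]) c4.le
        have l4 : 1 / (2 * W) + 3 / (8 * (d₁ + 1 / 2) ^ 2) + 1 / (8 * W ^ 2) ≤ 0.5 / m := by
          rw [le_div_iff₀ hm]
          refine le_trans ?_ c7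
          have : 0 < d₁ + 1 / 2 := by linarith only [hd, hd3, c2]
          gcongr
        have l5 : 0.88 / m = 0.38 / m + 0.5 / m := by ring
        linarith only [hκm, g1, l1, l2, l4, l5]
      by_cases c1 : n - x₀ ≤ 2.5
      · exact key (d₁ := 2) (W := 4) (m₂ := 2.45) (by linarith only [hd]) le_rfl (by linarith) (by norm_num) (by norm_num) (by linarith) (by norm_num)
      by_cases c2 : n - x₀ ≤ 2.75
      · exact key (d₁ := 2.5) (W := 3.75) (m₂ := 2.55) (by linarith only [c1]) (by norm_num) (by linarith only [hd3, c2]) (by norm_num) (by norm_num) (by linarith only [hn', c2]) (by norm_num)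
      · exact key (d₁ := 2.75) (W := 3.5) (m₂ := 2.6458) (by linarith only [c2]) (by norm_num) (by linarith only [hd3, c2]) (by norm_num) (by norm_num) (by linarith only [hx0, hn']) (by norm_num)
    · have hM7 : 7 ≤ M := by linarith
      have hm1 : 2.645 ≤ m := le_of_sq_le_sq (by linarith) hm.le
      obtain ⟨-, g1⟩ := h.stripRe_gt_of_phi_lt he (by linarith only [hd]) j (κ := κ / m) (G := 1 / M)
        (fun _ => by rw [hm2]; exact endRight_le_inv (by linarith only [b4]) (by linarith only [hd]))
        (fun _ => (endLeft_le_half (by positivity) hξ.le hy).trans (by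
          apply one_div_le_one_div_of_le hMp; linarith)) hφ
      have g1 := g1 hy'
      have k2 : 1 / (8 * (n + x₀ + 1 / 2) ^ 2) ≤ 1 / (8 * (M / 2) ^ 2) := by gcongr
      have k3 : 1 / M + (3 / (8 * (M / 2) ^ 2) + 1 / (8 * (M / 2) ^ 2)) ≤ 1.29 / M := by
        have e : 1 / M + (3 / (8 * (M / 2) ^ 2) + 1 / (8 * (M / 2) ^ 2)) = (1 + 2 * (1 / M)) * (1 / M) := by
          field_simp; ring
        have i1 : 1 / M ≤ 1 / 7 := by gcongr
        rw [e, show 1.29 / M = 1.29 * (1 / M) by ring]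
        gcongr
        linarith only [i1]
      have h1 : 1.29 / M ≤ 0.5 / m := by
        rw [div_le_div_iff₀ hMp hm, hM]
        nlinarith only [hm1]
      have h2 : 0.88 / m = 0.38 / m + 0.5 / m := by ring
      linarith

/-- The same with a better constant, at points close to the real axis in the left half of a strip. -/
lemma far_stripRe_ge' (h : ArcPoint n x₀ ρ ξ y) (he : (x₀ + ξ) ^ 2 + y ^ 2 < n ^ 2) (hn : 3 ≤ n)
    (hd : 2.5 < n - x₀) {j : ℤ} (hj' : j = n - 3 ∧ n - x₀ ≤ 3 ∨ 3.5 < n - x₀) {m κ : ℝ} (hm : 0 < m)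
    (hm2 : m ^ 2 = 2 * (n - x₀) + 1) (hκ : 0.88 ≤ κ)
    (hφ : -(alt j * (altSum n ⟨x₀ + ξ, y⟩).re) < alt j * alt n *
        (1 / (2 * (n - x₀ + 1 / 2)) - 1 / (2 * (n + x₀ + 1 / 2))) - κ / m) (hy1 : y ≤ 1.05) :
    0.74 / m ≤ stripRe j (x₀ + ξ) y := by
  have hx0 := h.left_pos
  have hξ := h.xi_pos
  have hy := h.im_pos
  have hn' : (3 : ℝ) ≤ n := by exact_mod_cast hn
  have hyy : y ^ 2 ≤ 1.1025 := by nlinarith only [hy, hy1]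
  have hκm : 0.88 / m ≤ κ / m := by gcongr
  have h2 : 0.88 / m = 0.74 / m + 0.14 / m := by ring
  rcases hj' with ⟨hj, hd3⟩ | hd3
  · have hε := alt_mul_alt_of_sub_three hj
    have hξ1 : ξ ≤ 0.232 := h.xi_le_of_sq_le he (Y := 1.1025) (by linarith only [hd]) hyy
    obtain ⟨g1, -⟩ := h.stripRe_gt_of_phi_lt he (by linarith) j (κ := κ / m) (G := 0.023)
      (fun h => by rw [hε] at h; norm_num at h)
      (fun _ => (endLeft_le (W₀ := 3.5) (by norm_num) (by linarith) hξ.le hξ1 hyy).trans (by norm_num)) hφ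
    have k1 : 1 / (8 * (n - (x₀ + ξ) + 1 / 2) ^ 2) ≤ 1 / (8 * 2.768 ^ 2) := by
      gcongr; linarith
    have k2 : 1 / (8 * (n + x₀ + 1 / 2) ^ 2) ≤ 1 / (8 * 3.5 ^ 2) := by gcongr; linarith only [hx0, hn']
    have k3 : 0.05 ≤ 0.14 / m := by
      have : m ≤ 2.6458 := le_of_sq_le_sq (by linarith) (by norm_num)
      rw [le_div_iff₀ hm]; linarith
    linarith
  · set M := m ^ 2 with hM
    have hM8 : 8 ≤ M := by linarith
    have hMp : 0 < M := by linarith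
    have hm0 : 2.828 ≤ m := le_of_sq_le_sq (by linarith) hm.le
    have hWM : M / 2 ≤ n + x₀ + 1 / 2 := by linarith
    have hξ1 : ξ ≤ 0.162 := h.xi_le_of_sq_le he (Y := 1.1025) (by linarith only [hd3]) hyy
    have hpM : 0.4797 * M ≤ n - x₀ + 1 / 2 - ξ := by linarith
    obtain ⟨g1, -⟩ := h.stripRe_gt_of_phi_lt he (by linarith) j (κ := κ / m) (G := 4.8 / M ^ 3 + 0.324 / M ^ 2)
      (fun _ => by
        refine (endRight_le (y := y) (Y := 1.1025) (p := 0.4797 * M) (by positivity) hpM hξ.le hyy).trans ?_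
        rw [← hm2]
        have : 1.1025 / (M * (0.4797 * M) ^ 2) = 1.1025 / 0.4797 ^ 2 / M ^ 3 := by field_simp
        rw [this]
        have : 1.1025 / 0.4797 ^ 2 / M ^ 3 ≤ 4.8 / M ^ 3 := by gcongr; norm_num
        have : 0 ≤ 0.324 / M ^ 2 := by positivity
        linarith)
      (fun _ => by
        refine (endLeft_le (Y := 1.1025) (W₀ := M / 2) (by positivity) hWM hξ.le hξ1 hyy).trans ?_
        have e : (1.1025 + 0.162 ^ 2) / (2 * (M / 2) ^ 3) + 0.162 / (2 * (M / 2) ^ 2) =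
          (1.1025 + 0.162 ^ 2) * 4 / M ^ 3 + 0.324 / M ^ 2 := by field_simp; ring
        rw [e]
        gcongr; norm_num) hφ
    have k1 : 1 / (8 * (n - (x₀ + ξ) + 1 / 2) ^ 2) ≤ 1 / (8 * (0.4797 * M) ^ 2) := by
      gcongr; linarith
    have k2 : 1 / (8 * (n + x₀ + 1 / 2) ^ 2) ≤ 1 / (8 * (M / 2) ^ 2) := by gcongr
    have k3 : 4.8 / M ^ 3 + 0.324 / M ^ 2 + (1 / (8 * (0.4797 * M) ^ 2) + 1 / (8 * (M / 2) ^ 2)) ≤ 0.25 / M := by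
      have e : 4.8 / M ^ 3 + 0.324 / M ^ 2 + (1 / (8 * (0.4797 * M) ^ 2) + 1 / (8 * (M / 2) ^ 2)) =
        (4.8 * (1 / M) + (0.324 + 1 / (8 * 0.4797 ^ 2) + 0.5)) * (1 / M) * (1 / M) := by field_simp; ring
      have i1 : 1 / M ≤ 1 / 8 := by gcongr
      have i0 : 0 < 1 / M := by positivity
      rw [e, show 0.25 / M = 0.25 * (1 / M) by ring]
      gcongr
      nlinarith only [i1, i0]
    have h1 : 0.25 / M ≤ 0.14 / m := by
      rw [div_le_div_iff₀ hMp hm, hM]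
      nlinarith only [hm0]
    linarith

/-- Points where `Re (π / sin πz)` is large are close to the real axis. -/
lemma far_im_le (h : ArcPoint n x₀ ρ ξ y) (he : (x₀ + ξ) ^ 2 + y ^ 2 < n ^ 2)
    (hd : 2 < n - x₀) {j : ℤ} {m : ℝ} (hm : 0 < m)
    (hm2 : m ^ 2 = 2 * (n - x₀) + 1) (ha : 0.38 / m ≤ stripRe j (x₀ + ξ) y) :
    ξ ≤ 0.68 ∧ (n - x₀ ≤ 15 ∧ y ≤ 1.5 ∨ 15 < n - x₀ ∧ 4 * y ≤ n - x₀ ∧ ξ ≤ 0.3) := by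
  have hy := h.im_pos
  have hS := stripSin_pos_of_re hy (lt_of_lt_of_le (by positivity) ha)
  rcases le_or_gt (n - x₀) 15 with hd' | hd'
  · have hy1 : y ≤ 1.5 := by
      by_contra! hc
      have h1 := stripRe_lt_of_le (y := y) (Y := 2.25) (A := 0.067) (by linarith) hS (by norm_num)
        (by nlinarith only [hc]) (by norm_num) (by norm_num)
      have h2 : m ≤ 5.57 := le_of_sq_le_sq (by linarith) (by norm_num)
      have h3 : 0.067 ≤ 0.38 / m := by rw [le_div_iff₀ hm]; linarith
      linarith
    exact ⟨h.xi_le_of_sq_le he (Y := 2.25) (by linarith) (by nlinarith only [hy, hy1]), Or.inl ⟨hd', hy1⟩⟩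
  · have hm5 : 5.567 ≤ m := le_of_sq_le_sq (by linarith) hm.le
    have hy1 : y ^ 2 ≤ 1.46 * m := by
      by_contra! hc
      have h1 := stripRe_lt_of_le (y := y) (Y := 1.46 * m) (A := 0.38 / m) (by
          by_contra! hy4
          nlinarith only [hc, hy4, hm5, hy]) hS (by positivity)
        hc.le (by positivity) (by
          have e : (0.38 / m) ^ 2 * (32.46 * (1.46 * m) ^ 2) = 0.38 ^ 2 * 32.46 * 1.46 ^ 2 := by field_simp
          have : 0 < (0.38 / m) ^ 2 := by positivity
          have : 0 ≤ (0.38 / m) ^ 2 * (1 + 9.869 * (1.46 * m) + 42.7 * (1.46 * m) ^ 3 + 30.1 * (1.46 * m) ^ 4 + 13.2 * (1.46 * m) ^ 5) := by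
            positivity
          norm_num at e
          nlinarith only [e, this])
      linarith
    have hξ3 : ξ ≤ 0.3 := h.xi_le_of_sq_le he (Y := 1.46 * m) (by nlinarith only [hm5, hm2]) hy1
    refine ⟨by linarith, Or.inr ⟨hd', ?_, hξ3⟩⟩
    have hdm : n - x₀ = (m ^ 2 - 1) / 2 := by linarith
    rw [hdm]
    refine le_of_sq_le_sq ?_ (by nlinarith only [hm5])
    have : 16 * (1.46 * m) ≤ ((m ^ 2 - 1) / 2) ^ 2 := by
      have : 5.3 * m ≤ m ^ 2 - 1 := by nlinarith only [hm5]
      have : (5.3 * m) ^ 2 ≤ (m ^ 2 - 1) ^ 2 := by gcongr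
      nlinarith only [this, hm5]
    nlinarith only [this, hy1]

/-- The tail, scaled by the distance to the end. -/
lemma far_tail_le {d U X y Z θ y₁ X₀ : ℝ} (hd : 0 < d) (hdX : d ≤ X + Z) (hZ : 0 ≤ Z) (hX : X₀ ≤ X) (hX₀ : 2 ≤ X₀) (hy₁ : 0 ≤ y₁)
    (hy : y₁ ≤ y) (hU : 4 ≤ U) (hdU : d + 1 ≤ U)
    (hθ : 2 * (X₀ + Z) * (X₀ + Z + 1) ≤ θ * ((X₀ + 1) ^ 2 + y₁ ^ 2) ^ 2) (hy1 : y₁ ≤ 1.05) :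
    2 * (d + 1) / ((X + 1) ^ 2 + y ^ 2) ^ 2 + 2 / U ^ 3 + 1 / (d * U ^ 2) ≤ (θ + 0.157) / d := by
  have hX1 : 2 ≤ X := hX₀.trans hX
  have h1 : 2 * (d + 1) / ((X + 1) ^ 2 + y ^ 2) ^ 2 ≤ θ / d := by
    rw [div_le_div_iff₀ (by positivity) hd]
    have k1 : 2 * (d + 1) * d ≤ 2 * (X + Z + 1) * (X + Z) := by gcongr
    refine k1.trans ?_
    have hs : 1 ≤ (X + 1) / (X₀ + 1) := by rw [one_le_div (by linarith)]; linarith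
    have hs' : (X + 1) / (X₀ + 1) * (X₀ + 1) = X + 1 := div_mul_cancel₀ _ (by linarith)
    set s := (X + 1) / (X₀ + 1) with hsdef
    have k2 : 2 * (X + Z + 1) * (X + Z) ≤ 2 * (X₀ + Z) * (X₀ + Z + 1) * s ^ 3 := by
      have h1 : X + Z + 1 ≤ (X₀ + Z + 1) * s := by nlinarith only [hs', hs, hZ]
      have h2 : X + Z ≤ (X₀ + Z) * s ^ 2 := by
        have : X ≤ X₀ * s ^ 2 := by
          rw [hsdef, div_pow, mul_div_assoc', le_div_iff₀ (by positivity)]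
          nlinarith only [mul_nonneg (sub_nonneg.2 hX) (show 0 ≤ X * X₀ - 1 by nlinarith only [hX1, hX₀])]
        nlinarith only [this, hs, hZ, mul_nonneg hZ (show 0 ≤ s ^ 2 - 1 by nlinarith only [hs])]
      calc 2 * (X + Z + 1) * (X + Z) ≤ 2 * ((X₀ + Z + 1) * s) * ((X₀ + Z) * s ^ 2) := by gcongr
        _ = _ := by ring
    refine k2.trans ?_
    have hθ0 : 0 ≤ θ := by
      by_contra! hc
      have : 0 < 2 * (X₀ + Z) * (X₀ + Z + 1) := by positivity
      nlinarith [show 0 < ((X₀ + 1) ^ 2 + y₁ ^ 2) ^ 2 by positivity]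
    calc 2 * (X₀ + Z) * (X₀ + Z + 1) * s ^ 3
        ≤ θ * ((X₀ + 1) ^ 2 + y₁ ^ 2) ^ 2 * s ^ 3 := by gcongr
      _ = θ * (((X₀ + 1) ^ 2 + y₁ ^ 2) ^ 2 * s ^ 3) := by ring
      _ ≤ θ * ((X + 1) ^ 2 + y₁ ^ 2) ^ 2 := by
        refine mul_le_mul_of_nonneg_left ?_ hθ0
        rw [← hs', mul_pow]
        have hq : 9 ≤ (X₀ + 1) ^ 2 := by nlinarith only [hX₀]
        have hY : y₁ ^ 2 ≤ 1.1025 := by nlinarith only [hy₁, hy1]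
        have hY0 : 0 ≤ y₁ ^ 2 := sq_nonneg _
        set q := (X₀ + 1) ^ 2
        set Y := y₁ ^ 2
        have hs3 : s ^ 2 ≤ s ^ 3 := by nlinarith only [hs, sq_nonneg s, mul_nonneg (sub_nonneg.2 hs) (sq_nonneg s)]
        have b1 : 9 * q * s ^ 3 ≤ q ^ 2 * s ^ 3 := by
          have : 9 * q ≤ q ^ 2 := by nlinarith only [hq]
          gcongr
        have b2 : 2 * q * Y * s ^ 2 ≤ 2.205 * q * s ^ 3 := by
          have : q * Y ≤ q * 1.1025 := by gcongr
          have h0 : 0 ≤ q := by linarith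
          nlinarith only [mul_le_mul this hs3 (by positivity) (by positivity)]
        have b3 : Y ^ 2 * (s ^ 2 + s + 1) ≤ 4 * s ^ 3 := by
          have l1 : Y ^ 2 ≤ 1.22 := by nlinarith only [hY, hY0]
          have l2 : s ^ 2 + s + 1 ≤ 3 * s ^ 3 := by nlinarith only [hs3, hs]
          nlinarith only [mul_le_mul l1 l2 (by positivity) (by norm_num), show 0 ≤ s ^ 3 by positivity]
        have b4 : 4 * s ^ 3 ≤ q * s ^ 3 := by gcongr; linarith
        have b5 : 0 ≤ q * s ^ 3 := by positivity
        nlinarith only [mul_nonneg (sub_nonneg.2 hs) (show 0 ≤ q ^ 2 * s ^ 3 - 2 * q * Y * s ^ 2 - Y ^ 2 * (s ^ 2 + s + 1) by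
          linarith)]
      _ ≤ θ * ((X + 1) ^ 2 + y ^ 2) ^ 2 := by gcongr
  have h2 : 2 / U ^ 3 + 1 / (d * U ^ 2) ≤ 0.157 / d := by
    have : 2 / U ^ 3 + 1 / (d * U ^ 2) = (2 * d + U) / U ^ 3 / d := by field_simp
    rw [this]
    gcongr
    rw [div_le_iff₀ (by positivity)]
    nlinarith only [hU, hdU, mul_nonneg (sub_nonneg.2 hU) (sub_nonneg.2 hU), mul_nonneg (mul_nonneg (sub_nonneg.2 hU) (sub_nonneg.2 hU)) (sub_nonneg.2 hU)]
  have : (θ + 0.157) / d = θ / d + 0.157 / d := by ring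
  linarith

lemma le_div_sqrt {d m c l : ℝ} (hm : 0 < m) (hm2 : m ^ 2 = 2 * d + 1) (hc : c ≤ d)
    (h : l ^ 2 * (2 * d + 1) ≤ (d - c) ^ 2) : l ≤ (d - c) / m := by
  rw [le_div_iff₀ hm]
  exact le_of_sq_le_sq (by rw [mul_pow, hm2]; exact h) (by linarith)

lemma far_sq_le {d y ξ : ℝ} (hd : 2 < d) (hy : 0 < y) (hyc : d ≤ 15 ∧ y ≤ 1.5 ∨ 15 < d ∧ 4 * y ≤ d ∧ ξ ≤ 0.3) :
    2 * y ^ 2 ≤ (d + 1) * (d + 2) := by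
  rcases hyc with ⟨-, h1⟩ | ⟨-, h1, -⟩
  · have : y ^ 2 ≤ 2.25 := by nlinarith only [hy, h1]
    nlinarith only [this, hd]
  · have h16 : (4 * y) ^ 2 ≤ d ^ 2 := by gcongr
    nlinarith only [h16, hd]

/-- The tail at points far from the ends. -/
lemma far_tail_le' {d U y ξ : ℝ} (hd : 15 < d) (hξ : ξ ≤ 0.3) (hU : d ≤ U) :
    2 * (d + 1) / ((d - ξ + 1) ^ 2 + y ^ 2) ^ 2 + 2 / U ^ 3 + 1 / (d * U ^ 2) ≤ 6 / d ^ 3 := by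
  have hd0 : 0 < d := by linarith
  have l1 : 2 * (d + 1) / ((d - ξ + 1) ^ 2 + y ^ 2) ^ 2 ≤ 2 * (1.1 * d) / (d ^ 2) ^ 2 := by
    gcongr
    · linarith
    · nlinarith only [sq_nonneg y, hξ, hd]
  have l2 : 2 / U ^ 3 ≤ 2 / d ^ 3 := by gcongr
  have l3 : 1 / (d * U ^ 2) ≤ 1 / (d * d ^ 2) := by gcongr
  have e : 2 * (1.1 * d) / (d ^ 2) ^ 2 + 2 / d ^ 3 + 1 / (d * d ^ 2) = 5.2 / d ^ 3 := by field_simp; ring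
  have l4 : 5.2 / d ^ 3 ≤ 6 / d ^ 3 := by gcongr; norm_num
  linarith

lemma far_cos_nonpos (h : ArcPoint n x₀ ρ ξ y) (he : (x₀ + ξ) ^ 2 + y ^ 2 < n ^ 2) (hn : 3 ≤ n)
    (hd : 2 < n - x₀) {j : ℤ} {m : ℝ} (hm : 0 < m) (hm2 : m ^ 2 = 2 * (n - x₀) + 1)
    (ha : 0.38 / m ≤ stripRe j (x₀ + ξ) y) (hX : 2 ≤ n - x₀ - ξ) (hC : stripCos j (x₀ + ξ) ≤ 0) :
    alt j * ((⟨ρ - ξ, -y⟩ : ℂ) * altSum₂ n ⟨x₀ + ξ, y⟩).im < 0 := by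
  have hx0 := h.left_pos
  have hξ := h.xi_pos
  have hy := h.im_pos
  have hn' : (3 : ℝ) ≤ n := by exact_mod_cast hn
  have hd0 : 0 < n - x₀ := by linarith
  have hS := stripSin_pos_of_re hy (lt_of_lt_of_le (by positivity) ha)
  obtain ⟨hξ1, hyc⟩ := h.far_im_le he hd hm hm2 ha
  have hyd := far_sq_le hd hy hyc
  have key : ∀ {β Z θ : ℝ}, 0 ≤ β → β * y ≤ stripCot j (x₀ + ξ) y → ξ ≤ Z → Z + 0.16 ≤ n - x₀ →
      2 * (n - x₀ + 1) / ((n - x₀ - ξ + 1) ^ 2 + y ^ 2) ^ 2 + 2 / (n + x₀ + 1) ^ 3 +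
      1 / ((n - x₀) * (n + x₀ + 1) ^ 2) ≤ θ / (n - x₀) →
      θ < β * 0.38 * ((n - x₀ - (Z + 0.16)) / m) →
      alt j * ((⟨ρ - ξ, -y⟩ : ℂ) * altSum₂ n ⟨x₀ + ξ, y⟩).im < 0 := by
    intro β Z θ c1 c2 c3 c4 c5 c6
    refine h.im_neg_of_cos_nonpos he hyd (by linarith) j hS hC (by positivity) ha c1 c2 c3 c4 c5 ?_
    rw [div_mul_cancel₀ _ hd0.ne']
    refine c6.trans_le (le_of_eq ?_)
    field_simp; ring
  rcases le_or_gt y 1 with hy1 | hy1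
  · have hξ2 : ξ ≤ 0.27 := h.xi_le_of_sq_le he (Y := 1) (by linarith) (by nlinarith only [hy, hy1])
    refine key (β := 2.9) (Z := 0.27) (by norm_num) (stripCot_ge_mul hy (by linarith)) hξ2 (by linarith)
      (far_tail_le (θ := 0.184) (y₁ := 0) (X₀ := 2) (Z := 0.27) hd0 (by linarith) (by norm_num) hX (by norm_num) le_rfl hy.le
        (by linarith) (by linarith) (by norm_num) (by norm_num)) ?_
    have := le_div_sqrt (c := 0.27 + 0.16) (l := 0.6) hm hm2 (by linarith) (by nlinarith only [hd])
    linarith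
  · have hB := stripCot_ge_of_one_le (j := j) (x := x₀ + ξ) hy1.le
    rcases hyc with ⟨h1, h2⟩ | ⟨h1, h2, h3⟩
    · refine key (β := 2.033) (Z := 0.68) (by norm_num) (by linarith) hξ1 (by linarith)
        (far_tail_le (θ := 0.2) (y₁ := 1) (X₀ := 2) (Z := 0.68) hd0 (by linarith) (by norm_num) hX (by norm_num) (by norm_num) hy1.le
          (by linarith) (by linarith) (by norm_num) (by norm_num)) ?_
      have := le_div_sqrt (c := 0.68 + 0.16) (l := 0.517) hm hm2 (by linarith) (by nlinarith only [hd])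
      linarith
    · have hm5 : 5.567 ≤ m := le_of_sq_le_sq (by linarith) hm.le
      refine key (β := 12.2 / (n - x₀)) (Z := 0.3) (θ := 6 / (n - x₀) ^ 2) (by positivity) ?_ h3 (by linarith)
        ((far_tail_le' h1 h3 (by linarith)).trans (le_of_eq (by field_simp))) ?_
      · refine le_trans ?_ hB
        rw [div_mul_eq_mul_div, div_le_iff₀ hd0]; linarith
      · have k1 := le_div_sqrt (c := 0.3 + 0.16) (l := 2) hm hm2 (by linarith) (by nlinarith only [h1])
        refine lt_of_lt_of_le ?_ (mul_le_mul_of_nonneg_left k1 (by positivity))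
        rw [show 12.2 / (n - x₀) * 0.38 * 2 = 12.2 * 0.38 * 2 * (n - x₀) / (n - x₀) ^ 2 by field_simp]
        gcongr
        linarith

set_option maxHeartbeats 1000000 in
lemma far_cos_pos (h : ArcPoint n x₀ ρ ξ y) (he : (x₀ + ξ) ^ 2 + y ^ 2 < n ^ 2) (hn : 3 ≤ n)
    (hd : 2.5 < n - x₀) {j : ℤ} (hj' : j = n - 3 ∧ n - x₀ ≤ 3 ∨ 3.5 < n - x₀) {m κ : ℝ} (hm : 0 < m)
    (hm2 : m ^ 2 = 2 * (n - x₀) + 1) (hκ : 0.88 ≤ κ)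
    (hφ : -(alt j * (altSum n ⟨x₀ + ξ, y⟩).re) < alt j * alt n *
        (1 / (2 * (n - x₀ + 1 / 2)) - 1 / (2 * (n + x₀ + 1 / 2))) - κ / m)
    (ha : 0.38 / m ≤ stripRe j (x₀ + ξ) y) (hX : 2.5 ≤ n - x₀ - ξ) (hX' : 3.5 < n - x₀ → 3.5 ≤ n - x₀ - ξ)
    (hC : 0 ≤ stripCos j (x₀ + ξ)) :
    alt j * ((⟨ρ - ξ, -y⟩ : ℂ) * altSum₂ n ⟨x₀ + ξ, y⟩).im < 0 := by
  have hx0 := h.left_pos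
  have hξ := h.xi_pos
  have hy := h.im_pos
  have hn' : (3 : ℝ) ≤ n := by exact_mod_cast hn
  have hd0 : 0 < n - x₀ := by linarith
  have hρ := h.rho_pos
  have hdρ := h.le_rho
  obtain ⟨hξ1, hyc⟩ := h.far_im_le he (by linarith) hm hm2 ha
  have hyd := far_sq_le (by linarith) hy hyc
  have hC1 := stripCos_le_one j (x₀ + ξ)
  obtain ⟨-, b2, -, -, -, -⟩ := h.early_bounds he
  set w := ρ / m with hw
  have hw0 : 0 < w := by positivity
  have hwl : ∀ {l : ℝ}, 0 ≤ l → l ^ 2 * (2 * (n - x₀) + 1) ≤ (n - x₀) ^ 2 → l ≤ w ∧ l * (ρ / (n - x₀)) ≤ w := by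
    intro l hl0 hl
    have h1 := le_div_sqrt (c := 0) (l := l) hm hm2 hd0.le (by linarith)
    rw [sub_zero] at h1
    constructor
    · refine h1.trans ?_
      rw [hw]; gcongr
    · calc l * (ρ / (n - x₀)) ≤ (n - x₀) / m * (ρ / (n - x₀)) := by gcongr
        _ = w := by rw [hw]; field_simp
  have hxi : ∀ {c : ℝ}, 0 ≤ c → ξ ≤ c * (n - x₀) → ∀ {A : ℝ}, 0 ≤ A → (1 - c) * A * w ≤ (ρ - ξ) * (A / m) := by
    intro c hc0 hc A hA
    have : (1 - c) * ρ ≤ ρ - ξ := by nlinarith only [mul_le_mul_of_nonneg_left hdρ hc0, hc]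
    calc (1 - c) * A * w = (1 - c) * ρ * (A / m) := by rw [hw]; ring
      _ ≤ _ := by gcongr
  have hw1 := hwl (l := 1.02) (by norm_num) (by nlinarith only [hd])
  have htail : ∀ {θ Z X₀ y₁ : ℝ}, n - x₀ ≤ n - x₀ - ξ + Z → 0 ≤ Z → X₀ ≤ n - x₀ - ξ → 2 ≤ X₀ → 0 ≤ y₁ → y₁ ≤ y →
      2 * (X₀ + Z) * (X₀ + Z + 1) ≤ θ * ((X₀ + 1) ^ 2 + y₁ ^ 2) ^ 2 → y₁ ≤ 1.05 →
      arcTail (n - x₀) (n + x₀ + 1) ρ ξ y ≤ (θ + 0.157) * (ρ / (n - x₀)) := by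
    intro θ Z X₀ y₁ c1 c2 c3 c4 c5 c6 c7 c8
    refine (h.arcTail_le (far_tail_le hd0 c1 c2 c3 c4 c5 c6 (by linarith) (by linarith only [hx0]) c7 c8)).trans (le_of_eq ?_)
    ring
  have hρd : 0 < ρ / (n - x₀) := by positivity
  rcases le_or_gt y 1.05 with hy1 | hy1
  · have hA := h.far_stripRe_ge' he hn hd hj' hm hm2 hκ hφ hy1
    rcases le_or_gt y 0.6366 with hy2 | hy2
    · have hξ2 : ξ ≤ 0.083 := h.xi_le_of_sq_le he (Y := 0.4053) (by linarith only [hd, hy, hy2]) (by nlinarith only [hy, hy2])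
      have k1 := hxi (c := 0.0332) (by norm_num) (by linarith only [hd, hξ2]) (A := 0.74) (by norm_num)
      have k2 := htail (θ := 0.124) (Z := 0.083) (X₀ := 2.5) (y₁ := 0) (by linarith only [hξ2]) (by norm_num) hX (by norm_num) le_rfl hy.le
        (by norm_num) (by norm_num)
      refine h.im_neg_of_cos_nonneg' he hyd (by linarith only [hd, hξ, hξ2]) j hC (r := 0.7297) (c := 1) (by positivity) hA hy2 (by norm_num)
        (by linarith [hw1.1]) hC1 le_rfl ?_
      linarith [hw1.1, hw1.2]
    · have hξ2 : ξ ≤ 0.232 := h.xi_le_of_sq_le he (Y := 1.1025) (by linarith only [hX, hξ, hξ1]) (by nlinarith only [hy, hy1])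
      have k1 := hxi (c := 0.0928) (by norm_num) (by linarith only [hd, hξ2]) (A := 0.74) (by norm_num)
      have k2 := htail (θ := 0.137) (Z := 0.232) (X₀ := 2.5) (y₁ := 0) (by linarith only [hξ2]) (by norm_num) hX (by norm_num) le_rfl hy.le
        (by norm_num) (by norm_num)
      refine h.im_neg_of_cos_nonneg he hyd (by linarith only [hd, hξ, hξ2]) j hC (c := 1) (by positivity) hA (by norm_num)
        (stripCot_ge_mul hy hy1) (pi_div_sinh_le (y₁ := 0.6366) (ν := 0.5556) (by norm_num) hy2.le hy (by norm_num)) hC1 ?_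
      linarith [hw1.1, hw1.2]
  · have hν := pi_div_sinh_le (y := y) (y₁ := 1.05) (ν := 0.2633) (by norm_num) hy1.le hy (by norm_num)
    have hB := stripCot_ge_of_one_le (j := j) (x := x₀ + ξ) (y := y) (by linarith)
    rcases hyc with ⟨h1, h2⟩ | ⟨h1, h2, h3⟩
    · have hyy : y ^ 2 ≤ 2.25 := by nlinarith only [hy, h2]
      have hB' : 2.033 * y ≤ stripCot j (x₀ + ξ) y := by linarith
      rcases hj' with ⟨hj, hd3⟩ | hd3
      · have hξ2 : ξ ≤ 0.5 := h.xi_le_of_sq_le he (Y := 2.25) (by linarith only [hX, hξ]) hyy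
        have k2 := htail (θ := 0.135) (Z := 0.5) (X₀ := 2.5) (y₁ := 1.05) (by linarith only [hX, hd3]) (by norm_num) hX (by norm_num) (by norm_num) hy1.le
          (by norm_num) (by norm_num)
        rcases Nat.lt_or_ge n 4 with hn4 | hn4
        · have hn3 : (n : ℝ) = 3 := by
            have : n = 3 := by omega
            rw [this]; norm_num
          have hrad := h.radius
          rw [hn3] at hrad
          have hρ8 : 8.75 ≤ ρ := by nlinarith only [hrad, hx0, hρ, show x₀ < 0.5 by linarith]
          have hmle : m ≤ 2.6458 := le_of_sq_le_sq (by linarith) (by norm_num)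
          have hw3 : 3 ≤ w := by rw [hw, le_div_iff₀ hm]; linarith
          have k1 : 0.94 * 0.38 * w ≤ (ρ - ξ) * (0.38 / m) := by
            calc 0.94 * 0.38 * w = 0.94 * ρ * (0.38 / m) := by rw [hw]; ring
              _ ≤ _ := by gcongr; linarith
          refine h.im_neg_of_cos_nonneg he hyd (by linarith) j hC (c := 1) (by positivity) ha (by norm_num) hB' hν hC1 ?_
          linarith [hw1.2]
        · have hn4' : (4 : ℝ) ≤ n := by exact_mod_cast hn4
          have hε := alt_mul_alt_of_sub_three hj
          have hA : 0.5 / m ≤ stripRe j (x₀ + ξ) y := by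
            obtain ⟨-, g1⟩ := h.stripRe_gt_of_phi_lt he (by linarith) j (κ := κ / m) (G := 1 / (2 * 5.5))
              (fun h => by rw [hε] at h; norm_num at h)
              (fun _ => (endLeft_le_half (by positivity) hξ.le hy).trans (by gcongr; linarith only [hd3, hn4'])) hφ
            have g1 := g1 (by linarith)
            have l1 : 3 / (8 * (n - (x₀ + ξ) + 1 / 2 + y) ^ 2) ≤ 3 / (8 * 3 ^ 2) := by
              gcongr; linarith
            have l2 : 1 / (8 * (n + x₀ + 1 / 2) ^ 2) ≤ 1 / (8 * 5.5 ^ 2) := by gcongr; linarith only [hd3, hn4']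
            have hmle : m ≤ 2.6458 := le_of_sq_le_sq (by linarith only [hm2, hX, hξ, hd3]) (by norm_num)
            have l4 : 0.137 ≤ 0.38 / m := by
              rw [le_div_iff₀ hm]; linarith only [hX, hξ, hd3, hmle]
            have hκm : 0.88 / m ≤ κ / m := by gcongr
            have l5 : 0.88 / m = 0.5 / m + 0.38 / m := by ring
            linarith only [hX, hξ, hd3, g1, l1, l2, l4, hκm, l5]
          have k1 := hxi (c := 0.2) (by norm_num) (by linarith only [hX, hξ, hd3]) (A := 0.5) (by norm_num)
          refine h.im_neg_of_cos_nonneg he hyd (by linarith only [hX, hξ, hd3]) j hC (c := 1) (by positivity) hA (by norm_num) hB' hν hC1 ?_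
          linarith [hw1.1, hw1.2]
      · have hξ2 : ξ ≤ 0.34 := h.xi_le_of_sq_le he (Y := 2.25) (by linarith only [hξ, hξ1, hd3]) hyy
        have hw2 := hwl (l := 1.237) (by norm_num) (by nlinarith only [hd3])
        have k1 := hxi (c := 0.0972) (by norm_num) (by linarith only [hξ, hd3, hξ2]) (A := 0.38) (by norm_num)
        have k2 := htail (θ := 0.082) (Z := 0.34) (X₀ := 3.5) (y₁ := 1.05) (by linarith only [hξ2]) (by norm_num) (hX' hd3) (by norm_num) (by norm_num) hy1.le
          (by norm_num) (by norm_num)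
        refine h.im_neg_of_cos_nonneg he hyd (by linarith only [hξ, hd3, hξ2]) j hC (c := 1) (by positivity) ha (by norm_num) hB' hν hC1 ?_
        linarith [hw2.1, hw2.2]
    · have hw2 := hwl (l := 2.69) (by norm_num) (by nlinarith only [h1])
      have k1 := hxi (c := 0.02) (by norm_num) (by linarith only [h1, h3]) (A := 0.38) (by norm_num)
      have k2 := h.arcTail_le (far_tail_le' (U := n + x₀ + 1) (y := y) h1 h3 (by linarith only [hx0, hξ, h3]))
      refine h.im_neg_of_cos_nonneg he hyd (by linarith only [hξ, h1, h3]) j hC (c := 1) (β := 12.2 / (n - x₀)) (by positivity) ha (by positivity) ?_ hν hC1 ?_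
      · refine le_trans ?_ hB
        rw [div_mul_eq_mul_div, div_le_iff₀ hd0]; linarith only [h2]
      · have hm5 : 5.567 ≤ m := le_of_sq_le_sq (by linarith only [hm2, hξ, h1, h3]) hm.le
        have l1 : 0.27 * w ≤ (ρ - ξ) * (0.38 / m) - 0.2633 * 1 := by linarith [hw2.1]
        refine k2.trans_lt (lt_of_lt_of_le ?_ (mul_le_mul_of_nonneg_left l1 (by positivity)))
        have l2 : ρ * (6 / (n - x₀) ^ 3) = 6 / (n - x₀) ^ 2 * (ρ / (n - x₀)) := by field_simp
        have l3 : 12.2 / (n - x₀) * (0.27 * w) = 12.2 * 0.27 / m * (ρ / (n - x₀)) := by rw [hw]; field_simp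
        rw [l2, l3]
        refine mul_lt_mul_of_pos_right ?_ hρd
        rw [div_lt_div_iff₀ (by positivity) hm]
        nlinarith only [hm2, h1, hm5, hm]

/-- Below the threshold the first coordinate moves in one direction, far from the ends. -/
lemma im_neg_of_phi_lt_far (h : ArcPoint n x₀ ρ ξ y) (he : (x₀ + ξ) ^ 2 + y ^ 2 < n ^ 2)
    (hd : 2 < n - x₀) {j : ℤ} (hj : j ≤ x₀) (hj' : x₀ < j + 1) {m κ : ℝ} (hm : 0 < m)
    (hm2 : m ^ 2 = 2 * (n - x₀) + 1) (hκ : 0.88 ≤ κ)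
    (hφ : -(alt j * (altSum n ⟨x₀ + ξ, y⟩).re) < alt j * alt n *
        (1 / (2 * (n - x₀ + 1 / 2)) - 1 / (2 * (n + x₀ + 1 / 2))) - κ / m) :
    alt j * ((⟨ρ - ξ, -y⟩ : ℂ) * altSum₂ n ⟨x₀ + ξ, y⟩).im < 0 := by
  have hx0 := h.left_pos
  have hξ := h.xi_pos
  have hn : 3 ≤ n := by
    have : ((2 : ℕ) : ℝ) < n := by push_cast; linarith
    exact_mod_cast this
  have ha := h.far_stripRe_ge he hn hd hj hj' hm hm2 hκ hφ
  have hS := stripSin_pos_of_re h.im_pos (lt_of_lt_of_le (by positivity) ha)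
  have hξ1 := (h.far_im_le he hd hm hm2 ha).1
  have hx := lt_of_stripSin_pos hS (by linarith)
  have hjn : j + 3 ≤ n := by
    have : (j : ℝ) + 2 < n := by linarith
    have : j + 2 < n := by exact_mod_cast this
    omega
  have hjn' : (j : ℝ) + 3 ≤ n := by exact_mod_cast hjn
  by_cases hC : stripCos j (x₀ + ξ) ≤ 0
  · exact h.far_cos_nonpos he hn hd hm hm2 ha (by linarith) hC
  · have hx' : x₀ + ξ < j + 1 / 2 := by
      by_contra! hc
      exact hC (stripCos_nonpos hc hx.le)
    refine h.far_cos_pos he hn (by linarith) ?_ hm hm2 hκ hφ ha (by linarith) (fun h35 => ?_) (not_le.1 hC).le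
    · rcases hjn.eq_or_lt with h1 | h1
      · left
        have h1' : (j : ℝ) + 3 = n := by exact_mod_cast h1
        exact ⟨by omega, by linarith⟩
      · right
        have h2 : j + 4 ≤ n := by omega
        have h2' : (j : ℝ) + 4 ≤ n := by exact_mod_cast h2
        linarith
    · have h1 : (n : ℝ) > j + 3 := by linarith
      have h1' : (n : ℤ) > j + 3 := by exact_mod_cast h1
      have h2 : j + 4 ≤ n := by omega
      have h2' : (j : ℝ) + 4 ≤ n := by exact_mod_cast h2
      linarith

end ArcPoint

lemma re_altSum (n : ℕ) (x y : ℝ) : (altSum n ⟨x, y⟩).re =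
    ∑ k ∈ Finset.Icc (-(n : ℤ)) n, alt k * ((x - k) / ((x - k) ^ 2 + y ^ 2)) := by
  rw [altSum, Complex.re_sum]
  refine Finset.sum_congr rfl fun k _ => ?_
  rw [mul_div_assoc', Complex.div_re, Complex.normSq_apply]
  simp
  ring

lemma alt_mul_re_altSum (n : ℕ) (x y : ℝ) : alt n * (altSum n ⟨x, y⟩).re =
    ∑ i ∈ Finset.range (2 * n + 1), (-1) ^ i * ((x - n + i) / ((x - n + i) ^ 2 + y ^ 2)) := by
  rw [re_altSum, alt_mul_sum_Icc n (fun k : ℤ => (x - k) / ((x - k) ^ 2 + y ^ 2))]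
  refine Finset.sum_congr rfl fun i _ => ?_
  push_cast
  rw [show x - (n - (i : ℝ)) = x - n + i by ring]

lemma div_sq_add_sq_succ_le {p y : ℝ} (hp : 0 < p) (hy : y ^ 2 ≤ p ^ 2 + p) :
    (p + 1) / ((p + 1) ^ 2 + y ^ 2) ≤ p / (p ^ 2 + y ^ 2) := by
  rw [div_le_div_iff₀ (by positivity) (by positivity)]
  nlinarith

lemma alt_mul_alt_of_sub_one {n : ℕ} {j : ℤ} (h : j = n - 1) : alt j * alt n = -1 := by
  have := alt_mul_self (n : ℤ)
  rw [h, alt_sub, mul_right_comm, this]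
  simp [alt]

lemma sin_sq_slice {j : ℤ} {x s u : ℝ} (h0 : (j : ℝ) ≤ x) (hs : x - j ≤ s) (hs' : s ≤ 1 / 2) (hu0 : 0 ≤ u)
    (hu : u ≤ 3.1415 * (1 / 2 - s)) (hu2 : u ≤ 1) : stripSin j x ^ 2 ≤ 1 - (u - u ^ 3 / 6) ^ 2 := by
  have h1 : u - u ^ 3 / 6 ≤ stripCos j x := by
    have hπ := Real.pi_gt_d4
    have e : stripCos j x = Real.sin (Real.pi * (1 / 2 - (x - j))) := by
      rw [stripCos, ← Real.sin_pi_div_two_sub]; congr 1; ring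
    have hmono : Real.sin u ≤ Real.sin (Real.pi * (1 / 2 - (x - j))) := by
      apply Real.sin_le_sin_of_le_of_le_pi_div_two
      · linarith
      · nlinarith only [h0, hπ]
      · nlinarith
    rw [e]
    refine le_trans ?_ hmono
    have := Real.sin_ge_sub_cube hu0
    linarith
  have h2 := stripSin_sq_add j x
  have h3 : 0 ≤ u - u ^ 3 / 6 := by nlinarith [mul_nonneg hu0 hu0, pow_nonneg hu0 3]
  nlinarith [pow_le_pow_left₀ h3 h1 2]

namespace ArcPoint
variable {n : ℕ} {x₀ ρ ξ y : ℝ}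

lemma turn_slice (h : ArcPoint n x₀ ρ ξ y) (he : (x₀ + ξ) ^ 2 + y ^ 2 < n ^ 2) (hn : 2 ≤ n)
    (hd : 0.95 ≤ n - x₀) (hd1 : n - x₀ ≤ 1) (hb : 0 ≤ ((⟨ρ - ξ, -y⟩ : ℂ) * fullSum₂ n ⟨x₀ + ξ, y⟩).re)
    {j : ℤ} (hj : j = n - 1) (hsc : 0 ≤ stripSin j (x₀ + ξ) * stripCos j (x₀ + ξ)) {a b Y u q : ℝ}
    (hab : a ≤ ξ ∧ ξ ≤ b)
    (hnum : 0 ≤ a ∧ a ≤ 0.5 ∧ b ≤ 0.45 ∧ Y = a * (1.9 - a) ∧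
      q = 9.869 * Y + 32.46 * Y ^ 2 + 42.7 * Y ^ 3 + 30.1 * Y ^ 4 + 13.2 * Y ^ 5 ∧
      0 ≤ u ∧ u ≤ 3.1415 * (0.45 - b) ∧ u ≤ 1 ∧
      (1 - (u - u ^ 3 / 6) ^ 2) * (1 + 2 * q) < q + 0.044 * q ^ 2) : False := by
  obtain ⟨h1, h2, h3, hY, hq, h4, h5, h6, h7⟩ := hnum
  have hjr : (j : ℝ) = n - 1 := by rw [hj]; push_cast; ring
  have hξ := h.xi_pos
  have hY0 : 0 ≤ Y := by rw [hY]; nlinarith only [h1, h2]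
  have hq0 : 0 ≤ q := by rw [hq]; positivity
  have hyY : Y ≤ y ^ 2 := by
    have := h.xi_mul_le
    have hξ1 : ξ ≤ 0.45 := hab.2.trans h3
    nlinarith only [this, hab.1, hab.2, h1, h2, hY, hd, hξ1, h3, mul_nonneg hξ.le (sub_nonneg.2 hd)]
  have hsq : q ≤ Real.sinh (Real.pi * y) ^ 2 := by
    refine le_trans ?_ (sinh_sq_ge y)
    have e : ∀ k : ℕ, Y ^ k ≤ y ^ (2 * k) := fun k => by rw [pow_mul]; gcongr
    have e1 := e 1; have e2 := e 2; have e3 := e 3; have e4 := e 4; have e5 := e 5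
    norm_num at e1 e2 e3 e4 e5
    rw [hq]; linarith
  have key := h.stripSin_ge_of_turn he hn hd hb j hsc hq0 hsq
  have hs := sin_sq_slice (j := j) (x := x₀ + ξ) (s := b + 0.05) (u := u) (by linarith) (by linarith [hab.2])
    (by linarith only [h3]) h4 (by linarith only [h5]) h6
  have hc : (0.044 : ℝ) ≤ 0.156 / (2.14 * (n - x₀) + 1.39) := by
    rw [le_div_iff₀ (by linarith)]; linarith
  have := mul_le_mul_of_nonneg_right hc (sq_nonneg q)
  have := mul_le_mul_of_nonneg_right hs (show 0 ≤ 1 + 2 * q by linarith)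
  linarith

lemma phi_lt_of_turn_one (h : ArcPoint n x₀ ρ ξ y) (he : (x₀ + ξ) ^ 2 + y ^ 2 < n ^ 2) (hn : 2 ≤ n)
    (hd : 0.95 ≤ n - x₀) (hd1 : n - x₀ ≤ 1) (hb : 0 ≤ ((⟨ρ - ξ, -y⟩ : ℂ) * fullSum₂ n ⟨x₀ + ξ, y⟩).re)
    {j : ℤ} (hj : j = n - 1) : -(alt j * (altSum n ⟨x₀ + ξ, y⟩).re) < -5 := by
  have hjr : (j : ℝ) = n - 1 := by rw [hj]; push_cast; ring
  have hn' : (2 : ℝ) ≤ n := by exact_mod_cast hn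
  have hy := h.im_pos
  have hξ := h.xi_pos
  have hy2 := h.sq_le_of_turn he hn hd hb
  have hξ1 : ξ ≤ 0.34 := h.xi_le_of_sq_le he (Y := 0.53) (by nlinarith only [hd]) (by linarith)
  have hπ := Real.pi_gt_d4; have hπ' := Real.pi_lt_d4
  have hS : 0 < stripSin j (x₀ + ξ) := stripSin_pos (by linarith) (by linarith)
  have hC : 0 ≤ stripCos j (x₀ + ξ) := by
    rw [stripCos]
    exact Real.cos_nonneg_of_neg_pi_div_two_le_of_le (by nlinarith) (by nlinarith)
  have hsc := mul_nonneg hS.le hC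
  have hξ2 : ξ ≤ 0.15 := by
    by_contra hc
    push Not at hc
    rcases le_total ξ 0.22 with h1 | h1
    · exact h.turn_slice he hn hd hd1 hb hj hsc ⟨hc.le, h1⟩ (u := 0.7225)
        ⟨by norm_num, by norm_num, by norm_num, rfl, rfl, by norm_num, by norm_num, by norm_num, by norm_num⟩
    rcases le_total ξ 0.26 with h2 | h2
    · exact h.turn_slice he hn hd hd1 hb hj hsc ⟨h1, h2⟩ (u := 0.596)
        ⟨by norm_num, by norm_num, by norm_num, rfl, rfl, by norm_num, by norm_num, by norm_num, by norm_num⟩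
    rcases le_total ξ 0.29 with h3 | h3
    · exact h.turn_slice he hn hd hd1 hb hj hsc ⟨h2, h3⟩ (u := 0.502)
        ⟨by norm_num, by norm_num, by norm_num, rfl, rfl, by norm_num, by norm_num, by norm_num, by norm_num⟩
    rcases le_total ξ 0.31 with h4 | h4
    · exact h.turn_slice he hn hd hd1 hb hj hsc ⟨h3, h4⟩ (u := 0.439)
        ⟨by norm_num, by norm_num, by norm_num, rfl, rfl, by norm_num, by norm_num, by norm_num, by norm_num⟩
    · exact h.turn_slice he hn hd hd1 hb hj hsc ⟨h4, hξ1⟩ (u := 0.345)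
        ⟨by norm_num, by norm_num, by norm_num, rfl, rfl, by norm_num, by norm_num, by norm_num, by norm_num⟩
  have hS2 : stripSin j (x₀ + ξ) ^ 2 ≤ 9.86961 * (ξ + 0.05) ^ 2 := by
    have e : stripSin j (x₀ + ξ) ≤ Real.pi * (ξ + 0.05) := by
      rw [stripSin]
      refine (Real.sin_le (by nlinarith only [hd1, hjr, hπ, hξ, hξ1])).trans ?_
      have : x₀ + ξ - j ≤ ξ + 0.05 := by linarith
      gcongr
    have := pow_le_pow_left₀ hS.le e 2
    rw [mul_pow] at this
    nlinarith [pi_sq_bounds.2, sq_nonneg (ξ + 0.05)]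
  have hξ3 : ξ ≤ 0.003 := by
    by_contra hc
    push Not at hc
    have hY : 1.75 * ξ ≤ y ^ 2 := by nlinarith [h.xi_mul_le]
    have hq : 17.27 * ξ ≤ Real.sinh (Real.pi * y) ^ 2 := by
      have := sinh_sq_ge y
      have : 0 ≤ 32.46 * y ^ 4 + 42.7 * y ^ 6 + 30.1 * y ^ 8 + 13.2 * y ^ 10 := by positivity
      linarith
    have key := h.stripSin_ge_of_turn he hn hd hb j hsc (by positivity) hq
    have hc' : 0 ≤ 0.156 / (2.14 * (n - x₀) + 1.39) * (17.27 * ξ) ^ 2 := by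
      have : 0 < 2.14 * (n - x₀) + 1.39 := by linarith only [hd, hπ, hπ']
      positivity
    have k1 := mul_le_mul_of_nonneg_right hS2 (show 0 ≤ 1 + 2 * (17.27 * ξ) by linarith only [hξ, hπ, hπ'])
    nlinarith only [key, hc', k1, hc, hξ2, mul_nonneg (sub_nonneg.2 hc.le) (sub_nonneg.2 hξ2),
      mul_nonneg hξ.le (mul_nonneg (sub_nonneg.2 hc.le) (sub_nonneg.2 hξ2))]
  have hS3 : stripSin j (x₀ + ξ) ^ 2 ≤ 0.0278 := hS2.trans (by nlinarith only [hξ3, hξ])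
  have key := h.stripSin_ge_of_turn he hn hd hb j hsc (sq_nonneg _) le_rfl
  set Q := Real.sinh (Real.pi * y) ^ 2 with hQ
  have hQ0 : 0 ≤ Q := sq_nonneg _
  have hc' : 0 ≤ 0.156 / (2.14 * (n - x₀) + 1.39) * Q ^ 2 := by
    have : 0 < 2.14 * (n - x₀) + 1.39 := by linarith
    positivity
  have hQ1 : Q ≤ 0.0296 := by
    nlinarith only [key, hc', hQ0, hS3, mul_le_mul_of_nonneg_right hS3 hQ0]
  have hD := stripDen_pos j (x₀ + ξ) hy
  have hD1 : stripDen j (x₀ + ξ) y ≤ 0.058 := by rw [stripDen]; linarith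
  have e1 := stripRe_sq_add j (x₀ + ξ) hy
  have e2 := stripRe_sq_sub j (x₀ + ξ) hy
  have ha0 := stripRe_pos hy hS
  have ha : 8 ≤ stripRe j (x₀ + ξ) y := by
    have k1 : 0 ≤ (stripRe j (x₀ + ξ) y ^ 2 - stripIm j (x₀ + ξ) y ^ 2) * stripDen j (x₀ + ξ) y ^ 2 := by
      rw [e2]
      have : 0 ≤ stripSin j (x₀ + ξ) ^ 2 * (1 + 2 * Q) - Q := by linarith only [key, hc']
      positivity
    have k2 : 0 ≤ stripRe j (x₀ + ξ) y ^ 2 - stripIm j (x₀ + ξ) y ^ 2 :=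
      nonneg_of_mul_nonneg_left k1 (by positivity)
    have k3 := mul_nonneg k2 hD.le
    have k4 := pi_sq_bounds.1
    have k5 : 9.8696 ≤ 2 * stripRe j (x₀ + ξ) y ^ 2 * 0.058 := by
      nlinarith only [k3, k4, e1, mul_le_mul_of_nonneg_left hD1 (sq_nonneg (stripRe j (x₀ + ξ) y))]
    by_contra hc
    push Not at hc
    nlinarith only [k5, hc, ha0]
  have hb' := h.early_bounds he
  have hε := alt_mul_alt_of_sub_one hj
  have hphi := h.phi_le he hd j (G := 1 / (2 * (n - x₀) + 1)) (fun h1 => by rw [hε] at h1; norm_num at h1)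
    (fun _ => endRight_le_inv (by linarith only [hd, hξ, hξ3]) (by linarith only [hd, hξ, hξ3]))
  rw [hε] at hphi
  have hx0 := h.left_pos
  have hX : 0 < n - (x₀ + ξ) := by linarith [hb'.2.2.2.1]
  have t1 : 1 / (8 * (n - (x₀ + ξ) + 1 / 2) ^ 2) ≤ 0.5 := by
    rw [div_le_iff₀ (by positivity)]; nlinarith only [hX]
  have t2 : 1 / (8 * (n + x₀ + 1 / 2) ^ 2) ≤ 0.5 := by
    rw [div_le_iff₀ (by positivity)]; nlinarith only [hx0, hn']
  have t3 : 1 / (2 * (n + x₀ + 1 / 2)) ≤ 0.5 := by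
    rw [div_le_iff₀ (by positivity)]; linarith only [hd1, hn', hξ, hξ3]
  have t4 : 1 / (2 * (n - x₀ + 1 / 2)) = 1 / (2 * (n - x₀) + 1) := by congr 1; ring
  linarith only [hξ, hξ3, ha, hphi, t1, t2, t3, t4]

lemma im_neg_of_phi_lt_one (h : ArcPoint n x₀ ρ ξ y) (he : (x₀ + ξ) ^ 2 + y ^ 2 < n ^ 2) (hn : 2 ≤ n)
    (hd : 0.95 ≤ n - x₀) (hd1 : n - x₀ ≤ 1) {j : ℤ} (hj : j = n - 1)
    (hφ : -(alt j * (altSum n ⟨x₀ + ξ, y⟩).re) < -5) :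
    alt j * ((⟨ρ - ξ, -y⟩ : ℂ) * altSum₂ n ⟨x₀ + ξ, y⟩).im < 0 := by
  have hn' : (2 : ℝ) ≤ n := by exact_mod_cast hn
  have hy := h.im_pos
  have hξ := h.xi_pos
  have hξ' := h.xi_lt
  have hρ := h.rho_pos
  have hρd := h.le_rho
  have hr' := h.radius'
  have hb' := h.early_bounds he
  have hε := alt_mul_alt_of_sub_one hj
  have hjn : alt j = -alt n := by
    have := alt_mul_self (n : ℤ)
    calc alt j = alt j * alt n * alt n := by rw [mul_assoc, this, mul_one]
      _ = -alt n := by rw [hε]; ring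
  have hx0 := h.left_pos
  have hy4 : y < 0.4 := by
    by_contra hc
    push Not at hc
    have hX : 0 < n - (x₀ + ξ) := by linarith [hb'.2.2.2.1]
    have k := (h.stripRe_gt_of_phi_lt he hd j (G := 0.5)
      (κ := 5 - (1 / (2 * (n - x₀ + 1 / 2)) - 1 / (2 * (n + x₀ + 1 / 2))))
      (fun h1 => by rw [hε] at h1; norm_num at h1)
      (fun _ => (endLeft_le_half (by linarith) hξ.le hy).trans (by
        rw [div_le_iff₀ (by positivity)]; linarith)) (by rw [hε]; linarith only [hφ])).1
    have t1 : 1 / (8 * (n - (x₀ + ξ) + 1 / 2) ^ 2) ≤ 0.5 := by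
      rw [div_le_iff₀ (by positivity)]; nlinarith only [hX]
    have t2 : 1 / (8 * (n + x₀ + 1 / 2) ^ 2) ≤ 0.1 := by
      rw [div_le_iff₀ (by positivity)]; nlinarith only [hx0, hn']
    have t3 : 0 ≤ 1 / (2 * (n + x₀ + 1 / 2)) := by positivity
    have t4 : 1 / (2 * (n - x₀ + 1 / 2)) ≤ 0.4 := by
      rw [div_le_iff₀ (by linarith only [hξ, hb'])]; linarith only [hd, hξ, hb']
    have ha : 3.4 < stripRe j (x₀ + ξ) y := by linarith
    have := stripRe_sq_le hc (stripSin_pos_of_re hy (by linarith))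
    nlinarith only [this, ha,
      mul_nonneg (sq_nonneg (stripRe j (x₀ + ξ) y)) (sq_nonneg (Real.sinh (Real.pi * y)))]
  set d := n - x₀ with hdd
  set Y := 1 - d with hY
  have hY0 : 0 ≤ Y := by linarith
  have hρ3 : ρ ≤ 1.6 := by
    have : 1 ≤ x₀ := by linarith
    nlinarith only [hr', this, hd1, hd, hρd]
  -- the pole next to `n` dominates
  have hσ : 3.9 * ((Y + ξ) ^ 2 + y ^ 2) < Y + ξ := by
    rw [hjn, neg_mul, neg_neg, alt_mul_re_altSum] at hφ
    obtain ⟨m, rfl⟩ : ∃ m, n = m + 1 := ⟨n - 1, by omega⟩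
    rw [show 2 * (m + 1) + 1 = (2 * m + 1) + 1 + 1 by ring, Finset.sum_range_succ',
      Finset.sum_range_succ'] at hφ
    have hT := (sum_alternating_mem (m := 2 * m + 1)
      (u := fun i : ℕ => (x₀ + ξ - ((m + 1 : ℕ) : ℝ) + ((i + 1 + 1 : ℕ) : ℝ)) /
        ((x₀ + ξ - ((m + 1 : ℕ) : ℝ) + ((i + 1 + 1 : ℕ) : ℝ)) ^ 2 + y ^ 2))
      (fun i => by
        have : (0 : ℝ) ≤ i := Nat.cast_nonneg i
        have : 0 ≤ x₀ + ξ - ((m + 1 : ℕ) : ℝ) + ((i + 1 + 1 : ℕ) : ℝ) := by push_cast at hdd hd1 ⊢; linarith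
        positivity)
      (fun i => by
        have : (0 : ℝ) ≤ i := Nat.cast_nonneg i
        have hp : 1 ≤ x₀ + ξ - ((m + 1 : ℕ) : ℝ) + ((i + 1 + 1 : ℕ) : ℝ) := by push_cast at hdd hd1 ⊢; linarith
        have := div_sq_add_sq_succ_le (y := y) (by linarith) (by nlinarith only [hp, hy4, hy] : y ^ 2 ≤
          (x₀ + ξ - ((m + 1 : ℕ) : ℝ) + ((i + 1 + 1 : ℕ) : ℝ)) ^ 2 +
            (x₀ + ξ - ((m + 1 : ℕ) : ℝ) + ((i + 1 + 1 : ℕ) : ℝ)))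
        convert this using 2 <;> push_cast <;> ring)).1
    have e0 : ∀ i : ℕ, (-1 : ℝ) ^ (i + 1 + 1) = (-1) ^ i := fun i => by rw [pow_succ, pow_succ]; ring
    simp only [e0] at hφ
    have ex : x₀ + ξ - ((m + 1 : ℕ) : ℝ) = ξ - d := by rw [hdd]; ring
    rw [ex] at hφ hT
    have h1 : (-1 : ℝ) ^ (0 + 1) * ((ξ - d + ((0 + 1 : ℕ) : ℝ)) / ((ξ - d + ((0 + 1 : ℕ) : ℝ)) ^ 2 + y ^ 2)) =
        -((Y + ξ) / ((Y + ξ) ^ 2 + y ^ 2)) := by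
      rw [hY]; norm_num; rw [show ξ - d + 1 = 1 - d + ξ by ring]
    have h2 : -1.1 ≤ (-1 : ℝ) ^ 0 * ((ξ - d + ((0 : ℕ) : ℝ)) / ((ξ - d + ((0 : ℕ) : ℝ)) ^ 2 + y ^ 2)) := by
      have := h.normSq_sub ((m + 1 : ℕ) : ℝ)
      rw [ex] at this
      simp only [pow_zero, one_mul, Nat.cast_zero, add_zero]
      rw [this, le_div_iff₀ (h.den_pos _), ← hdd]
      nlinarith only [mul_nonneg hξ.le (sub_nonneg.2 hρd), hd, hd1, hξ]
    have h3 : 3.9 < (Y + ξ) / ((Y + ξ) ^ 2 + y ^ 2) := by linarith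
    rw [lt_div_iff₀ (by positivity)] at h3
    exact h3
  have hden : (Y + ξ) ^ 2 + y ^ 2 = Y ^ 2 + 2 * ξ * (Y + ρ) := by
    linear_combination h.circle
  rw [hden] at hσ
  have hξY : 6.4 * ξ ≤ Y := by nlinarith only [hσ, hξ, mul_nonneg hξ.le hY0, mul_le_mul_of_nonneg_left (hd.trans hρd) hξ.le, sq_nonneg Y]
  have hYp : 0 < Y := by linarith
  have hdY : Y ^ 2 + 2 * ξ * (Y + ρ) ≤ 0.297 * Y := by linarith
  rw [hjn, neg_mul, neg_lt_zero, im_mul_altSum₂, alt_mul_sum_Icc]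
  set t : ℝ → ℝ := fun X => X * (X + 2 * ρ) / (X ^ 2 + 2 * ξ * (X + ρ)) ^ 2 with ht
  have hterm : ∀ i : ℕ, ((⟨ρ - ξ, -y⟩ : ℂ) / ((⟨x₀ + ξ, y⟩ : ℂ) - ((n - i : ℤ) : ℂ)) ^ 2).im =
      -(y * t (i - d)) := by
    intro i
    rw [h.im_term, ht]
    push_cast
    rw [show (n : ℝ) - i - x₀ = -(i - d) by rw [hdd]; ring, ← mul_neg, ← neg_div]
    congr 2
    · ring
    · ring
  simp only [hterm]
  obtain ⟨m, rfl⟩ : ∃ m, n = 1 + m := ⟨n - 1, by omega⟩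
  have hge := sum_alternating_ge (u := fun i : ℕ => -(y * t (i - d))) (N := 1) (fun i hi => by
    have hi' : (1 : ℝ) ≤ i := by exact_mod_cast hi
    have := antitoneOn_kernel hρ hξ hξ'.le (a := ((2 * i + 1 : ℕ) : ℝ) - d)
      (b := ((2 * i + 2 : ℕ) : ℝ) - d) (by simp; linarith) (by simp; linarith) (by simp)
    have := mul_le_mul_of_nonneg_left this h.im_pos.le
    simp only [ht]
    linarith only [this]) m
  refine lt_of_lt_of_le ?_ hge
  have t0 : t (-d) ≤ 0 := by
    simp only [ht]
    exact div_nonpos_of_nonpos_of_nonneg (mul_nonpos_of_nonpos_of_nonneg (by linarith) (by linarith)) (sq_nonneg _)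
  have t1 : 22 * ρ ≤ t Y := by
    have hp : 0 < Y ^ 2 + 2 * ξ * (Y + ρ) := by positivity
    simp only [ht]
    rw [le_div_iff₀ (by positivity)]
    calc 22 * ρ * (Y ^ 2 + 2 * ξ * (Y + ρ)) ^ 2 ≤ 22 * ρ * (0.297 * Y) ^ 2 := by gcongr
      _ ≤ Y * (Y + 2 * ρ) := by
        have : Y ≤ 0.05 := by linarith only [hd]
        nlinarith only [mul_pos hρ hYp, mul_pos hYp hYp, mul_le_mul_of_nonneg_left this (mul_pos hρ hYp).le]
  have t2 : t (2 - d) ≤ 4 * ρ := by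
    have hp : 1 ≤ 2 - d := by linarith
    have hq : 1 ≤ (2 - d) ^ 2 + 2 * ξ * (2 - d + ρ) := by
      have : 0 ≤ 2 * ξ * (2 - d + ρ) := by positivity
      nlinarith only [this, hp]
    simp only [ht]
    rw [div_le_iff₀ (by positivity)]
    have hs : (2 - d) ^ 2 ≤ ((2 - d) ^ 2 + 2 * ξ * (2 - d + ρ)) ^ 2 := by
      have : 0 ≤ 2 * ξ * (2 - d + ρ) := by positivity
      nlinarith only [this, hp, hq]
    have h4 : 2 - d ≤ 2 * ρ := by linarith
    have := mul_le_mul_of_nonneg_left hs hρ.le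
    nlinarith only [this, h4, hp, hρ, mul_nonneg (sub_nonneg.2 hp) hρ.le]
  have t3 : t (-d) - t Y + t (2 - d) < 0 := by linarith
  have := mul_pos_of_neg_of_neg t3 (neg_lt_zero.2 hy)
  simp only [Finset.sum_range_succ, Finset.sum_range_zero]
  push_cast
  rw [zero_sub, ← hY]
  linarith only [this]

end ArcPoint

/-! ### The first coordinate outside the disc of radius `n` -/

lemma div_sq_add_sq_le {q y : ℝ} (hy : 0 < y) : q / (q ^ 2 + y ^ 2) ≤ 1 / (2 * y) := by
  rw [div_le_div_iff₀ (by positivity) (by positivity)]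
  nlinarith [sq_nonneg (q - y)]

/-- A monotone majorant of the variation of `q / (q² + y²)`. -/
def kernelVariation (y q : ℝ) : ℝ :=
  if q ≤ y then q / (q ^ 2 + y ^ 2) else 1 / y - q / (q ^ 2 + y ^ 2)

lemma abs_kernel_sub_le {q y : ℝ} (hy : 0 < y) (hq : -y ≤ q) :
    |(q + 1) / ((q + 1) ^ 2 + y ^ 2) - q / (q ^ 2 + y ^ 2)| ≤
      kernelVariation y (q + 1) - kernelVariation y q := by
  have h1 := div_sq_add_sq_le (q := q) hy
  have h2 := div_sq_add_sq_le (q := q + 1) hy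
  have e : 1 / (2 * y) + 1 / (2 * y) = 1 / y := by field_simp; norm_num
  have hd : (q + 1) / ((q + 1) ^ 2 + y ^ 2) - q / (q ^ 2 + y ^ 2) =
      (y ^ 2 - q * (q + 1)) / (((q + 1) ^ 2 + y ^ 2) * (q ^ 2 + y ^ 2)) := by
    field_simp; ring
  rw [kernelVariation, kernelVariation]
  split_ifs with c1 c2 c2
  · rw [abs_of_nonneg]
    rw [hd]
    refine div_nonneg ?_ (by positivity)
    nlinarith only [hy, hq, c1]
  · linarith
  · rw [abs_le]; constructor <;> linarith
  · rw [abs_of_nonpos]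
    · linarith
    rw [hd]
    refine div_nonpos_of_nonpos_of_nonneg ?_ (by positivity)
    push Not at c2
    nlinarith only [hy, c2, hq]

lemma abs_sum_alternating_sub_le {u Φ : ℕ → ℝ} (h : ∀ i, |u (i + 1) - u i| ≤ Φ (i + 1) - Φ i) (m : ℕ) :
    |2 * (∑ i ∈ Finset.range (2 * m + 1), (-1) ^ i * u i) - u 0 - u (2 * m)| ≤ Φ (2 * m) - Φ 0 := by
  induction m with
  | zero => simp; ring_nf
  | succ m ih =>
    have e1 : (-1 : ℝ) ^ (2 * m + 1) = -1 := by rw [pow_succ, pow_mul]; norm_num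
    have e2 : (-1 : ℝ) ^ (2 * m + 1 + 1) = 1 := by rw [pow_succ, e1]; norm_num
    rw [show 2 * (m + 1) + 1 = 2 * m + 1 + 1 + 1 by ring, Finset.sum_range_succ _ (2 * m + 1 + 1),
      Finset.sum_range_succ _ (2 * m + 1), e1, e2, show 2 * (m + 1) = 2 * m + 1 + 1 by ring]
    have h1 := h (2 * m)
    have h2 := h (2 * m + 1)
    rw [abs_le] at *
    constructor <;> linarith

lemma abs_alt_mul_re_altSum_le {n : ℕ} {x y d : ℝ} (hx : 0 ≤ x) (hy : 0 < y) (hd : 0 < d)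
    (hz : (n : ℝ) ^ 2 ≤ x ^ 2 + y ^ 2) (hzd : d ^ 2 ≤ (x - n) ^ 2 + y ^ 2) :
    |alt n * (altSum n ⟨x, y⟩).re| ≤ 1 / d := by
  rw [alt_mul_re_altSum]
  set p := x - n with hp
  have hn0 : (0 : ℝ) ≤ n := Nat.cast_nonneg n
  rcases le_or_gt p y with hpy | hpy
  · have hpy' : -y ≤ p := by
      rcases le_total y n with h1 | h1
      · nlinarith
      · linarith
    have h1 := abs_sum_alternating_sub_le (u := fun i : ℕ => (p + i) / ((p + i) ^ 2 + y ^ 2))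
      (Φ := fun i : ℕ => kernelVariation y (p + i)) (fun i => by
        have := abs_kernel_sub_le (q := p + i) hy (by have : (0 : ℝ) ≤ i := Nat.cast_nonneg i; linarith)
        push_cast
        rw [← add_assoc]
        exact this) n
    have h2 : kernelVariation y (p + (0 : ℕ)) = p / (p ^ 2 + y ^ 2) := by
      rw [kernelVariation]; simp [hpy]
    have h3 : kernelVariation y (p + (2 * n : ℕ)) ≤
        1 / y - (p + (2 * n : ℕ)) / ((p + (2 * n : ℕ)) ^ 2 + y ^ 2) := by
      rw [kernelVariation]
      split_ifs
      · have := div_sq_add_sq_le (q := p + (2 * n : ℕ)) hy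
        have e : 1 / (2 * y) + 1 / (2 * y) = 1 / y := by field_simp; norm_num
        linarith
      · exact le_rfl
    have h4 : 0 ≤ p / (p ^ 2 + y ^ 2) + (p + (2 * n : ℕ)) / ((p + (2 * n : ℕ)) ^ 2 + y ^ 2) := by
      rw [div_add_div _ _ (by positivity) (by positivity)]
      refine div_nonneg ?_ (by positivity)
      push_cast
      have e : p * ((p + 2 * n) ^ 2 + y ^ 2) + (p ^ 2 + y ^ 2) * (p + 2 * n) =
          2 * x * (x ^ 2 + y ^ 2 - n ^ 2) := by rw [hp]; ring
      rw [e]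
      exact mul_nonneg (by linarith) (by linarith)
    simp only [Nat.cast_zero, add_zero] at h1 h2
    rw [h2] at h1
    have h5 : 1 / (2 * y) ≤ 1 / d := by
      apply one_div_le_one_div_of_le hd
      have : p ^ 2 ≤ y ^ 2 := sq_le_sq' hpy' hpy
      nlinarith only [hzd, this, hy, hd]
    have e : 2 * (1 / (2 * y)) = 1 / y := by field_simp
    rw [abs_le] at h1 ⊢
    constructor <;> linarith only [h3, h4, h1, h5, e]
  · have hp0 : 0 < p := hy.trans hpy
    have h1 := sum_alternating_mem (m := 2 * n + 1) (u := fun i : ℕ => (p + i) / ((p + i) ^ 2 + y ^ 2))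
      (fun i => by positivity)
      (fun i => by
        have hi : (0 : ℝ) ≤ i := Nat.cast_nonneg i
        have := div_sq_add_sq_succ_le (p := p + i) (y := y) (by positivity) (by nlinarith only [hy, hpy])
        push_cast
        rw [← add_assoc]
        exact this)
    rw [abs_of_nonneg h1.1]
    refine h1.2.trans ?_
    simp only [Nat.cast_zero, add_zero]
    rw [div_le_div_iff₀ (by positivity) hd, one_mul]
    have : d * p ≤ p ^ 2 + y ^ 2 := by nlinarith [sq_nonneg (d - p)]
    linarith

/-! ### Bounds for the second coordinate -/

lemma neg_im_fullSum (n : ℕ) (x y : ℝ) : -(fullSum n ⟨x, y⟩).im =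
    ∑ k ∈ Finset.Icc (-(n : ℤ)) n, y / ((x - k) ^ 2 + y ^ 2) := by
  rw [fullSum, Complex.im_sum, ← Finset.sum_neg_distrib]
  refine Finset.sum_congr rfl fun k _ => ?_
  rw [Complex.div_im, Complex.normSq_apply]
  simp
  ring

lemma tendsto_tail_im_fullSum (n : ℕ) (j : ℤ) (x : ℝ) {y : ℝ} (hy : 0 < y) :
    Tendsto (fun m : ℕ => ∑ i ∈ Finset.range m, (y / ((n - x + (i + 1)) ^ 2 + y ^ 2) +
      y / ((n + x + (i + 1)) ^ 2 + y ^ 2))) atTop (𝓝 (stripCot j x y + (fullSum n ⟨x, y⟩).im)) := by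
  have h := ((Complex.continuous_im.tendsto _).comp (tendsto_tail_fullSum n (z := ⟨x, y⟩) hy)).neg
  rw [Complex.sub_im, im_pi_cot j, neg_sub, sub_neg_eq_add, add_comm] at h
  refine h.congr fun m => ?_
  simp only [Function.comp_apply]
  rw [Complex.im_sum, ← Finset.sum_neg_distrib]
  refine Finset.sum_congr rfl fun i _ => ?_
  rw [Complex.add_im, Complex.div_im, Complex.div_im, Complex.normSq_apply, Complex.normSq_apply]
  simp
  have e1 : (x - (n + (i + 1))) * (x - (n + (i + 1))) + y * y = (n - x + (i + 1)) ^ 2 + y ^ 2 := by ring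
  have e2 : (x + (n + (i + 1))) * (x + (n + (i + 1))) + y * y = (n + x + (i + 1)) ^ 2 + y ^ 2 := by ring
  rw [e1, e2]
  ring

lemma stripCot_sub_le {n : ℕ} (j : ℤ) {x y : ℝ} (hy : 0 < y) (h1 : 0 ≤ n - x) (h2 : 0 ≤ n + x) :
    stripCot j x y + (fullSum n ⟨x, y⟩).im ≤ y / (n - x + 1 / 2) + y / (n + x + 1 / 2) := by
  refine le_of_tendsto' (tendsto_tail_im_fullSum n j x hy) fun m => ?_
  have key : ∀ q : ℝ, 0 ≤ q → ∑ i ∈ Finset.range m, y / ((q + (i + 1)) ^ 2 + y ^ 2) ≤ y / (q + 1 / 2) := by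
    intro q hq
    have := sum_le_of_telescope (f := fun i : ℕ => y / ((q + (i + 1)) ^ 2 + y ^ 2))
      (g := fun i : ℕ => y / (q + i + 1 / 2)) (fun i => by positivity) (fun i => by
        have hi : (0 : ℝ) ≤ i := Nat.cast_nonneg i
        push_cast
        rw [div_sub_div _ _ (by positivity) (by positivity), div_le_div_iff₀ (by positivity) (by positivity)]
        have e : y * (q + (i + 1) + 1 / 2) - (q + i + 1 / 2) * y = y := by ring
        rw [e]
        refine mul_le_mul_of_nonneg_left ?_ hy.le
        nlinarith [sq_nonneg y]) m
    simpa using this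
  rw [Finset.sum_add_distrib]
  exact add_le_add (key _ h1) (key _ h2)

lemma arctan_le_self {u : ℝ} (hu : 0 ≤ u) : Real.arctan u ≤ u := by
  have := nonneg_of_deriv_nonneg (f := fun u => u - Real.arctan u) (f' := fun u => 1 - 1 / (1 + u ^ 2))
    (fun u => (hasDerivAt_id u).sub (Real.hasDerivAt_arctan u)) (by simp)
    (fun u _ => by
      rw [sub_nonneg, div_le_one (by positivity)]
      nlinarith [sq_nonneg u]) hu
  linarith

lemma arctan_ge_cubic {u : ℝ} (hu : 0 ≤ u) : u - u ^ 3 / 3 ≤ Real.arctan u := by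
  have := nonneg_of_deriv_nonneg (f := fun u => Real.arctan u - (u - u ^ 3 / 3))
    (f' := fun u => 1 / (1 + u ^ 2) - (1 - u ^ 2))
    (fun u => by
      refine ((Real.hasDerivAt_arctan u).sub ((hasDerivAt_id u).sub
        ((hasDerivAt_pow 3 u).div_const 3))).congr_deriv ?_
      norm_num) (by simp)
    (fun u _ => by
      rw [sub_nonneg, le_div_iff₀ (by positivity)]
      nlinarith [sq_nonneg (u ^ 2)]) hu
  linarith

lemma arctan_ge {s t : ℝ} (hs : 0 ≤ s) (hs1 : s < 1) (ht : 1 + s ≤ t * (1 - s)) :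
    Real.pi / 4 + (s - s ^ 3 / 3) ≤ Real.arctan t := by
  have h1 := Real.arctan_add (x := 1) (y := s) (by linarith)
  rw [Real.arctan_one] at h1
  have h2 : (1 + s) / (1 - 1 * s) ≤ t := by
    rw [div_le_iff₀ (by linarith)]; linarith
  have := Real.arctan_strictMono.monotone h2
  linarith [arctan_ge_cubic hs]

lemma arctan_div_sub {p y : ℝ} (hp : 0 < p) (hy : 0 < y) :
    Real.arctan (y / p) - Real.arctan (y / (p + 1)) ≤ y / (p ^ 2 + p + y ^ 2) := by
  have h0 : 0 < y / p * (y / (p + 1)) := by positivity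
  have h := Real.arctan_add (x := y / p) (y := -(y / (p + 1))) (by nlinarith)
  rw [Real.arctan_neg, ← sub_eq_add_neg] at h
  rw [h]
  have e : (y / p + -(y / (p + 1))) / (1 - y / p * -(y / (p + 1))) = y / (p ^ 2 + p + y ^ 2) := by
    rw [mul_neg, sub_neg_eq_add, div_eq_div_iff (by positivity) (by positivity)]
    field_simp
    ring
  rw [e]
  exact arctan_le_self (by positivity)

lemma arctan_add_le_sum {p y θ : ℝ} (hp : 0 < p) (hy : 0 < y) (hθ : θ = 0 ∨ θ = 2 / 5 ∧ 1 ≤ p ∧ y ≤ 2.8) (m : ℕ) :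
    Real.arctan (y / p) + θ * (y / (p ^ 2 + y ^ 2)) -
      (Real.arctan (y / (p + m)) + θ * (y / ((p + m) ^ 2 + y ^ 2))) ≤
    ∑ i ∈ Finset.range m, y / ((p + i) ^ 2 + y ^ 2) := by
  induction m with
  | zero => simp
  | succ m ih =>
    rw [Finset.sum_range_succ]
    have hq : 0 < p + m := by positivity
    have hpq : p ≤ p + m := by linarith [Nat.cast_nonneg (α := ℝ) m]
    set q := p + m with hqd
    have h1 := arctan_div_sub hq hy
    have h2 : y / (q ^ 2 + q + y ^ 2) ≤
        (1 - θ) * (y / (q ^ 2 + y ^ 2)) + θ * (y / ((q + 1) ^ 2 + y ^ 2)) := by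
      rcases hθ with rfl | ⟨rfl, hp1, hy2⟩
      · simp only [sub_zero, one_mul, zero_mul, add_zero]
        apply div_le_div_of_nonneg_left hy.le (by positivity) (by linarith)
      · have hq1 : 1 ≤ q := hp1.trans hpq
        have hy3 : y ^ 2 ≤ 7.84 := by nlinarith only [hy2, hy]
        have hq2 : 2 ≤ q ^ 2 + q := by nlinarith
        have e : (1 - 2 / 5) * (y / (q ^ 2 + y ^ 2)) + 2 / 5 * (y / ((q + 1) ^ 2 + y ^ 2)) -
            y / (q ^ 2 + q + y ^ 2) = y * ((q ^ 2 + q + y ^ 2) * (3 / 5 + q / 5) - y ^ 2) /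
              ((q ^ 2 + y ^ 2) * ((q + 1) ^ 2 + y ^ 2) * (q ^ 2 + q + y ^ 2)) := by
          field_simp; ring
        have h3 : 0 ≤ (q ^ 2 + q + y ^ 2) * (3 / 5 + q / 5) - y ^ 2 := by
          nlinarith [mul_nonneg (sub_nonneg.2 hq1) (by positivity : 0 ≤ q ^ 2 + q + y ^ 2)]
        have : 0 ≤ y * ((q ^ 2 + q + y ^ 2) * (3 / 5 + q / 5) - y ^ 2) /
              ((q ^ 2 + y ^ 2) * ((q + 1) ^ 2 + y ^ 2) * (q ^ 2 + q + y ^ 2)) := by positivity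
        linarith only [e, this]
    have e : p + ((m + 1 : ℕ) : ℝ) = q + 1 := by rw [hqd]; push_cast; ring
    rw [e]
    linarith

lemma tendsto_arctan_kernel (p y θ : ℝ) :
    Tendsto (fun m : ℕ => Real.arctan (y / (p + m)) + θ * (y / ((p + m) ^ 2 + y ^ 2))) atTop (𝓝 0) := by
  have h1 : Tendsto (fun m : ℕ => p + (m : ℝ)) atTop atTop :=
    tendsto_atTop_add_const_left _ _ tendsto_natCast_atTop_atTop
  have h2 := (Real.continuous_arctan.tendsto 0).comp (h1.const_div_atTop y)
  have h3 : Tendsto (fun m : ℕ => (p + (m : ℝ)) ^ 2 + y ^ 2) atTop atTop :=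
    tendsto_atTop_add_const_right _ _ ((tendsto_pow_atTop two_ne_zero).comp h1)
  have h4 := (h3.const_div_atTop y).const_mul θ
  rw [Real.arctan_zero] at h2
  simpa using h2.add h4

lemma le_stripCot_sub {n : ℕ} (j : ℤ) {x y θ : ℝ} (hy : 0 < y) (h1 : x < n + 1) (h2 : 0 < n + x + 1)
    (hθ : θ = 0 ∨ θ = 2 / 5 ∧ x ≤ n ∧ y ≤ 2.8) :
    Real.arctan (y / (n + 1 - x)) + θ * (y / ((n + 1 - x) ^ 2 + y ^ 2)) + Real.arctan (y / (n + 1 + x)) ≤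
      stripCot j x y + (fullSum n ⟨x, y⟩).im := by
  have hlim := ((tendsto_arctan_kernel (n + 1 - x) y θ).const_sub
    (Real.arctan (y / (n + 1 - x)) + θ * (y / ((n + 1 - x) ^ 2 + y ^ 2)))).add
    ((tendsto_arctan_kernel (n + 1 + x) y 0).const_sub
    (Real.arctan (y / (n + 1 + x)) + 0 * (y / ((n + 1 + x) ^ 2 + y ^ 2))))
  have := le_of_tendsto_of_tendsto' hlim (tendsto_tail_im_fullSum n j x hy) fun m => ?_
  · simpa using this
  · have k1 := arctan_add_le_sum (p := n + 1 - x) (y := y) (θ := θ) (by linarith) hy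
      (hθ.imp id fun h => ⟨h.1, by linarith, h.2.2⟩) m
    have k2 := arctan_add_le_sum (p := n + 1 + x) (y := y) (θ := 0) (by linarith) hy (Or.inl rfl) m
    rw [Finset.sum_add_distrib]
    have e1 : ∀ i : ℕ, (n : ℝ) + 1 - x + i = n - x + (i + 1) := fun i => by ring
    have e2 : ∀ i : ℕ, (n : ℝ) + 1 + x + i = n + x + (i + 1) := fun i => by ring
    simp only [e1, e2] at k1 k2 ⊢
    exact add_le_add k1 k2

lemma stripCot_sq_add (j : ℤ) (x : ℝ) {y : ℝ} (hy : 0 < y) :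
    (stripCot j x y ^ 2 + stripRe j x y ^ 2) * stripDen j x y = Real.pi ^ 2 * (1 + Real.sinh (Real.pi * y) ^ 2) := by
  have hD := stripDen_pos j x hy
  have hc := Real.cosh_sq (Real.pi * y)
  rw [stripCot, stripRe]
  have e : stripDen j x y = stripSin j x ^ 2 + Real.sinh (Real.pi * y) ^ 2 := rfl
  field_simp
  rw [e, hc]
  ring

lemma stripCot_ge_of_stripRe {j : ℤ} {x y a β : ℝ} (hy : 0 < y) (ha : 0 ≤ stripRe j x y) (ha' : stripRe j x y ≤ a)
    (h : β ^ 2 + a ^ 2 ≤ 9.8696) : β ≤ stripCot j x y := by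
  have hD := stripDen_pos j x hy
  have h1 := stripCot_sq_add j x hy
  have h2 : stripDen j x y ≤ 1 + Real.sinh (Real.pi * y) ^ 2 := by
    rw [stripDen]; nlinarith [stripSin_sq_add j x, sq_nonneg (stripCos j x)]
  have h3 : Real.pi ^ 2 ≤ stripCot j x y ^ 2 + stripRe j x y ^ 2 := by
    by_contra hc
    push Not at hc
    have k1 := mul_lt_mul_of_pos_right hc hD
    have k2 := mul_le_mul_of_nonneg_left h2 (sq_nonneg Real.pi)
    linarith
  have h4 := pi_sq_bounds.1
  have h5 := stripCot_pos (j := j) (x := x) hy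
  by_contra hc
  push Not at hc
  nlinarith

lemma stripCot_le {j : ℤ} {x y Y c : ℝ} (hY : 0 < Y) (hyY : Y ≤ y) (hc : 0 ≤ c)
    (h : 9.86961 * (1 + (9.869 * Y ^ 2 + 32.46 * Y ^ 4 + 42.7 * Y ^ 6 + 30.1 * Y ^ 8 + 13.2 * Y ^ 10)) ≤
      c ^ 2 * (9.869 * Y ^ 2 + 32.46 * Y ^ 4 + 42.7 * Y ^ 6 + 30.1 * Y ^ 8 + 13.2 * Y ^ 10)) :
    stripCot j x y ≤ c := by
  have hy : 0 < y := hY.trans_le hyY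
  have hD := stripDen_pos j x hy
  have h1 := stripCot_sq_add j x hy
  have hs : 9.869 * Y ^ 2 + 32.46 * Y ^ 4 + 42.7 * Y ^ 6 + 30.1 * Y ^ 8 + 13.2 * Y ^ 10 ≤
      Real.sinh (Real.pi * y) ^ 2 := by
    refine le_trans ?_ (sinh_sq_ge y)
    gcongr
  set P := 9.869 * Y ^ 2 + 32.46 * Y ^ 4 + 42.7 * Y ^ 6 + 30.1 * Y ^ 8 + 13.2 * Y ^ 10 with hP
  have hP0 : 0 < P := by positivity
  have hpi := pi_sq_bounds.2
  set Q := Real.sinh (Real.pi * y) ^ 2 with hQ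
  have hQ0 : 0 < Q := hP0.trans_le hs
  have hc2 : 9.86961 ≤ c ^ 2 := by nlinarith only [h, hP0]
  have k1 : 9.86961 * (1 + Q) ≤ c ^ 2 * Q := by nlinarith only [h, hs, hP0]
  have k2 : Q * (1 + stripSin j x ^ 2 / Q) = stripDen j x y := by
    rw [stripDen]; field_simp; ring
  have e1 : stripCot j x y * stripDen j x y = Real.pi * Real.sinh (Real.pi * y) * Real.cosh (Real.pi * y) := by
    rw [stripCot]; field_simp
  have e2 : (stripCot j x y * stripDen j x y) ^ 2 = Real.pi ^ 2 * Q * (1 + Q) := by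
    rw [e1, mul_pow, mul_pow, Real.cosh_sq, hQ]; ring
  have h5 := stripCot_pos (j := j) (x := x) hy
  have hQD : Q ≤ stripDen j x y := by rw [stripDen]; nlinarith [sq_nonneg (stripSin j x)]
  have k3 : (stripCot j x y * Q) ^ 2 ≤ (c * Q) ^ 2 := by
    calc (stripCot j x y * Q) ^ 2 ≤ (stripCot j x y * stripDen j x y) ^ 2 := by gcongr
      _ = Real.pi ^ 2 * Q * (1 + Q) := e2
      _ ≤ 9.86961 * Q * (1 + Q) := by gcongr
      _ ≤ (c * Q) ^ 2 := by nlinarith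
  have k4 := (sq_le_sq₀ (by positivity) (by positivity)).1 k3
  exact le_of_mul_le_mul_right k4 hQ0

/-- An upper bound for the second coordinate on the circle of radius `n`. -/
lemma neg_im_fullSum_le {n : ℕ} {x y Y c s θ g : ℝ} (hx : 0 ≤ x) (hxy : x ^ 2 + y ^ 2 = n ^ 2) (hY : 0 < Y) (hyY : Y ≤ y)
    (hc : 0 ≤ c ∧ 9.86961 * (1 + (9.869 * Y ^ 2 + 32.46 * Y ^ 4 + 42.7 * Y ^ 6 + 30.1 * Y ^ 8 + 13.2 * Y ^ 10)) ≤
      c ^ 2 * (9.869 * Y ^ 2 + 32.46 * Y ^ 4 + 42.7 * Y ^ 6 + 30.1 * Y ^ 8 + 13.2 * Y ^ 10))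
    (hs : 0 ≤ s ∧ s < 1) (hst : (1 + s) * (2 * n + 1) ≤ 2 * (n + 1) * Y * (1 - s))
    (hθ : θ = 0 ∨ θ = 2 / 5 ∧ y ≤ 2.8) (hg : g * ((n + 1 - x) ^ 2 + y ^ 2) ≤ y) :
    -(fullSum n ⟨x, y⟩).im ≤ c - (0.78535 + (s - s ^ 3 / 3)) - θ * g := by
  have hy : 0 < y := hY.trans_le hyY
  have hn0 : (0 : ℝ) ≤ n := Nat.cast_nonneg n
  have hxn : x ≤ n := by nlinarith only [hxy, hx, hY, hyY]
  have h1 := stripCot_le (j := 0) (x := x) hY hyY hc.1 hc.2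
  have h2 := le_stripCot_sub (n := n) 0 (x := x) (θ := θ) hy (by linarith) (by linarith)
    (hθ.imp id fun h => ⟨h.1, hxn, h.2⟩)
  have hp1 : 0 < (n : ℝ) + 1 - x := by linarith
  have hp2 : 0 < (n : ℝ) + 1 + x := by linarith only [hx]
  have h3 : g ≤ y / ((n + 1 - x) ^ 2 + y ^ 2) := by
    rw [le_div_iff₀ (by positivity)]; exact hg
  have hlt : y / (n + 1 - x) * (y / (n + 1 + x)) < 1 := by
    rw [div_mul_div_comm, div_lt_one (by positivity)]
    nlinarith only [hxy]
  have h4 := Real.arctan_add hlt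
  have e : (y / (n + 1 - x) + y / (n + 1 + x)) / (1 - y / (n + 1 - x) * (y / (n + 1 + x))) =
      2 * (n + 1) * y / (2 * n + 1) := by
    have h5 : (1 - y / (n + 1 - x) * (y / (n + 1 + x))) = (2 * n + 1) / ((n + 1 - x) * (n + 1 + x)) := by
      field_simp
      linear_combination -hxy
    rw [h5]
    field_simp
    ring
  rw [e] at h4
  have h6 := arctan_ge (s := s) (t := 2 * (n + 1) * y / (2 * n + 1)) hs.1 hs.2 (by
    rw [div_mul_eq_mul_div, le_div_iff₀ (by positivity)]
    refine hst.trans ?_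
    have : 0 ≤ 1 - s := by linarith [hs.2]
    gcongr)
  have h7 := Real.pi_gt_d4
  have h8 : θ * g ≤ θ * (y / ((n + 1 - x) ^ 2 + y ^ 2)) := by
    refine mul_le_mul_of_nonneg_left h3 ?_
    rcases hθ with h | h
    · rw [h]
    · rw [h.1]; norm_num
  linarith

lemma neg_im_fullSum_le_two {x y : ℝ} (hx : 0 ≤ x) (hxy : x ^ 2 + y ^ 2 = 4) (hy : 1.2 ≤ y) :
    -(fullSum 2 ⟨x, y⟩).im ≤ 2.19 ∧ (1.326 ≤ y → -(fullSum 2 ⟨x, y⟩).im ≤ 2.095) ∧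
    (1.5 ≤ y → -(fullSum 2 ⟨x, y⟩).im ≤ 2.036) := by
  have hxy' : x ^ 2 + y ^ 2 = ((2 : ℕ) : ℝ) ^ 2 := by rw [hxy]; norm_num
  have hy2 : y ≤ 2.8 := by nlinarith
  refine ⟨?_, fun h1 => ?_, fun h1 => ?_⟩
  · have := neg_im_fullSum_le (n := 2) (x := x) (y := y) (Y := 1.2) (c := 3.146) (s := 0.18) (θ := 0) (g := 0)
      hx hxy' (by norm_num) hy (by norm_num) (by norm_num) (by norm_num) (Or.inl rfl) (by linarith)
    norm_num at this ⊢; linarith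
  · have := neg_im_fullSum_le (n := 2) (x := x) (y := y) (Y := 1.326) (c := 3.1435) (s := 0.228) (θ := 2 / 5)
      (g := 0.102) hx hxy' (by norm_num) h1 (by norm_num) (by norm_num) (by norm_num) (Or.inr ⟨rfl, hy2⟩)
      (by push_cast; nlinarith only [hxy, hx, h1])
    norm_num at this ⊢; linarith
  · have := neg_im_fullSum_le (n := 2) (x := x) (y := y) (Y := 1.5) (c := 3.1425) (s := 0.2856) (θ := 2 / 5)
      (g := 0.115) hx hxy' (by norm_num) h1 (by norm_num) (by norm_num) (by norm_num) (Or.inr ⟨rfl, hy2⟩)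
      (by push_cast; nlinarith only [hxy, hx, h1])
    norm_num at this ⊢; linarith

lemma neg_im_fullSum_le_three {n : ℕ} (hn : 3 ≤ n) {x y : ℝ} (hx : 0 ≤ x) (hxy : x ^ 2 + y ^ 2 = n ^ 2) (hy : 1 ≤ y)
    (hy2 : y ≤ 2.5) :
    -(fullSum n ⟨x, y⟩).im ≤ 2.215 ∧ (1.1 ≤ y → -(fullSum n ⟨x, y⟩).im ≤ 2.18) := by
  have hn' : (3 : ℝ) ≤ n := by exact_mod_cast hn
  have hxn : x ≤ n := by nlinarith
  have hX : (n - x) * (n + x) = y ^ 2 := by linear_combination -hxy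
  rcases le_total y 1.25 with h1 | h1
  · have hx2 : 2.7 ≤ x := by
      by_contra hc
      push Not at hc
      nlinarith
    have hX2 : (n - x) * 5.7 ≤ y ^ 2 := by
      rw [← hX]; exact mul_le_mul_of_nonneg_left (by linarith) (by linarith)
    have hX3 : n - x ≤ 0.2742 := by nlinarith only [h1, hX2, hy]
    have hg : 0.39 * ((n + 1 - x) ^ 2 + y ^ 2) ≤ y := by
      have : (n + 1 - x) ^ 2 ≤ 1 + 2.2742 * (n - x) := by
        nlinarith only [mul_le_mul_of_nonneg_left hX3 (sub_nonneg.2 hxn)]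
      nlinarith only [this, hX2, hy, h1, mul_nonneg (sub_nonneg.2 hy) (sub_nonneg.2 h1)]
    refine ⟨?_, fun h2 => ?_⟩
    · have := neg_im_fullSum_le (n := n) (x := x) (y := y) (Y := 1) (c := 3.154) (s := 0) (θ := 2 / 5) (g := 0.39)
        hx hxy (by norm_num) hy (by norm_num) (by norm_num) (by linarith only []) (Or.inr ⟨rfl, by linarith⟩) hg
      norm_num at this ⊢; linarith
    · have := neg_im_fullSum_le (n := n) (x := x) (y := y) (Y := 1.1) (c := 3.149) (s := 0.0476) (θ := 2 / 5)
        (g := 0.39) hx hxy (by norm_num) h2 (by norm_num) (by norm_num) (by linarith only [hn'])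
        (Or.inr ⟨rfl, by linarith⟩) hg
      norm_num at this ⊢; linarith
  · have hx2 : 1.65 ≤ x := by
      by_contra hc
      push Not at hc
      nlinarith
    have hX2 : (n - x) * 4.65 ≤ y ^ 2 := by
      rw [← hX]; exact mul_le_mul_of_nonneg_left (by linarith) (by linarith)
    have hX3 : n - x ≤ 1.345 := by nlinarith only [hy2, hX2, hy]
    have hg : 0.2 * ((n + 1 - x) ^ 2 + y ^ 2) ≤ y := by
      have : (n + 1 - x) ^ 2 ≤ 1 + 3.345 * (n - x) := by
        nlinarith only [mul_le_mul_of_nonneg_left hX3 (sub_nonneg.2 hxn)]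
      nlinarith only [this, hX2, hy2, h1, mul_nonneg (sub_nonneg.2 hy2) (sub_nonneg.2 h1)]
    have := neg_im_fullSum_le (n := n) (x := x) (y := y) (Y := 1.25) (c := 3.145) (s := 0.111) (θ := 2 / 5)
        (g := 0.2) hx hxy (by norm_num) h1 (by norm_num) (by norm_num) (by linarith only [hn'])
        (Or.inr ⟨rfl, by linarith⟩) hg
    norm_num at this ⊢
    constructor
    · linarith
    · intro _; linarith

lemma neg_im_fullSum_le_of_one_half_le {n : ℕ} {x y : ℝ} (hx : 0 ≤ x) (hxy : x ^ 2 + y ^ 2 = n ^ 2) (hy : 1.5 ≤ y) :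
    -(fullSum n ⟨x, y⟩).im ≤ 2.18 := by
  have hn0 : (0 : ℝ) ≤ n := Nat.cast_nonneg n
  have := neg_im_fullSum_le (n := n) (x := x) (y := y) (Y := 1.5) (c := 3.1425) (s := 0.199) (θ := 0) (g := 0)
      hx hxy (by norm_num) hy (by norm_num) (by norm_num) (by linarith) (Or.inl rfl) (by linarith)
  norm_num at this ⊢; linarith

namespace ArcPoint
variable {n : ℕ} {x₀ ρ ξ y ξ₁ y₁ : ℝ}

/-- The point where the arc leaves the disc of radius `n`. -/
lemma junction (h : ArcPoint n x₀ ρ ξ y) :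
    ArcPoint n x₀ ρ (n ^ 2 / (x₀ + ρ) - x₀) (n * ρ / (x₀ + ρ)) ∧
      (n ^ 2 / (x₀ + ρ)) ^ 2 + (n * ρ / (x₀ + ρ)) ^ 2 = n ^ 2 ∧ n - x₀ ≤ n * ρ / (x₀ + ρ) := by
  have h1 := h.left_pos; have h2 := h.rho_pos; have h3 := h.left_lt; have h4 := h.radius; have h5 := h.le_rho
  have hn : 0 < (n : ℝ) := h1.trans h3
  refine ⟨⟨h1, h3, h4, by positivity, ?_⟩, ?_, ?_⟩
  · have e : (n : ℝ) ^ 2 = x₀ ^ 2 + 2 * x₀ * ρ := by linear_combination -h4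
    rw [div_pow, mul_pow, e]
    field_simp
    ring
  · field_simp
    linear_combination -h4
  · rw [le_div_iff₀ (by positivity)]
    nlinarith

lemma le_neg_im_fullSum (h : ArcPoint n x₀ ρ ξ y) (he : (x₀ + ξ) ^ 2 + y ^ 2 < n ^ 2) (hd : 0.95 ≤ n - x₀) (j : ℤ)
    (ha : 0 ≤ stripRe j (x₀ + ξ) y) (hφ : |alt j * (altSum n ⟨x₀ + ξ, y⟩).re| ≤ 1 / (n - x₀))
    {d₁ X₁ Y₁ N₁ a β : ℝ} (hd1 : d₁ ≤ n - x₀) (hX1 : X₁ ≤ n - (x₀ + ξ)) (hY1 : y ≤ Y₁) (hN1 : N₁ ≤ n + x₀)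
    (hnum : 0 < d₁ ∧ 0 ≤ X₁ ∧ 0 ≤ N₁ ∧
      1 / d₁ + 1 / (2 * d₁ + 1) + 1 / (8 * (X₁ + 1 / 2) ^ 2) + 1 / (8 * (N₁ + 1 / 2) ^ 2) ≤ a ∧
      β ^ 2 + a ^ 2 ≤ 9.8696) :
    β - Y₁ / (X₁ + 1 / 2) - Y₁ / (N₁ + 1 / 2) ≤ -(fullSum n ⟨x₀ + ξ, y⟩).im := by
  obtain ⟨c1, c2, c3, c4, c5⟩ := hnum
  have hy := h.im_pos
  have hξ := h.xi_pos
  have hx0 := h.left_pos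
  have hb' := h.early_bounds he
  obtain ⟨r1, r2, E, hE, -, heq⟩ := h.phi_eq he hd j
  have r3 := endRight_le_inv (d := n - x₀) (ξ := ξ) (y := y) (by linarith only [hb']) (by linarith)
  have r4 := endLeft_le_half (W := n + x₀ + 1 / 2) (ξ := ξ) (y := y) (by linarith) hξ.le hy
  have e1 : 1 / (2 * ((n : ℝ) - x₀ + 1 / 2)) = 1 / (2 * (n - x₀) + 1) := by congr 1; ring
  have r5 : 1 / (2 * ((n : ℝ) + x₀ + 1 / 2)) ≤ 1 / (2 * (n - x₀) + 1) :=
    one_div_le_one_div_of_le (by linarith only [hξ, hb']) (by linarith only [hx0])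
  have r6 : 0 ≤ 1 / (2 * ((n : ℝ) + x₀ + 1 / 2)) := by
    have : 0 < (n : ℝ) + x₀ + 1 / 2 := by linarith only [hξ, hx0, hb']
    positivity
  have s1 : 1 / (n - x₀) ≤ 1 / d₁ := one_div_le_one_div_of_le c1 hd1
  have s2 : 1 / (2 * ((n : ℝ) - x₀) + 1) ≤ 1 / (2 * d₁ + 1) := one_div_le_one_div_of_le (by linarith only [c1]) (by linarith only [hd1])
  have s3 : 1 / (8 * (n - (x₀ + ξ) + 1 / 2) ^ 2) ≤ 1 / (8 * (X₁ + 1 / 2) ^ 2) :=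
    one_div_le_one_div_of_le (by positivity) (by gcongr)
  have s4 : 1 / (8 * (n + x₀ + 1 / 2) ^ 2) ≤ 1 / (8 * (N₁ + 1 / 2) ^ 2) :=
    one_div_le_one_div_of_le (by positivity) (by gcongr)
  have haa : stripRe j (x₀ + ξ) y ≤ a := by
    rw [abs_le] at hE hφ
    rw [e1] at heq
    have hε : alt j * alt n = 1 ∨ alt j * alt n = -1 := by
      rcases alt_eq_one_or j with h1 | h1 <;> rcases alt_eq_one_or n with h2 | h2 <;> rw [h1, h2] <;> norm_num
    rcases hε with h1 | h1 <;> rw [h1] at heq <;> linarith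
  have hβ := stripCot_ge_of_stripRe hy ha haa c5
  have ht := stripCot_sub_le (n := n) j (x := x₀ + ξ) hy (by linarith only [hb']) (by linarith)
  have hY0 : 0 ≤ Y₁ := hy.le.trans hY1
  have t1 : y / (n - (x₀ + ξ) + 1 / 2) ≤ Y₁ / (X₁ + 1 / 2) := by gcongr
  have t2 : y / (n + (x₀ + ξ) + 1 / 2) ≤ Y₁ / (N₁ + 1 / 2) := by
    exact div_le_div₀ hY0 hY1 (by linarith only [c3]) (by linarith only [hN1, hξ])
  linarith only [hβ, ht, t1, t2]

lemma early_bound_two (hn : (n : ℝ) = 2) (h : ArcPoint n x₀ ρ ξ y) (he : (x₀ + ξ) ^ 2 + y ^ 2 < n ^ 2) (hd : 1 < n - x₀) (j : ℤ)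
    (ha : 0 ≤ stripRe j (x₀ + ξ) y) (hφ : |alt j * (altSum n ⟨x₀ + ξ, y⟩).re| ≤ 1 / (n - x₀))
    (hy2 : y ^ 2 ≤ 0.39 + 0.14 * (n - x₀)) (hX : 1 < n - (x₀ + ξ)) :
    (n - x₀ ≤ 1.1 → 2.2 < -(fullSum n ⟨x₀ + ξ, y⟩).im) ∧
    (1.1 ≤ n - x₀ → n - x₀ ≤ 1.25 → 2.1 < -(fullSum n ⟨x₀ + ξ, y⟩).im) ∧
    (1.25 ≤ n - x₀ → n - x₀ ≤ 2 → 2.04 < -(fullSum n ⟨x₀ + ξ, y⟩).im) := by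
  have hy := h.im_pos
  refine ⟨fun h1 => ?_, fun h1 h2 => ?_, fun h1 h2 => ?_⟩
  · have hr := h.radius'
    have hξ := h.xi_pos
    have hρ : ρ ≤ 1.773 := by nlinarith only [hr, hd, h1, hn]
    have hy3 : y ≤ 0.597 := by nlinarith only [h.circle, hρ, hX, hξ, hd, h1, hy]
    have := h.le_neg_im_fullSum he (by linarith) j ha hφ (d₁ := 1) (X₁ := 1) (Y₁ := 0.597) (N₁ := 2.9)
      (a := 1.4004) (β := 2.812) hd.le hX.le hy3 (by linarith) (by norm_num)
    norm_num at this ⊢; linarith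
  · have hy3 : y ≤ 0.752 := by nlinarith only [hy2, h2, hy]
    have := h.le_neg_im_fullSum he (by linarith) j ha hφ (d₁ := 1.1) (X₁ := 1) (Y₁ := 0.752) (N₁ := 2.75)
      (a := 1.29) (β := 2.864) h1 hX.le hy3 (by linarith) (by norm_num)
    norm_num at this ⊢; linarith
  · have hy3 : y ≤ 0.8186 := by nlinarith only [hy2, h2, hy]
    have := h.le_neg_im_fullSum he (by linarith) j ha hφ (d₁ := 1.25) (X₁ := 1) (Y₁ := 0.8186) (N₁ := 2)
      (a := 1.162) (β := 2.918) h1 hX.le hy3 (by linarith) (by norm_num)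
    norm_num at this ⊢; linarith

lemma early_bound_three (hn : 3 ≤ (n : ℝ)) (h : ArcPoint n x₀ ρ ξ y) (he : (x₀ + ξ) ^ 2 + y ^ 2 < n ^ 2)
    (hd : 1 < n - x₀) (j : ℤ)
    (ha : 0 ≤ stripRe j (x₀ + ξ) y) (hφ : |alt j * (altSum n ⟨x₀ + ξ, y⟩).re| ≤ 1 / (n - x₀))
    (hy2 : y ^ 2 ≤ 0.39 + 0.14 * (n - x₀)) (hX : n - x₀ ≤ 2 → 1 < n - (x₀ + ξ)) :
    2.185 < -(fullSum n ⟨x₀ + ξ, y⟩).im ∧ (n - x₀ ≤ 1.1 → 2.22 < -(fullSum n ⟨x₀ + ξ, y⟩).im) := by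
  have hy := h.im_pos
  have key : n - x₀ ≤ 1.1 → 2.22 < -(fullSum n ⟨x₀ + ξ, y⟩).im := fun h1 => by
    have hr := h.radius'
    have hξ := h.xi_pos
    have hX := hX (by linarith)
    have hρ : ρ ≤ 1.42 := by nlinarith only [hr, hd, h1, hn]
    have hy3 : y ≤ 0.54 := by nlinarith only [h.circle, hρ, hX, hξ, hd, h1, hy]
    have := h.le_neg_im_fullSum he (by linarith) j ha hφ (d₁ := 1) (X₁ := 1) (Y₁ := 0.54) (N₁ := 4.5)
      (a := 1.4) (β := 2.812) hd.le hX.le hy3 (by linarith) (by norm_num)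
    norm_num at this ⊢; linarith
  refine ⟨?_, key⟩
  rcases le_total (n - x₀) 1.1 with h1 | h1
  · have := key h1; norm_num at this ⊢; linarith
  rcases le_total (n - x₀) 1.25 with h2 | h2
  · have hX := hX (by linarith)
    have hy3 : y ≤ 0.752 := by nlinarith only [hy2, h2, hy]
    have := h.le_neg_im_fullSum he (by linarith) j ha hφ (d₁ := 1.1) (X₁ := 1) (Y₁ := 0.752) (N₁ := 4.75)
      (a := 1.282) (β := 2.867) h1 hX.le hy3 (by linarith) (by norm_num)
    norm_num at this ⊢; linarith
  rcases le_total (n - x₀) 2 with h3 | h3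
  · have hX := hX (by linarith)
    have hy3 : y ≤ 0.8186 := by nlinarith only [hy2, h3, hy]
    have := h.le_neg_im_fullSum he (by linarith) j ha hφ (d₁ := 1.25) (X₁ := 1) (Y₁ := 0.8186) (N₁ := 4)
      (a := 1.148) (β := 2.924) h2 hX.le hy3 (by linarith) (by norm_num)
    norm_num at this ⊢; linarith
  · have hξ := h.xi_le_of_sq_le he (Z := 0.18) (Y := 0.39 + 0.14 * (n - x₀)) (by nlinarith only [h3]) hy2
    have hx0 := h.left_pos
    set d := n - x₀ with hdd
    have hy3 : y ≤ 0.36 * (d - 0.18 + 1 / 2) := by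
      by_contra hc
      push Not at hc
      nlinarith only [hc, hy2, h3]
    have hy4 : y ≤ 0.36 * (d + 1 / 2) := by linarith
    have := h.le_neg_im_fullSum he (by linarith) j ha hφ (d₁ := 2) (X₁ := d - 0.18) (Y₁ := y) (N₁ := d)
      (a := 0.75) (β := 3.05) h3 (by linarith only [hξ]) le_rfl (by linarith only [hx0]) ⟨by norm_num, by linarith, by linarith, by
        have k1 : 1 / (8 * (d - 0.18 + 1 / 2) ^ 2) ≤ 1 / (8 * (2 - 0.18 + 1 / 2) ^ 2) :=
          one_div_le_one_div_of_le (by norm_num) (by gcongr)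
        have k2 : 1 / (8 * (d + 1 / 2) ^ 2) ≤ 1 / (8 * (2 + 1 / 2) ^ 2) :=
          one_div_le_one_div_of_le (by norm_num) (by gcongr)
        norm_num at k1 k2 ⊢
        linarith only [k1, k2], by norm_num⟩
    have k1 : y / (d - 0.18 + 1 / 2) ≤ 0.36 := by rw [div_le_iff₀ (by linarith)]; exact hy3
    have k2 : y / (d + 1 / 2) ≤ 0.36 := by rw [div_le_iff₀ (by linarith)]; exact hy4
    norm_num at this k1 k2 ⊢; linarith

/-- A point in the disc of radius `n` before a turning point of the second coordinate lies lower than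
all points of the arc outside of the disc, if the first coordinate is small there. -/
lemma im_fullSum_lt_junction (h : ArcPoint n x₀ ρ ξ y) (hn : 2 ≤ n) (hd : 1 < n - x₀)
    (h₁ : ArcPoint n x₀ ρ ξ₁ y₁) (he₁ : (x₀ + ξ₁) ^ 2 + y₁ ^ 2 < n ^ 2)
    (hb : 0 ≤ ((⟨ρ - ξ₁, -y₁⟩ : ℂ) * fullSum₂ n ⟨x₀ + ξ₁, y₁⟩).re) (hξ : ξ ≤ ξ₁) {j : ℤ}
    (hj : j ≤ x₀) (hj' : x₀ < j + 1)
    (hφ : |alt j * (altSum n ⟨x₀ + ξ, y⟩).re| ≤ 1 / (n - x₀)) :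
    (fullSum n ⟨x₀ + ξ, y⟩).im < (fullSum n ⟨n ^ 2 / (x₀ + ρ), n * ρ / (x₀ + ρ)⟩).im := by
  have hx0 := h.left_pos
  have hρ := h.rho_pos
  have hξ0 := h.xi_pos
  have hy := h.im_pos
  have hb₁ := h₁.early_bounds he₁
  have hyy : y ^ 2 ≤ y₁ ^ 2 := by
    rw [h.circle, h₁.circle]; nlinarith only [hξ, hb₁]
  have he : (x₀ + ξ) ^ 2 + y ^ 2 < n ^ 2 := by nlinarith only [he₁, hyy, hξ, hx0, hξ0]
  have hlt := h₁.lt_of_turn he₁ hn hd.le hb hj'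
  have hS : 0 < stripSin j (x₀ + ξ) := stripSin_pos (by linarith) (by linarith)
  have ha := (stripRe_pos hy hS).le
  have hy2 := hyy.trans (h₁.sq_le_of_turn he₁ hn (by linarith) hb)
  have hX : n - x₀ ≤ 2 → 1 < n - (x₀ + ξ) := fun hd2 => by
    have : (j : ℝ) = n - 2 := by rw [strip_index hj hj' hd hd2]; push_cast; ring
    linarith
  obtain ⟨hJ, hJ2, hJ3⟩ := h.junction
  have hxs : 0 ≤ (n : ℝ) ^ 2 / (x₀ + ρ) := by positivity
  set xs := (n : ℝ) ^ 2 / (x₀ + ρ) with hxsd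
  set ys := n * ρ / (x₀ + ρ) with hysd
  rcases Nat.lt_or_ge n 3 with h3 | h3
  · obtain rfl : n = 2 := by omega
    have hx : ((2 : ℕ) : ℝ) = 2 := by norm_num
    obtain ⟨k1, k2, k3⟩ := early_bound_two hx h he hd j ha hφ hy2 (hX (by rw [hx]; linarith))
    have hr := h.radius
    have hyform : ys * (4 + x₀ ^ 2) = 2 * (4 - x₀ ^ 2) := by
      have : x₀ + ρ ≠ 0 := by positivity
      rw [hysd]
      push_cast at hr ⊢
      field_simp
      linear_combination x₀ * hr
    rw [hx] at hd hJ2 k1 k2 k3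
    have y1 : 1.2 ≤ ys := by nlinarith only [hyform, hd, hx0]
    obtain ⟨l1, l2, l3⟩ := neg_im_fullSum_le_two hxs (by rw [hJ2]; norm_num) y1
    rcases le_total (2 - x₀) 1.1 with c1 | c1
    · have := k1 c1; norm_num at this l1 ⊢; linarith
    rcases le_total (2 - x₀) 1.25 with c2 | c2
    · have := k2 c1 c2
      have k := l2 (by nlinarith only [hyform, c1, hx0])
      norm_num at this k ⊢; linarith
    · have := k3 c2 (by linarith)
      have k := l3 (by nlinarith only [hyform, c2, hx0])
      norm_num at this k ⊢; linarith
  · have hn3 : (3 : ℝ) ≤ n := by exact_mod_cast h3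
    obtain ⟨k1, k2⟩ := early_bound_three hn3 h he hd j ha hφ hy2 hX
    rcases le_or_gt (n - x₀) 2 with c1 | c1
    · have hys : ys ≤ 2.5 := by
        rw [hysd, div_le_iff₀ (by positivity)]
        have hr := h.radius
        have e : 2 * x₀ * (2.5 * (x₀ + ρ) - n * ρ) = 2.5 * (n ^ 2 + x₀ ^ 2) - n * (n ^ 2 - x₀ ^ 2) := by
          linear_combination (2.5 - n) * hr
        have : 0 ≤ 2 * x₀ * (2.5 * (x₀ + ρ) - n * ρ) := by
          rw [e]
          nlinarith only [c1, hn3, hx0, sq_nonneg ((n : ℝ) - 3), mul_nonneg (sub_nonneg.2 c1) hx0.le,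
            mul_nonneg (mul_nonneg (sub_nonneg.2 c1) hx0.le) (by linarith : (0 : ℝ) ≤ n),
            mul_nonneg (sub_nonneg.2 c1) (by positivity : (0 : ℝ) ≤ n * n), mul_nonneg (sub_nonneg.2 c1) (by linarith : (0 : ℝ) ≤ n)]
        have := nonneg_of_mul_nonneg_right this (by positivity)
        linarith only [this]
      obtain ⟨l1, l2⟩ := neg_im_fullSum_le_three h3 hxs hJ2 (hd.le.trans hJ3) hys
      rcases le_total (n - x₀) 1.1 with c2 | c2
      · have := k2 c2; norm_num at this l1 ⊢; linarith
      · have := l2 (c2.trans hJ3); norm_num at this k1 ⊢; linarith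
    · have := neg_im_fullSum_le_of_one_half_le hxs hJ2 (by linarith)
      norm_num at this k1 ⊢; linarith

end ArcPoint

/-- The parametrization of the arc by the angle at the centre. -/
def arcMap (x₀ ρ θ : ℝ) : ℂ := ⟨x₀ + ρ * (1 - Real.cos θ), ρ * Real.sin θ⟩

lemma hasDerivAt_arcMap (x₀ ρ θ : ℝ) :
    HasDerivAt (arcMap x₀ ρ) (Complex.I * ⟨ρ - ρ * (1 - Real.cos θ), -(ρ * Real.sin θ)⟩) θ := by
  have h1 : HasDerivAt (fun θ : ℝ => x₀ + ρ * (1 - Real.cos θ)) (ρ * Real.sin θ) θ := by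
    refine ((((Real.hasDerivAt_cos θ).const_sub 1).const_mul ρ).const_add x₀).congr_deriv ?_
    ring
  have h2 : HasDerivAt (fun θ : ℝ => ρ * Real.sin θ) (ρ * Real.cos θ) θ :=
    (Real.hasDerivAt_sin θ).const_mul ρ
  have h := h1.ofReal_comp.add (h2.ofReal_comp.mul_const Complex.I)
  have e : arcMap x₀ ρ = fun θ : ℝ => ((x₀ + ρ * (1 - Real.cos θ) : ℝ) : ℂ) + ((ρ * Real.sin θ : ℝ) : ℂ) * Complex.I := by
    funext t
    exact (Complex.mk_eq_add_mul_I _ _)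
  rw [e]
  refine h.congr_deriv ?_
  apply Complex.ext <;>
    simp only [Complex.add_re, Complex.add_im, Complex.mul_re, Complex.mul_im, Complex.ofReal_re,
      Complex.ofReal_im, Complex.I_re, Complex.I_im] <;> ring

namespace ArcPoint
variable {n : ℕ} {x₀ ρ ξ y : ℝ}

lemma exists_angle (h : ArcPoint n x₀ ρ ξ y) :
    ∃ θ ∈ Set.Ioo 0 Real.pi, ξ = ρ * (1 - Real.cos θ) ∧ y = ρ * Real.sin θ := by
  have hρ := h.rho_pos
  have h1 := h.xi_pos
  have h2 := h.xi_lt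
  have h3 : ξ / ρ < 2 := by rw [div_lt_iff₀ hρ]; linarith
  have h4 : 0 < ξ / ρ := by positivity
  refine ⟨Real.arccos (1 - ξ / ρ), ⟨Real.arccos_pos.2 (by linarith), ?_⟩, ?_, ?_⟩
  · refine lt_of_le_of_ne (Real.arccos_le_pi _) fun hc => ?_
    rw [Real.arccos_eq_pi] at hc
    linarith
  · rw [Real.cos_arccos (by linarith) (by linarith)]; field_simp; ring
  · rw [Real.sin_arccos]
    have : 1 - (1 - ξ / ρ) ^ 2 = (y / ρ) ^ 2 := by
      rw [div_pow, h.circle]; field_simp; ring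
    have hy := h.im_pos
    rw [this, Real.sqrt_sq (by positivity)]
    field_simp

lemma arcMap (h : ArcPoint n x₀ ρ ξ y) {θ : ℝ} (hθ : θ ∈ Set.Ioo 0 Real.pi) :
    ArcPoint n x₀ ρ (ρ * (1 - Real.cos θ)) (ρ * Real.sin θ) where
  left_pos := h.left_pos
  left_lt := h.left_lt
  radius := h.radius
  im_pos := mul_pos h.rho_pos (Real.sin_pos_of_mem_Ioo hθ)
  circle := by
    have := Real.sin_sq_add_cos_sq θ
    linear_combination ρ ^ 2 * this

lemma hasDerivAt_re_altSum (h : ArcPoint n x₀ ρ ξ y) {θ : ℝ} (hθ : θ ∈ Set.Ioo 0 Real.pi) :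
    HasDerivAt (fun t => (altSum n (HarmonicSurface.arcMap x₀ ρ t)).re)
      (((⟨ρ - ρ * (1 - Real.cos θ), -(ρ * Real.sin θ)⟩ : ℂ) * altSum₂ n (HarmonicSurface.arcMap x₀ ρ θ)).im) θ := by
  have him : 0 < (HarmonicSurface.arcMap x₀ ρ θ).im := (h.arcMap hθ).im_pos
  have h1 := (hasDerivAt_altSum (n := n) fun k _ => ne_intCast_of_im_pos him k).comp_of_eq θ (hasDerivAt_arcMap x₀ ρ θ) rfl
  have h2 := Complex.reCLM.hasFDerivAt.comp_hasDerivAt θ h1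
  refine h2.congr_deriv ?_
  simp only [Complex.reCLM_apply, Complex.mul_re, Complex.mul_im, Complex.neg_re, Complex.neg_im, Complex.I_re, Complex.I_im]
  ring

lemma hasDerivAt_im_fullSum (h : ArcPoint n x₀ ρ ξ y) {θ : ℝ} (hθ : θ ∈ Set.Ioo 0 Real.pi) :
    HasDerivAt (fun t => (fullSum n (HarmonicSurface.arcMap x₀ ρ t)).im)
      (-((⟨ρ - ρ * (1 - Real.cos θ), -(ρ * Real.sin θ)⟩ : ℂ) * fullSum₂ n (HarmonicSurface.arcMap x₀ ρ θ)).re) θ := by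
  have him : 0 < (HarmonicSurface.arcMap x₀ ρ θ).im := (h.arcMap hθ).im_pos
  have h1 := (hasDerivAt_fullSum (n := n) fun k _ => ne_intCast_of_im_pos him k).comp_of_eq θ (hasDerivAt_arcMap x₀ ρ θ) rfl
  have h2 := Complex.imCLM.hasFDerivAt.comp_hasDerivAt θ h1
  refine h2.congr_deriv ?_
  simp only [Complex.imCLM_apply, Complex.mul_re, Complex.mul_im, Complex.neg_re, Complex.neg_im, Complex.I_re, Complex.I_im]
  ring

lemma sq_add_sq (h : ArcPoint n x₀ ρ ξ y) : (x₀ + ξ) ^ 2 + y ^ 2 = x₀ ^ 2 + 2 * ξ * (x₀ + ρ) := by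
  linear_combination h.circle

lemma abs_re_altSum_le (h : ArcPoint n x₀ ρ ξ y) (hz : (n : ℝ) ^ 2 ≤ (x₀ + ξ) ^ 2 + y ^ 2) (j : ℤ) :
    |alt j * (altSum n ⟨x₀ + ξ, y⟩).re| ≤ 1 / (n - x₀) := by
  have h1 := abs_alt_mul_re_altSum_le (n := n) (x := x₀ + ξ) (y := y) (d := n - x₀)
    (by linarith [h.left_pos, h.xi_pos]) h.im_pos (sub_pos.2 h.left_lt) hz (by
      rw [h.normSq_sub]
      nlinarith [mul_nonneg h.xi_pos.le (sub_nonneg.2 h.le_rho)])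
  rw [abs_mul, abs_alt] at h1 ⊢
  exact h1

/-- The derivatives of the two coordinates along the arc do not vanish simultaneously, and
the two coordinates determine the point of the arc. -/
def Good (n : ℕ) (x₀ ρ : ℝ) : Prop :=
  Set.InjOn (fun θ => ((altSum n (HarmonicSurface.arcMap x₀ ρ θ)).re, (fullSum n (HarmonicSurface.arcMap x₀ ρ θ)).im)) (Set.Ioo 0 Real.pi) ∧
  ∀ θ ∈ Set.Ioo 0 Real.pi,
    ((⟨ρ - ρ * (1 - Real.cos θ), -(ρ * Real.sin θ)⟩ : ℂ) * altSum₂ n (HarmonicSurface.arcMap x₀ ρ θ)).im ≠ 0 ∨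
    ((⟨ρ - ρ * (1 - Real.cos θ), -(ρ * Real.sin θ)⟩ : ℂ) * fullSum₂ n (HarmonicSurface.arcMap x₀ ρ θ)).re ≠ 0

lemma good_of_im_ne (h : ArcPoint n x₀ ρ ξ y) {c : ℝ} (hc : ∀ θ ∈ Set.Ioo 0 Real.pi, 0 < c *
    ((⟨ρ - ρ * (1 - Real.cos θ), -(ρ * Real.sin θ)⟩ : ℂ) * altSum₂ n (HarmonicSurface.arcMap x₀ ρ θ)).im) :
    Good n x₀ ρ := by
  constructor
  · have := injOn_of_threshold (a := 0) (b := Real.pi) (K := 0) (φ := fun _ => 0) (φ' := fun _ => 0)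
      (ψ := fun θ => c * (altSum n (HarmonicSurface.arcMap x₀ ρ θ)).re) (fun θ _ => hasDerivAt_const θ 0)
      (fun θ hθ => (h.hasDerivAt_re_altSum hθ).const_mul c) (fun θ _ h0 => absurd h0 (lt_irrefl _))
      (fun θ hθ _ => hc θ hθ)
    intro s hs t ht hst
    refine this hs ht ?_
    simp only [Prod.mk.injEq] at hst ⊢
    exact ⟨trivial, by rw [hst.1]⟩
  · intro θ hθ
    left
    intro h0
    have := hc θ hθ
    rw [h0, mul_zero] at this
    exact lt_irrefl _ this

lemma good_of_threshold (h : ArcPoint n x₀ ρ ξ y) {j : ℤ} {K b : ℝ} (hb : b ≤ Real.pi)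
    (h₁ : ∀ θ ∈ Set.Ioo 0 b, -(alt j * (altSum n (HarmonicSurface.arcMap x₀ ρ θ)).re) < K →
      alt j * ((⟨ρ - ρ * (1 - Real.cos θ), -(ρ * Real.sin θ)⟩ : ℂ) * altSum₂ n (HarmonicSurface.arcMap x₀ ρ θ)).im < 0)
    (h₂ : ∀ θ ∈ Set.Ioo 0 b,
      0 ≤ ((⟨ρ - ρ * (1 - Real.cos θ), -(ρ * Real.sin θ)⟩ : ℂ) * fullSum₂ n (HarmonicSurface.arcMap x₀ ρ θ)).re →
      -(alt j * (altSum n (HarmonicSurface.arcMap x₀ ρ θ)).re) < K) :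
    Set.InjOn (fun θ => ((altSum n (HarmonicSurface.arcMap x₀ ρ θ)).re, (fullSum n (HarmonicSurface.arcMap x₀ ρ θ)).im)) (Set.Ioo 0 b) ∧
    ∀ θ ∈ Set.Ioo 0 b,
    ((⟨ρ - ρ * (1 - Real.cos θ), -(ρ * Real.sin θ)⟩ : ℂ) * altSum₂ n (HarmonicSurface.arcMap x₀ ρ θ)).im ≠ 0 ∨
    ((⟨ρ - ρ * (1 - Real.cos θ), -(ρ * Real.sin θ)⟩ : ℂ) * fullSum₂ n (HarmonicSurface.arcMap x₀ ρ θ)).re ≠ 0 := by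
  have hsub : ∀ θ ∈ Set.Ioo 0 b, θ ∈ Set.Ioo 0 Real.pi := fun θ hθ => ⟨hθ.1, hθ.2.trans_le hb⟩
  constructor
  · have := injOn_of_threshold (a := 0) (b := b) (K := K)
      (φ := fun θ => -(alt j * (altSum n (HarmonicSurface.arcMap x₀ ρ θ)).re))
      (ψ := fun θ => (fullSum n (HarmonicSurface.arcMap x₀ ρ θ)).im)
      (fun θ hθ => ((h.hasDerivAt_re_altSum (hsub θ hθ)).const_mul (alt j)).neg)
      (fun θ hθ => h.hasDerivAt_im_fullSum (hsub θ hθ)) (fun θ hθ h0 => neg_pos.2 (h₁ θ hθ h0))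
      (fun θ hθ h0 => by
        by_contra hc
        exact absurd (h₂ θ hθ (by linarith)) (not_lt.2 h0))
    intro s hs t ht hst
    refine this hs ht ?_
    simp only [Prod.mk.injEq] at hst ⊢
    exact ⟨by rw [hst.1], hst.2⟩
  · intro θ hθ
    by_contra hc
    push Not at hc
    have := h₁ θ hθ (h₂ θ hθ hc.2.ge)
    rw [hc.1, mul_zero] at this
    exact lt_irrefl _ this

lemma good_of_le_one (h : ArcPoint n x₀ ρ ξ y) (hn : 2 ≤ n) (hd : 0.95 ≤ n - x₀) (hd1 : n - x₀ ≤ 1) : Good n x₀ ρ := by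
  refine h.good_of_threshold (j := n - 1) (K := -5) le_rfl (fun θ hθ h0 => ?_) (fun θ hθ h0 => ?_)
  · have ha := h.arcMap hθ
    rcases lt_or_ge ((x₀ + ρ * (1 - Real.cos θ)) ^ 2 + (ρ * Real.sin θ) ^ 2) ((n : ℝ) ^ 2) with he | he
    · exact ha.im_neg_of_phi_lt_one he hn hd hd1 rfl h0
    · have h1 := ha.abs_re_altSum_le he (n - 1)
      have h2 : 1 / ((n : ℝ) - x₀) ≤ 5 := by rw [div_le_iff₀ (by linarith)]; linarith
      have := le_abs_self (alt (n - 1 : ℤ) * (altSum n (HarmonicSurface.arcMap x₀ ρ θ)).re)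
      rw [HarmonicSurface.arcMap] at *
      linarith
  · have ha := h.arcMap hθ
    rcases lt_or_ge ((x₀ + ρ * (1 - Real.cos θ)) ^ 2 + (ρ * Real.sin θ) ^ 2) ((n : ℝ) ^ 2) with he | he
    · exact ha.phi_lt_of_turn_one he hn hd hd1 h0 rfl
    · exact absurd h0 (not_le.2 (ha.re_mul_fullSum₂_neg he))

lemma good_of_one_lt (h : ArcPoint n x₀ ρ ξ y) (hn : 2 ≤ n) (hd : 1 < n - x₀) : Good n x₀ ρ := by
  set m := Real.sqrt (2 * (n - x₀) + 1) with hmd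
  have hm : 0 < m := Real.sqrt_pos.2 (by linarith)
  have hm2 : m ^ 2 = 2 * (n - x₀) + 1 := Real.sq_sqrt (by linarith)
  set j := ⌊x₀⌋ with hjd
  have hj : (j : ℝ) ≤ x₀ := Int.floor_le x₀
  have hj' : x₀ < j + 1 := Int.lt_floor_add_one x₀
  obtain ⟨κ, hκ, k1, k2, k3, k4⟩ : ∃ κ : ℝ,
      (κ = 0.83 ∨ κ = 0.88 ∧ 1.5 ≤ n - x₀ ∨ κ = 0.95 ∧ 1.5 ≤ n - x₀ ∧ n - x₀ ≤ 2 ∧ 3 ≤ n) ∧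
      0.83 ≤ κ ∧ (1.5 ≤ n - x₀ → 0.88 ≤ κ) ∧ (n - x₀ ≤ 2 → 1.5 ≤ n - x₀ → 3 ≤ n → 0.95 ≤ κ) ∧
      (2 < n - x₀ → 0.88 ≤ κ) := by
    by_cases c1 : 1.5 ≤ n - x₀
    · by_cases c2 : n - x₀ ≤ 2 ∧ 3 ≤ n
      · exact ⟨0.95, Or.inr (Or.inr ⟨rfl, c1, c2⟩), by norm_num, fun _ => by norm_num, fun _ _ _ => by norm_num,
          fun _ => by norm_num⟩
      · exact ⟨0.88, Or.inr (Or.inl ⟨rfl, c1⟩), by norm_num, fun _ => by norm_num, fun a _ b => absurd ⟨a, b⟩ c2,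
          fun _ => by norm_num⟩
    · exact ⟨0.83, Or.inl rfl, by norm_num, fun c => absurd c c1, fun _ c => absurd c c1,
        fun c => absurd (by linarith) c1⟩
  obtain ⟨hJ, hJ2, -⟩ := h.junction
  obtain ⟨τ, hτ, hτ1, hτ2⟩ := hJ.exists_angle
  have hS : 0 < x₀ + ρ := add_pos h.left_pos h.rho_pos
  have hearly : ∀ θ ∈ Set.Ioo 0 Real.pi, (x₀ + ρ * (1 - Real.cos θ)) ^ 2 + (ρ * Real.sin θ) ^ 2 < (n : ℝ) ^ 2 ↔ θ < τ := by
    intro θ hθ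
    have e : (n : ℝ) ^ 2 = (x₀ + (n ^ 2 / (x₀ + ρ) - x₀)) ^ 2 + (n * ρ / (x₀ + ρ)) ^ 2 := by
      rw [add_sub_cancel, hJ2]
    rw [e, hJ.sq_add_sq, (h.arcMap hθ).sq_add_sq, hτ1]
    have hcos : Real.cos τ < Real.cos θ ↔ θ < τ :=
      Real.strictAntiOn_cos.lt_iff_gt ⟨hτ.1.le, hτ.2.le⟩ ⟨hθ.1.le, hθ.2.le⟩
    rw [← hcos]
    have hρ := h.rho_pos
    constructor
    · intro h1
      have : 0 < 2 * (ρ * (x₀ + ρ)) * (Real.cos θ - Real.cos τ) := by linarith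
      exact sub_pos.1 (pos_of_mul_pos_right this (by positivity))
    · intro h1
      have : 0 < 2 * (ρ * (x₀ + ρ)) * (Real.cos θ - Real.cos τ) := mul_pos (by positivity) (sub_pos.2 h1)
      linarith
  have hE := h.good_of_threshold (j := j) (b := τ) (K := alt j * alt n *
      (1 / (2 * (n - x₀ + 1 / 2)) - 1 / (2 * (n + x₀ + 1 / 2))) - κ / m) hτ.2.le
    (fun θ hθ h0 => by
      have hθ' : θ ∈ Set.Ioo 0 Real.pi := ⟨hθ.1, hθ.2.trans hτ.2⟩
      have he := (hearly θ hθ').2 hθ.2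
      rcases le_or_gt (n - x₀) 2 with hd2 | hd2
      · exact (h.arcMap hθ').im_neg_of_phi_lt_near he hn hd hd2 (strip_index hj hj' hd hd2) hm hm2 k1 k2 (k3 hd2) h0
      · exact (h.arcMap hθ').im_neg_of_phi_lt_far he hd2 hj hj' hm hm2 (k4 hd2) h0)
    (fun θ hθ h0 => by
      have hθ' : θ ∈ Set.Ioo 0 Real.pi := ⟨hθ.1, hθ.2.trans hτ.2⟩
      exact (h.arcMap hθ').phi_lt_of_turn ((hearly θ hθ').2 hθ.2) hn hd h0 hj hj' hm hm2 hκ)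
  have hlate : ∀ θ ∈ Set.Ioo 0 Real.pi, τ ≤ θ →
      ((⟨ρ - ρ * (1 - Real.cos θ), -(ρ * Real.sin θ)⟩ : ℂ) * fullSum₂ n (HarmonicSurface.arcMap x₀ ρ θ)).re < 0 :=
    fun θ hθ h0 => (h.arcMap hθ).re_mul_fullSum₂_neg (not_lt.1 fun hc => absurd ((hearly θ hθ).1 hc) (not_lt.2 h0))
  have hmono : ∀ s ∈ Set.Ioo 0 Real.pi, ∀ t ∈ Set.Ioo 0 Real.pi, s < t → (∀ θ ∈ Set.Ioo 0 Real.pi, s ≤ θ →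
      ((⟨ρ - ρ * (1 - Real.cos θ), -(ρ * Real.sin θ)⟩ : ℂ) * fullSum₂ n (HarmonicSurface.arcMap x₀ ρ θ)).re < 0) →
      (fullSum n (HarmonicSurface.arcMap x₀ ρ s)).im < (fullSum n (HarmonicSurface.arcMap x₀ ρ t)).im := by
    intro s hs t ht hst hneg
    have hsub : ∀ θ ∈ Set.Icc s t, θ ∈ Set.Ioo 0 Real.pi := fun θ hθ => ⟨hs.1.trans_le hθ.1, hθ.2.trans_lt ht.2⟩
    refine strictMonoOn_of_deriv_pos (f := fun θ => (fullSum n (HarmonicSurface.arcMap x₀ ρ θ)).im) (convex_Icc s t)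
      (fun θ hθ => (h.hasDerivAt_im_fullSum (hsub θ hθ)).continuousAt.continuousWithinAt) (fun θ hθ => ?_)
      ⟨le_rfl, hst.le⟩ ⟨hst.le, le_rfl⟩ hst
    have hθ' := interior_subset hθ
    rw [(h.hasDerivAt_im_fullSum (hsub θ hθ')).deriv]
    exact neg_pos.2 (hneg θ (hsub θ hθ') hθ'.1)
  refine ⟨?_, fun θ hθ => ?_⟩
  · have key : ∀ s ∈ Set.Ioo 0 Real.pi, ∀ t ∈ Set.Ioo 0 Real.pi, s < t →
        ((altSum n (HarmonicSurface.arcMap x₀ ρ s)).re, (fullSum n (HarmonicSurface.arcMap x₀ ρ s)).im) =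
        ((altSum n (HarmonicSurface.arcMap x₀ ρ t)).re, (fullSum n (HarmonicSurface.arcMap x₀ ρ t)).im) → False := by
      intro s hs t ht hst heq
      simp only [Prod.mk.injEq] at heq
      rcases lt_or_ge t τ with h1 | h1
      · exact hst.ne (hE.1 ⟨hs.1, hst.trans h1⟩ ⟨ht.1, h1⟩ (Prod.ext heq.1 heq.2))
      rcases le_or_gt τ s with h2 | h2
      · exact (hmono s hs t ht hst fun θ hθ h3 => hlate θ hθ (h2.trans h3)).ne heq.2
      by_cases hb : ∀ θ ∈ Set.Ioo 0 Real.pi, s ≤ θ →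
          ((⟨ρ - ρ * (1 - Real.cos θ), -(ρ * Real.sin θ)⟩ : ℂ) * fullSum₂ n (HarmonicSurface.arcMap x₀ ρ θ)).re < 0
      · exact (hmono s hs t ht hst hb).ne heq.2
      · push Not at hb
        obtain ⟨b, hb, hsb, hb0⟩ := hb
        have hbτ : b < τ := not_le.1 fun hc => absurd hb0 (not_le.2 (hlate b hb hc))
        have hφ : |alt j * (altSum n (HarmonicSurface.arcMap x₀ ρ s)).re| ≤ 1 / (n - x₀) := by
          rw [heq.1]
          exact (h.arcMap ht).abs_re_altSum_le (not_lt.1 fun hc => absurd ((hearly t ht).1 hc) (not_lt.2 h1)) j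
        have hcos : Real.cos b ≤ Real.cos s :=
          Real.strictAntiOn_cos.antitoneOn ⟨hs.1.le, hs.2.le⟩ ⟨hb.1.le, hb.2.le⟩ hsb
        have hlt := (h.arcMap hs).im_fullSum_lt_junction hn hd (h.arcMap hb) ((hearly b hb).2 hbτ) hb0
          (mul_le_mul_of_nonneg_left (by linarith) h.rho_pos.le) hj hj' hφ
        have e : (⟨n ^ 2 / (x₀ + ρ), n * ρ / (x₀ + ρ)⟩ : ℂ) = HarmonicSurface.arcMap x₀ ρ τ := by
          rw [HarmonicSurface.arcMap, ← hτ1, ← hτ2]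
          congr 1; ring
        rw [e] at hlt
        have hle : (fullSum n (HarmonicSurface.arcMap x₀ ρ τ)).im ≤ (fullSum n (HarmonicSurface.arcMap x₀ ρ t)).im := by
          rcases h1.eq_or_lt with h3 | h3
          · rw [h3]
          · exact (hmono τ hτ t ht h3 fun θ hθ h4 => hlate θ hθ h4).le
        have := heq.2
        rw [HarmonicSurface.arcMap] at this
        linarith
    intro s hs t ht heq
    rcases lt_trichotomy s t with h1 | h1 | h1
    · exact (key s hs t ht h1 heq).elim
    · exact h1
    · exact (key t ht s hs h1 heq.symm).elim
  · rcases lt_or_ge θ τ with h1 | h1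
    · exact hE.2 θ ⟨hθ.1, h1⟩
    · exact Or.inr (hlate θ hθ h1).ne

lemma good (h : ArcPoint n x₀ ρ ξ y) : Good n x₀ ρ := by
  have hn : 0 < n := by
    have := h.left_pos.trans h.left_lt
    exact_mod_cast this
  rcases Nat.lt_or_ge n 2 with h1 | h1
  · obtain rfl : n = 1 := by omega
    exact h.good_of_im_ne (c := -1) fun θ hθ => by
      have := (h.arcMap hθ).im_mul_altSum₂_neg_of_one
      rw [HarmonicSurface.arcMap]; linarith
  rcases le_or_gt (n - x₀) 0.95 with h2 | h2
  · exact h.good_of_im_ne (c := alt n) fun θ hθ => (h.arcMap hθ).alt_mul_im_pos h1 (by norm_num at h2 ⊢; linarith)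
  rcases le_or_gt (n - x₀) 1 with h3 | h3
  · exact h.good_of_le_one h1 h2.le h3
  · exact h.good_of_one_lt h1 h3

/-- The first two coordinates determine the points of an arc. -/
lemma eq_of_eq {ξ₁ y₁ : ℝ} (h : ArcPoint n x₀ ρ ξ y) (h₁ : ArcPoint n x₀ ρ ξ₁ y₁)
    (ha : (altSum n ⟨x₀ + ξ, y⟩).re = (altSum n ⟨x₀ + ξ₁, y₁⟩).re)
    (hf : (fullSum n ⟨x₀ + ξ, y⟩).im = (fullSum n ⟨x₀ + ξ₁, y₁⟩).im) : ξ = ξ₁ ∧ y = y₁ := by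
  obtain ⟨s, hs, rfl, rfl⟩ := h.exists_angle
  obtain ⟨t, ht, rfl, rfl⟩ := h₁.exists_angle
  obtain rfl := h.good.1 hs ht (Prod.ext ha hf)
  exact ⟨rfl, rfl⟩

lemma deriv_ne (h : ArcPoint n x₀ ρ ξ y) : ((⟨ρ - ξ, -y⟩ : ℂ) * altSum₂ n ⟨x₀ + ξ, y⟩).im ≠ 0 ∨
    ((⟨ρ - ξ, -y⟩ : ℂ) * fullSum₂ n ⟨x₀ + ξ, y⟩).re ≠ 0 := by
  obtain ⟨s, hs, rfl, rfl⟩ := h.exists_angle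
  exact h.good.2 s hs

end ArcPoint

/-! ### The map and its local holomorphic primitives -/

lemma pt_mem_stackEnds {n : ℕ} {z : ℂ} : (OnePoint.some z : Sphere) ∈ stackEnds n ↔ ∃ k : ℤ, |k| ≤ n ∧ z = k := by
  simp [stackEnds, pt]

lemma infty_notMem_stackEnds (n : ℕ) : (OnePoint.infty : Sphere) ∉ stackEnds n := by
  rintro ⟨k, -, hk⟩
  exact OnePoint.infty_ne_coe _ hk

lemma finite_int_ends (n : ℕ) : {z : ℂ | ∃ k : ℤ, |k| ≤ n ∧ z = k}.Finite := by
  have : {z : ℂ | ∃ k : ℤ, |k| ≤ n ∧ z = k} ⊆ (fun k : ℤ => (k : ℂ)) '' Set.Icc (-(n : ℤ)) n := by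
    rintro z ⟨k, hk, rfl⟩
    exact ⟨k, abs_le.1 hk, rfl⟩
  exact ((Set.finite_Icc _ _).image _).subset this

lemma stackEnds_finite (n : ℕ) : (stackEnds n).Finite := by
  refine ((finite_int_ends n).image OnePoint.some).subset ?_
  rintro p ⟨k, hk, rfl⟩
  exact ⟨k, ⟨k, hk, rfl⟩, rfl⟩

lemma isOpen_ne_ends (n : ℕ) : IsOpen {z : ℂ | ∀ k : ℤ, |k| ≤ n → z ≠ k} := by
  convert (finite_int_ends n).isClosed.isOpen_compl using 1
  ext z
  simp

lemma sum_Icc_one (n : ℕ) (g : ℕ → ℂ) : ∑ k ∈ Finset.Icc 1 n, g k = ∑ k ∈ Finset.range n, g (k + 1) := by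
  rw [Finset.range_eq_Ico, Finset.sum_Ico_add' g 0 n 1]
  rfl

lemma stackForms_zero (n : ℕ) (z : ℂ) : stackForms n 0 z = altSum₂ n z := by
  rw [altSum₂, sum_Icc_neg_eq]
  simp only [stackForms, Matrix.cons_val_zero, sum_Icc_one]
  congr 1
  · simp [alt]
  · refine Finset.sum_congr rfl fun k _ => ?_
    have h : alt ((k : ℤ) + 1) = (-1) ^ (k + 1) := by exact_mod_cast alt_natCast (k + 1)
    rw [alt_neg, h]
    push_cast
    rw [sub_neg_eq_add]
    ring

lemma stackForms_one (n : ℕ) (z : ℂ) : stackForms n 1 z = Complex.I * fullSum₂ n z := by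
  rw [fullSum₂, sum_Icc_neg_eq]
  simp only [stackForms, Matrix.cons_val_one, Matrix.cons_val_zero, sum_Icc_one]
  push_cast
  simp only [sub_neg_eq_add, sub_zero]
  ring

lemma stackForms_two (n : ℕ) (z : ℂ) : stackForms n 2 z = 1 / (z + n) - 1 / (z - n) := rfl

/-- The map `Re ∫ (ω₁, ω₂, ω₃)`. -/
def stackMap (n : ℕ) : Sphere → EuclideanSpace ℝ (Fin 3)
  | OnePoint.infty => 0
  | OnePoint.some z => !₂[-(altSum n z).re, (fullSum n z).im, Real.log ‖z + n‖ - Real.log ‖z - n‖]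

/-- Primitives of the three forms in the coordinate centred at `p`. -/
def primAt (n : ℕ) : Sphere → Fin 3 → ℂ → ℂ
  | OnePoint.infty => ![fun ζ => -∑ k ∈ Finset.Icc (-(n : ℤ)) n, alt k * (ζ / (1 - k * ζ)),
      fun ζ => -Complex.I * ∑ k ∈ Finset.Icc (-(n : ℤ)) n, ζ / (1 - k * ζ),
      fun ζ => Complex.log (1 + n * ζ) - Complex.log (1 - n * ζ)]
  | OnePoint.some a => ![fun ζ => -altSum n (a + ζ), fun ζ => -Complex.I * fullSum n (a + ζ),
      fun ζ => Complex.log ((a + ζ + n) / (a + n)) - Complex.log ((a + ζ - n) / (a - n))]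

lemma hasDerivAt_div_one_sub {k ζ : ℂ} (h : 1 - k * ζ ≠ 0) :
    HasDerivAt (fun ζ => ζ / (1 - k * ζ)) (1 / (1 - k * ζ) ^ 2) ζ := by
  have h1 := (hasDerivAt_id ζ).div (((hasDerivAt_id ζ).const_mul k).const_sub 1) h
  refine h1.congr_deriv ?_
  simp only [id, one_mul, mul_one]
  congr 1
  ring

lemma eventually_one_sub_ne (n : ℕ) : ∀ᶠ ζ : ℂ in 𝓝 0, ∀ k ∈ Finset.Icc (-(n : ℤ)) n, 1 - (k : ℂ) * ζ ≠ 0 := by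
  rw [Finset.eventually_all]
  intro k _
  have : ContinuousAt (fun ζ : ℂ => 1 - (k : ℂ) * ζ) 0 := by fun_prop
  exact this.eventually_ne (by simp)

lemma hasDerivAt_primAt {n : ℕ} {p : Sphere} (hp : p ∉ stackEnds n) (i : Fin 3) :
    ∃ D : ℂ → ℂ, ∀ᶠ ζ in 𝓝 0, HasDerivAt (primAt n p i) (D ζ) ζ ∧
      (ζ ≠ 0 ∨ p ≠ OnePoint.infty → D ζ = localCoeff (stackForms n i) p ζ) := by
  induction p using OnePoint.rec with
  | infty =>
    have hev := eventually_one_sub_ne n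
    fin_cases i
    · refine ⟨fun ζ => -∑ k ∈ Finset.Icc (-(n : ℤ)) n, alt k * (1 / (1 - k * ζ) ^ 2), ?_⟩
      filter_upwards [hev] with ζ hζ
      refine ⟨(HasDerivAt.fun_sum fun k hk => (hasDerivAt_div_one_sub (hζ k hk)).const_mul (alt k : ℂ)).neg, fun h0 => ?_⟩
      replace h0 : ζ ≠ 0 := by simpa using h0
      simp only [localCoeff]
      erw [stackForms_zero]
      rw [altSum₂, neg_mul, Finset.mul_sum]
      congr 1
      refine Finset.sum_congr rfl fun k hk => ?_
      have := hζ k hk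
      have e : ζ⁻¹ - k = (1 - k * ζ) / ζ := by field_simp
      rw [e]
      field_simp
    · refine ⟨fun ζ => -Complex.I * ∑ k ∈ Finset.Icc (-(n : ℤ)) n, (1 / (1 - k * ζ) ^ 2), ?_⟩
      filter_upwards [hev] with ζ hζ
      refine ⟨(HasDerivAt.fun_sum fun k hk => (hasDerivAt_div_one_sub (hζ k hk))).const_mul (-Complex.I), fun h0 => ?_⟩
      replace h0 : ζ ≠ 0 := by simpa using h0
      simp only [localCoeff]
      erw [stackForms_one]
      rw [fullSum₂, mul_left_comm, Finset.mul_sum, Finset.mul_sum, Finset.mul_sum]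
      refine Finset.sum_congr rfl fun k hk => ?_
      have := hζ k hk
      have e : ζ⁻¹ - k = (1 - k * ζ) / ζ := by field_simp
      rw [e]
      field_simp
    · refine ⟨fun ζ => n / (1 + n * ζ) - -n / (1 - n * ζ), ?_⟩
      have c1 : ContinuousAt (fun ζ : ℂ => 1 + (n : ℂ) * ζ) 0 := by fun_prop
      have c2 : ContinuousAt (fun ζ : ℂ => 1 - (n : ℂ) * ζ) 0 := by fun_prop
      filter_upwards [c1.eventually_mem (Complex.isOpen_slitPlane.mem_nhds (by simp)),
        c2.eventually_mem (Complex.isOpen_slitPlane.mem_nhds (by simp))] with ζ s1 s2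
      constructor
      · have d1 := (((hasDerivAt_id ζ).const_mul (n : ℂ)).const_add 1).clog s1
        have d2 := (((hasDerivAt_id ζ).const_mul (n : ℂ)).const_sub 1).clog s2
        refine (d1.sub d2).congr_deriv ?_
        simp
      · intro h0
        replace h0 : ζ ≠ 0 := by simpa using h0
        have n1 := Complex.slitPlane_ne_zero s1
        have n2 := Complex.slitPlane_ne_zero s2
        simp only [localCoeff]
        erw [stackForms_two]
        have e1 : ζ⁻¹ - n = (1 - n * ζ) / ζ := by field_simp
        have e2 : ζ⁻¹ + n = (1 + n * ζ) / ζ := by field_simp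
        rw [e1, e2]
        field_simp
        ring
  | coe a =>
    have ha : ∀ k : ℤ, |k| ≤ n → a ≠ k := fun k hk h => hp (pt_mem_stackEnds.2 ⟨k, hk, h⟩)
    have c0 : ContinuousAt (fun ζ : ℂ => a + ζ) 0 := by fun_prop
    have hev : ∀ᶠ ζ : ℂ in 𝓝 0, ∀ k : ℤ, |k| ≤ n → a + ζ ≠ k :=
      c0.eventually_mem ((isOpen_ne_ends n).mem_nhds (by simpa using ha))
    have hadd : ∀ ζ : ℂ, HasDerivAt (fun ζ : ℂ => a + ζ) 1 ζ := fun ζ => (hasDerivAt_id ζ).const_add a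
    refine ⟨localCoeff (stackForms n i) (OnePoint.some a), ?_⟩
    fin_cases i
    · filter_upwards [hev] with ζ hζ
      refine ⟨(((hasDerivAt_altSum hζ).comp ζ (hadd ζ)).neg).congr_deriv ?_, fun _ => rfl⟩
      simp only [localCoeff]
      erw [stackForms_zero]
      ring
    · filter_upwards [hev] with ζ hζ
      refine ⟨(((hasDerivAt_fullSum hζ).comp ζ (hadd ζ)).const_mul (-Complex.I)).congr_deriv ?_, fun _ => rfl⟩
      simp only [localCoeff]
      erw [stackForms_one]
      ring
    · have a1 : a + n ≠ 0 := fun h => ha (-n) (by simp) (by push_cast; linear_combination h)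
      have a2 : a - n ≠ 0 := fun h => ha n (by simp) (by push_cast; linear_combination h)
      have c1 : ContinuousAt (fun ζ : ℂ => (a + ζ + n) / (a + n)) 0 := by fun_prop
      have c2 : ContinuousAt (fun ζ : ℂ => (a + ζ - n) / (a - n)) 0 := by fun_prop
      filter_upwards [c1.eventually_mem (Complex.isOpen_slitPlane.mem_nhds (by simp [a1])),
        c2.eventually_mem (Complex.isOpen_slitPlane.mem_nhds (by simp [a2]))] with ζ s1 s2
      refine ⟨?_, fun _ => rfl⟩
      have d1 := (((hadd ζ).add_const (n : ℂ)).div_const (a + n)).clog s1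
      have d2 := (((hadd ζ).sub_const (n : ℂ)).div_const (a - n)).clog s2
      have n1 := Complex.slitPlane_ne_zero s1
      have n2 := Complex.slitPlane_ne_zero s2
      refine (d1.sub d2).congr_deriv ?_
      simp only [localCoeff]
      erw [stackForms_two]
      have m1 : a + ζ + n ≠ 0 := fun h => n1 (by rw [h, zero_div])
      have m2 : a + ζ - n ≠ 0 := fun h => n2 (by rw [h, zero_div])
      field_simp

lemma stackMap_patch {n : ℕ} {p : Sphere} (hp : p ∉ stackEnds n) (i : Fin 3) :
    ∃ c : ℝ, ∀ᶠ ζ in 𝓝 0, stackMap n (patch p ζ) i = (primAt n p i ζ).re + c := by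
  induction p using OnePoint.rec with
  | infty =>
    refine ⟨0, ?_⟩
    have hev := eventually_one_sub_ne n
    have c1 : ContinuousAt (fun ζ : ℂ => 1 + (n : ℂ) * ζ) 0 := by fun_prop
    filter_upwards [hev, c1.eventually_ne (by simp : 1 + (n : ℂ) * 0 ≠ 0)] with ζ hζ h1
    by_cases h0 : ζ = 0
    · subst h0
      fin_cases i <;> simp [patch, stackMap, primAt]
    have hterm : ∀ k ∈ Finset.Icc (-(n : ℤ)) n, 1 / (ζ⁻¹ - k) = ζ / (1 - k * ζ) := fun k hk => by
      have := hζ k hk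
      have e : ζ⁻¹ - k = (1 - k * ζ) / ζ := by field_simp
      rw [e, one_div_div]
    fin_cases i
    · simp only [patch, h0, if_false, stackMap, primAt]
      simp
      rw [altSum, Complex.re_sum]
      refine Finset.sum_congr rfl fun k hk => ?_
      rw [← hterm k hk, ← Complex.re_ofReal_mul, mul_one_div]
    · simp only [patch, h0, if_false, stackMap, primAt]
      simp
      rw [fullSum, Complex.im_sum]
      exact Finset.sum_congr rfl fun k hk => congrArg Complex.im (hterm k hk)
    · have h2 : 1 - (n : ℂ) * ζ ≠ 0 := by simpa using hζ n (by simp)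
      simp only [patch, h0, if_false, stackMap, primAt]
      simp [Complex.log_re]
      have e1 : ζ⁻¹ - n = (1 - n * ζ) / ζ := by field_simp
      have e2 : ζ⁻¹ + n = (1 + n * ζ) / ζ := by field_simp
      rw [e1, e2, norm_div, norm_div, Real.log_div (by simpa using h1) (by simpa using h0),
        Real.log_div (by simpa using h2) (by simpa using h0)]
      ring
  | coe a =>
    have ha : ∀ k : ℤ, |k| ≤ n → a ≠ k := fun k hk h => hp (pt_mem_stackEnds.2 ⟨k, hk, h⟩)
    fin_cases i
    · exact ⟨0, Eventually.of_forall fun ζ => by simp [patch, stackMap, primAt]⟩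
    · exact ⟨0, Eventually.of_forall fun ζ => by simp [patch, stackMap, primAt]⟩
    · have a1 : a + n ≠ 0 := fun h => ha (-n) (by simp) (by push_cast; linear_combination h)
      have a2 : a - n ≠ 0 := fun h => ha n (by simp) (by push_cast; linear_combination h)
      have c1 : ContinuousAt (fun ζ : ℂ => a + ζ + n) 0 := by fun_prop
      have c2 : ContinuousAt (fun ζ : ℂ => a + ζ - n) 0 := by fun_prop
      refine ⟨Real.log ‖a + n‖ - Real.log ‖a - n‖, ?_⟩
      filter_upwards [c1.eventually_ne (by simpa using a1), c2.eventually_ne (by simpa using a2)] with ζ m1 m2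
      simp only [patch, stackMap, primAt]
      simp [Complex.log_re]
      rw [Real.log_div (by simpa using m1) (by simpa using a1), Real.log_div (by simpa using m2) (by simpa using a2)]
      ring

lemma analyticAt_primAt {n : ℕ} {p : Sphere} (hp : p ∉ stackEnds n) (i : Fin 3) : AnalyticAt ℂ (primAt n p i) 0 := by
  obtain ⟨D, hD⟩ := hasDerivAt_primAt hp i
  exact Complex.analyticAt_iff_eventually_differentiableAt.2 (hD.mono fun ζ h => h.1.differentiableAt)

lemma deriv_primAt_eq {n : ℕ} {p : Sphere} (hp : p ∉ stackEnds n) (i : Fin 3) :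
    deriv (primAt n p i) =ᶠ[𝓝[≠] 0] localCoeff (stackForms n i) p := by
  obtain ⟨D, hD⟩ := hasDerivAt_primAt hp i
  filter_upwards [hD.filter_mono nhdsWithin_le_nhds, self_mem_nhdsWithin] with ζ h h0
  rw [h.1.deriv, h.2 (Or.inl h0)]

lemma coeffAt_eq {n : ℕ} {p : Sphere} (hp : p ∉ stackEnds n) (i : Fin 3) :
    coeffAt (stackForms n i) p = deriv (primAt n p i) 0 := by
  have h := (analyticAt_primAt hp i).deriv.continuousAt.tendsto
  exact ((h.mono_left nhdsWithin_le_nhds).congr' (deriv_primAt_eq hp i)).limUnder_eq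

lemma coeffAt_some {n : ℕ} {a : ℂ} (ha : (OnePoint.some a : Sphere) ∉ stackEnds n) (i : Fin 3) :
    coeffAt (stackForms n i) (OnePoint.some a) = stackForms n i a := by
  obtain ⟨D, hD⟩ := hasDerivAt_primAt ha i
  have h := hD.self_of_nhds
  rw [coeffAt_eq ha, h.1.deriv, h.2 (Or.inr (OnePoint.coe_ne_infty a))]
  exact congrArg (stackForms n i) (add_zero a)

lemma isHolomorphicFormAt {n : ℕ} {p : Sphere} (hp : p ∉ stackEnds n) (i : Fin 3) :
    IsHolomorphicFormAt (stackForms n i) p := by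
  have h := (analyticAt_primAt hp i).deriv
  exact ⟨h.meromorphicAt.congr (deriv_primAt_eq hp i),
    (meromorphicOrderAt_congr (deriv_primAt_eq hp i)) ▸ h.meromorphicOrderAt_nonneg⟩

lemma isHarmonicMap_stackMap (n : ℕ) : IsHarmonicMap (stackEnds n) (stackMap n) := by
  intro p hp i
  obtain ⟨c, hc⟩ := stackMap_patch hp i
  have h := ((analyticAt_primAt hp i).add (analyticAt_const (v := (c : ℂ)))).harmonicAt_re
  refine (InnerProductSpace.harmonicAt_congr_nhds ?_).1 h
  filter_upwards [hc] with ζ h1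
  rw [h1]
  simp

lemma contDiffAt_stackMap {n : ℕ} {p : Sphere} (hp : p ∉ stackEnds n) :
    ContDiffAt ℝ ((⊤ : ℕ∞) : WithTop ℕ∞) (fun ζ : ℂ => stackMap n (patch p ζ)) 0 := by
  rw [contDiffAt_piLp]
  intro i
  obtain ⟨c, hc⟩ := stackMap_patch hp i
  have h := (analyticAt_primAt hp i).contDiffAt (n := ((⊤ : ℕ∞) : WithTop ℕ∞))
  have h1 : ContDiffAt ℝ ((⊤ : ℕ∞) : WithTop ℕ∞) (fun ζ => (primAt n p i ζ).re + c) 0 :=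
    (Complex.reCLM.contDiff.contDiffAt.comp 0 (h.restrict_scalars ℝ)).add contDiffAt_const
  exact h1.congr_of_eventuallyEq hc

lemma tendsto_chart (p : Sphere) : Tendsto (chart p) (𝓝 p) (𝓝 0) ∧ ∀ᶠ q in 𝓝 p, patch p (chart p q) = q := by
  induction p using OnePoint.rec with
  | infty =>
    rw [OnePoint.nhds_infty_eq, coclosedCompact_eq_cocompact, ← Metric.cobounded_eq_cocompact]
    constructor
    · rw [tendsto_sup]
      exact ⟨tendsto_map'_iff.2 (Filter.tendsto_inv₀_cobounded.congr fun z => rfl),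
        (tendsto_pure_nhds _ _)⟩
    · rw [eventually_sup]
      refine ⟨?_, by simp [chart, patch]⟩
      rw [eventually_map]
      filter_upwards [Bornology.isBounded_singleton (x := (0 : ℂ))] with z hz
      have hz' : z ≠ 0 := hz
      simp [chart, patch, hz']
  | coe a =>
    rw [OnePoint.nhds_coe_eq]
    constructor
    · rw [tendsto_map'_iff]
      have : Tendsto (fun z : ℂ => z - a) (𝓝 a) (𝓝 0) := by
        have h : ContinuousAt (fun z : ℂ => z - a) a := by fun_prop
        simpa using h.tendsto
      exact this.congr fun z => rfl
    · rw [eventually_map]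
      exact Eventually.of_forall fun z => by simp [chart, patch]

lemma patch_zero (p : Sphere) : patch p 0 = p := by
  induction p using OnePoint.rec with
  | infty => simp [patch]
  | coe a => simp [patch]

lemma chart_self (p : Sphere) : chart p p = 0 := by
  induction p using OnePoint.rec with
  | infty => rfl
  | coe a => simp [chart]

lemma continuousAt_stackMap {n : ℕ} {p : Sphere} (hp : p ∉ stackEnds n) : ContinuousAt (stackMap n) p := by
  have h := (contDiffAt_stackMap hp).continuousAt.tendsto.comp (tendsto_chart p).1
  rw [patch_zero] at h
  exact h.congr' ((tendsto_chart p).2.mono fun q hq => congrArg (stackMap n) hq)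

lemma isWeierstrassMap_stackMap (n : ℕ) : IsWeierstrassMap (stackEnds n) (stackForms n) (stackMap n) := by
  intro γ hγ i
  obtain ⟨S, hS, hdiff⟩ := hγ.differentiable
  have hint := hγ.integrable i
  have e : (formIntegral (stackForms n i) γ).re = ∫ t in (0 : ℝ)..1, (pullback (stackForms n i) γ t).re :=
    (Complex.reCLM.intervalIntegral_comp_comm hint).symm
  rw [e]
  refine (MeasureTheory.integral_eq_of_hasDerivAt_off_countable (fun t => stackMap n (γ t) i)
    (fun t => (pullback (stackForms n i) γ t).re) hS ?_ ?_ ?_).symm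
  · rw [Set.uIcc_of_le zero_le_one]
    intro t ht
    have h1 := (continuousAt_stackMap (hγ.avoids t ht)).comp_continuousWithinAt (hγ.continuousOn t ht)
    have h2 : Continuous fun v : EuclideanSpace ℝ (Fin 3) => v i := by fun_prop
    exact h2.continuousAt.comp_continuousWithinAt h1
  · rw [min_eq_left zero_le_one, max_eq_right zero_le_one]
    intro t ht
    have ht' : t ∈ Set.Icc (0 : ℝ) 1 := Set.Ioo_subset_Icc_self ht.1
    have hp := hγ.avoids t ht'
    have hγc : ContinuousAt γ t := (hγ.continuousOn t ht').continuousAt (Icc_mem_nhds ht.1.1 ht.1.2)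
    obtain ⟨c, hc⟩ := stackMap_patch hp i
    obtain ⟨k1, k2⟩ := tendsto_chart (γ t)
    have hd := (hdiff t ht).hasDerivAt
    have hP := (analyticAt_primAt hp i).differentiableAt.hasDerivAt
    rw [← coeffAt_eq hp i] at hP
    have h1 := hP.comp_of_eq t hd (chart_self _).symm
    have h2 := (Complex.reCLM.hasFDerivAt.comp_hasDerivAt t h1).add_const c
    refine h2.congr_of_eventuallyEq ?_
    filter_upwards [hγc.tendsto.eventually k2, (k1.comp hγc.tendsto).eventually hc] with s s1 s2
    simp only [Function.comp_apply] at s2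
    rw [s1] at s2
    rw [s2]
    rfl
  · exact ⟨hint.1.re, hint.2.re⟩

lemma solvesPeriodProblem (n : ℕ) : SolvesPeriodProblem (stackEnds n) (stackForms n) := by
  intro γ hγ h01 i
  rw [← isWeierstrassMap_stackMap n γ hγ i, h01, sub_self]

/-! ### The immersion property -/

lemma sum_Icc_neg_comm {M : Type*} [AddCommMonoid M] (n : ℕ) (f : ℤ → M) :
    ∑ k ∈ Finset.Icc (-(n : ℤ)) n, f (-k) = ∑ k ∈ Finset.Icc (-(n : ℤ)) n, f k := by
  refine Finset.sum_nbij' (fun k => -k) (fun k => -k) ?_ ?_ ?_ ?_ ?_ <;> intro k hk <;> simp at hk ⊢ <;> omega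

lemma altSum_neg (n : ℕ) (z : ℂ) : altSum n (-z) = -altSum n z := by
  rw [altSum, altSum, ← sum_Icc_neg_comm, ← Finset.sum_neg_distrib]
  refine Finset.sum_congr rfl fun k _ => ?_
  rw [alt_neg]; push_cast
  rw [show -z - -(k : ℂ) = -(z - k) by ring, div_neg]

lemma fullSum_neg (n : ℕ) (z : ℂ) : fullSum n (-z) = -fullSum n z := by
  rw [fullSum, fullSum, ← sum_Icc_neg_comm, ← Finset.sum_neg_distrib]
  refine Finset.sum_congr rfl fun k _ => ?_
  push_cast
  rw [show -z - -(k : ℂ) = -(z - k) by ring, div_neg]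

lemma altSum₂_neg (n : ℕ) (z : ℂ) : altSum₂ n (-z) = altSum₂ n z := by
  rw [altSum₂, altSum₂, ← sum_Icc_neg_comm]
  refine Finset.sum_congr rfl fun k _ => ?_
  rw [alt_neg]; push_cast
  rw [show -z - -(k : ℂ) = -(z - k) by ring, neg_sq]

lemma fullSum₂_neg (n : ℕ) (z : ℂ) : fullSum₂ n (-z) = fullSum₂ n z := by
  rw [fullSum₂, fullSum₂, ← sum_Icc_neg_comm]
  refine Finset.sum_congr rfl fun k _ => ?_
  push_cast
  rw [show -z - -(k : ℂ) = -(z - k) by ring, neg_sq]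

lemma altSum_conj (n : ℕ) (z : ℂ) : altSum n (starRingEnd ℂ z) = starRingEnd ℂ (altSum n z) := by
  simp [altSum]

lemma fullSum_conj (n : ℕ) (z : ℂ) : fullSum n (starRingEnd ℂ z) = starRingEnd ℂ (fullSum n z) := by
  simp [fullSum]

lemma altSum₂_conj (n : ℕ) (z : ℂ) : altSum₂ n (starRingEnd ℂ z) = starRingEnd ℂ (altSum₂ n z) := by
  simp [altSum₂]

lemma fullSum₂_conj (n : ℕ) (z : ℂ) : fullSum₂ n (starRingEnd ℂ z) = starRingEnd ℂ (fullSum₂ n z) := by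
  simp [fullSum₂]

/-- The circle `|z + n| = c |z - n|` through a point of the open first quadrant. -/
lemma arcPoint_of_pos {n : ℕ} (hn : 0 < n) {x y c : ℝ} (hx : 0 < x) (hy : 0 < y)
    (hc : 2 * x * c = x ^ 2 + y ^ 2 + n ^ 2) :
    ArcPoint n (c - Real.sqrt (c ^ 2 - n ^ 2)) (Real.sqrt (c ^ 2 - n ^ 2)) (x - (c - Real.sqrt (c ^ 2 - n ^ 2))) y := by
  have hn' : (0 : ℝ) < n := by exact_mod_cast hn
  have hcn : n < c := by
    by_contra h
    push Not at h
    nlinarith [sq_nonneg (x - n), sq_pos_of_pos hy]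
  have h0 : 0 < c ^ 2 - n ^ 2 := by nlinarith
  have hs := Real.sq_sqrt h0.le
  have hp := Real.sqrt_pos.2 h0
  set r := Real.sqrt (c ^ 2 - n ^ 2)
  refine ⟨?_, ?_, ?_, hy, ?_⟩
  · nlinarith
  · by_contra h
    push Not at h
    nlinarith
  · linear_combination -hs
  · linear_combination -hc - hs

/-- The three forms have no common real direction in their kernels. -/
def Nondegenerate (n : ℕ) (z : ℂ) : Prop :=
  ∀ v : ℂ, (altSum₂ n z * v).re = 0 → (Complex.I * fullSum₂ n z * v).re = 0 →
    ((1 / (z + n) - 1 / (z - n)) * v).re = 0 → v = 0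

lemma Nondegenerate.of_conj {n : ℕ} {z : ℂ} (h : Nondegenerate n (starRingEnd ℂ z)) : Nondegenerate n z := by
  intro v h1 h2 h3
  have := h (starRingEnd ℂ v) (by rw [altSum₂_conj, ← map_mul, Complex.conj_re, h1])
    (by
      rw [fullSum₂_conj, show Complex.I * starRingEnd ℂ (fullSum₂ n z) * starRingEnd ℂ v =
        -starRingEnd ℂ (Complex.I * fullSum₂ n z * v) by simp, Complex.neg_re, Complex.conj_re, h2, neg_zero])
    (by
      rw [show (1 / (starRingEnd ℂ z + n) - 1 / (starRingEnd ℂ z - n)) * starRingEnd ℂ v =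
        starRingEnd ℂ ((1 / (z + n) - 1 / (z - n)) * v) by simp, Complex.conj_re, h3])
  simpa using this

lemma Nondegenerate.of_neg {n : ℕ} {z : ℂ} (h : Nondegenerate n (-z)) : Nondegenerate n z := by
  intro v h1 h2 h3
  refine h v (by rwa [altSum₂_neg]) (by rwa [fullSum₂_neg]) ?_
  rwa [show 1 / (-z + n) - 1 / (-z - n) = 1 / (z + n) - 1 / (z - n) by
    rw [show -z + (n : ℂ) = -(z - n) by ring, show -z - (n : ℂ) = -(z + n) by ring, div_neg, div_neg]; ring]

lemma form_two_eq {n : ℕ} {z : ℂ} (h1 : z + n ≠ 0) (h2 : z - n ≠ 0) :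
    (1 / (z + n) - 1 / (z - n)) * ((n : ℂ) ^ 2 - z ^ 2) = 2 * n := by
  field_simp
  ring

lemma ne_of_im {z w : ℂ} (hz : z.im ≠ 0) (hw : w.im = 0) : z + w ≠ 0 ∧ z - w ≠ 0 := by
  constructor <;> intro h <;> apply hz <;> have := congrArg Complex.im h <;> simpa [hw] using this

lemma nondegenerate_of_pos {n : ℕ} (hn : 0 < n) {z : ℂ} (hx : 0 < z.re) (hy : 0 < z.im) : Nondegenerate n z := by
  have h := arcPoint_of_pos hn hx hy (c := (z.re ^ 2 + z.im ^ 2 + n ^ 2) / (2 * z.re)) (by field_simp)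
  set x₀ := (z.re ^ 2 + z.im ^ 2 + n ^ 2) / (2 * z.re) - Real.sqrt (((z.re ^ 2 + z.im ^ 2 + n ^ 2) / (2 * z.re)) ^ 2 - n ^ 2)
  set ρ := Real.sqrt (((z.re ^ 2 + z.im ^ 2 + n ^ 2) / (2 * z.re)) ^ 2 - n ^ 2)
  have hz : (⟨x₀ + (z.re - x₀), z.im⟩ : ℂ) = z := by rw [add_sub_cancel]
  have hd := h.deriv_ne
  have hsq := h.sq_sub_sq
  rw [hz] at hd hsq
  rw [add_sub_cancel] at hsq
  set ω : ℂ := ⟨ρ - (z.re - x₀), -z.im⟩ with hω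
  have hω0 : ω ≠ 0 := fun h0 => by
    have := congrArg Complex.im h0
    simp [hω] at this
    linarith
  obtain ⟨m1, m2⟩ := ne_of_im (w := n) hy.ne' (by simp)
  have hW := form_two_eq m1 m2
  rw [hsq] at hW
  have hn' : (0 : ℝ) < n := by exact_mod_cast hn
  intro v h1 h2 h3
  obtain ⟨u, rfl⟩ : ∃ u, v = ω * u := ⟨v / ω, by field_simp⟩
  have hu : u.re = 0 := by
    have e : ((2 * z.re : ℝ) : ℂ) * ((1 / (z + n) - 1 / (z - n)) * (ω * u)) = ((2 * n : ℝ) : ℂ) * u := by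
      push_cast at hW ⊢
      linear_combination u * hW
    have := congrArg Complex.re e
    rw [Complex.re_ofReal_mul, Complex.re_ofReal_mul, h3, mul_zero] at this
    have h4 : 2 * (n : ℝ) ≠ 0 := by positivity
    exact (mul_eq_zero.1 this.symm).resolve_left h4
  have hu' : u = Complex.I * (u.im : ℂ) := by apply Complex.ext <;> simp [hu]
  have k1 : u.im * (ω * altSum₂ n z).im = 0 := by
    rw [show altSum₂ n z * (ω * u) = (ω * altSum₂ n z) * u by ring, Complex.mul_re, hu] at h1
    linarith
  have k2 : u.im * (ω * fullSum₂ n z).re = 0 := by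
    rw [show Complex.I * fullSum₂ n z * (ω * u) = Complex.I * ((ω * fullSum₂ n z) * u) by ring, Complex.I_mul_re,
      Complex.mul_im, hu] at h2
    linarith
  have h5 : u.im = 0 := by
    rcases hd with hd | hd
    · exact (mul_eq_zero.1 k1).resolve_right hd
    · exact (mul_eq_zero.1 k2).resolve_right hd
  rw [hu', h5]
  simp

lemma re_one_div_sq (a b : ℝ) : ((1 : ℂ) / (⟨a, b⟩ : ℂ) ^ 2).re = (a ^ 2 - b ^ 2) / (a ^ 2 + b ^ 2) ^ 2 := by
  rw [re_div_sq]
  simp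

/-- On the imaginary axis the second coordinate is strictly monotone. -/
lemma re_fullSum₂_neg_of_re_eq_zero (n : ℕ) {y : ℝ} (hy : 0 < y) : (fullSum₂ n ⟨0, y⟩).re < 0 := by
  rcases le_or_gt (n : ℝ) y with h | h
  · rw [fullSum₂, Complex.re_sum]
    have key : ∀ k : ℤ, ((1 : ℂ) / ((⟨0, y⟩ : ℂ) - k) ^ 2).re = ((k : ℝ) ^ 2 - y ^ 2) / ((k : ℝ) ^ 2 + y ^ 2) ^ 2 := by
      intro k
      rw [show (⟨0, y⟩ : ℂ) - k = ⟨-k, y⟩ by apply Complex.ext <;> simp, re_one_div_sq, neg_sq]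
    simp only [key]
    refine Finset.sum_neg' (fun k hk => ?_) ⟨0, by simp, ?_⟩
    · refine div_nonpos_of_nonpos_of_nonneg ?_ (by positivity)
      have hk' : |(k : ℝ)| ≤ n := by
        rw [Finset.mem_Icc] at hk
        rw [abs_le]
        exact ⟨by exact_mod_cast hk.1, by exact_mod_cast hk.2⟩
      rw [← sq_abs (k : ℝ)]
      have := pow_le_pow_left₀ (abs_nonneg _) (hk'.trans h) 2
      linarith
    · refine div_neg_of_neg_of_pos ?_ (by positivity)
      simp; positivity
  · have hlim := (Complex.continuous_re.tendsto _).comp (tendsto_tail_fullSum₂ n (z := ⟨0, y⟩) hy)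
    have h1 := ge_of_tendsto' (b := 0) hlim fun m => by
      simp only [Function.comp_apply]
      rw [Complex.re_sum]
      refine Finset.sum_nonneg fun i _ => ?_
      have hi : (0 : ℝ) ≤ i := Nat.cast_nonneg i
      have e1 : (n : ℂ) - (⟨0, y⟩ : ℂ) + (i + 1) = (⟨n + (i + 1), -y⟩ : ℂ) := by apply Complex.ext <;> simp
      have e2 : (n : ℂ) + (⟨0, y⟩ : ℂ) + (i + 1) = (⟨n + (i + 1), y⟩ : ℂ) := by apply Complex.ext <;> simp
      rw [Complex.add_re, e1, e2, re_one_div_sq, re_one_div_sq]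
      have : y ^ 2 ≤ (n + (i + 1) : ℝ) ^ 2 := by gcongr; linarith
      refine add_nonneg (div_nonneg (by linarith [neg_sq y]) (by positivity)) (div_nonneg (by linarith) (by positivity))
    rw [Complex.sub_re, pi_div_sin 0 0 y] at h1
    have e0 : stripRe 0 0 y = 0 := by simp [stripRe, stripSin]
    have e1 : stripIm 0 0 y ≠ 0 := by
      have hs : 0 < Real.sinh (Real.pi * y) := Real.sinh_pos_iff.2 (by positivity)
      have hD := stripDen_pos 0 0 hy
      have : 0 < Real.pi * stripCos 0 0 * Real.sinh (Real.pi * y) / stripDen 0 0 y := by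
        simp only [stripCos]
        simp
        positivity
      rw [stripIm]
      linarith
    have e2 : (((alt 0 : ℂ) * (⟨stripRe 0 0 y, stripIm 0 0 y⟩ : ℂ)) ^ 2).re = -(stripIm 0 0 y) ^ 2 := by
      rw [e0, mul_pow, pow_two (alt 0 : ℂ), alt_mul_alt, one_mul, pow_two, Complex.mul_re]
      ring
    rw [e2] at h1
    have := sq_pos_of_ne_zero e1
    linarith

lemma nondegenerate_of_re_eq_zero {n : ℕ} (hn : 0 < n) {z : ℂ} (hx : z.re = 0) (hy : 0 < z.im) : Nondegenerate n z := by
  intro v h1 h2 h3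
  have hn' : (0 : ℝ) < n := by exact_mod_cast hn
  obtain ⟨m1, m2⟩ := ne_of_im (w := n) hy.ne' (by simp)
  have hW := form_two_eq m1 m2
  have hz : z = ⟨0, z.im⟩ := Complex.ext hx rfl
  have hsq : (n : ℂ) ^ 2 - z ^ 2 = ((n ^ 2 + z.im ^ 2 : ℝ) : ℂ) := by
    rw [hz]; apply Complex.ext <;> simp [pow_two]
  rw [hsq] at hW
  have hv : v.re = 0 := by
    have e : ((n ^ 2 + z.im ^ 2 : ℝ) : ℂ) * ((1 / (z + n) - 1 / (z - n)) * v) = ((2 * n : ℝ) : ℂ) * v := by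
      push_cast at hW ⊢
      linear_combination v * hW
    have := congrArg Complex.re e
    rw [Complex.re_ofReal_mul, Complex.re_ofReal_mul, h3, mul_zero] at this
    have h4 : 2 * (n : ℝ) ≠ 0 := by positivity
    exact (mul_eq_zero.1 this.symm).resolve_left h4
  have k := re_fullSum₂_neg_of_re_eq_zero n hy
  rw [← hz] at k
  rw [mul_assoc, Complex.I_mul_re, Complex.mul_im, hv] at h2
  have : v.im = 0 := (mul_eq_zero.1 (by linarith : (fullSum₂ n z).re * v.im = 0)).resolve_left k.ne
  exact Complex.ext hv this

lemma nondegenerate_of_im_eq_zero {n : ℕ} (hn : 0 < n) {z : ℂ} (hy : z.im = 0) (hz : ∀ k : ℤ, |k| ≤ n → z ≠ k) :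
    Nondegenerate n z := by
  intro v h1 h2 h3
  obtain ⟨x, rfl⟩ : ∃ x : ℝ, z = x := ⟨z.re, Complex.ext rfl hy⟩
  have hn' : (0 : ℝ) < n := by exact_mod_cast hn
  have m1 : (x : ℂ) + n ≠ 0 := fun h => hz (-n) (by simp) (by push_cast; linear_combination h)
  have m2 : (x : ℂ) - n ≠ 0 := fun h => hz n (by simp) (by push_cast; linear_combination h)
  have hW := form_two_eq m1 m2
  have hv : v.re = 0 := by
    have e : ((n ^ 2 - x ^ 2 : ℝ) : ℂ) * ((1 / (x + n) - 1 / (x - n)) * v) = ((2 * n : ℝ) : ℂ) * v := by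
      push_cast at hW ⊢
      linear_combination v * hW
    have := congrArg Complex.re e
    rw [Complex.re_ofReal_mul, Complex.re_ofReal_mul, h3, mul_zero] at this
    have h4 : 2 * (n : ℝ) ≠ 0 := by positivity
    exact (mul_eq_zero.1 this.symm).resolve_left h4
  have e : fullSum₂ n x = ((∑ k ∈ Finset.Icc (-(n : ℤ)) n, 1 / (x - k) ^ 2 : ℝ) : ℂ) := by
    rw [fullSum₂]; push_cast; rfl
  have hpos : 0 < ∑ k ∈ Finset.Icc (-(n : ℤ)) n, 1 / (x - k) ^ 2 := by
    refine Finset.sum_pos' (fun k _ => by positivity) ⟨0, by simp, ?_⟩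
    have : x ≠ 0 := fun h => hz 0 (by simp) (by simp [h])
    simp only [Int.cast_zero, sub_zero]
    positivity
  rw [e, mul_assoc, Complex.I_mul_re, Complex.im_ofReal_mul] at h2
  have : v.im = 0 := (mul_eq_zero.1 (neg_eq_zero.1 h2)).resolve_left hpos.ne'
  exact Complex.ext hv this

lemma nondegenerate {n : ℕ} (hn : 0 < n) {z : ℂ} (hz : ∀ k : ℤ, |k| ≤ n → z ≠ k) : Nondegenerate n z := by
  have upper : ∀ w : ℂ, 0 < w.im → Nondegenerate n w := by
    intro w hw
    rcases lt_trichotomy w.re 0 with h | h | h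
    · refine Nondegenerate.of_neg (Nondegenerate.of_conj (nondegenerate_of_pos hn ?_ ?_)) <;> simpa
    · exact nondegenerate_of_re_eq_zero hn h hw
    · exact nondegenerate_of_pos hn h hw
  rcases lt_trichotomy z.im 0 with h | h | h
  · exact Nondegenerate.of_conj (upper _ (by simpa using h))
  · exact nondegenerate_of_im_eq_zero hn h hz
  · exact upper z h

lemma fderiv_stackMap_apply {n : ℕ} {p : Sphere} (hp : p ∉ stackEnds n) (i : Fin 3) (v : ℂ) :
    (fderiv ℝ (fun ζ : ℂ => stackMap n (patch p ζ)) 0 v) i = (coeffAt (stackForms n i) p * v).re := by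
  have hd := ((contDiffAt_stackMap hp).differentiableAt (by simp)).hasFDerivAt
  have h1 := (EuclideanSpace.proj i : EuclideanSpace ℝ (Fin 3) →L[ℝ] ℝ).hasFDerivAt.comp (0 : ℂ) hd
  obtain ⟨c, hc⟩ := stackMap_patch hp i
  have hP := (analyticAt_primAt hp i).differentiableAt.hasDerivAt
  rw [← coeffAt_eq hp i] at hP
  have h2 := (Complex.reCLM.hasFDerivAt.comp (0 : ℂ) (hP.hasFDerivAt.restrictScalars ℝ)).add_const c
  have h3 := h2.congr_of_eventuallyEq hc
  have := congrArg (fun L : ℂ →L[ℝ] ℝ => L v) (h1.unique h3)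
  simp at this
  rw [this]
  simp [mul_comm]

lemma coeffAt_infty (n : ℕ) : coeffAt (stackForms n 1) OnePoint.infty = -Complex.I * (2 * n + 1 : ℝ) ∧
    coeffAt (stackForms n 2) OnePoint.infty = (2 * n : ℝ) := by
  rw [coeffAt_eq (infty_notMem_stackEnds n), coeffAt_eq (infty_notMem_stackEnds n)]
  constructor
  · have : HasDerivAt (primAt n OnePoint.infty 1) (-Complex.I * ∑ k ∈ Finset.Icc (-(n : ℤ)) n, (1 / (1 - (k : ℂ) * 0) ^ 2)) 0 :=
      (HasDerivAt.fun_sum fun k _ => hasDerivAt_div_one_sub (by simp)).const_mul (-Complex.I)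
    rw [this.deriv]
    simp
    norm_cast
    omega
  · have s1 : (1 : ℂ) + n * 0 ∈ Complex.slitPlane := by simp
    have s2 : (1 : ℂ) - n * 0 ∈ Complex.slitPlane := by simp
    have d1 := (((hasDerivAt_id (0 : ℂ)).const_mul (n : ℂ)).const_add 1).clog s1
    have d2 := (((hasDerivAt_id (0 : ℂ)).const_mul (n : ℂ)).const_sub 1).clog s2
    have : HasDerivAt (primAt n OnePoint.infty 2) _ 0 := d1.sub d2
    rw [this.deriv]
    simp
    ring

lemma injective_fderiv_stackMap {n : ℕ} (hn : 0 < n) {p : Sphere} (hp : p ∉ stackEnds n) :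
    Function.Injective (fderiv ℝ (fun ζ : ℂ => stackMap n (patch p ζ)) 0) := by
  rw [injective_iff_map_eq_zero]
  intro v hv
  have h : ∀ i, (coeffAt (stackForms n i) p * v).re = 0 := fun i => by
    rw [← fderiv_stackMap_apply hp i, hv]; rfl
  induction p using OnePoint.rec with
  | infty =>
    have hn' : (0 : ℝ) < n := by exact_mod_cast hn
    obtain ⟨e1, e2⟩ := coeffAt_infty n
    have h1 := h 1
    have h2 := h 2
    rw [e2, Complex.re_ofReal_mul] at h2
    rw [e1, neg_mul, neg_mul, Complex.neg_re, mul_assoc, Complex.I_mul_re, Complex.im_ofReal_mul, neg_neg] at h1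
    exact Complex.ext ((mul_eq_zero.1 h2).resolve_left (by positivity)) ((mul_eq_zero.1 h1).resolve_left (by positivity))
  | coe a =>
    have ha : ∀ k : ℤ, |k| ≤ n → a ≠ k := fun k hk h => hp (pt_mem_stackEnds.2 ⟨k, hk, h⟩)
    refine nondegenerate hn ha v ?_ ?_ ?_
    · have := h 0
      rwa [show (a : Sphere) = OnePoint.some a from rfl, coeffAt_some hp, stackForms_zero] at this
    · have := h 1
      rwa [show (a : Sphere) = OnePoint.some a from rfl, coeffAt_some hp, stackForms_one] at this
    · have := h 2
      rwa [show (a : Sphere) = OnePoint.some a from rfl, coeffAt_some hp, stackForms_two] at this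

/-! ### Injectivity -/

lemma sub_le_sum_alternating {m : ℕ} {u : ℕ → ℝ} (h0 : ∀ i, 0 ≤ u i) (h1 : ∀ i, u (i + 1) ≤ u i) :
    u 0 - u 1 ≤ ∑ i ∈ Finset.range (m + 1), (-1) ^ i * u i := by
  have h := (sum_alternating_mem (m := m) (u := fun i => u (i + 1)) (fun i => h0 _) (fun i => h1 _)).2
  rw [Finset.sum_range_succ']
  have e : ∑ i ∈ Finset.range m, (-1) ^ (i + 1) * u (i + 1) = -∑ i ∈ Finset.range m, (-1) ^ i * u (i + 1) := by
    rw [← Finset.sum_neg_distrib]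
    exact Finset.sum_congr rfl fun i _ => by ring
  rw [e]
  simp at h ⊢
  linarith

lemma div_sq_add_zero (t : ℝ) : t / (t ^ 2 + 0 ^ 2) = 1 / t := by
  rcases eq_or_ne t 0 with rfl | h
  · simp
  · field_simp
    simp

lemma abs_altSum_ofReal_le {n : ℕ} {x : ℝ} (hx : n < x) : |(altSum n ⟨x, 0⟩).re| ≤ 1 / (x - n) := by
  have hd : 0 < x - n := sub_pos.2 hx
  have h := sum_alternating_mem (m := 2 * n + 1) (u := fun i => 1 / (x - n + i)) (fun i => by positivity)
    (fun i => by
      push_cast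
      exact one_div_le_one_div_of_le (by positivity) (by linarith))
  have e := alt_mul_re_altSum n x 0
  simp only [div_sq_add_zero] at e
  rw [← e] at h
  have ea : |(altSum n ⟨x, 0⟩).re| = alt n * (altSum n ⟨x, 0⟩).re := by
    rw [← abs_of_nonneg h.1, abs_mul, abs_alt, one_mul]
  rw [ea]
  simpa using h.2

lemma one_div_lt_abs_altSum_ofReal {n : ℕ} {x : ℝ} (hx : 0 < x) (hxn : x < n) (hk : ∀ k : ℤ, |k| ≤ n → x ≠ k) :
    1 / (n - x) < |(altSum n ⟨x, 0⟩).re| := by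
  obtain ⟨j, m, σ, hn, rfl, h0, h1⟩ : ∃ j m : ℕ, ∃ σ : ℝ, n = j + (m + 1) ∧ x = j + σ ∧ 0 < σ ∧ σ < 1 := by
    have f1 := Nat.floor_le hx.le
    have f2 := Nat.lt_floor_add_one x
    have f3 : ⌊x⌋₊ < n := (Nat.floor_lt hx.le).2 hxn
    refine ⟨⌊x⌋₊, n - 1 - ⌊x⌋₊, x - ⌊x⌋₊, by omega, by ring, ?_, by linarith⟩
    refine sub_pos.2 (lt_of_le_of_ne f1 fun h => hk ⌊x⌋₊ ?_ ?_)
    · rw [Nat.abs_cast]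
      exact_mod_cast f3.le
    · rw [Int.cast_natCast]
      exact h.symm
  have e := alt_mul_re_altSum n (j + σ) 0
  simp only [div_sq_add_zero] at e
  rw [show 2 * n + 1 = (m + 1) + ((2 * j + m + 1) + 1) by omega, Finset.sum_range_add, ← Finset.sum_range_reflect] at e
  have e1 : ∀ i ∈ Finset.range (m + 1), (-1 : ℝ) ^ (m + 1 - 1 - i) * (1 / ((j : ℝ) + σ - n + ((m + 1 - 1 - i : ℕ) : ℝ))) =
      (-1) ^ (m + 1) * ((-1) ^ i * (1 / (1 - σ + i))) := by
    intro i hi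
    obtain ⟨l, rfl⟩ : ∃ l, m = i + l := ⟨m - i, by rw [Finset.mem_range] at hi; omega⟩
    rw [show i + l + 1 - 1 - i = l by omega, hn]
    push_cast
    rw [show (j : ℝ) + σ - (j + (i + l + 1)) + l = -(1 - σ + i) by ring, one_div_neg_eq_neg_one_div]
    have : ((-1 : ℝ) ^ i) * (-1) ^ i = 1 := by rw [← mul_pow]; norm_num
    linear_combination (-1 : ℝ) ^ l * (1 / (1 - σ + i)) * (this)
  have e2 : ∀ i ∈ Finset.range ((2 * j + m + 1) + 1), (-1 : ℝ) ^ (m + 1 + i) * (1 / ((j : ℝ) + σ - n + ((m + 1 + i : ℕ) : ℝ))) =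
      (-1) ^ (m + 1) * ((-1) ^ i * (1 / (σ + i))) := by
    intro i _
    rw [hn]
    push_cast
    rw [show (j : ℝ) + σ - (j + (m + 1)) + (m + 1 + i) = σ + i by ring, pow_add]
    ring
  rw [Finset.sum_congr rfl e1, Finset.sum_congr rfl e2, ← Finset.mul_sum, ← Finset.mul_sum, ← mul_add] at e
  have hA0 : ∀ i : ℕ, 0 ≤ 1 / (1 - σ + i) := fun i => by
    have : 0 < 1 - σ := by linarith
    positivity
  have hA1 : ∀ i : ℕ, 1 / (1 - σ + (i + 1 : ℕ)) ≤ 1 / (1 - σ + i) := fun i => by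
    have : 0 < 1 - σ := by linarith
    push_cast
    exact one_div_le_one_div_of_le (by positivity) (by linarith)
  have hB0 : ∀ i : ℕ, 0 ≤ 1 / (σ + i) := fun i => by positivity
  have hB1 : ∀ i : ℕ, 1 / (σ + (i + 1 : ℕ)) ≤ 1 / (σ + i) := fun i => by
    push_cast
    exact one_div_le_one_div_of_le (by positivity) (by linarith)
  have hA := sub_le_sum_alternating (m := m) hA0 hA1
  have hB := sub_le_sum_alternating (m := 2 * j + m + 1) hB0 hB1
  have hB' : 1 / 2 < 1 / (σ + (0 : ℕ)) - 1 / (σ + (1 : ℕ)) := by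
    rw [show 1 / (σ + (0 : ℕ)) - 1 / (σ + (1 : ℕ)) = 1 / (σ * (σ + 1)) by push_cast; field_simp; ring]
    exact one_div_lt_one_div_of_lt (by positivity) (by nlinarith)
  have hA' : 1 / 2 < 1 / (1 - σ + (0 : ℕ)) - 1 / (1 - σ + (1 : ℕ)) := by
    have p1 : 0 < 1 - σ := by linarith
    have p2 : 0 < 2 - σ := by linarith
    rw [show 1 / (1 - σ + (0 : ℕ)) - 1 / (1 - σ + (1 : ℕ)) = 1 / ((1 - σ) * (2 - σ)) by
      push_cast
      rw [show 1 - σ + 1 = 2 - σ by ring, add_zero]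
      field_simp; ring]
    exact one_div_lt_one_div_of_lt (by positivity) (by nlinarith)
  have habs := congrArg abs e
  rw [abs_mul, abs_mul, abs_alt, abs_pow, abs_neg, abs_one, one_pow, one_mul, one_mul] at habs
  rw [habs]
  refine lt_of_lt_of_le ?_ (le_abs_self _)
  have hd : (n : ℝ) - (j + σ) = m + 1 - σ := by rw [hn]; push_cast; ring
  rw [hd]
  rcases Nat.eq_zero_or_pos m with rfl | hm
  · simp only [zero_add, Finset.sum_range_one, pow_zero, one_mul] at hA ⊢
    rw [Nat.cast_zero, zero_add, add_zero]
    linarith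
  · have hm' : (1 : ℝ) ≤ m := by exact_mod_cast hm
    have : 1 / (m + 1 - σ) ≤ 1 / 1 := one_div_le_one_div_of_le one_pos (by linarith)
    linarith

lemma im_fullSum_neg_of_im_pos (n : ℕ) {z : ℂ} (hz : 0 < z.im) : (fullSum n z).im < 0 := by
  have h := neg_im_fullSum n z.re z.im
  have : 0 < ∑ k ∈ Finset.Icc (-(n : ℤ)) n, z.im / ((z.re - k) ^ 2 + z.im ^ 2) :=
    Finset.sum_pos (fun k _ => by positivity) ⟨0, by simp⟩
  have e : fullSum n ⟨z.re, z.im⟩ = fullSum n z := rfl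
  rw [e] at h
  linarith

lemma im_fullSum_sign (n : ℕ) (z : ℂ) : (0 < (fullSum n z).im ↔ z.im < 0) ∧ ((fullSum n z).im < 0 ↔ 0 < z.im) := by
  have h1 := im_fullSum_neg_of_im_pos n (z := z)
  have h2 := im_fullSum_neg_of_im_pos n (z := starRingEnd ℂ z)
  rw [fullSum_conj, Complex.conj_im, Complex.conj_im] at h2
  have h3 : z.im = 0 → (fullSum n z).im = 0 := fun h => by
    have e := fullSum_conj n z
    rw [Complex.conj_eq_iff_im.2 h] at e
    exact Complex.conj_eq_iff_im.1 e.symm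
  rcases lt_trichotomy z.im 0 with h | h | h
  · have := h2 (by linarith)
    constructor <;> constructor <;> intro <;> linarith
  · have := h3 h
    constructor <;> constructor <;> intro <;> linarith
  · have := h1 h
    constructor <;> constructor <;> intro <;> linarith

/-- The value of `(|z + n|² - |z - n|²) / (|z + n|² + |z - n|²)` agrees at `z` and `w`. -/
def SameLevel (n : ℕ) (z w : ℂ) : Prop :=
  z.re * (w.re ^ 2 + w.im ^ 2 + n ^ 2) = w.re * (z.re ^ 2 + z.im ^ 2 + n ^ 2)

lemma sq_norm_add_sub (n : ℕ) (z : ℂ) : ‖z + n‖ ^ 2 = z.re ^ 2 + z.im ^ 2 + n ^ 2 + 2 * n * z.re ∧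
    ‖z - n‖ ^ 2 = z.re ^ 2 + z.im ^ 2 + n ^ 2 - 2 * n * z.re := by
  constructor <;> rw [Complex.sq_norm, Complex.normSq_apply] <;> simp <;> ring

lemma sameLevel_of_eq {n : ℕ} (hn : 0 < n) {z w : ℂ} (hz1 : z + n ≠ 0) (hz2 : z - n ≠ 0) (hw1 : w + n ≠ 0) (hw2 : w - n ≠ 0)
    (h : Real.log ‖z + n‖ - Real.log ‖z - n‖ = Real.log ‖w + n‖ - Real.log ‖w - n‖) : SameLevel n z w := by
  have a1 := norm_pos_iff.2 hz1
  have a2 := norm_pos_iff.2 hz2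
  have b1 := norm_pos_iff.2 hw1
  have b2 := norm_pos_iff.2 hw2
  have e : ‖z + n‖ * ‖w - n‖ = ‖w + n‖ * ‖z - n‖ := by
    apply Real.log_injOn_pos (Set.mem_Ioi.2 (by positivity)) (Set.mem_Ioi.2 (by positivity))
    rw [Real.log_mul a1.ne' b2.ne', Real.log_mul b1.ne' a2.ne']
    linarith
  have e2 : ‖z + n‖ ^ 2 * ‖w - n‖ ^ 2 = ‖w + n‖ ^ 2 * ‖z - n‖ ^ 2 := by rw [← mul_pow, e, mul_pow]
  rw [(sq_norm_add_sub n z).1, (sq_norm_add_sub n z).2, (sq_norm_add_sub n w).1, (sq_norm_add_sub n w).2] at e2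
  have hn' : (n : ℝ) ≠ 0 := by exact_mod_cast hn.ne'
  rw [SameLevel]
  apply mul_left_cancel₀ hn'
  linear_combination e2 / 4

lemma re_eq_zero_of_log_eq {n : ℕ} (hn : 0 < n) {z : ℂ} (hz1 : z + n ≠ 0) (hz2 : z - n ≠ 0)
    (h : Real.log ‖z + n‖ - Real.log ‖z - n‖ = 0) : z.re = 0 := by
  have e : ‖z + n‖ = ‖z - n‖ :=
    Real.log_injOn_pos (Set.mem_Ioi.2 (norm_pos_iff.2 hz1)) (Set.mem_Ioi.2 (norm_pos_iff.2 hz2)) (sub_eq_zero.1 h)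
  have e2 : ‖z + n‖ ^ 2 = ‖z - n‖ ^ 2 := by rw [e]
  rw [(sq_norm_add_sub n z).1, (sq_norm_add_sub n z).2] at e2
  have hn' : (n : ℝ) ≠ 0 := by exact_mod_cast hn.ne'
  apply mul_left_cancel₀ hn'
  linarith

lemma strictMonoOn_im_fullSum (n : ℕ) : StrictMonoOn (fun y : ℝ => (fullSum n ⟨0, y⟩).im) (Set.Ioi 0) := by
  have hd : ∀ y : ℝ, 0 < y → HasDerivAt (fun y : ℝ => (fullSum n ⟨0, y⟩).im) (-(fullSum₂ n ⟨0, y⟩).re) y := by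
    intro y hy
    have e : ∀ t : ℝ, (⟨0, t⟩ : ℂ) = t * Complex.I := fun t => by apply Complex.ext <;> simp
    have h1 : HasDerivAt (fun t : ℝ => (⟨0, t⟩ : ℂ)) Complex.I y := by
      simp only [e]
      simpa using (Complex.ofRealCLM.hasDerivAt (x := y)).mul_const Complex.I
    have h2 := (hasDerivAt_fullSum (n := n) (z := ⟨0, y⟩) fun k _ => ne_intCast_of_im_pos hy k).comp y h1
    have h3 := Complex.imCLM.hasFDerivAt.comp_hasDerivAt y h2
    refine h3.congr_deriv ?_
    simp
  refine strictMonoOn_of_deriv_pos (convex_Ioi 0) (fun y hy => (hd y hy).continuousAt.continuousWithinAt) fun y hy => ?_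
  rw [interior_Ioi] at hy
  rw [(hd y hy).deriv]
  linarith [re_fullSum₂_neg_of_re_eq_zero n hy]

lemma eq_of_re_pos {n : ℕ} (hn : 0 < n) {z w : ℂ} (hz : 0 < z.re) (hw : 0 < w.re) (hzi : 0 < z.im) (hwi : 0 < w.im)
    (ha : (altSum n z).re = (altSum n w).re) (hf : (fullSum n z).im = (fullSum n w).im) (hl : SameLevel n z w) : z = w := by
  rw [SameLevel] at hl
  have h := arcPoint_of_pos hn hz hzi (c := (z.re ^ 2 + z.im ^ 2 + n ^ 2) / (2 * z.re)) (by field_simp)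
  have h₁ := arcPoint_of_pos hn hw hwi (c := (z.re ^ 2 + z.im ^ 2 + n ^ 2) / (2 * z.re)) (by
    field_simp
    linarith)
  obtain ⟨e1, e2⟩ := h.eq_of_eq h₁ (by rw [add_sub_cancel, add_sub_cancel]; exact ha)
    (by rw [add_sub_cancel, add_sub_cancel]; exact hf)
  exact Complex.ext (by linarith) e2

lemma eq_of_im_pos {n : ℕ} (hn : 0 < n) {z w : ℂ} (hzi : 0 < z.im) (hwi : 0 < w.im)
    (ha : (altSum n z).re = (altSum n w).re) (hf : (fullSum n z).im = (fullSum n w).im) (hl : SameLevel n z w) : z = w := by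
  have pz : 0 < z.re ^ 2 + z.im ^ 2 + n ^ 2 := by positivity
  have pw : 0 < w.re ^ 2 + w.im ^ 2 + n ^ 2 := by positivity
  rcases lt_trichotomy z.re 0 with h | h | h
  · have hw : w.re < 0 := by
      by_contra hc
      push Not at hc
      have h1 := mul_neg_of_neg_of_pos h pw
      rw [SameLevel] at hl
      have := mul_nonneg hc pz.le
      linarith
    have key := eq_of_re_pos hn (z := -starRingEnd ℂ z) (w := -starRingEnd ℂ w) (by simpa) (by simpa) (by simpa) (by simpa)
      (by rw [altSum_neg, altSum_neg, altSum_conj, altSum_conj]; simpa)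
      (by rw [fullSum_neg, fullSum_neg, fullSum_conj, fullSum_conj]; simpa)
      (by
        rw [SameLevel] at hl ⊢
        simp only [Complex.neg_re, Complex.neg_im, Complex.conj_re, Complex.conj_im]
        linear_combination -hl)
    exact (starRingEnd ℂ).injective (neg_injective key)
  · have hw : w.re = 0 := by
      rw [SameLevel] at hl
      have h0 : w.re * (z.re ^ 2 + z.im ^ 2 + n ^ 2) = 0 := by rw [← hl, h, zero_mul]
      exact (mul_eq_zero.1 h0).resolve_right pz.ne'
    have := (strictMonoOn_im_fullSum n).injOn (Set.mem_Ioi.2 hzi) (Set.mem_Ioi.2 hwi) (by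
      have e1 : (⟨0, z.im⟩ : ℂ) = z := Complex.ext h.symm rfl
      have e2 : (⟨0, w.im⟩ : ℂ) = w := Complex.ext hw.symm rfl
      simp only [e1, e2, hf])
    exact Complex.ext (h.trans hw.symm) this
  · have hw : 0 < w.re := by
      by_contra hc
      push Not at hc
      have h1 := mul_pos h pw
      rw [SameLevel] at hl
      have := mul_nonpos_of_nonpos_of_nonneg hc pz.le
      linarith
    exact eq_of_re_pos hn h hw hzi hwi ha hf hl

lemma not_mul_eq_sq {n : ℕ} {x x' : ℝ} (hx : 0 < x) (hxn : x < n) (hk : ∀ k : ℤ, |k| ≤ n → x ≠ k) (h : x * x' = n ^ 2) :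
    (altSum n ⟨x, 0⟩).re ≠ (altSum n ⟨x', 0⟩).re := by
  intro he
  have hn : (0 : ℝ) < n := hx.trans hxn
  have hx' : n < x' := by
    by_contra hc
    push Not at hc
    nlinarith
  have h1 := one_div_lt_abs_altSum_ofReal hx hxn hk
  have h2 := abs_altSum_ofReal_le hx'
  have h3 : 1 / (x' - n) ≤ 1 / (n - x) := one_div_le_one_div_of_le (by linarith) (by nlinarith)
  rw [he] at h1
  linarith

lemma eq_of_pos_of_sameLevel {n : ℕ} (hn : 0 < n) {x x' : ℝ} (hx : 0 < x) (hx' : 0 < x') (hk : ∀ k : ℤ, |k| ≤ n → x ≠ k)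
    (hk' : ∀ k : ℤ, |k| ≤ n → x' ≠ k) (ha : (altSum n ⟨x, 0⟩).re = (altSum n ⟨x', 0⟩).re)
    (hl : x * (x' ^ 2 + n ^ 2) = x' * (x ^ 2 + n ^ 2)) : x = x' := by
  have e : (x - x') * (x * x' - n ^ 2) = 0 := by linear_combination -hl
  rcases mul_eq_zero.1 e with h | h
  · linarith
  · exfalso
    have hn' : (0 : ℝ) < n := by exact_mod_cast hn
    have h1 : x ≠ n := by simpa using hk n (by simp)
    rcases lt_or_gt_of_ne h1 with h2 | h2
    · exact not_mul_eq_sq hx h2 hk (by linarith) ha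
    · refine not_mul_eq_sq hx' ?_ hk' (by linarith) ha.symm
      by_contra hc
      push Not at hc
      nlinarith

lemma eq_of_im_eq_zero {n : ℕ} (hn : 0 < n) {z w : ℂ} (hz : ∀ k : ℤ, |k| ≤ n → z ≠ k) (hw : ∀ k : ℤ, |k| ≤ n → w ≠ k)
    (hzi : z.im = 0) (hwi : w.im = 0) (ha : (altSum n z).re = (altSum n w).re) (hl : SameLevel n z w) : z = w := by
  obtain ⟨x, rfl⟩ : ∃ x : ℝ, z = ⟨x, 0⟩ := ⟨z.re, Complex.ext rfl hzi⟩
  obtain ⟨x', rfl⟩ : ∃ x : ℝ, w = ⟨x, 0⟩ := ⟨w.re, Complex.ext rfl hwi⟩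
  have hk : ∀ k : ℤ, |k| ≤ n → x ≠ k := fun k h e => hz k h (by rw [e]; rfl)
  have hk' : ∀ k : ℤ, |k| ≤ n → x' ≠ k := fun k h e => hw k h (by rw [e]; rfl)
  simp only [SameLevel] at hl
  have hn' : (0 : ℝ) < n := by exact_mod_cast hn
  have hx : x ≠ 0 := by simpa using hk 0 (by simp)
  have p1 : 0 < x ^ 2 + n ^ 2 := by positivity
  have p2 : 0 < x' ^ 2 + n ^ 2 := by positivity
  have neg_alt : ∀ t : ℝ, (altSum n ⟨-t, 0⟩).re = -(altSum n ⟨t, 0⟩).re := fun t => by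
    rw [show (⟨-t, 0⟩ : ℂ) = -⟨t, 0⟩ by apply Complex.ext <;> simp, altSum_neg, Complex.neg_re]
  have key : x = x' := by
    rcases lt_or_gt_of_ne hx with h | h
    · have h' : x' < 0 := by
        by_contra hc
        push Not at hc
        nlinarith [mul_pos (neg_pos.2 h) p2, mul_nonneg hc p1.le]
      have := eq_of_pos_of_sameLevel hn (x := -x) (x' := -x') (by linarith) (by linarith)
        (fun k hk1 e => hk (-k) (by rwa [abs_neg]) (by push_cast; linarith))
        (fun k hk1 e => hk' (-k) (by rwa [abs_neg]) (by push_cast; linarith))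
        (by rw [neg_alt, neg_alt, ha]) (by linear_combination -hl)
      linarith
    · have h' : 0 < x' := by
        by_contra hc
        push Not at hc
        nlinarith [mul_pos h p2, mul_nonneg (neg_nonneg.2 hc) p1.le]
      exact eq_of_pos_of_sameLevel hn h h' hk hk' ha (by linear_combination hl)
  rw [key]

lemma eq_of_stackMap_eq {n : ℕ} (hn : 0 < n) {z w : ℂ} (hz : ∀ k : ℤ, |k| ≤ n → z ≠ k) (hw : ∀ k : ℤ, |k| ≤ n → w ≠ k)
    (ha : (altSum n z).re = (altSum n w).re) (hf : (fullSum n z).im = (fullSum n w).im) (hl : SameLevel n z w) : z = w := by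
  obtain ⟨z1, z2⟩ := im_fullSum_sign n z
  obtain ⟨w1, w2⟩ := im_fullSum_sign n w
  rw [hf] at z1 z2
  rcases lt_trichotomy z.im 0 with h | h | h
  · have hw' := w1.1 (z1.2 h)
    have := eq_of_im_pos hn (z := starRingEnd ℂ z) (w := starRingEnd ℂ w) (by simpa) (by simpa)
      (by rw [altSum_conj, altSum_conj]; simpa) (by rw [fullSum_conj, fullSum_conj]; simpa)
      (by simpa [SameLevel] using hl)
    exact (starRingEnd ℂ).injective this
  · have hw' : w.im = 0 := by
      rcases lt_trichotomy w.im 0 with h' | h' | h'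
      · linarith [z1.1 (w1.2 h')]
      · exact h'
      · linarith [z2.1 (w2.2 h')]
    exact eq_of_im_eq_zero hn hz hw h hw' ha hl
  · exact eq_of_im_pos hn h (w2.1 (z2.2 h)) ha hf hl

lemma add_sub_natCast_ne_zero {n : ℕ} {z : ℂ} (hz : ∀ k : ℤ, |k| ≤ n → z ≠ k) : z + n ≠ 0 ∧ z - n ≠ 0 :=
  ⟨fun h => hz (-n) (by simp) (by push_cast; linear_combination h),
    fun h => hz n (by simp) (by push_cast; linear_combination h)⟩

lemma stackMap_infty_ne {n : ℕ} (hn : 0 < n) {z : ℂ} (hz : ∀ k : ℤ, |k| ≤ n → z ≠ k) :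
    stackMap n (OnePoint.some z) ≠ stackMap n OnePoint.infty := by
  intro h
  have h1 : (fullSum n z).im = 0 := congrArg (fun v : EuclideanSpace ℝ (Fin 3) => v 1) h
  have h2 : Real.log ‖z + n‖ - Real.log ‖z - n‖ = 0 := congrArg (fun v : EuclideanSpace ℝ (Fin 3) => v 2) h
  obtain ⟨m1, m2⟩ := add_sub_natCast_ne_zero hz
  have hre := re_eq_zero_of_log_eq hn m1 m2 h2
  obtain ⟨z1, z2⟩ := im_fullSum_sign n z
  rw [h1] at z1 z2
  simp at z1 z2
  exact hz 0 (by simp) (by apply Complex.ext <;> simp <;> linarith)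

lemma stackMap_injOn {n : ℕ} (hn : 0 < n) : Set.InjOn (stackMap n) (stackEnds n)ᶜ := by
  intro p hp q hq h
  have fin : ∀ {a : ℂ}, (a : Sphere) ∈ (stackEnds n)ᶜ → ∀ k : ℤ, |k| ≤ n → a ≠ k :=
    fun hp k hk h => hp (pt_mem_stackEnds.2 ⟨k, hk, h⟩)
  induction p using OnePoint.rec with
  | infty =>
    induction q using OnePoint.rec with
    | infty => rfl
    | coe b => exact absurd h.symm (stackMap_infty_ne hn (fin hq))
  | coe a =>
    induction q using OnePoint.rec with
    | infty => exact absurd h (stackMap_infty_ne hn (fin hp))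
    | coe b =>
      have h0 : -(altSum n a).re = -(altSum n b).re := congrArg (fun v : EuclideanSpace ℝ (Fin 3) => v 0) h
      have h1 : (fullSum n a).im = (fullSum n b).im := congrArg (fun v : EuclideanSpace ℝ (Fin 3) => v 1) h
      have h2 : Real.log ‖a + n‖ - Real.log ‖a - n‖ = Real.log ‖b + n‖ - Real.log ‖b - n‖ :=
        congrArg (fun v : EuclideanSpace ℝ (Fin 3) => v 2) h
      obtain ⟨m1, m2⟩ := add_sub_natCast_ne_zero (fin hp)
      obtain ⟨k1, k2⟩ := add_sub_natCast_ne_zero (fin hq)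
      rw [eq_of_stackMap_eq hn (fin hp) (fin hq) (neg_injective h0) h1 (sameLevel_of_eq hn m1 m2 k1 k2 h2)]

/-! ### Behaviour at the ends and the embedding property -/

lemma tendsto_nhdsNE_pt {β : Type*} {g : Sphere → β} {k : ℤ} {l : Filter β} :
    Tendsto g (𝓝[≠] (pt k)) l ↔ Tendsto (fun z : ℂ => g (OnePoint.some z)) (𝓝[≠] (k : ℂ)) l := by
  have e : ((↑) : ℂ → Sphere) ⁻¹' {((k : ℂ) : Sphere)}ᶜ = {(k : ℂ)}ᶜ := by ext; simp
  rw [pt, OnePoint.nhdsWithin_coe, e, tendsto_map'_iff]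
  rfl

lemma exists_continuousAt_remainder {n : ℕ} {k : ℤ} (hk : |k| ≤ n) :
    (∃ A : ℂ → ℂ, ContinuousAt A k ∧ ∀ z, altSum n z = alt k / (z - k) + A z) ∧
    (∃ B : ℂ → ℂ, ContinuousAt B k ∧ ∀ z, fullSum n z = 1 / (z - k) + B z) := by
  have hmem : k ∈ Finset.Icc (-(n : ℤ)) n := by rw [Finset.mem_Icc]; exact abs_le.1 hk
  have hne : ∀ j ∈ (Finset.Icc (-(n : ℤ)) n).erase k, (k : ℂ) - j ≠ 0 := fun j hj =>
    sub_ne_zero.2 (by exact_mod_cast (Finset.ne_of_mem_erase hj).symm)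
  constructor
  · refine ⟨fun z => ∑ j ∈ (Finset.Icc (-(n : ℤ)) n).erase k, alt j / (z - j), ?_, fun z => ?_⟩
    · refine tendsto_finsetSum _ fun j hj => ?_
      exact ContinuousAt.div continuousAt_const (by fun_prop) (hne j hj)
    · rw [altSum, Finset.add_sum_erase _ (fun j : ℤ => (alt j : ℂ) / (z - j)) hmem]
  · refine ⟨fun z => ∑ j ∈ (Finset.Icc (-(n : ℤ)) n).erase k, 1 / (z - j), ?_, fun z => ?_⟩
    · refine tendsto_finsetSum _ fun j hj => ?_
      exact ContinuousAt.div continuousAt_const (by fun_prop) (hne j hj)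
    · rw [fullSum, Finset.add_sum_erase _ (fun j : ℤ => (1 : ℂ) / (z - j)) hmem]

lemma tendsto_norm_one_div_sub (a : ℂ) : Tendsto (fun z : ℂ => ‖1 / (z - a)‖) (𝓝[≠] a) atTop := by
  have h0 : Tendsto (fun z : ℂ => z - a) (𝓝[≠] a) (𝓝[≠] 0) := by
    refine tendsto_nhdsWithin_iff.2 ⟨?_, ?_⟩
    · have : ContinuousAt (fun z : ℂ => z - a) a := by fun_prop
      simpa using this.tendsto.mono_left nhdsWithin_le_nhds
    · filter_upwards [self_mem_nhdsWithin] with z hz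
      exact sub_ne_zero.2 hz
  exact (tendsto_norm_cobounded_atTop.comp (Filter.tendsto_inv₀_nhdsNE_zero.comp h0)).congr fun z => by
    simp only [Function.comp, one_div]

lemma tendsto_norm_stackMap {n : ℕ} {k : ℤ} (hk : |k| ≤ n) :
    Tendsto (fun p => ‖stackMap n p‖) (𝓝[≠] (pt k)) atTop := by
  rw [tendsto_nhdsNE_pt]
  obtain ⟨⟨A, hA, eA⟩, ⟨B, hB, eB⟩⟩ := exists_continuousAt_remainder hk
  have hr : Tendsto (fun z => ‖A z‖ + ‖B z‖) (𝓝[≠] (k : ℂ)) (𝓝 (‖A k‖ + ‖B k‖)) :=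
    (hA.norm.add hB.norm).tendsto.mono_left nhdsWithin_le_nhds
  have h1 := ((tendsto_norm_one_div_sub k).atTop_add hr.neg).const_mul_atTop (show (0 : ℝ) < 1 / 2 by norm_num)
  refine tendsto_atTop_mono (fun z => ?_) h1
  have n0 := PiLp.norm_apply_le (stackMap n (OnePoint.some z)) 0
  have n1 := PiLp.norm_apply_le (stackMap n (OnePoint.some z)) 1
  have m0 : stackMap n (OnePoint.some z) 0 = -(altSum n z).re := rfl
  have m1 : stackMap n (OnePoint.some z) 1 = (fullSum n z).im := rfl
  rw [m0, norm_neg, Real.norm_eq_abs, eA, Complex.add_re, show (alt k : ℂ) / (z - k) = alt k * (1 / (z - k)) by ring,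
    Complex.re_ofReal_mul] at n0
  rw [m1, Real.norm_eq_abs, eB, Complex.add_im] at n1
  have a0 : |(1 / (z - k)).re| = |alt k * (1 / (z - k)).re| := by rw [abs_mul, abs_alt, one_mul]
  have a1 := abs_add_le (alt k * (1 / (z - k)).re + (A z).re) (-(A z).re)
  have a2 := abs_add_le ((1 / (z - k)).im + (B z).im) (-(B z).im)
  rw [add_neg_cancel_right, abs_neg] at a1 a2
  have a3 := Complex.norm_le_abs_re_add_abs_im (1 / (z - k))
  have a4 := Complex.abs_re_le_norm (A z)
  have a5 := Complex.abs_im_le_norm (B z)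
  linarith

lemma isEmbedding_stackMap {n : ℕ} (hn : 0 < n) :
    IsEmbedding (fun p : ((stackEnds n)ᶜ : Set Sphere) => stackMap n p) := by
  refine ⟨isInducing_iff_nhds.2 fun x => le_antisymm ?_ ?_, fun p q h => Subtype.ext (stackMap_injOn hn p.2 q.2 h)⟩
  · exact ((continuousAt_stackMap x.2).comp continuousAt_subtype_val).tendsto.le_comap
  · rw [le_iff_ultrafilter]
    intro U hU
    have hf : Tendsto (fun p : ((stackEnds n)ᶜ : Set Sphere) => stackMap n p) U (𝓝 (stackMap n x)) :=
      tendsto_iff_comap.2 hU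
    obtain ⟨q, -, hq⟩ := (isCompact_univ (X := Sphere)).ultrafilter_le_nhds (U.map Subtype.val) (by simp)
    have hq' : Tendsto (Subtype.val : ((stackEnds n)ᶜ : Set Sphere) → Sphere) U (𝓝 q) := hq
    by_cases hqE : q ∈ stackEnds n
    · exfalso
      obtain ⟨k, hk, rfl⟩ := hqE
      have hw : Tendsto (Subtype.val : ((stackEnds n)ᶜ : Set Sphere) → Sphere) U (𝓝[≠] (pt k)) :=
        tendsto_nhdsWithin_iff.2 ⟨hq', Eventually.of_forall fun p hp => p.2 ⟨k, hk, hp⟩⟩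
      exact not_tendsto_nhds_of_tendsto_atTop ((tendsto_norm_stackMap hk).comp hw) _ hf.norm
    · have hfq := (continuousAt_stackMap hqE).tendsto.comp hq'
      have := stackMap_injOn hn hqE x.2 (tendsto_nhds_unique hfq hf)
      rw [nhds_subtype_eq_comap, ← this]
      exact hq'.le_comap

lemma isSmoothEmbedding_stackMap {n : ℕ} (hn : 0 < n) : IsSmoothEmbedding (stackEnds n) (stackMap n) :=
  ⟨fun _ hp => contDiffAt_stackMap hp, fun _ hp => injective_fderiv_stackMap hn hp, isEmbedding_stackMap hn⟩

lemma tendsto_log_norm_sub (a : ℂ) : Tendsto (fun z : ℂ => Real.log ‖z - a‖) (𝓝[≠] a) atBot := by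
  refine Real.tendsto_log_nhdsNE_zero.comp (tendsto_nhdsWithin_iff.2 ⟨?_, ?_⟩)
  · have : ContinuousAt (fun z : ℂ => ‖z - a‖) a := by fun_prop
    simpa using this.tendsto.mono_left nhdsWithin_le_nhds
  · filter_upwards [self_mem_nhdsWithin] with z hz
    exact norm_ne_zero_iff.2 (sub_ne_zero.2 hz)

lemma tendsto_height_bot {n : ℕ} (hn : 0 < n) : Tendsto (fun p => stackMap n p 2) (𝓝[≠] (pt (-n))) atBot := by
  rw [tendsto_nhdsNE_pt]
  have h1 := tendsto_log_norm_sub ((-n : ℤ) : ℂ)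
  have c : ContinuousAt (fun z : ℂ => -Real.log ‖z - n‖) ((-n : ℤ) : ℂ) := by
    refine (ContinuousAt.log (by fun_prop) ?_).neg
    rw [norm_ne_zero_iff]
    push_cast
    rw [show -(n : ℂ) - n = -(2 * n) by ring, neg_ne_zero]
    have : (n : ℂ) ≠ 0 := by exact_mod_cast hn.ne'
    simpa
  refine (h1.atBot_add (c.tendsto.mono_left nhdsWithin_le_nhds)).congr fun z => ?_
  show _ = Real.log ‖z + n‖ - Real.log ‖z - n‖
  push_cast
  rw [sub_neg_eq_add]
  ring

lemma tendsto_height_top {n : ℕ} (hn : 0 < n) : Tendsto (fun p => stackMap n p 2) (𝓝[≠] (pt n)) atTop := by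
  rw [tendsto_nhdsNE_pt]
  have h1 := tendsto_log_norm_sub ((n : ℤ) : ℂ)
  have c : ContinuousAt (fun z : ℂ => Real.log ‖z + n‖) ((n : ℤ) : ℂ) := by
    refine ContinuousAt.log (by fun_prop) ?_
    rw [norm_ne_zero_iff]
    push_cast
    rw [show (n : ℂ) + n = 2 * n by ring]
    have : (n : ℂ) ≠ 0 := by exact_mod_cast hn.ne'
    simpa
  refine ((tendsto_neg_atBot_atTop.comp h1).atTop_add (c.tendsto.mono_left nhdsWithin_le_nhds)).congr fun z => ?_
  show _ = Real.log ‖z + n‖ - Real.log ‖z - n‖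
  simp
  ring

lemma strictMonoOn_height (n : ℕ) :
    StrictMonoOn (fun k : ℤ => Real.log (n + k) - Real.log (n - k)) (Set.Ioo (-n : ℤ) n) := by
  intro j hj k hk hjk
  have h1 : (-n : ℝ) < j := by exact_mod_cast hj.1
  have h2 : (k : ℝ) < n := by exact_mod_cast hk.2
  have h3 : (j : ℝ) < k := by exact_mod_cast hjk
  have := Real.log_lt_log (x := n + j) (y := n + k) (by linarith) (by linarith)
  have := Real.log_lt_log (x := n - k) (y := n - j) (by linarith) (by linarith)
  simp only
  linarith

lemma tendsto_height {n : ℕ} {k : ℤ} (hk : k ∈ Set.Ioo (-n : ℤ) n) :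
    Tendsto (fun p => stackMap n p 2) (𝓝[≠] (pt k)) (𝓝 (Real.log (n + k) - Real.log (n - k))) := by
  rw [tendsto_nhdsNE_pt]
  have h1 : (0 : ℝ) < n + k := by have : (-n : ℝ) < k := by exact_mod_cast hk.1
                                  linarith
  have h2 : (0 : ℝ) < n - k := by have : (k : ℝ) < n := by exact_mod_cast hk.2
                                  linarith
  have e1 : ‖(k : ℂ) + n‖ = n + k := by
    rw [show (k : ℂ) + n = ((n + k : ℝ) : ℂ) by push_cast; ring, Complex.norm_real, Real.norm_of_nonneg h1.le]
  have e2 : ‖(k : ℂ) - n‖ = n - k := by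
    rw [show (k : ℂ) - n = -((n - k : ℝ) : ℂ) by push_cast; ring, norm_neg, Complex.norm_real, Real.norm_of_nonneg h2.le]
  have c : ContinuousAt (fun z : ℂ => Real.log ‖z + n‖ - Real.log ‖z - n‖) (k : ℂ) :=
    (ContinuousAt.log (by fun_prop) (by rw [e1]; exact h1.ne')).sub
      (ContinuousAt.log (by fun_prop) (by rw [e2]; exact h2.ne'))
  have := c.tendsto.mono_left (nhdsWithin_le_nhds (s := {(k : ℂ)}ᶜ))
  simp only [e1, e2] at this
  exact this

/-! ### Polar parts of the forms at the ends -/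

/-- The principal part of `g` at `a` is `α / (z - a)² + β / (z - a)`. -/
def HasPolarPart (g : ℂ → ℂ) (a α β : ℂ) : Prop :=
  ∃ D : ℂ → ℂ, AnalyticAt ℂ D 0 ∧ ∀ ζ, g (a + ζ) = α / ζ ^ 2 + β / ζ + D ζ

lemma HasPolarPart.const_mul {g : ℂ → ℂ} {a α β : ℂ} (h : HasPolarPart g a α β) (c : ℂ) :
    HasPolarPart (fun z => c * g z) a (c * α) (c * β) := by
  obtain ⟨D, hD, e⟩ := h
  exact ⟨fun ζ => c * D ζ, analyticAt_const.mul hD, fun ζ => by simp only [e]; ring⟩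

lemma HasPolarPart.add {g g' : ℂ → ℂ} {a α β α' β' : ℂ} (h : HasPolarPart g a α β) (h' : HasPolarPart g' a α' β') :
    HasPolarPart (fun z => g z + g' z) a (α + α') (β + β') := by
  obtain ⟨D, hD, e⟩ := h
  obtain ⟨D', hD', e'⟩ := h'
  exact ⟨fun ζ => D ζ + D' ζ, hD.add hD', fun ζ => by simp only [e, e']; ring⟩

lemma HasPolarPart.meromorphicAt {g : ℂ → ℂ} {a α β : ℂ} (h : HasPolarPart g a α β) :
    MeromorphicAt (localCoeff g (OnePoint.some a)) 0 := by
  obtain ⟨D, hD, e⟩ := h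
  have e' : localCoeff g (OnePoint.some a) = fun ζ => α / ζ ^ 2 + β / ζ + D ζ := funext e
  rw [e']
  exact (((MeromorphicAt.const α 0).div ((MeromorphicAt.id 0).pow 2)).add
    ((MeromorphicAt.const β 0).div (MeromorphicAt.id 0))).add hD.meromorphicAt

lemma HasPolarPart.poleOrder {g : ℂ → ℂ} {a α β : ℂ} (h : HasPolarPart g a α β) :
    (α ≠ 0 → poleOrder g (OnePoint.some a) = 2) ∧ (α = 0 → β ≠ 0 → poleOrder g (OnePoint.some a) = 1) ∧
      (α = 0 → β = 0 → poleOrder g (OnePoint.some a) = 0) := by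
  have hm := h.meromorphicAt
  obtain ⟨D, hD, e⟩ := h
  have hid : AnalyticAt ℂ (fun ζ : ℂ => ζ) 0 := analyticAt_id
  refine ⟨fun h0 => ?_, fun h0 h1 => ?_, fun h0 h1 => ?_⟩
  · have : meromorphicOrderAt (localCoeff g (OnePoint.some a)) 0 = ((-2 : ℤ) : WithTop ℤ) := by
      rw [meromorphicOrderAt_eq_int_iff hm]
      refine ⟨fun ζ => α + β * ζ + ζ ^ 2 * D ζ, (analyticAt_const.add (analyticAt_const.mul hid)).add ((hid.pow 2).mul hD),
        by simpa, ?_⟩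
      filter_upwards [self_mem_nhdsWithin] with ζ hζ
      have hζ' : ζ ≠ 0 := hζ
      simp only [localCoeff, e, sub_zero, smul_eq_mul]
      rw [show (-2 : ℤ) = -((2 : ℕ) : ℤ) by norm_num, zpow_neg, zpow_natCast]
      field_simp
    rw [HarmonicSurface.poleOrder, this]
    rfl
  · have : meromorphicOrderAt (localCoeff g (OnePoint.some a)) 0 = ((-1 : ℤ) : WithTop ℤ) := by
      rw [meromorphicOrderAt_eq_int_iff hm]
      refine ⟨fun ζ => β + ζ * D ζ, analyticAt_const.add (hid.mul hD), by simpa, ?_⟩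
      filter_upwards [self_mem_nhdsWithin] with ζ hζ
      have hζ' : ζ ≠ 0 := hζ
      simp only [localCoeff, e, sub_zero, smul_eq_mul, h0, zero_div, zero_add, zpow_neg_one]
      field_simp
    rw [HarmonicSurface.poleOrder, this]
    rfl
  · have e' : localCoeff g (OnePoint.some a) = D := funext fun ζ => by
      simp only [localCoeff, e, h0, h1, zero_div, zero_add]
    have h2 := hD.meromorphicOrderAt_nonneg
    rw [HarmonicSurface.poleOrder, e']
    have : 0 ≤ (meromorphicOrderAt D 0).untop₀ := by
      cases hm : meromorphicOrderAt D 0 with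
      | top => simp
      | coe m =>
        rw [hm] at h2
        simpa using h2
    omega

lemma HasPolarPart.hasResidue {g : ℂ → ℂ} {a α β : ℂ} (h : HasPolarPart g a α β) :
    HasResidue g (OnePoint.some a) β := by
  obtain ⟨D, hD, e⟩ := h
  obtain ⟨ε, hε, hball⟩ := Metric.eventually_nhds_iff_ball.1 hD.eventually_analyticAt
  have hs : ∀ᶠ r : ℝ in 𝓝[>] 0, r ∈ Set.Ioo 0 ε := Ioo_mem_nhdsGT hε
  filter_upwards [hs] with r hr
  have hsub : Metric.closedBall (0 : ℂ) r ⊆ Metric.ball 0 ε := Metric.closedBall_subset_ball hr.2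
  have hc : ContinuousOn D (Metric.closedBall 0 r) := fun ζ hζ => (hball ζ (hsub hζ)).continuousAt.continuousWithinAt
  have iD : (∮ ζ in C(0, r), D ζ) = 0 :=
    Complex.circleIntegral_eq_zero_of_differentiable_on_off_countable hr.1.le Set.countable_empty hc
      fun ζ hζ => (hball ζ (hsub (Metric.ball_subset_closedBall hζ.1))).differentiableAt
  have hne : ∀ ζ ∈ Metric.sphere (0 : ℂ) r, ζ ≠ 0 := fun ζ hζ h0 => by
    rw [h0] at hζ
    simp at hζ
    exact hr.1.ne hζ
  have i2 : (∮ ζ in C(0, r), (ζ - 0) ^ (-2 : ℤ)) = 0 := circleIntegral.integral_sub_zpow_of_ne (by norm_num) 0 0 r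
  have i1 := circleIntegral.integral_sub_center_inv 0 hr.1.ne'
  have c2 : CircleIntegrable (fun ζ : ℂ => α * (ζ - 0) ^ (-2 : ℤ)) 0 r :=
    ContinuousOn.circleIntegrable hr.1.le fun ζ hζ => ContinuousAt.continuousWithinAt
      (continuousAt_const.mul (ContinuousAt.zpow₀ (by fun_prop) _ (Or.inl (by simpa using hne ζ hζ))))
  have c1 : CircleIntegrable (fun ζ : ℂ => β * (ζ - 0)⁻¹) 0 r :=
    ContinuousOn.circleIntegrable hr.1.le fun ζ hζ => ContinuousAt.continuousWithinAt
      (continuousAt_const.mul (ContinuousAt.inv₀ (by fun_prop) (by simpa using hne ζ hζ)))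
  have c0 : CircleIntegrable D 0 r := ContinuousOn.circleIntegrable hr.1.le (hc.mono Metric.sphere_subset_closedBall)
  have e' : localCoeff g (OnePoint.some a) = fun ζ => (α * (ζ - 0) ^ (-2 : ℤ) + β * (ζ - 0)⁻¹) + D ζ := funext fun ζ => by
    simp only [localCoeff, e, sub_zero]
    rw [show (-2 : ℤ) = -((2 : ℕ) : ℤ) by norm_num, zpow_neg, zpow_natCast]
    rfl
  have c12 : CircleIntegrable (fun ζ : ℂ => α * (ζ - 0) ^ (-2 : ℤ) + β * (ζ - 0)⁻¹) 0 r := c2.add c1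
  rw [e', circleIntegral.integral_add c12 c0, circleIntegral.integral_add c2 c1,
    circleIntegral.integral_const_mul, circleIntegral.integral_const_mul, i2, i1, iD]
  ring

lemma HasPolarPart.tendsto {g : ℂ → ℂ} {a α β : ℂ} (h : HasPolarPart g a α β) :
    Tendsto (fun z => (z - a) ^ 2 * g z) (𝓝[≠] a) (𝓝 α) := by
  obtain ⟨D, hD, e⟩ := h
  have h0 : ContinuousAt (fun z : ℂ => z - a) a := by fun_prop
  have hD' : ContinuousAt (fun z => D (z - a)) a :=
    ContinuousAt.comp (g := D) (by simpa using hD.continuousAt) h0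
  have hc : ContinuousAt (fun z => α + β * (z - a) + (z - a) ^ 2 * D (z - a)) a :=
    (continuousAt_const.add (continuousAt_const.mul h0)).add ((h0.pow 2).mul hD')
  have h1 := hc.tendsto.mono_left (nhdsWithin_le_nhds (s := {a}ᶜ))
  simp only [sub_self, mul_zero, add_zero, ne_eq, OfNat.ofNat_ne_zero, not_false_eq_true, zero_pow, zero_mul] at h1
  refine h1.congr' ?_
  filter_upwards [self_mem_nhdsWithin] with z hz
  have hz' : z - a ≠ 0 := sub_ne_zero.2 hz
  have := e (z - a)
  rw [add_sub_cancel] at this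
  rw [this]
  field_simp

/-- The residue of the third form at the end `k`. -/
def thirdResidue (n : ℕ) (k : ℤ) : ℝ := (if k = -n then 1 else 0) - (if k = n then 1 else 0)

lemma thirdResidue_eq_zero_iff {n : ℕ} (hn : 0 < n) (k : ℤ) : thirdResidue n k = 0 ↔ |k| ≠ n := by
  rw [thirdResidue, ne_eq, abs_eq (by positivity)]
  split_ifs <;> simp <;> omega

lemma hasPolarPart_stackForms_zero {n : ℕ} {k : ℤ} (hk : |k| ≤ n) : HasPolarPart (stackForms n 0) k (alt k) 0 := by
  have hmem : k ∈ Finset.Icc (-(n : ℤ)) n := by rw [Finset.mem_Icc]; exact abs_le.1 hk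
  refine ⟨fun ζ => ∑ j ∈ (Finset.Icc (-(n : ℤ)) n).erase k, alt j / (k + ζ - j) ^ 2, ?_, fun ζ => ?_⟩
  · refine Finset.analyticAt_fun_sum _ fun j hj => ?_
    have hne : (k : ℂ) + 0 - j ≠ 0 := by
      rw [add_zero]
      exact sub_ne_zero.2 (by exact_mod_cast (Finset.ne_of_mem_erase hj).symm)
    exact analyticAt_const.div (((analyticAt_const.add analyticAt_id).sub analyticAt_const).pow 2) (pow_ne_zero 2 hne)
  · rw [stackForms_zero, altSum₂, ← Finset.add_sum_erase _ _ hmem, add_sub_cancel_left]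
    ring

lemma hasPolarPart_stackForms_one {n : ℕ} {k : ℤ} (hk : |k| ≤ n) : HasPolarPart (stackForms n 1) k Complex.I 0 := by
  have hmem : k ∈ Finset.Icc (-(n : ℤ)) n := by rw [Finset.mem_Icc]; exact abs_le.1 hk
  refine ⟨fun ζ => Complex.I * ∑ j ∈ (Finset.Icc (-(n : ℤ)) n).erase k, 1 / (k + ζ - j) ^ 2, ?_, fun ζ => ?_⟩
  · refine analyticAt_const.mul (Finset.analyticAt_fun_sum _ fun j hj => ?_)
    have hne : (k : ℂ) + 0 - j ≠ 0 := by
      rw [add_zero]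
      exact sub_ne_zero.2 (by exact_mod_cast (Finset.ne_of_mem_erase hj).symm)
    exact analyticAt_const.div (((analyticAt_const.add analyticAt_id).sub analyticAt_const).pow 2) (pow_ne_zero 2 hne)
  · rw [stackForms_one, fullSum₂, ← Finset.add_sum_erase _ _ hmem, add_sub_cancel_left]
    ring

lemma hasPolarPart_inv (a b : ℂ) : HasPolarPart (fun z => 1 / (z - b)) a 0 (if a = b then 1 else 0) := by
  split_ifs with h
  · exact ⟨fun _ => 0, analyticAt_const, fun ζ => by simp [h]⟩
  · refine ⟨fun ζ => 1 / (a + ζ - b), ?_, fun ζ => by simp⟩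
    exact analyticAt_const.div ((analyticAt_const.add analyticAt_id).sub analyticAt_const)
      (by simpa [sub_eq_zero] using h)

lemma hasPolarPart_stackForms_two (n : ℕ) (k : ℤ) : HasPolarPart (stackForms n 2) k 0 (thirdResidue n k) := by
  have h := (hasPolarPart_inv k (-n)).add ((hasPolarPart_inv k n).const_mul (-1))
  have e1 : ((k : ℂ) = -n) ↔ k = -n := by exact_mod_cast Iff.rfl
  have e2 : ((k : ℂ) = n) ↔ k = n := by exact_mod_cast Iff.rfl
  simp only [e1, e2] at h
  convert h using 1
  · funext z
    rw [stackForms_two, sub_neg_eq_add]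
    ring
  · simp
  · rw [thirdResidue]
    push_cast
    split_ifs <;> simp

lemma exists_hasPolarPart {n : ℕ} {k : ℤ} (hk : |k| ≤ n) (i : Fin 3) :
    ∃ α : ℂ, ∃ c : ℝ, HasPolarPart (stackForms n i) k α c := by
  fin_cases i
  · exact ⟨_, 0, by simpa using hasPolarPart_stackForms_zero hk⟩
  · exact ⟨_, 0, by simpa using hasPolarPart_stackForms_one hk⟩
  · exact ⟨_, _, hasPolarPart_stackForms_two n k⟩

lemma isWeierstrassData (n : ℕ) : IsWeierstrassData (stackEnds n) (stackForms n) where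
  finite := stackEnds_finite n
  meromorphic i p := by
    by_cases hp : p ∈ stackEnds n
    · obtain ⟨k, hk, rfl⟩ := hp
      obtain ⟨α, c, h⟩ := exists_hasPolarPart hk i
      exact h.meromorphicAt
    · exact (isHolomorphicFormAt hp i).1
  holomorphic _ hp i := isHolomorphicFormAt hp i

lemma exists_hasResidue {n : ℕ} {p : Sphere} (hp : p ∈ stackEnds n) (i : Fin 3) :
    ∃ c : ℝ, HasResidue (stackForms n i) p c := by
  obtain ⟨k, hk, rfl⟩ := hp
  obtain ⟨α, c, h⟩ := exists_hasPolarPart hk i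
  exact ⟨c, h.hasResidue⟩

/-! ### Types of the ends -/

lemma hasPolarPart_transform {n : ℕ} {k : ℤ} (hk : |k| ≤ n) (A : Matrix (Fin 3) (Fin 3) ℝ) (i : Fin 3) :
    HasPolarPart (transform A (stackForms n) i) k (A i 0 * alt k + A i 1 * Complex.I) (A i 2 * thirdResidue n k) := by
  have h := (((hasPolarPart_stackForms_zero hk).const_mul (A i 0)).add
    ((hasPolarPart_stackForms_one hk).const_mul (A i 1))).add ((hasPolarPart_stackForms_two n k).const_mul (A i 2))
  convert h using 1
  · funext z
    rw [transform, Fin.sum_univ_three]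
  · ring
  · ring

lemma poleOrders_transform {n : ℕ} (hn : 0 < n) {k : ℤ} (hk : |k| ≤ n) (A : Matrix (Fin 3) (Fin 3) ℝ) (i : Fin 3) :
    (¬(A i 0 = 0 ∧ A i 1 = 0) → poleOrders (transform A (stackForms n)) (pt k) i = 2) ∧
    (A i 0 = 0 ∧ A i 1 = 0 → A i 2 ≠ 0 →
      poleOrders (transform A (stackForms n)) (pt k) i = if |k| = n then 1 else 0) := by
  obtain ⟨h1, h2, h3⟩ := (hasPolarPart_transform hk A i).poleOrder
  have ha : alt k ≠ 0 := fun h => by simpa [h] using abs_alt k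
  constructor
  · intro h
    refine h1 fun h0 => h ?_
    have r := congrArg Complex.re h0
    have s := congrArg Complex.im h0
    simp at r s
    exact ⟨r.resolve_right ha, s⟩
  · rintro ⟨h4, h5⟩ h6
    have h0 : (A i 0 * alt k + A i 1 * Complex.I : ℂ) = 0 := by simp [h4, h5]
    have key := thirdResidue_eq_zero_iff hn k
    split_ifs with hkn
    · exact h2 h0 (by
        have : thirdResidue n k ≠ 0 := fun h => key.1 h hkn
        exact mul_ne_zero (by exact_mod_cast h6) (by exact_mod_cast this))
    · exact h3 h0 (by rw [key.2 hkn]; simp)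

lemma isEndType_pt {n : ℕ} (hn : 0 < n) {k : ℤ} (hk : |k| ≤ n) :
    IsEndType (stackForms n) (pt k) ![if |k| = n then 1 else 0, 2, 2] := by
  refine ⟨?_, ?_, fun A => ?_⟩
  · intro i j hij
    fin_cases i <;> fin_cases j <;> first | (exfalso; revert hij; decide) | (simp; try split_ifs <;> omega)
  · refine ⟨Matrix.GeneralLinearGroup.mkOfDetNeZero !![0, 0, 1; 1, 0, 0; 0, 1, 0] (by simp [Matrix.det_fin_three]), ?_⟩
    funext i
    have h := poleOrders_transform hn hk !![0, 0, 1; 1, 0, 0; 0, 1, 0] i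
    fin_cases i
    · exact h.2 (by simp) (by simp)
    · exact h.1 (by simp)
    · exact h.1 (by simp)
  · have hdet : A.1.det ≠ 0 := (Matrix.isUnit_iff_isUnit_det _).1 A.isUnit |>.ne_zero
    have h := poleOrders_transform hn hk A.1
    by_cases h0 : A.1 0 0 = 0 ∧ A.1 0 1 = 0
    · rw [Matrix.det_fin_three, h0.1, h0.2] at hdet
      have e0 := (h 0).2 h0 (fun h2 => hdet (by rw [h2]; ring))
      have e1 := (h 1).1 (fun h1 => hdet (by rw [h1.1, h1.2]; ring))
      have e2 := (h 2).1 (fun h2 => hdet (by rw [h2.1, h2.2]; ring))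
      refine le_of_eq (congrArg toLex ?_)
      funext i
      fin_cases i
      · exact e0.symm
      · exact e1.symm
      · exact e2.symm
    · refine le_of_lt ⟨0, by simp, ?_⟩
      have e0 := (h 0).1 h0
      show (if |k| = n then 1 else 0) < poleOrders (transform A.1 (stackForms n)) (pt k) 0
      rw [e0]
      split_ifs <;> norm_num

lemma IsEndType.unique {ω : Fin 3 → ℂ → ℂ} {p : Sphere} {t t' : Fin 3 → ℕ} (h : IsEndType ω p t) (h' : IsEndType ω p t') :
    t = t' := by
  obtain ⟨-, ⟨A, hA⟩, hm⟩ := h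
  obtain ⟨-, ⟨A', hA'⟩, hm'⟩ := h'
  have h1 := hm A'
  have h2 := hm' A
  rw [hA'] at h1
  rw [hA] at h2
  exact toLex.injective (le_antisymm h1 h2)

lemma isEndType_planar {n : ℕ} (hn : 0 < n) {k : ℤ} (hk : |k| < n) : IsEndType (stackForms n) (pt k) ![0, 2, 2] := by
  simpa [hk.ne] using isEndType_pt hn hk.le

lemma isEndType_catenoid {n : ℕ} (hn : 0 < n) {k : ℤ} (hk : |k| = n) : IsEndType (stackForms n) (pt k) ![1, 2, 2] := by
  simpa [hk] using isEndType_pt hn hk.le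

lemma pt_injective : Function.Injective pt := fun j k h => by
  exact_mod_cast OnePoint.coe_injective h

lemma ncard_planar {n : ℕ} (hn : 0 < n) :
    {p ∈ stackEnds n | IsEndType (stackForms n) p ![0, 2, 2]}.ncard = 2 * n - 1 := by
  have e : {p ∈ stackEnds n | IsEndType (stackForms n) p ![0, 2, 2]} = pt '' Set.Ioo (-n : ℤ) n := by
    ext p
    constructor
    · rintro ⟨⟨k, hk, rfl⟩, ht⟩
      refine ⟨k, abs_lt.1 (lt_of_le_of_ne hk fun h => ?_), rfl⟩
      have := congrFun (ht.unique (isEndType_catenoid hn h)) 0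
      simp at this
    · rintro ⟨k, hk, rfl⟩
      have hk' := abs_lt.2 hk
      exact ⟨⟨k, hk'.le, rfl⟩, isEndType_planar hn hk'⟩
  rw [e, Set.ncard_image_of_injective _ pt_injective, ← Finset.coe_Ioo, Set.ncard_coe_finset, Int.card_Ioo]
  omega

lemma ncard_catenoid {n : ℕ} (hn : 0 < n) :
    {p ∈ stackEnds n | IsEndType (stackForms n) p ![1, 2, 2]}.ncard = 2 := by
  have e : {p ∈ stackEnds n | IsEndType (stackForms n) p ![1, 2, 2]} = {pt n, pt (-n)} := by
    ext p
    constructor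
    · rintro ⟨⟨k, hk, rfl⟩, ht⟩
      rcases lt_or_eq_of_le hk with h | h
      · have := congrFun (ht.unique (isEndType_planar hn h)) 0
        simp at this
      · rcases (abs_eq (by positivity)).1 h with rfl | rfl
        · exact Or.inl rfl
        · exact Or.inr rfl
    · rintro (rfl | rfl)
      · exact ⟨⟨n, by simp, rfl⟩, isEndType_catenoid hn (by simp)⟩
      · exact ⟨⟨-n, by simp, rfl⟩, isEndType_catenoid hn (by simp)⟩
  rw [e, Set.ncard_pair fun h => ?_]
  have := pt_injective h
  omega

/-! ### Limits of the Gauss map -/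

/-- The vector `Im (b c̄, c ā, a b̄)`. -/
def imCross (a b c : ℂ) : EuclideanSpace ℝ (Fin 3) := !₂[(b * star c).im, (c * star a).im, (a * star b).im]

lemma imCross_mul (w a b c : ℂ) : imCross (w * a) (w * b) (w * c) = Complex.normSq w • imCross a b c := by
  ext i
  fin_cases i <;> simp [imCross, Complex.normSq_apply] <;> ring

lemma continuous_imCross : Continuous fun t : ℂ × ℂ × ℂ => imCross t.1 t.2.1 t.2.2 := by
  unfold imCross
  refine (PiLp.continuous_toLp 2 _).comp (continuous_pi fun i => ?_)
  fin_cases i <;> simp <;> fun_prop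

lemma tendsto_gaussMap {n : ℕ} {k : ℤ} (hk : |k| ≤ n) :
    Tendsto (gaussMap (stackForms n)) (𝓝[≠] (pt k)) (𝓝 !₂[0, 0, (-1) ^ (k.natAbs + 1)]) := by
  rw [tendsto_nhdsNE_pt]
  have hlim := (hasPolarPart_stackForms_zero hk).tendsto.prodMk_nhds
    ((hasPolarPart_stackForms_one hk).tendsto.prodMk_nhds (hasPolarPart_stackForms_two n k).tendsto)
  have h1 := (continuous_imCross.tendsto _).comp hlim
  have ev : imCross (alt k) Complex.I 0 = !₂[0, 0, (-1) ^ (k.natAbs + 1)] := by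
    rw [show (-1 : ℝ) ^ (k.natAbs + 1) = -alt k by rw [pow_succ, alt]; ring]
    ext i
    fin_cases i <;> simp [imCross]
  have hnorm : ‖(!₂[0, 0, (-1) ^ (k.natAbs + 1)] : EuclideanSpace ℝ (Fin 3))‖ = 1 := by
    rw [EuclideanSpace.norm_eq, Fin.sum_univ_three]
    simp
  simp only [ev] at h1
  have h2 := (h1.norm.inv₀ (by rw [hnorm]; exact one_ne_zero)).smul h1
  rw [hnorm, inv_one, one_smul] at h2
  refine h2.congr' ?_
  have hopen : ∀ᶠ z : ℂ in 𝓝[≠] (k : ℂ), ∀ j : ℤ, |j| ≤ n → z ≠ j := by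
    have hf := ((finite_int_ends n).subset (Set.sdiff_subset (t := {(k : ℂ)}))).isClosed.isOpen_compl
    have : ({z : ℂ | ∃ k : ℤ, |k| ≤ n ∧ z = k} \ {(k : ℂ)})ᶜ ∈ 𝓝 (k : ℂ) := hf.mem_nhds (by simp)
    filter_upwards [nhdsWithin_le_nhds this, self_mem_nhdsWithin] with z h1 h2 j hj hz
    exact h1 ⟨⟨j, hj, hz⟩, h2⟩
  filter_upwards [hopen, self_mem_nhdsWithin] with z hz hzk
  have hp : (OnePoint.some z : Sphere) ∉ stackEnds n := fun h => by
    obtain ⟨j, hj, e⟩ := pt_mem_stackEnds.1 h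
    exact hz j hj e
  have hw : 0 < Complex.normSq ((z - k) ^ 2) := Complex.normSq_pos.2 (pow_ne_zero 2 (sub_ne_zero.2 hzk))
  have e : normalVector (stackForms n) (OnePoint.some z) =
      imCross (stackForms n 0 z) (stackForms n 1 z) (stackForms n 2 z) := by
    simp only [normalVector, coeffAt_some hp]
    rfl
  simp only [Function.comp, imCross_mul]
  rw [gaussMap, e, norm_smul, Real.norm_of_nonneg hw.le, mul_inv, smul_smul, mul_right_comm, inv_mul_cancel₀ hw.ne', one_mul]

end HarmonicSurface

end

open HarmonicSurface in
theorem theorem3p1 (n : ℕ) (hn : 0 < n) :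
    IsWeierstrassData (stackEnds n) (stackForms n) ∧
    (∀ p ∈ stackEnds n, ∀ i, ∃ c : ℝ, HasResidue (stackForms n i) p c) ∧
    SolvesPeriodProblem (stackEnds n) (stackForms n) ∧
    -- planar ends at the integers `k` with `|k| < n`, catenoid ends at `±n`
    (∀ k : ℤ, |k| < n → IsEndType (stackForms n) (pt k) ![0, 2, 2]) ∧
    (∀ k : ℤ, |k| = n → IsEndType (stackForms n) (pt k) ![1, 2, 2]) ∧
    {p ∈ stackEnds n | IsEndType (stackForms n) p ![0, 2, 2]}.ncard = 2 * n - 1 ∧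
    {p ∈ stackEnds n | IsEndType (stackForms n) p ![1, 2, 2]}.ncard = 2 ∧
    -- vertical limiting normals, alternating between `(0,0,-1)` and `(0,0,1)`
    (∀ k : ℤ, |k| ≤ n →
      Tendsto (gaussMap (stackForms n)) (𝓝[≠] (pt k)) (𝓝 !₂[0, 0, (-1) ^ (k.natAbs + 1)])) ∧
    ∃ f : Sphere → EuclideanSpace ℝ (Fin 3),
      IsWeierstrassMap (stackEnds n) (stackForms n) f ∧
      IsHarmonicMap (stackEnds n) f ∧
      IsSmoothEmbedding (stackEnds n) f ∧
      -- the planar ends are stacked at increasing heights between the two catenoid ends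
      Tendsto (fun p => f p 2) (𝓝[≠] (pt (-n))) atBot ∧
      Tendsto (fun p => f p 2) (𝓝[≠] (pt n)) atTop ∧
      ∃ h : ℤ → ℝ, StrictMonoOn h (Set.Ioo (-n : ℤ) n) ∧
        ∀ k ∈ Set.Ioo (-n : ℤ) n, Tendsto (fun p => f p 2) (𝓝[≠] (pt k)) (𝓝 (h k)) := by
  refine ⟨isWeierstrassData n, fun p hp i => exists_hasResidue hp i, solvesPeriodProblem n,
    fun k hk => isEndType_planar hn hk, fun k hk => isEndType_catenoid hn hk, ncard_planar hn, ncard_catenoid hn,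
    fun k hk => tendsto_gaussMap hk, stackMap n, isWeierstrassMap_stackMap n, isHarmonicMap_stackMap n,
    isSmoothEmbedding_stackMap hn, tendsto_height_bot hn, tendsto_height_top hn, _, strictMonoOn_height n,
    fun k hk => tendsto_height hk⟩
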